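/- **Notation.** Let $\mathbb T$ be the circle group and $\mathcal F$ the set of its finite subgroups. Let $\mathcal O_{\mathcal F}=\prod_{H\in\mathcal F}\mathbb Q[c_H]$ (product of graded rings, $|c_H|=-2$), let $\mathcal E$ be the multiplicative set of Euler classes $c^v$, for $v\colon\mathcal F\to\mathbb Z_{\ge 0}$ of finite support, where $c^v$ has component $c_H^{v(H)}$ at $H$, and let $t_*^{\mathcal F}=\mathcal E^{-1}\mathcal O_{\mathcal F}$. The category $\mathcal A$ has as objects the maps $\beta\colon N\to t_*^{\mathcal F}\otimes_{\mathbb Q}V$ of graded $\mathcal O_{\mathcal F}$-modules, with $V$ a graded rational vector space, such that $\mathcal E^{-1}\beta$ is an isomorphism; its maps are the pairs $(\theta\colon N\to N',\ \phi\colon V\to V')$ with $\beta'\theta=(1\otimes\phi)\beta$. Let $dg\mathcal A$ be the category of differential graded objects in $\mathcal A$, that is, objects of $\mathcal A$ with an endomorphism $d$ of degree $-1$ and $d^2=0$. It is enriched over rational chain complexes: $\mathrm{Hom}(X,Y)_n$ is the space of maps $X\to Y$ in $\mathcal A$ of degree $n$, with differential $f\mapsto df-(-1)^nfd$. Its cofibrations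 are the monomorphisms, its weak equivalences are the quasi-isomorphisms, and its fibrations are the maps with the right lifting property with respect to the trivial cofibrations. For $H\in\mathcal F$ let $\mathbb Q(H)$ be the $\mathbb Q[c_H]$-module $\mathbb Q=\mathbb Q[c_H]/(c_H)$, regarded as an $\mathcal O_{\mathcal F}$-module. The algebraic basic cells are $L_H=(\Sigma\mathbb Q(H)\to 0)$ for $H\in\mathcal F$ and $L_{\mathbb T}=(\mathcal O_{\mathcal F}\to t_*^{\mathcal F})$, with zero differential. Let $\mathbb I(H)=\Sigma^{-2}\,\mathbb Q[c_H,c_H^{-1}]/\mathbb Q[c_H]$ and $\mathbb I=\Sigma^{-2}\,t_*^{\mathcal F}/\mathcal O_{\mathcal F}$. For $H\in\mathcal F$ let $I_H=(\Sigma\mathbb I(H)\oplus\Sigma^2\mathbb I(H)\to 0)$ with $d(x,y)=(0,c_Hx)$, and let $I_{\mathbb T}=(t_*^{\mathcal F}\oplus\Sigma\mathbb I\to t_*^{\mathcal F})$, where the map is the projection and $d(x,y)=(0,[x])$. There are inclusions $L_H\to I_H$, $q\mapsto(q[c_H^{-1}],0)$, and $L_{\mathbb T}\to I_{\mathbb T}$,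 $f\mapsto(f,0)$. Let $\mathcal B_a=\{I_H\}$, where $H$ runs over all closed subgroups of $\mathbb T$ (these are the finite subgroups and $\mathbb T$ itself), and let $\mathcal E(\mathcal B_a)$ be the rational differential graded ring with one object for each closed subgroup $H$, with morphism complexes $\mathrm{Hom}(I_H,I_K)$ and the composition of maps. On the category of (right) differential graded $\mathcal E(\mathcal B_a)$-modules the weak equivalences are the quasi-isomorphisms, the fibrations are the epimorphisms, and the cofibrations are the maps with the left lifting property with respect to the trivial fibrations. **Statement.** With these classes of maps, $dg\mathcal A$ and the category of differential graded $\mathcal E(\mathcal B_a)$-modules are model categories. For every closed subgroup $H$ of $\mathbb T$ the object $I_H$ is a fibrant replacement of $L_H$: it is fibrant, and the inclusion $L_H\to I_H$ is a weak equivalence. The model category $dg\mathcal A$ is Quillen equivalent to the model category of differential graded modules over $\mathcal E(\mathcal B_a)$; more precisely, the functor $Y\mapsto\big(H\mapsto\mathrm{Hom}(I_H,Y)\big)$ from $dg\mathcal A$ to differential graded $\mathcal E(\mathcal B_a)$-modules has a left adjoint, it preserves fibrations and trivial fibrations, and the total derived functors of the two adjoints exist and are adjoint equivalences of the homotopy categories.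 -/

import Mathlib

noncomputable section

namespace CircleModel

open CategoryTheory HomotopicalAlgebra TensorProduct Polynomial

/-! ### The graded rings `𝒪_ℱ` and `t_*^ℱ` -/

/-- The set `ℱ` of finite subgroups of the circle group. -/
abbrev FinSubgroup : Type := {H : Subgroup Circle // Finite H}

/-- The ring `∏_H ℚ`, the product over all finite subgroups. -/
def QF : Type := FinSubgroup → ℚ

namespace QF

instance : CommRing QF := inferInstanceAs (CommRing (FinSubgroup → ℚ))
instance : Algebra ℚ QF := inferInstanceAs (Algebra ℚ (FinSubgroup → ℚ))

/-- The projection onto the factor indexed by `H`. -/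
def proj (H : FinSubgroup) : QF →ₐ[ℚ] ℚ := Pi.evalAlgHom ℚ (fun _ : FinSubgroup => ℚ) H

lemma ext {a b : QF} (h : ∀ H, proj H a = proj H b) : a = b := funext h

open Classical in
/-- The element with component `q` at `H`, and zero elsewhere. -/
def single (H : FinSubgroup) (q : ℚ) : QF := (Pi.single H q : FinSubgroup → ℚ)

open Classical in
lemma proj_single_self (H : FinSubgroup) (q : ℚ) : proj H (single H q) = q :=
  Pi.single_eq_same (M := fun _ : FinSubgroup => ℚ) H q

open Classical in
lemma proj_single_of_ne {H K : FinSubgroup} (h : K ≠ H) (q : ℚ) : proj K (single H q) = 0 :=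
  Pi.single_eq_of_ne (M := fun _ : FinSubgroup => ℚ) h q

end QF

/-- The ring of operations `∏_H ℚ[c_H]`, with `c_H` in degree `-2`. The product is that of graded
rings, so in degree `-2k` it is `∏_H ℚ c_H ^ k`; hence its underlying ring is the polynomial ring
over `∏_H ℚ` in the total Chern class `c = X`. -/
abbrev OF : Type := QF[X]

/-- The projection of `𝒪_ℱ` onto its factor `ℚ[c_H]`. -/
def component (H : FinSubgroup) : OF →ₐ[ℚ] ℚ[X] :=
  Polynomial.mapAlgHom (QF.proj H)

/-- The grading of a vector space for which an element is homogeneous of degree `n` if all its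
non-zero coordinates have degree `n`; here `co i` is the `i`-th coordinate and `δ i` its degree. -/
def gradeBy {ι M W : Type} [AddCommGroup M] [Module ℚ M] [AddCommGroup W] [Module ℚ W]
    (co : ι → M →ₗ[ℚ] W) (δ : ι → ℤ) (n : ℤ) : Submodule ℚ M where
  carrier := {x | ∀ i, co i x ≠ 0 → δ i = n}
  zero_mem' i h := absurd (map_zero (co i)) h
  add_mem' {x y} hx hy i h := by
    by_cases h' : co i x = 0
    · exact hy i (fun h'' => h (by rw [map_add, h', h'', add_zero]))
    · exact hx i h'
  smul_mem' a x hx i h := hx i (fun h' => h (by rw [map_smul, h', smul_zero]))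

/-- The homogeneous part of `𝒪_ℱ` of degree `n`: the multiples of `c ^ k` with `-2k = n`. -/
def OF.deg (n : ℤ) : Submodule ℚ OF :=
  gradeBy (fun k : ℕ => (Polynomial.lcoeff QF k).restrictScalars ℚ)
    (fun k => -2 * (k : ℤ)) n

/-- The multiplicative set `ℰ` of Euler classes `c^v`, for `v : ℱ → ℕ` of finite support, where
`c^v` is the element whose component at `H` is `c_H ^ v(H)`. -/
def eulerClasses : Submonoid OF where
  carrier := {f | ∃ v : FinSubgroup →₀ ℕ, ∀ H, component H f = X ^ v H}
  one_mem' := ⟨0, fun H => by simp⟩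
  mul_mem' := by
    rintro f g ⟨v, hv⟩ ⟨w, hw⟩
    exact ⟨v + w, fun H => by rw [map_mul, hv, hw, Finsupp.add_apply, pow_add]⟩

/-- The ring `t_*^ℱ = ℰ⁻¹ 𝒪_ℱ`. -/
def TF : Type := Localization eulerClasses

namespace TF

instance : CommRing TF := inferInstanceAs (CommRing (Localization eulerClasses))
instance : Algebra OF TF := inferInstanceAs (Algebra OF (Localization eulerClasses))
instance : IsLocalization eulerClasses TF :=
  inferInstanceAs (IsLocalization eulerClasses (Localization eulerClasses))
instance : Algebra ℚ TF := ((algebraMap OF TF).comp (algebraMap ℚ OF)).toAlgebra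
instance : IsScalarTower ℚ OF TF := IsScalarTower.of_algebraMap_eq fun _ => rfl

end TF

/-- The ring `ℚ[c_H, c_H⁻¹]`, as an algebra over `𝒪_ℱ` through the projection to `ℚ[c_H]`. -/
def Laurent (_ : FinSubgroup) : Type := LaurentPolynomial ℚ

namespace Laurent

instance (H : FinSubgroup) : CommRing (Laurent H) := inferInstanceAs (CommRing (LaurentPolynomial ℚ))
instance (H : FinSubgroup) : Algebra ℚ (Laurent H) :=
  inferInstanceAs (Algebra ℚ (LaurentPolynomial ℚ))

/-- The ring map `𝒪_ℱ → ℚ[c_H] → ℚ[c_H, c_H⁻¹]`. -/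
def structureMap (H : FinSubgroup) : OF →ₐ[ℚ] Laurent H :=
  (Polynomial.toLaurentAlg : ℚ[X] →ₐ[ℚ] LaurentPolynomial ℚ).comp (component H)

instance (H : FinSubgroup) : Algebra OF (Laurent H) := (structureMap H).toRingHom.toAlgebra

instance (H : FinSubgroup) : IsScalarTower ℚ OF (Laurent H) :=
  IsScalarTower.of_algebraMap_eq fun x => ((structureMap H).commutes x).symm

/-- The coefficient of `c_H ^ k`. -/
def coeff (H : FinSubgroup) (k : ℤ) : Laurent H →ₗ[ℚ] ℚ where
  toFun f := AddMonoidAlgebra.coeff f k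
  map_add' _ _ := rfl
  map_smul' _ _ := rfl

end Laurent

lemma isUnit_eulerClass (H : FinSubgroup) (s : eulerClasses) :
    IsUnit (algebraMap OF (Laurent H) s) := by
  obtain ⟨s, v, hv⟩ := s
  have : algebraMap OF (Laurent H) s = (LaurentPolynomial.T (v H) : LaurentPolynomial ℚ) := by
    change Polynomial.toLaurentAlg (component H s) = _
    rw [hv, Polynomial.toLaurentAlg_apply, Polynomial.toLaurent_X_pow]
  rw [this]
  exact LaurentPolynomial.isUnit_T _

/-- The component at `H` of an element of `t_*^ℱ`. -/
def TF.component (H : FinSubgroup) : TF →ₐ[OF] Laurent H :=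
  IsLocalization.liftAlgHom (M := eulerClasses) (S := TF) (f := Algebra.ofId OF (Laurent H))
    (isUnit_eulerClass H)

/-! ### Graded vector spaces and graded `𝒪_ℱ`-modules -/

/-- A `ℤ`-graded rational vector space. -/
structure GrVect where
  carrier : Type
  [addCommGroup : AddCommGroup carrier]
  [module : Module ℚ carrier]
  deg : ℤ → Submodule ℚ carrier
  isInternal : DirectSum.IsInternal deg

instance : CoeSort GrVect Type := ⟨GrVect.carrier⟩
attribute [instance] GrVect.addCommGroup GrVect.module

/-- A graded module over the graded ring `𝒪_ℱ`. -/
structure GrMod extends GrVect where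
  [moduleOF : Module OF carrier]
  [isScalarTower : IsScalarTower ℚ OF carrier]
  smul_mem : ∀ {i j : ℤ} {f : OF} {x : carrier}, f ∈ OF.deg i → x ∈ deg j → f • x ∈ deg (i + j)

instance : CoeSort GrMod Type := ⟨fun M => M.carrier⟩
attribute [instance] GrMod.moduleOF GrMod.isScalarTower

/-- The homogeneous part of `t_*^ℱ` of degree `n`: the elements all of whose components lie in
`ℚ c_H ^ k` with `-2k = n`. -/
def TF.deg (n : ℤ) : Submodule ℚ TF := 
  gradeBy (M := TF) (fun i : FinSubgroup × ℤ => Laurent.coeff i.1 i.2 ∘ₗ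
    (TF.component i.1).toLinearMap.restrictScalars ℚ) (fun i => -2 * i.2) n

/-- The grading of `t_*^ℱ ⊗ V`, for a graded vector space `V`. -/
def tensorDeg (V : GrVect) (n : ℤ) : Submodule ℚ (TF ⊗[ℚ] V) :=
  Submodule.span ℚ {z | ∃ i j : ℤ, i + j = n ∧ ∃ x ∈ TF.deg i, ∃ v ∈ V.deg j, z = x ⊗ₜ[ℚ] v}

/-- An object of `𝒜`: a map `β : N → t_*^ℱ ⊗ V` of graded `𝒪_ℱ`-modules, with `V` a graded vector
space, such that `ℰ⁻¹β` is an isomorphism. -/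
structure AObj where
  nub : GrMod
  vertex : GrVect
  β : nub →ₗ[OF] TF ⊗[ℚ] vertex
  β_mem : ∀ {n : ℤ} {x : nub}, x ∈ nub.deg n → β x ∈ tensorDeg vertex n
  β_loc : Function.Bijective (LocalizedModule.map eulerClasses β)

namespace AObj

/-- Pairs of a linear map of nubs and a linear map of vertices, without further conditions. -/
abbrev Pairs (X Y : AObj) : Type :=
  (X.nub →ₗ[OF] Y.nub) × (X.vertex →ₗ[ℚ] Y.vertex)

/-- The maps `X → Y` in `𝒜` of degree `n`, that is, the maps `Σⁿ X → Y` in `𝒜`. (As `t_*^ℱ` is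
concentrated in even degrees, there are no signs.) -/
def homDeg (X Y : AObj) (n : ℤ) : Submodule ℚ (Pairs X Y) where
  carrier := {f | (∀ i, ∀ x ∈ X.nub.deg i, f.1 x ∈ Y.nub.deg (i + n)) ∧
    (∀ i, ∀ v ∈ X.vertex.deg i, f.2 v ∈ Y.vertex.deg (i + n)) ∧
    ∀ x, Y.β (f.1 x) = f.2.lTensor TF (X.β x)}
  zero_mem' := by simp
  add_mem' {f g} hf hg := ⟨fun i x hx => add_mem (hf.1 i x hx) (hg.1 i x hx),
    fun i x hx => add_mem (hf.2.1 i x hx) (hg.2.1 i x hx), fun x => by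
      simp [hf.2.2 x, hg.2.2 x, LinearMap.lTensor_add]⟩
  smul_mem' a f hf := ⟨fun i x hx => Submodule.smul_mem _ a (hf.1 i x hx),
    fun i x hx => Submodule.smul_mem _ a (hf.2.1 i x hx), fun x => by
      have := Y.β.map_smul_of_tower a (f.1 x)
      simp [this, hf.2.2 x, LinearMap.lTensor_smul]⟩

/-- Composition of pairs. -/
def comp {X Y Z : AObj} : Pairs Y Z →ₗ[ℚ] Pairs X Y →ₗ[ℚ] Pairs X Z :=
  LinearMap.mk₂ ℚ (fun g f => (g.1 ∘ₗ f.1, g.2 ∘ₗ f.2))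
    (by intros; ext <;> simp) (by intros; ext <;> simp)
    (by intros; ext <;> simp) (by
      intro c g f
      ext x
      · exact g.1.map_smul_of_tower c (f.1 x)
      · simp)

lemma comp_mem {X Y Z : AObj} {p q n : ℤ} (h : p + q = n) {g : Pairs Y Z} {f : Pairs X Y}
    (hg : g ∈ homDeg Y Z p) (hf : f ∈ homDeg X Y q) : comp g f ∈ homDeg X Z n := by
  subst h
  refine ⟨fun i x hx => ?_, fun i x hx => ?_, fun x => ?_⟩
  · have := hg.1 _ _ (hf.1 i x hx)
    rwa [show i + q + p = i + (p + q) by ring] at this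
  · have := hg.2.1 _ _ (hf.2.1 i x hx)
    rwa [show i + q + p = i + (p + q) by ring] at this
  · change Z.β (g.1 (f.1 x)) = (g.2 ∘ₗ f.2).lTensor TF (X.β x)
    rw [hg.2.2, hf.2.2, LinearMap.lTensor_comp]
    rfl

lemma comp_assoc {W X Y Z : AObj} (h : Pairs Y Z) (g : Pairs X Y) (f : Pairs W X) :
    comp (comp h g) f = comp h (comp g f) := rfl

end AObj

/-! ### Differential graded objects -/

/-- A differential graded object in `𝒜`: an object of `𝒜` with an endomorphism of degree `-1` and
square zero. -/
structure DgA extends AObj where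
  d : AObj.Pairs toAObj toAObj
  d_mem : d ∈ AObj.homDeg toAObj toAObj (-1)
  d_comp_d : AObj.comp d d = 0

/-- The sign `(-1)^n`. -/
def sgn (n : ℤ) : ℚ := ((n.negOnePow : ℤ) : ℚ)

lemma sgn_zero : sgn 0 = 1 := by simp [sgn]

lemma sgn_add (m n : ℤ) : sgn (m + n) = sgn m * sgn n := by
  simp [sgn, Int.negOnePow_add]

lemma sgn_mul_self (n : ℤ) : sgn n * sgn n = 1 := by
  rw [← sgn_add, sgn, Int.negOnePow_even _ ⟨n, rfl⟩]; simp

lemma sgn_sub_one (n : ℤ) : sgn (n - 1) = - sgn n := by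
  simp [sgn, Int.negOnePow_sub]

namespace DgA

open AObj

/-- A morphism of dg objects: a map in `𝒜` of degree zero that commutes with the differentials. -/
@[ext]
structure Hom (X Y : DgA) where
  pair : Pairs X.toAObj Y.toAObj
  mem : pair ∈ homDeg X.toAObj Y.toAObj 0
  comm : comp Y.d pair = comp pair X.d

instance : Category DgA where
  Hom := Hom
  id X :=
    { pair := (LinearMap.id, LinearMap.id)
      mem := ⟨by simp, by simp, by simp⟩
      comm := rfl }
  comp {X Y Z} f g :=
    { pair := AObj.comp g.pair f.pair
      mem := comp_mem (add_zero 0) g.mem f.mem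
      comm := by rw [← comp_assoc, g.comm, comp_assoc, f.comm, comp_assoc] }

/-- The differential `f ↦ d ∘ f - (-1)^n f ∘ d` of maps of degree `n`. -/
def diff (X Y : DgA) (n : ℤ) : Pairs X.toAObj Y.toAObj →ₗ[ℚ] Pairs X.toAObj Y.toAObj :=
  comp Y.d - sgn n • comp.flip X.d

lemma diff_apply (X Y : DgA) (n : ℤ) (f : Pairs X.toAObj Y.toAObj) :
    diff X Y n f = comp Y.d f - sgn n • comp f X.d := rfl

lemma diff_mem {X Y : DgA} {i j : ℤ} (h : j + 1 = i) {f : Pairs X.toAObj Y.toAObj}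
    (hf : f ∈ homDeg X.toAObj Y.toAObj i) : diff X Y i f ∈ homDeg X.toAObj Y.toAObj j :=
  sub_mem (comp_mem (by omega) Y.d_mem hf)
    (Submodule.smul_mem _ _ (comp_mem (by omega) hf X.d_mem))

lemma diff_diff {X Y : DgA} {i j : ℤ} (h : j + 1 = i) (f : Pairs X.toAObj Y.toAObj) :
    diff X Y j (diff X Y i f) = 0 := by
  obtain rfl : j = i - 1 := by omega
  simp only [diff_apply, map_sub, map_smul, smul_sub,
    sgn_sub_one, neg_smul, ← comp_assoc, Y.d_comp_d, map_zero, LinearMap.zero_apply]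
  simp only [comp_assoc, X.d_comp_d, map_zero, smul_zero]
  simp

lemma diff_comp {X Y Z : DgA} {p q n : ℤ} (h : p + q = n) (g : Pairs Y.toAObj Z.toAObj)
    (f : Pairs X.toAObj Y.toAObj) :
    diff X Z n (comp g f) = comp (diff Y Z p g) f + sgn p • comp g (diff X Y q f) := by
  subst h
  simp only [diff_apply, map_sub, map_smul, LinearMap.sub_apply, LinearMap.smul_apply, smul_sub,
    comp_assoc, sgn_add, mul_smul]
  abel

/-- The rational chain complex `Hom(X, Y)` of maps of dg objects. -/
def homComplex (X Y : DgA) : ChainComplex (ModuleCat.{0} ℚ) ℤ where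
  X n := ModuleCat.of ℚ (homDeg X.toAObj Y.toAObj n)
  d i j := if h : j + 1 = i then ModuleCat.ofHom ((diff X Y i).restrict fun _ hf => diff_mem h hf)
    else 0
  shape i j h := dif_neg h
  d_comp_d' i j k hij hjk := by
    have hij : j + 1 = i := hij
    have hjk : k + 1 = j := hjk
    rw [dif_pos hij, dif_pos hjk]
    refine ModuleCat.hom_ext (LinearMap.ext fun f => ?_)
    exact Subtype.ext (diff_diff hij (Subtype.val f))

lemma homComplex_d {X Y : DgA} {i j : ℤ} (h : j + 1 = i) (f : homDeg X.toAObj Y.toAObj i) :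
    (homComplex X Y).d i j f = (⟨diff X Y i f.1, diff_mem h f.2⟩ : homDeg X.toAObj Y.toAObj j) := by
  simp only [homComplex, dif_pos h]
  rfl

/-- Composition of homogeneous maps. -/
def homComp {X Y Z : DgA} {p q n : ℤ} (h : p + q = n) :
    (homComplex Y Z).X p →ₗ[ℚ] (homComplex X Y).X q →ₗ[ℚ] (homComplex X Z).X n :=
  show homDeg Y.toAObj Z.toAObj p →ₗ[ℚ] homDeg X.toAObj Y.toAObj q →ₗ[ℚ]
      homDeg X.toAObj Z.toAObj n from
    LinearMap.mk₂ ℚ (fun g f => ⟨comp g.1 f.1, comp_mem h g.2 f.2⟩)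
      (fun g g' f => Subtype.ext (by simp))
      (fun c g f => Subtype.ext (by simp))
      (fun g f f' => Subtype.ext (by simp))
      (fun c g f => Subtype.ext (by simp))

lemma homComp_leibniz {X Y Z : DgA} {p q n p' q' n' : ℤ} (h : p + q = n) (h₁ : p' + q = n')
    (h₂ : p + q' = n') (h₃ : n' + 1 = n) (f : (homComplex Y Z).X p) (g : (homComplex X Y).X q) :
    (homComplex X Z).d n n' (homComp h f g) =
      homComp h₁ ((homComplex Y Z).d p p' f) g +
        sgn p • homComp h₂ f ((homComplex X Y).d q q' g) := by
  have e₁ := homComplex_d (X := Y) (Y := Z) (show p' + 1 = p by omega) f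
  have e₂ := homComplex_d (X := X) (Y := Y) (show q' + 1 = q by omega) g
  have e₃ := homComplex_d (X := X) (Y := Z) h₃ (homComp h f g)
  refine e₃.trans (Eq.trans (Subtype.ext ?_)
    (congrArg₂ (fun a b => homComp h₁ a g + sgn p • homComp h₂ f b) e₁ e₂).symm)
  exact diff_comp h (Subtype.val f) (Subtype.val g)

/-- A morphism, as an element of degree zero of the hom complex. -/
def homElt {X Y : DgA} (φ : X ⟶ Y) : (homComplex X Y).X 0 :=
  (⟨Hom.pair φ, Hom.mem φ⟩ : homDeg X.toAObj Y.toAObj 0)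

lemma d_homElt {X Y : DgA} (φ : X ⟶ Y) : (homComplex X Y).d 0 (-1) (homElt φ) = 0 := by
  refine (homComplex_d (by norm_num) _).trans (Subtype.ext ?_)
  change diff X Y 0 (Hom.pair φ) = 0
  rw [diff_apply, sgn_zero, one_smul, Hom.comm, sub_self]

/-- Composition with a morphism, as a map of hom complexes. -/
def homComplexMap (X : DgA) {Y Z : DgA} (φ : Y ⟶ Z) : homComplex X Y ⟶ homComplex X Z where
  f n := ModuleCat.ofHom (homComp (zero_add n) (homElt φ))
  comm' i j h := by
    have h : j + 1 = i := h
    refine ModuleCat.hom_ext (LinearMap.ext fun f => ?_)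
    have := homComp_leibniz (zero_add i) (show -1 + i = j by omega) (zero_add j) h (homElt φ) f
    rw [d_homElt, map_zero, LinearMap.zero_apply, zero_add, sgn_zero, one_smul] at this
    exact this

end DgA

/-! ### Differential graded rings with many objects, and their modules -/

/-- A rational differential graded ring with objects `G`: a category with object set `G`, enriched
over rational chain complexes. -/
structure DGRing (G : Type) where
  hom : G → G → ChainComplex (ModuleCat.{0} ℚ) ℤ
  comp : ∀ {a b c : G} {p q n : ℤ}, p + q = n →
    ((hom b c).X p →ₗ[ℚ] (hom a b).X q →ₗ[ℚ] (hom a c).X n)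
  one : ∀ a : G, (hom a a).X 0
  one_comp : ∀ {a b : G} {p : ℤ} (f : (hom a b).X p), comp (zero_add p) (one b) f = f
  comp_one : ∀ {a b : G} {p : ℤ} (f : (hom a b).X p), comp (add_zero p) f (one a) = f
  assoc : ∀ {a b c e : G} {p q r pq qr n : ℤ} (hpq : p + q = pq) (hqr : q + r = qr)
    (h : pq + r = n) (h' : p + qr = n) (f : (hom c e).X p) (g : (hom b c).X q)
    (k : (hom a b).X r), comp h (comp hpq f g) k = comp h' f (comp hqr g k)
  d_one : ∀ a : G, (hom a a).d 0 (-1) (one a) = 0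
  leibniz : ∀ {a b c : G} {p q n p' q' n' : ℤ} (h : p + q = n) (h₁ : p' + q = n')
    (h₂ : p + q' = n') (_ : n' + 1 = n) (f : (hom b c).X p) (g : (hom a b).X q),
    (hom a c).d n n' (comp h f g) =
      comp h₁ ((hom b c).d p p' f) g + sgn p • comp h₂ f ((hom a b).d q q' g)

/-- A (right) module over a rational differential graded ring with many objects. -/
structure DGMod {G : Type} (R : DGRing G) where
  obj : G → ChainComplex (ModuleCat.{0} ℚ) ℤ
  act : ∀ {a b : G} {p q n : ℤ}, p + q = n →
    ((obj b).X p →ₗ[ℚ] (R.hom a b).X q →ₗ[ℚ] (obj a).X n)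
  act_one : ∀ {a : G} {p : ℤ} (m : (obj a).X p), act (add_zero p) m (R.one a) = m
  act_comp : ∀ {a b c : G} {p q r pq qr n : ℤ} (hpq : p + q = pq) (hqr : q + r = qr)
    (h : pq + r = n) (h' : p + qr = n) (m : (obj c).X p) (g : (R.hom b c).X q)
    (k : (R.hom a b).X r), act h (act hpq m g) k = act h' m (R.comp hqr g k)
  leibniz : ∀ {a b : G} {p q n p' q' n' : ℤ} (h : p + q = n) (h₁ : p' + q = n')
    (h₂ : p + q' = n') (_ : n' + 1 = n) (m : (obj b).X p) (g : (R.hom a b).X q),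
    (obj a).d n n' (act h m g) =
      act h₁ ((obj b).d p p' m) g + sgn p • act h₂ m ((R.hom a b).d q q' g)

namespace DGMod

variable {G : Type} {R : DGRing G}

/-- A morphism of modules: chain maps commuting with the action. -/
@[ext]
structure Hom (M N : DGMod R) where
  app : ∀ a : G, M.obj a ⟶ N.obj a
  app_act : ∀ {a b : G} {p q n : ℤ} (h : p + q = n) (m : (M.obj b).X p) (g : (R.hom a b).X q),
    (app a).f n (M.act h m g) = N.act h ((app b).f p m) g

instance : Category (DGMod R) where
  Hom := Hom
  id M := { app := fun a => 𝟙 _, app_act := by intros; simp }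
  comp f g :=
    { app := fun a => f.app a ≫ g.app a
      app_act := by intros; simp [f.app_act, g.app_act] }
  id_comp f := Hom.ext (by simp)
  comp_id f := Hom.ext (by simp)
  assoc f g h := Hom.ext (by simp)

/-- The weak equivalences of modules are the quasi-isomorphisms. -/
instance : CategoryWithWeakEquivalences (DGMod R) where
  weakEquivalences _ _ f := ∀ a : G, QuasiIso (Hom.app f a)

/-- The fibrations of modules are the epimorphisms. -/
instance : CategoryWithFibrations (DGMod R) where
  fibrations := .epimorphisms _

/-- The cofibrations of modules are determined by the left lifting property. -/
instance : CategoryWithCofibrations (DGMod R) where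
  cofibrations := (trivialFibrations (DGMod R)).llp

end DGMod

namespace DgA

open AObj

/-- The endomorphism ring of a family of dg objects: the full subcategory, enriched over
rational chain complexes, on the members of the family. -/
def endRing {G : Type} (B : G → DgA) : DGRing G where
  hom a b := homComplex (B a) (B b)
  comp h := homComp h
  one a := homElt (𝟙 (B a))
  one_comp _ := rfl
  comp_one _ := rfl
  assoc _ _ _ _ _ _ _ := rfl
  d_one a := d_homElt (𝟙 (B a))
  leibniz := homComp_leibniz

/-- The functor `Hom(B, -)` from dg objects to modules over the endomorphism ring of `B`. -/
def homFunctor {G : Type} (B : G → DgA) : DgA ⥤ DGMod (endRing B) where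
  obj Y :=
    { obj := fun a => homComplex (B a) Y
      act := fun h => homComp h
      act_one := fun _ => rfl
      act_comp := fun _ _ _ _ _ _ _ => rfl
      leibniz := homComp_leibniz }
  map {Y Z} φ :=
    { app := fun a => homComplexMap (B a) φ
      app_act := fun _ _ _ => rfl }

/-- `f` induces an isomorphism from `ker d / im d` to `ker d' / im d'`. -/
def IsHomologyIso {A A' : Type} [AddCommGroup A] [AddCommGroup A'] (d : A → A) (d' : A' → A')
    (f : A → A') : Prop :=
  (∀ x, d x = 0 → (∃ y, d' y = f x) → ∃ y, d y = x) ∧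
    ∀ y, d' y = 0 → ∃ x, d x = 0 ∧ ∃ z, d' z = f x - y

/-- The weak equivalences of dg objects are the quasi-isomorphisms: the maps that induce an
isomorphism in homology, on nubs and on vertices. -/
instance : CategoryWithWeakEquivalences DgA where
  weakEquivalences X Y f := IsHomologyIso X.d.1 Y.d.1 (Hom.pair f).1 ∧
    IsHomologyIso X.d.2 Y.d.2 (Hom.pair f).2

/-- The cofibrations of dg objects are the monomorphisms. -/
instance : CategoryWithCofibrations DgA where
  cofibrations := .monomorphisms _

/-- The fibrations of dg objects are determined by the right lifting property. -/
instance : CategoryWithFibrations DgA where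
  fibrations := (trivialCofibrations DgA).rlp

end DgA

/-! ### Model categories and Quillen equivalences -/

section Quillen

universe v₁ v₂ u₁ u₂

/-- The given classes of fibrations, cofibrations and weak equivalences form a model category. -/
def IsModelCategory (C : Type u₁) [Category.{v₁} C] [hf : CategoryWithFibrations C]
    [hc : CategoryWithCofibrations C] [hw : CategoryWithWeakEquivalences C] : Prop :=
  ∃ m : ModelCategory C, m.categoryWithFibrations = hf ∧ m.categoryWithCofibrations = hc ∧
    m.categoryWithWeakEquivalences = hw

/-- The object `X` is fibrant: the map from it to the terminal object is a fibration. -/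
def IsFibrantObj {C : Type u₁} [Category.{v₁} C] [CategoryWithFibrations C] (X : C) : Prop :=
  ∀ (Z : C) (_ : Limits.IsTerminal Z) (f : X ⟶ Z), Fibration f

variable {C : Type u₁} [Category.{v₁} C] [CategoryWithFibrations C] [CategoryWithWeakEquivalences C]
  {D : Type u₂} [Category.{v₂} D] [CategoryWithFibrations D] [CategoryWithWeakEquivalences D]

/-- A Quillen adjoint pair: the right adjoint preserves fibrations and trivial fibrations. -/
structure IsQuillenAdjunction {F : C ⥤ D} {G : D ⥤ C} (_ : F ⊣ G) : Prop where
  fibration : fibrations D ≤ (fibrations C).inverseImage G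
  trivialFibration : trivialFibrations D ≤ (trivialFibrations C).inverseImage G

/-- A Quillen equivalence: a Quillen adjoint pair whose total derived functors between the
homotopy categories exist and are adjoint equivalences. Here `e.functor` and `e.inverse` are the
total left and right derived functors, with structure maps `α` and `β`, and the last condition says
that the unit of `e` is that of the derived adjunction. -/
structure IsQuillenEquivalence {F : C ⥤ D} {G : D ⥤ C} (adj : F ⊣ G) : Prop extends
    IsQuillenAdjunction adj where
  derived : ∃ (e : (weakEquivalences C).Localization ≌ (weakEquivalences D).Localization)
    (α : (weakEquivalences C).Q ⋙ e.functor ⟶ F ⋙ (weakEquivalences D).Q)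
    (β : G ⋙ (weakEquivalences C).Q ⟶ (weakEquivalences D).Q ⋙ e.inverse),
    e.functor.IsLeftDerivedFunctor α (weakEquivalences C) ∧
    e.inverse.IsRightDerivedFunctor β (weakEquivalences D) ∧
    ∀ X : C, e.unit.app ((weakEquivalences C).Q.obj X) ≫ e.inverse.map (α.app X) =
      (weakEquivalences C).Q.map (adj.unit.app X) ≫ β.app (F.obj X)

end Quillen

/-! ### Constructions with graded modules -/

section Internal

variable {M : Type} [AddCommGroup M] [Module ℚ M]

lemma isInternal_of_separating (deg : ℤ → Submodule ℚ M) {W : ℤ → Type}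
    [∀ n, AddCommGroup (W n)] [∀ n, Module ℚ (W n)] (q : ∀ n, M →ₗ[ℚ] W n)
    (h0 : ∀ m n, m ≠ n → ∀ x ∈ deg m, q n x = 0)
    (hinj : ∀ n, ∀ x ∈ deg n, q n x = 0 → x = 0) (htop : iSup deg = ⊤) :
    DirectSum.IsInternal deg := by
  refine DirectSum.isInternal_submodule_of_iSupIndep_of_iSup_eq_top ?_ htop
  rw [iSupIndep_def]
  intro n
  rw [Submodule.disjoint_def]
  intro x hx hx'
  have hle : (⨆ j, ⨆ (_ : j ≠ n), deg j) ≤ LinearMap.ker (q n) :=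
    iSup₂_le fun j hj y hy => LinearMap.mem_ker.2 (h0 j n hj y hy)
  exact hinj n x hx (hle hx')

lemma isInternal_gradeBy {ι W : Type} [AddCommGroup W] [Module ℚ W] (co : ι → M →ₗ[ℚ] W)
    (δ : ι → ℤ) (hinj : ∀ x, (∀ i, co i x = 0) → x = 0) (htop : iSup (gradeBy co δ) = ⊤) :
    DirectSum.IsInternal (gradeBy co δ) := by
  refine isInternal_of_separating _ (W := fun n => {i // δ i = n} → W)
    (fun n => LinearMap.pi fun i => co i.1) ?_ ?_ htop
  · intro m n hmn x hx
    funext ⟨i, hi⟩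
    by_contra h
    exact hmn ((hx i h).symm.trans hi)
  · intro n x hx h
    refine hinj x fun i => ?_
    by_contra h'
    exact h' (congrFun h ⟨i, hx i h'⟩)

lemma exists_projections {deg : ℤ → Submodule ℚ M} (h : DirectSum.IsInternal deg) :
    ∃ p : ℤ → M →ₗ[ℚ] M, (∀ n, ∀ x ∈ deg n, p n x = x) ∧
      ∀ m n, m ≠ n → ∀ x ∈ deg m, p n x = 0 := by
  refine ⟨fun n => (deg n).subtype ∘ₗ DirectSum.component ℚ ℤ (fun i => deg i) n ∘ₗ
    (LinearEquiv.ofBijective (DirectSum.coeLinearMap deg) h).symm.toLinearMap, ?_, ?_⟩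
  · intro n x hx
    exact congrArg Subtype.val (h.ofBijective_coeLinearMap_of_mem hx)
  · intro m n hmn x hx
    exact congrArg Subtype.val (h.ofBijective_coeLinearMap_of_mem_ne hmn hx)

end Internal

namespace GrMod

/-- The suspension `Σ^k M`, with `(Σ^k M)_n = M_{n-k}`. -/
def shift (M : GrMod) (k : ℤ) : GrMod where
  carrier := M
  deg n := M.deg (n - k)
  isInternal := by
    obtain ⟨p, hp, hp'⟩ := exists_projections M.isInternal
    refine isInternal_of_separating _ (fun n => p (n - k))
      (fun m n hmn x hx => hp' (m - k) (n - k) (by omega) x hx)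
      (fun n x hx h => (hp _ x hx).symm.trans h) ?_
    rw [eq_top_iff, ← M.isInternal.submodule_iSup_eq_top]
    refine iSup_le fun n => ?_
    refine le_trans (le_of_eq ?_) (le_iSup (fun n => M.deg (n - k)) (n + k))
    simp
  smul_mem {i j f x} hf hx := by
    have := M.smul_mem hf hx
    rwa [← add_sub_assoc] at this

/-- The direct sum of two graded modules. -/
def prod (M N : GrMod) : GrMod where
  carrier := M × N
  deg n := (M.deg n).prod (N.deg n)
  isInternal := by
    obtain ⟨p, hp, hp'⟩ := exists_projections M.isInternal
    obtain ⟨q, hq, hq'⟩ := exists_projections N.isInternal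
    refine isInternal_of_separating _ (fun n => (p n).prodMap (q n))
      (fun m n hmn x hx => Prod.ext (hp' m n hmn _ hx.1) (hq' m n hmn _ hx.2))
      (fun n x hx h => ?_) ?_
    · exact Prod.ext ((hp _ _ hx.1).symm.trans (congrArg Prod.fst h))
        ((hq _ _ hx.2).symm.trans (congrArg Prod.snd h))
    · rw [eq_top_iff]
      rintro ⟨x, y⟩ -
      have hx : x ∈ (⨆ n, (M.deg n).prod (N.deg n)).comap (LinearMap.inl ℚ M N) := by
        have : (⊤ : Submodule ℚ M) ≤ (⨆ n, (M.deg n).prod (N.deg n)).comap (LinearMap.inl ℚ M N) := by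
          rw [← M.isInternal.submodule_iSup_eq_top]
          exact iSup_le fun n z hz =>
            le_iSup (fun n => (M.deg n).prod (N.deg n)) n ⟨hz, (N.deg n).zero_mem⟩
        exact this trivial
      have hy : y ∈ (⨆ n, (M.deg n).prod (N.deg n)).comap (LinearMap.inr ℚ M N) := by
        have : (⊤ : Submodule ℚ N) ≤ (⨆ n, (M.deg n).prod (N.deg n)).comap (LinearMap.inr ℚ M N) := by
          rw [← N.isInternal.submodule_iSup_eq_top]
          exact iSup_le fun n z hz =>
            le_iSup (fun n => (M.deg n).prod (N.deg n)) n ⟨(M.deg n).zero_mem, hz⟩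
        exact this trivial
      rw [Submodule.mem_comap] at hx hy
      simpa using add_mem hx hy
  smul_mem hf hx := ⟨M.smul_mem hf hx.1, N.smul_mem hf hx.2⟩

/-- The quotient of a graded module by a homogeneous submodule. -/
def quot (M : GrMod) (L : Submodule OF M)
    (hL : L.restrictScalars ℚ ≤ ⨆ n, L.restrictScalars ℚ ⊓ M.deg n) : GrMod where
  carrier := M ⧸ L
  deg n := (M.deg n).map (L.mkQ.restrictScalars ℚ)
  isInternal := by
    obtain ⟨p, hp, hp'⟩ := exists_projections M.isInternal
    have hpL : ∀ n, L.restrictScalars ℚ ≤ (L.restrictScalars ℚ).comap (p n) := by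
      intro n
      refine hL.trans (iSup_le fun m x hx => ?_)
      by_cases h : m = n
      · subst h
        rw [Submodule.mem_comap, hp _ _ hx.2]
        exact hx.1
      · rw [Submodule.mem_comap, hp' m n h _ hx.2]
        exact zero_mem _
    refine isInternal_of_separating _
      (fun n => (Submodule.mapQ (L.restrictScalars ℚ) (L.restrictScalars ℚ) (p n) (hpL n) :
        (M ⧸ L) →ₗ[ℚ] (M ⧸ L))) ?_ ?_ ?_
    · rintro m n hmn _ ⟨x, hx, rfl⟩
      change L.mkQ (p n x) = 0
      rw [hp' m n hmn x hx, map_zero]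
    · rintro n _ ⟨x, hx, rfl⟩ h
      change L.mkQ (p n x) = 0 at h
      rwa [hp n x hx] at h
    · rw [← Submodule.map_iSup, M.isInternal.submodule_iSup_eq_top, Submodule.map_top,
        LinearMap.range_eq_top]
      exact L.mkQ_surjective
  smul_mem := by
    rintro i j f _ hf ⟨x, hx, rfl⟩
    exact ⟨f • x, M.smul_mem hf hx, rfl⟩

end GrMod

/-! ### The basic graded modules -/

lemma OF.eq_monomial_of_mem_deg {n : ℤ} {f : OF} (hf : f ∈ OF.deg n) :
    f = 0 ∨ ∃ (k : ℕ) (a : QF), f = monomial k a ∧ -2 * (k : ℤ) = n := by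
  by_cases h : f = 0
  · exact Or.inl h
  obtain ⟨k, hk⟩ : ∃ k, f.coeff k ≠ 0 := by
    by_contra! h'
    exact h (Polynomial.ext (by simpa using h'))
  refine Or.inr ⟨k, f.coeff k, Polynomial.ext fun j => ?_, hf k hk⟩
  rw [coeff_monomial]
  split_ifs with hj
  · rw [hj]
  · by_contra hj'
    have h₁ : -2 * (k : ℤ) = n := hf k hk
    have h₂ : -2 * (j : ℤ) = n := hf j hj'
    omega

lemma OF.monomial_mem_deg (k : ℕ) (a : QF) :
    (monomial k a : OF) ∈ OF.deg (-2 * (k : ℤ)) := by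
  intro j hj
  change (monomial k a : OF).coeff j ≠ 0 at hj
  rw [coeff_monomial] at hj
  split_ifs at hj with h
  · rw [h]
  · exact absurd rfl hj

lemma OF.iSup_deg : iSup OF.deg = ⊤ := by
  rw [eq_top_iff]
  rintro f -
  induction f using Polynomial.induction_on' with
  | add p q hp hq => exact add_mem hp hq
  | monomial k a => exact le_iSup OF.deg _ (OF.monomial_mem_deg k a)

/-- The graded module `𝒪_ℱ`. -/
def grOF : GrMod where
  carrier := OF
  deg := OF.deg
  isInternal := isInternal_gradeBy _ _ (fun x h => Polynomial.ext fun k => h k) OF.iSup_deg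
  smul_mem {i j f x} hf hx := by
    obtain rfl | ⟨k, a, rfl, rfl⟩ := OF.eq_monomial_of_mem_deg hf
    · simp
    obtain rfl | ⟨l, b, rfl, rfl⟩ := OF.eq_monomial_of_mem_deg hx
    · simp
    rw [smul_eq_mul, monomial_mul_monomial]
    convert OF.monomial_mem_deg (k + l) (a * b) using 1
    push_cast
    ring_nf

/-- The Laurent monomial `q c_H ^ k`. -/
def Laurent.mono (H : FinSubgroup) (q : ℚ) (k : ℤ) : Laurent H :=
  (LaurentPolynomial.C q * LaurentPolynomial.T k : LaurentPolynomial ℚ)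

lemma Laurent.mono_zero (H : FinSubgroup) (k : ℤ) : Laurent.mono H 0 k = 0 := by
  change (LaurentPolynomial.C 0 * LaurentPolynomial.T k : LaurentPolynomial ℚ) = 0
  rw [map_zero, zero_mul]

lemma Laurent.mono_one_zero (H : FinSubgroup) : Laurent.mono H 1 0 = 1 := by
  change (LaurentPolynomial.C 1 * LaurentPolynomial.T 0 : LaurentPolynomial ℚ) = 1
  rw [map_one, one_mul, LaurentPolynomial.T_zero]

lemma Laurent.mono_mul_mono (H : FinSubgroup) (q r : ℚ) (k l : ℤ) :
    Laurent.mono H q k * Laurent.mono H r l = Laurent.mono H (q * r) (k + l) := by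
  have : (LaurentPolynomial.C q * LaurentPolynomial.T k : LaurentPolynomial ℚ) *
      (LaurentPolynomial.C r * LaurentPolynomial.T l) =
      LaurentPolynomial.C (q * r) * LaurentPolynomial.T (k + l) := by
    rw [map_mul, LaurentPolynomial.T_add, mul_mul_mul_comm]
  exact this

lemma Laurent.algebraMap_monomial (H : FinSubgroup) (k : ℕ) (a : QF) :
    algebraMap OF (Laurent H) (monomial k a) = Laurent.mono H (QF.proj H a) k := by
  change Polynomial.toLaurentAlg (component H (monomial k a)) = _
  rw [component, Polynomial.coe_mapAlgHom, Polynomial.map_monomial,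
    Polynomial.toLaurentAlg_apply, Polynomial.toLaurent_C_mul_T]
  rfl

lemma Laurent.coeff_mono_mul (H : FinSubgroup) (q : ℚ) (k j : ℤ) (x : Laurent H) :
    Laurent.coeff H j (Laurent.mono H q k * x) = q * Laurent.coeff H (j - k) x := by
  have (y : LaurentPolynomial ℚ) :
      AddMonoidAlgebra.coeff (LaurentPolynomial.C q * LaurentPolynomial.T k * y) j =
        q * AddMonoidAlgebra.coeff y (j - k) := by
    rw [← LaurentPolynomial.single_eq_C_mul_T, AddMonoidAlgebra.coeff_single_mul_apply,
      neg_add_eq_sub]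
  exact this x

/-- The degree `n` part of `ℚ[c_H, c_H⁻¹]`. -/
def Laurent.deg (H : FinSubgroup) (n : ℤ) : Submodule ℚ (Laurent H) :=
  gradeBy (Laurent.coeff H) (fun k => -2 * k) n

lemma Laurent.smul_mem_deg {H : FinSubgroup} {i j : ℤ} {f : OF} {x : Laurent H}
    (hf : f ∈ OF.deg i) (hx : x ∈ Laurent.deg H j) : f • x ∈ Laurent.deg H (i + j) := by
  obtain rfl | ⟨k, a, rfl, rfl⟩ := OF.eq_monomial_of_mem_deg hf
  · have h := zero_smul OF x
    rw [h]
    exact zero_mem _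
  intro l hl
  rw [Algebra.smul_def, Laurent.algebraMap_monomial, Laurent.coeff_mono_mul] at hl
  have : -2 * (l - k) = j := hx (l - k) (right_ne_zero_of_mul hl)
  linarith

lemma Laurent.mono_mem_deg (H : FinSubgroup) (q : ℚ) (k : ℤ) :
    Laurent.mono H q k ∈ Laurent.deg H (-2 * k) := by
  intro l hl
  rw [← mul_one (Laurent.mono H q k), Laurent.coeff_mono_mul] at hl
  have h1 : AddMonoidAlgebra.coeff (1 : LaurentPolynomial ℚ) (l - k) ≠ 0 :=
    right_ne_zero_of_mul hl
  rw [← LaurentPolynomial.T_zero, LaurentPolynomial.T_apply] at h1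
  split_ifs at h1 with h2
  · rw [show l = k by omega]
  · exact absurd rfl h1

/-- The graded module `ℚ[c_H, c_H⁻¹]`. -/
def grLaurent (H : FinSubgroup) : GrMod where
  carrier := Laurent H
  deg := Laurent.deg H
  isInternal := by
    refine isInternal_gradeBy _ _ (fun x h => LaurentPolynomial.ext h) ?_
    rw [eq_top_iff]
    rintro (f : LaurentPolynomial ℚ) -
    induction f using LaurentPolynomial.induction_on' with
    | add p q hp hq => exact add_mem hp hq
    | C_mul_T n a => exact le_iSup (Laurent.deg H) _ (Laurent.mono_mem_deg H a n)
  smul_mem := Laurent.smul_mem_deg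

lemma algebraMap_mem_laurentDeg (H : FinSubgroup) {n : ℤ} {f : OF} (hf : f ∈ OF.deg n) :
    algebraMap OF (Laurent H) f ∈ Laurent.deg H n := by
  obtain rfl | ⟨k, a, rfl, rfl⟩ := OF.eq_monomial_of_mem_deg hf
  · rw [map_zero]
    exact zero_mem _
  rw [Laurent.algebraMap_monomial]
  exact Laurent.mono_mem_deg H (QF.proj H a) k

lemma TF.mem_deg_iff {n : ℤ} {x : TF} :
    x ∈ TF.deg n ↔ ∀ H, TF.component H x ∈ Laurent.deg H n :=
  ⟨fun h H k hk => h (H, k) hk, fun h i hi => h i.1 i.2 hi⟩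

lemma TF.algebraMap_mem_deg {n : ℤ} {f : OF} (hf : f ∈ OF.deg n) :
    algebraMap OF TF f ∈ TF.deg n := by
  rw [TF.mem_deg_iff]
  intro H
  rw [AlgHom.commutes]
  exact algebraMap_mem_laurentDeg H hf

lemma algebraMap_eulerClass (H : FinSubgroup) (s : eulerClasses) {v : FinSubgroup →₀ ℕ}
    (hv : ∀ H, component H s = X ^ v H) :
    algebraMap OF (Laurent H) s = Laurent.mono H 1 (v H) := by
  change Polynomial.toLaurentAlg (component H s) =
    (LaurentPolynomial.C 1 * LaurentPolynomial.T (v H) : LaurentPolynomial ℚ)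
  rw [hv, Polynomial.toLaurentAlg_apply, Polynomial.toLaurent_X_pow, map_one, one_mul]

lemma TF.component_mk' (H : FinSubgroup) (f : OF) (s : eulerClasses) {v : FinSubgroup →₀ ℕ}
    (hv : ∀ H, CircleModel.component H s = X ^ v H) :
    TF.component H (IsLocalization.mk' TF f s) =
      algebraMap OF (Laurent H) f * Laurent.mono H 1 (-(v H)) := by
  have h₁ : TF.component H (IsLocalization.mk' TF f s) * algebraMap OF (Laurent H) s =
      algebraMap OF (Laurent H) f := by
    rw [← AlgHom.commutes (TF.component H), ← map_mul, IsLocalization.mk'_spec, AlgHom.commutes]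
  rw [← h₁, algebraMap_eulerClass H s hv, mul_assoc, Laurent.mono_mul_mono, mul_one,
    add_neg_cancel, Laurent.mono_one_zero, mul_one]

lemma TF.mk'_monomial_mem (k : ℕ) (a : QF) (s : eulerClasses)
    {v : FinSubgroup →₀ ℕ} (hv : ∀ H, CircleModel.component H s = X ^ v H) {n : ℤ}
    (h : ∀ H, QF.proj H a ≠ 0 → -2 * ((k : ℤ) - v H) = n) :
    IsLocalization.mk' TF (monomial k a) s ∈ TF.deg n := by
  rw [TF.mem_deg_iff]
  intro H
  rw [TF.component_mk' H _ s hv, Laurent.algebraMap_monomial, Laurent.mono_mul_mono, mul_one,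
    ← sub_eq_add_neg]
  by_cases ha : QF.proj H a = 0
  · rw [ha, Laurent.mono_zero]
    exact zero_mem _
  · rw [← h H ha]
    exact Laurent.mono_mem_deg H (QF.proj H a) _

lemma TF.mk'_add_left (f g : OF) (s : eulerClasses) :
    IsLocalization.mk' TF (f + g) s = IsLocalization.mk' TF f s + IsLocalization.mk' TF g s := by
  rw [IsLocalization.mk'_eq_mul_mk'_one f, IsLocalization.mk'_eq_mul_mk'_one g,
    IsLocalization.mk'_eq_mul_mk'_one (f + g), map_add, add_mul]

open Classical in
lemma TF.iSup_deg : iSup TF.deg = ⊤ := by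
  rw [eq_top_iff]
  rintro x -
  obtain ⟨f, s, rfl⟩ := IsLocalization.exists_mk'_eq eulerClasses x
  obtain ⟨v, hv⟩ := s.2
  induction f using Polynomial.induction_on' with
  | add p q hp hq =>
    rw [TF.mk'_add_left]
    exact add_mem hp hq
  | monomial k a =>
    let b (t : Finset FinSubgroup) : QF := ∑ H ∈ t, QF.single H (QF.proj H a)
    have hb : ∀ t, ∀ K ∈ t, QF.proj K (b t) = QF.proj K a := by
      intro t K hK
      rw [map_sum, Finset.sum_eq_single_of_mem K hK fun H _ hH =>
        QF.proj_single_of_ne hH.symm _, QF.proj_single_self]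
    have hs : ∀ t, IsLocalization.mk' TF (monomial k (b t) : OF) s ∈ iSup TF.deg := by
      intro t
      induction t using Finset.induction_on with
      | empty => simp [b]
      | insert H t hH ih =>
        have e : b (insert H t) = QF.single H (QF.proj H a) + b t := Finset.sum_insert hH
        rw [e, map_add, TF.mk'_add_left]
        refine add_mem (le_iSup TF.deg (-2 * ((k : ℤ) - v H))
          (TF.mk'_monomial_mem k _ s hv fun H' hH' => ?_)) ih
        have : H' = H := by
          by_contra hne
          exact hH' (QF.proj_single_of_ne hne _)
        rw [this]
    rw [← sub_add_cancel a (b v.support), map_add, TF.mk'_add_left]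
    refine add_mem (le_iSup TF.deg (-2 * (k : ℤ))
      (TF.mk'_monomial_mem k _ s hv fun H hH => ?_)) (hs _)
    have : v H = 0 := by
      by_contra h
      exact hH (by rw [map_sub, hb _ H (Finsupp.mem_support_iff.2 h), sub_self])
    simp [this]

lemma TF.eq_zero_of_component (x : TF) (h : ∀ H, TF.component H x = 0) : x = 0 := by
  obtain ⟨f, s, rfl⟩ := IsLocalization.exists_mk'_eq eulerClasses x
  have hf : f = 0 := by
    refine Polynomial.ext fun k => QF.ext fun H => ?_
    have h₁ : algebraMap OF (Laurent H) f = 0 := by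
      rw [← AlgHom.commutes (TF.component H), ← IsLocalization.mk'_spec TF f s, map_mul, h,
        zero_mul]
    have h₂ : CircleModel.component H f = 0 := by
      have h₁' : Polynomial.toLaurent (CircleModel.component H f) = 0 := h₁
      exact (map_eq_zero_iff _ Polynomial.toLaurent_injective).1 h₁'
    have h₃ := congrArg (fun p => Polynomial.coeff p k) h₂
    simpa [CircleModel.component] using h₃
  rw [hf, IsLocalization.mk'_zero]

/-- The graded module `t_*^ℱ`. -/
def grTF : GrMod where
  carrier := TF
  deg := TF.deg
  isInternal := by
    refine isInternal_gradeBy (M := TF) _ _ (fun x h => ?_) TF.iSup_deg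
    exact TF.eq_zero_of_component x fun H => LaurentPolynomial.ext fun k => h (H, k)
  smul_mem {i j f x} hf hx := by
    rw [TF.mem_deg_iff] at hx ⊢
    intro H
    rw [map_smul]
    exact Laurent.smul_mem_deg hf (hx H)

/-- The submodule of an `𝒪_ℱ`-algebra `S` that is the image of `𝒪_ℱ`. -/
abbrev imageOF (S : Type) [CommRing S] [Algebra OF S] : Submodule OF S :=
  LinearMap.range (Algebra.linearMap OF S)

lemma imageOF_homogeneous (M : GrMod) (φ : OF →ₗ[OF] M)
    (hφ : ∀ n, ∀ f ∈ OF.deg n, φ f ∈ M.deg n) :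
    (LinearMap.range φ).restrictScalars ℚ ≤
      ⨆ n, (LinearMap.range φ).restrictScalars ℚ ⊓ M.deg n := by
  rintro _ ⟨f, rfl⟩
  have h : (⊤ : Submodule ℚ OF) ≤ (⨆ n, (LinearMap.range φ).restrictScalars ℚ ⊓ M.deg n).comap
      (φ.restrictScalars ℚ) := by
    rw [← OF.iSup_deg]
    exact iSup_le fun n g hg =>
      le_iSup (fun n => (LinearMap.range φ).restrictScalars ℚ ⊓ M.deg n) n
        ⟨⟨g, rfl⟩, hφ n g hg⟩
  exact h (Submodule.mem_top (x := f))

/-- The graded module `𝕀(H) = Σ⁻² ℚ[c_H, c_H⁻¹] / ℚ[c_H]`. -/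
def grIH (H : FinSubgroup) : GrMod :=
  ((grLaurent H).quot (imageOF (Laurent H)) (imageOF_homogeneous (grLaurent H)
    (Algebra.linearMap OF (Laurent H)) fun _ _ hf => algebraMap_mem_laurentDeg H hf)).shift (-2)

/-- The graded module `𝕀 = Σ⁻² t_*^ℱ / 𝒪_ℱ`. -/
def grI : GrMod :=
  (grTF.quot (imageOF TF) (imageOF_homogeneous grTF
    (Algebra.linearMap OF TF) fun _ _ hf => TF.algebraMap_mem_deg hf)).shift (-2)

/-- The `ℚ[c_H]`-module `ℚ = ℚ[c_H]/(c_H)`, as a module over `𝒪_ℱ`. -/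
def Residue (_ : FinSubgroup) : Type := ℚ

namespace Residue

instance (H : FinSubgroup) : AddCommGroup (Residue H) := inferInstanceAs (AddCommGroup ℚ)
instance (H : FinSubgroup) : Module ℚ (Residue H) := inferInstanceAs (Module ℚ ℚ)

/-- The ring map `𝒪_ℱ → ℚ[c_H] → ℚ`. -/
def ev (H : FinSubgroup) : OF →+* ℚ :=
  (Polynomial.constantCoeff : ℚ[X] →+* ℚ).comp (component H).toRingHom

instance (H : FinSubgroup) : Module OF (Residue H) := Module.compHom ℚ (ev H)

lemma smul_def (H : FinSubgroup) (f : OF) (x : Residue H) : f • x = ev H f • x := rfl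

lemma ev_eq (H : FinSubgroup) (f : OF) : ev H f = QF.proj H (f.coeff 0) := by
  simp [ev, component]

instance (H : FinSubgroup) : IsScalarTower ℚ OF (Residue H) where
  smul_assoc a f x := by
    rw [smul_def, smul_def, ev_eq, ev_eq, coeff_smul, smul_smul]
    rfl

end Residue

/-- A vector space, as a graded vector space concentrated in degree zero. -/
def degZero (M : Type) [AddCommGroup M] [Module ℚ M] (n : ℤ) : Submodule ℚ M :=
  gradeBy (fun _ : Unit => (LinearMap.id : M →ₗ[ℚ] M)) (fun _ => 0) n

lemma isInternal_degZero (M : Type) [AddCommGroup M] [Module ℚ M] :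
    DirectSum.IsInternal (degZero M) := by
  refine isInternal_gradeBy _ _ (fun x h => h ()) ?_
  rw [eq_top_iff]
  exact fun x _ => le_iSup (degZero M) 0 (show x ∈ degZero M 0 from fun _ _ => rfl)

/-- The graded vector space which is `M` in degree zero. -/
def grZero (M : Type) [AddCommGroup M] [Module ℚ M] : GrVect where
  carrier := M
  deg := degZero M
  isInternal := isInternal_degZero M

/-- The graded module `ℚ(H)`, concentrated in degree zero. -/
def grResidue (H : FinSubgroup) : GrMod where
  carrier := Residue H
  deg := degZero (Residue H)
  isInternal := isInternal_degZero (Residue H)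
  smul_mem {i j f x} hf hx u h := by
    change f • x ≠ 0 at h
    rw [Residue.smul_def, Residue.ev_eq] at h
    have h₁ : f.coeff 0 ≠ 0 := fun h' => h (by rw [h', map_zero, zero_smul])
    have h₂ : x ≠ 0 := fun h' => h (by rw [h', smul_zero])
    have h₃ : -2 * ((0 : ℕ) : ℤ) = i := hf 0 h₁
    have h₄ : (0 : ℤ) = j := hx u h₂
    change (0 : ℤ) = i + j
    rw [← h₃, ← h₄]
    simp

/-! ### The algebraic basic cells and their fibrant replacements -/

lemma localizedMap_bijective {M N : Type} [AddCommGroup M] [AddCommGroup N] [Module OF M]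
    [Module OF N] (β : M →ₗ[OF] N) (hker : ∀ x, β x = 0 → ∃ s ∈ eulerClasses, s • x = 0)
    (hcoker : ∀ y, ∃ s ∈ eulerClasses, ∃ x, β x = s • y) :
    Function.Bijective (LocalizedModule.map eulerClasses β) := by
  constructor
  · rw [injective_iff_map_eq_zero]
    intro z
    induction z using LocalizedModule.induction_on with
    | h m s =>
      intro h
      rw [LocalizedModule.map_mk, ← LocalizedModule.zero_mk s, LocalizedModule.mk_eq] at h
      obtain ⟨u, hu⟩ := h
      simp only [smul_zero] at hu
      obtain ⟨t, ht, htm⟩ := hker ((u * s) • m) (by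
        rw [Submonoid.smul_def, map_smul, ← Submonoid.smul_def, mul_smul, hu])
      rw [← LocalizedModule.zero_mk s, LocalizedModule.mk_eq]
      refine ⟨⟨t, ht⟩ * u, ?_⟩
      rw [smul_zero, smul_zero, ← htm, mul_smul, mul_smul]
      rfl
  · intro z
    induction z using LocalizedModule.induction_on with
    | h y s =>
      obtain ⟨t, ht, x, hx⟩ := hcoker y
      refine ⟨LocalizedModule.mk x (⟨t, ht⟩ * s), ?_⟩
      rw [LocalizedModule.map_mk, hx]
      exact LocalizedModule.mk_cancel_common_left (⟨t, ht⟩ : eulerClasses) s y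

lemma exists_eulerClass (H : FinSubgroup) (k : ℕ) :
    ∃ s ∈ eulerClasses, component H s = X ^ k := by
  have h (K : FinSubgroup) : component K (monomial k (QF.single H 1) + C (1 - QF.single H 1)) =
      monomial k (QF.proj K (QF.single H 1)) + C (1 - QF.proj K (QF.single H 1)) := by
    simp [component, Polynomial.map_monomial]
  have hH : component H (monomial k (QF.single H 1) + C (1 - QF.single H 1)) = X ^ k := by
    rw [h, QF.proj_single_self, sub_self, map_zero, add_zero, Polynomial.X_pow_eq_monomial]
  refine ⟨_, ⟨Finsupp.single H k, fun K => ?_⟩, hH⟩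
  by_cases hK : K = H
  · rw [hK, hH, Finsupp.single_eq_same]
  · rw [h, QF.proj_single_of_ne hK, map_zero, zero_add, sub_zero, map_one,
      Finsupp.single_eq_of_ne hK, pow_zero]

/-- The module `N` is `ℰ`-torsion. -/
def IsTorsionMod (N : Type) [AddCommGroup N] [Module OF N] : Prop :=
  ∀ x : N, ∃ s ∈ eulerClasses, s • x = 0

/-- The object `(N → 0)` of `𝒜`, for a torsion module `N`. -/
def torsionObj (N : GrMod) (hN : IsTorsionMod N) : AObj where
  nub := N
  vertex := grZero PUnit.{1}
  β := 0
  β_mem _ := zero_mem _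
  β_loc := by
    refine localizedMap_bijective _ (fun x _ => hN x) fun y => ⟨1, one_mem _, 0, ?_⟩
    exact (inferInstance : Subsingleton (TF ⊗[ℚ] PUnit.{1})).elim _ _

lemma isTorsion_residue (H : FinSubgroup) : IsTorsionMod (Residue H) := by
  intro x
  obtain ⟨s, hs, h⟩ := exists_eulerClass H 1
  refine ⟨s, hs, ?_⟩
  have : Residue.ev H s = 0 := by
    change (Polynomial.constantCoeff : ℚ[X] →+* ℚ) (component H s) = 0
    rw [h]
    simp
  rw [Residue.smul_def, this]
  exact zero_smul ℚ x

lemma isTorsion_laurent (H : FinSubgroup) : IsTorsionMod (Laurent H ⧸ imageOF (Laurent H)) := by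
  intro x
  obtain ⟨y, rfl⟩ := Submodule.mkQ_surjective _ x
  obtain ⟨k, f, hf⟩ := LaurentPolynomial.exists_T_pow (y : LaurentPolynomial ℚ)
  obtain ⟨s, hs, h⟩ := exists_eulerClass H k
  refine ⟨s, hs, ?_⟩
  rw [← map_smul]
  refine (Submodule.Quotient.mk_eq_zero _).2
    ⟨f.map (algebraMap ℚ QF), ?_⟩
  have h₁ : component H (f.map (algebraMap ℚ QF)) = f := by
    refine Polynomial.ext fun n => ?_
    simp [component]
  have h₂ (z : LaurentPolynomial ℚ) (hz : toLaurent f = z * LaurentPolynomial.T k) :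
      toLaurent (component H (f.map (algebraMap ℚ QF))) =
        toLaurent (component H s) * z := by
    rw [h₁, h, hz, Polynomial.toLaurent_X_pow, mul_comm]
  exact h₂ y hf

lemma isTorsion_TF : IsTorsionMod (TF ⧸ imageOF TF) := by
  intro x
  obtain ⟨y, rfl⟩ := Submodule.mkQ_surjective _ x
  obtain ⟨f, s, rfl⟩ := IsLocalization.exists_mk'_eq eulerClasses y
  refine ⟨s, s.2, ?_⟩
  rw [← map_smul]
  refine (Submodule.Quotient.mk_eq_zero _).2 ⟨f, ?_⟩
  rw [Algebra.smul_def, mul_comm, IsLocalization.mk'_spec]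
  rfl

lemma IsTorsionMod.prod {M N : Type} [AddCommGroup M] [Module OF M] [AddCommGroup N] [Module OF N]
    (hM : IsTorsionMod M) (hN : IsTorsionMod N) : IsTorsionMod (M × N) := by
  rintro ⟨x, y⟩
  obtain ⟨s, hs, hsx⟩ := hM x
  obtain ⟨t, ht, hty⟩ := hN y
  refine ⟨s * t, mul_mem hs ht, Prod.ext ?_ ?_⟩
  · change (s * t) • x = 0
    rw [mul_comm, mul_smul, hsx, smul_zero]
  · change (s * t) • y = 0
    rw [mul_smul, hty, smul_zero]

/-- The map `x ↦ x ⊗ 1`. -/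
def tensorOne : TF →ₗ[OF] TF ⊗[ℚ] ℚ :=
  (TensorProduct.AlgebraTensorModule.rid ℚ OF TF).symm.toLinearMap

lemma tensorOne_injective : Function.Injective tensorOne :=
  (TensorProduct.AlgebraTensorModule.rid ℚ OF TF).symm.injective

lemma tensorOne_mem {n : ℤ} {x : TF} (hx : x ∈ TF.deg n) :
    tensorOne x ∈ tensorDeg (grZero ℚ) n :=
  Submodule.subset_span ⟨n, 0, add_zero n, x, hx, (1 : ℚ), fun _ _ => rfl, rfl⟩

/-- For a finite subgroup `H`, the basic cell `L_H = (Σ ℚ(H) → 0)`, with zero differential. -/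
def cellFin (H : FinSubgroup) : DgA where
  toAObj := torsionObj ((grResidue H).shift 1) (isTorsion_residue H)
  d := 0
  d_mem := zero_mem _
  d_comp_d := by simp

/-- The basic cell `L_𝕋 = (𝒪_ℱ → t_*^ℱ)`, with zero differential. -/
def cellT : DgA where
  nub := grOF
  vertex := grZero ℚ
  β := tensorOne ∘ₗ Algebra.linearMap OF TF
  β_mem hx := tensorOne_mem (TF.algebraMap_mem_deg hx)
  β_loc := by
    refine localizedMap_bijective _ (fun f hf => ?_) fun y => ?_
    · have h : algebraMap OF TF f = 0 := by
        exact tensorOne_injective (hf.trans (map_zero tensorOne).symm)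
      obtain ⟨s, hs⟩ := (IsLocalization.map_eq_zero_iff eulerClasses TF f).1 h
      exact ⟨s, s.2, hs⟩
    · obtain ⟨f, s, hf⟩ := IsLocalization.exists_mk'_eq eulerClasses
        (TensorProduct.AlgebraTensorModule.rid ℚ OF TF y)
      refine ⟨s, s.2, f, ?_⟩
      change tensorOne (algebraMap OF TF f) = _
      rw [← IsLocalization.mk'_spec TF f s, hf, mul_comm, ← Algebra.smul_def, map_smul]
      congr 1
      exact LinearEquiv.symm_apply_apply _ y
  d := 0
  d_mem := zero_mem _
  d_comp_d := by simp

/-- For a finite subgroup `H`, the object `I_H = (Σ𝕀(H) ⋉ Σ²𝕀(H) → 0)`. Its differential is given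
by the map `Σ𝕀(H) → Σ³𝕀(H)` that is zero in degree one and an isomorphism in higher degrees, namely
the multiplication by `c`. -/
def injFin (H : FinSubgroup) : DgA where
  toAObj := torsionObj (((grIH H).shift 1).prod ((grIH H).shift 2))
    (.prod (isTorsion_laurent H) (isTorsion_laurent H))
  d := (LinearMap.inr OF (grIH H) (grIH H) ∘ₗ LinearMap.lsmul OF (grIH H) X ∘ₗ
    LinearMap.fst OF (grIH H) (grIH H), 0)
  d_mem := by
    refine ⟨fun i x hx => ⟨zero_mem _, ?_⟩, fun i x hx => zero_mem _, fun x => ?_⟩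
    · have h : (X : OF) • x.1 ∈ (grIH H).deg (-2 + (i - 1)) := by
        refine (grIH H).smul_mem ?_ hx.1
        simpa using! OF.monomial_mem_deg 1 1
      rw [show -2 + (i - 1) = i + -1 - 2 by ring] at h
      exact h
    · exact (map_zero _).symm
  d_comp_d := by
    refine Prod.ext (LinearMap.ext fun x => Prod.ext rfl ?_) rfl
    exact smul_zero (A := grIH H) (X : OF)

/-- The object `I_𝕋 = (t_*^ℱ ⋉ Σ𝕀 → t_*^ℱ)`. Its differential is given by the quotient map
`t_*^ℱ → Σ²𝕀 = t_*^ℱ / 𝒪_ℱ`, which is zero in non-positive degrees and an isomorphism in positive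
degrees. -/
def injT : DgA where
  nub := grTF.prod (grI.shift 1)
  vertex := grZero ℚ
  β := tensorOne ∘ₗ LinearMap.fst OF TF (TF ⧸ imageOF TF)
  β_mem hx := tensorOne_mem hx.1
  β_loc := by
    refine localizedMap_bijective (M := TF × (TF ⧸ imageOF TF)) _ (fun x hx => ?_) fun y => ?_
    · obtain ⟨x, z⟩ := x
      have h : x = 0 := by
        exact tensorOne_injective (hx.trans (map_zero tensorOne).symm)
      obtain ⟨s, hs, hz⟩ := isTorsion_TF z
      exact ⟨s, hs, Prod.ext ((congrArg (s • ·) h).trans (smul_zero s)) hz⟩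
    · refine ⟨1, one_mem _, (TensorProduct.AlgebraTensorModule.rid ℚ OF TF y, 0), ?_⟩
      rw [one_smul]
      exact LinearEquiv.symm_apply_apply _ y
  d := (LinearMap.inr OF TF (TF ⧸ imageOF TF) ∘ₗ (imageOF TF).mkQ ∘ₗ
    LinearMap.fst OF TF (TF ⧸ imageOF TF), 0)
  d_mem := by
    refine ⟨fun i x hx => ⟨zero_mem _, x.1, ?_, rfl⟩, fun i x hx => zero_mem _, fun x => ?_⟩
    · have h := hx.1
      rw [show i = i + -1 - 1 - -2 by ring] at h
      exact h
    · rw [LinearMap.lTensor_zero]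
      exact map_zero tensorOne
  d_comp_d := by
    refine Prod.ext (LinearMap.ext fun x => Prod.ext rfl ?_) rfl
    exact map_zero (imageOF TF).mkQ

lemma mkQ_smul_mono (H : FinSubgroup) (f : OF) (q : ℚ) :
    (imageOF (Laurent H)).mkQ (f • Laurent.mono H q (-1)) =
      (imageOF (Laurent H)).mkQ (Laurent.mono H (Residue.ev H f * q) (-1)) := by
  have h₁ : (X : OF) • Laurent.mono H q (-1) = algebraMap OF (Laurent H) (algebraMap ℚ OF q) := by
    rw [Algebra.smul_def, ← Polynomial.monomial_one_one_eq_X, Laurent.algebraMap_monomial,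
      Laurent.mono_mul_mono, Polynomial.algebraMap_apply, ← Polynomial.monomial_zero_left,
      Laurent.algebraMap_monomial]
    simp
  have h₂ : (C (f.coeff 0) : OF) • Laurent.mono H q (-1) =
      Laurent.mono H (Residue.ev H f * q) (-1) := by
    rw [Algebra.smul_def, ← Polynomial.monomial_zero_left, Laurent.algebraMap_monomial,
      Laurent.mono_mul_mono, Residue.ev_eq]
    simp
  have h₃ : f • Laurent.mono H q (-1) = f.divX • algebraMap OF (Laurent H) (algebraMap ℚ OF q) +
      Laurent.mono H (Residue.ev H f * q) (-1) := by
    rw [← h₁, ← h₂, smul_smul, ← add_smul, Polynomial.divX_mul_X_add]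
  have h₄ : (imageOF (Laurent H)).mkQ
      (f.divX • algebraMap OF (Laurent H) (algebraMap ℚ OF q)) = 0 :=
    (Submodule.Quotient.mk_eq_zero _).2 (Submodule.smul_mem _ _ ⟨_, rfl⟩)
  rw [h₃, map_add, h₄, zero_add]

/-- The map `ℚ(H) → 𝕀(H)` that sends `1` to the class of `c_H⁻¹`. -/
def residueMap (H : FinSubgroup) : Residue H →ₗ[OF] Laurent H ⧸ imageOF (Laurent H) where
  toFun q := (imageOF (Laurent H)).mkQ (Laurent.mono H q (-1))
  map_add' q r := by
    rw [← map_add]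
    congr 1
    have (a b : ℚ) : (LaurentPolynomial.C (a + b) * LaurentPolynomial.T (-1) :
        LaurentPolynomial ℚ) = LaurentPolynomial.C a * LaurentPolynomial.T (-1) +
          LaurentPolynomial.C b * LaurentPolynomial.T (-1) := by
      rw [map_add, add_mul]
    exact this q r
  map_smul' f q := by
    rw [RingHom.id_apply, ← map_smul]
    exact (mkQ_smul_mono H f q).symm

lemma X_smul_residueMap (H : FinSubgroup) (x : Residue H) : (X : OF) • residueMap H x = 0 := by
  rw [← map_smul, Residue.smul_def, Residue.ev_eq, coeff_X_zero, map_zero, zero_smul, map_zero]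

/-- The inclusion `L_H → I_H`, for a finite subgroup `H`. -/
def inclFin (H : FinSubgroup) : cellFin H ⟶ injFin H where
  pair := (LinearMap.inl OF (grIH H) (grIH H) ∘ₗ residueMap H, LinearMap.id)
  mem := by
    refine ⟨fun i x hx => ⟨⟨Laurent.mono H x (-1), ?_, rfl⟩, zero_mem _⟩, fun i x hx => ?_,
      fun x => (map_zero _).symm⟩
    · by_cases h : x = 0
      · have h₀ : Laurent.mono H x (-1) = 0 := h ▸ Laurent.mono_zero H (-1)
        exact (congrArg (· ∈ (grLaurent H).deg (i + 0 - 1 - -2)) h₀).mpr (zero_mem _)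
      · have h₁ : (0 : ℤ) = i - 1 := hx () h
        have h₂ := Laurent.mono_mem_deg H x (-1)
        rw [show i + 0 - 1 - -2 = -2 * -1 by omega]
        exact h₂
    · rw [add_zero]
      exact hx
  comm := by
    refine Eq.trans ?_ (map_zero (AObj.comp _)).symm
    refine Prod.ext (LinearMap.ext fun x => Prod.ext rfl ?_) rfl
    exact X_smul_residueMap H x

/-- The inclusion `L_𝕋 → I_𝕋`. -/
def inclT : cellT ⟶ injT where
  pair := (LinearMap.inl OF TF (TF ⧸ imageOF TF) ∘ₗ Algebra.linearMap OF TF, LinearMap.id)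
  mem := by
    refine ⟨fun i x hx => ⟨?_, zero_mem _⟩, fun i x hx => ?_, fun x => ?_⟩
    · rw [add_zero]
      exact TF.algebraMap_mem_deg hx
    · rw [add_zero]
      exact hx
    · exact (LinearMap.congr_fun (LinearMap.lTensor_id (R := ℚ) TF ℚ) (cellT.β x)).symm
  comm := by
    refine Eq.trans ?_ (map_zero (AObj.comp _)).symm
    refine Prod.ext (LinearMap.ext fun x => Prod.ext rfl ?_) rfl
    exact (Submodule.Quotient.mk_eq_zero _).2 ⟨x, rfl⟩

open Classical in
/-- The kind of a closed subgroup of the circle: either a finite subgroup, or (`none`) the whole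
circle, which is the only closed subgroup that is not finite. -/
def kind (H : ClosedSubgroup Circle) : Option FinSubgroup :=
  if h : Finite H.toSubgroup then some ⟨H.toSubgroup, h⟩ else none

/-- The algebraic basic cells. -/
def cell : Option FinSubgroup → DgA
  | some H => cellFin H
  | none => cellT

/-- The objects `I_H` and `I_𝕋`. -/
def inj : Option FinSubgroup → DgA
  | some H => injFin H
  | none => injT

/-- The inclusions `L_H → I_H` and `L_𝕋 → I_𝕋`. -/
def incl : ∀ k, cell k ⟶ inj k
  | some H => inclFin H
  | none => inclT

/-- The algebraic basic cell `L_H`, for a closed subgroup `H` of the circle. -/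
def basicCell (H : ClosedSubgroup Circle) : DgA := cell (kind H)

/-- The family `ℬ_a` of the fibrant replacements `I_H` of the algebraic basic cells, one for each
closed subgroup `H` of the circle. -/
def basicInj (H : ClosedSubgroup Circle) : DgA := inj (kind H)

/-- The inclusion `L_H → I_H`. -/
def basicIncl (H : ClosedSubgroup Circle) : basicCell H ⟶ basicInj H := incl (kind H)

end CircleModel

end

set_option linter.unusedVariables false

/-! Everything rests on one class of objects, those whose nub is divisible by the Euler classes
(`IsDiv`). They are injective in 𝒜 (`IsDiv.exists_extension`): vertices extend by linear algebra,
and on nubs one reduces to an inclusion with ℰ-torsion cokernel, where Zorn's lemma and division by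
a single c_H suffice. Every object embeds in a divisible one (`toHull_inj`, `hull_isDiv`), and
quotients of divisible objects are divisible, so 𝒜 has injective dimension at most one. Hence, with
no boundedness assumption, divisible acyclic dg objects are contractible (`Acyclic.contractible`),
and maps from an acyclic object to a divisible one form an acyclic complex (`Acyclic.homAcyclic`).

For the model structure on dg objects, the obstruction to lifting a monomorphism with cokernel Q
against a surjection with divisible kernel K is a class in the homology of Hom(Q, K) in degree -1
(`hasLiftingProperty_of_homAcyclic`); it vanishes if Q or K is acyclic. The factorizations come from
embeddings in divisible contractible objects (`exists_envelope`) and from homotopy fibres. By the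
retract argument the fibrations are the retracts of surjections with divisible kernel, and the
fibrant objects are the divisible ones. In particular I_H is fibrant; L_H → I_H is a
quasi-isomorphism because c_H acts surjectively on 𝕀(H), with kernel spanned by the class of c_H⁻¹,
and 𝒪_ℱ is the kernel of t → t/𝒪_ℱ.

The model structure on modules is the projective one, obtained from the small object argument with
spheres and disks. These are taken to be the modules Hom(I, Z) for Z a suspension of I_H, or the
homotopy fibre of the identity of one. So their freeness is the Yoneda lemma, and their images under
the left adjoint are known. The left adjoint exists since every module is the cokernel of a map
between sums of disks (`exists_univ`).

The equivalence is Morita theory for a family of divisible compact generators. Compactness: L_H is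
generated by one element on the nub and one on the vertex, so a map from it to a direct sum meets
finitely many summands, and for divisible targets this passes to I_H up to homotopy
(`IsCompactUpToQuasiIso.exists_finset`). Therefore the modules with a universal arrow to a divisible
object that is a weak equivalence are closed under cell attachments, telescopes and retracts, and
include all cofibrant modules (`weakEquivalence_of_isCofibrant`). Generation: a divisible Y with all
Hom(I_H, Y) acyclic is acyclic (`generates_basicInj`). The cells of finite subgroups detect the
torsion part, the kernel of β, by induction on the power of c_H that kills a cycle, and L_𝕋 then
detects the vertex. Hence Hom(I, -) reflects weak equivalences between divisible objects, and the
unit being a weak equivalence on cofibrant modules is enough for the formal criterion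
`isQuillenEquivalence_of`. -/

noncomputable section
namespace CircleModel

open CategoryTheory HomotopicalAlgebra TensorProduct Polynomial

/-! ### Graded vector spaces -/

namespace GrVect

variable (V : GrVect)

/-- The projection of a graded vector space onto its part of degree `n`. -/
def proj (n : ℤ) : V →ₗ[ℚ] V := Classical.choose (exists_projections V.isInternal) n

variable {V}

lemma proj_of_mem {n : ℤ} {x : V} (hx : x ∈ V.deg n) : V.proj n x = x :=
  (Classical.choose_spec (exists_projections V.isInternal)).1 n x hx

lemma proj_of_mem_ne {m n : ℤ} (h : m ≠ n) {x : V} (hx : x ∈ V.deg m) : V.proj n x = 0 :=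
  (Classical.choose_spec (exists_projections V.isInternal)).2 m n h x hx

lemma induction {p : V → Prop} (x : V) (hom : ∀ n, ∀ x ∈ V.deg n, p x)
    (add : ∀ x y, p x → p y → p (x + y)) : p x := by
  have hx : x ∈ iSup V.deg := by
    rw [V.isInternal.submodule_iSup_eq_top]
    trivial
  exact Submodule.iSup_induction V.deg (motive := p) hx hom (hom 0 0 (zero_mem _)) add

lemma proj_mem (n : ℤ) (x : V) : V.proj n x ∈ V.deg n := by
  induction x using induction with
  | hom m x hx =>
    by_cases h : m = n
    · subst h
      rwa [proj_of_mem hx]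
    · rw [proj_of_mem_ne h hx]
      exact zero_mem _
  | add x y hx hy =>
    rw [map_add]
    exact add_mem hx hy

/-- Allowing every larger finite set makes the induction work: the sets that serve two summands are
replaced by their union. -/
lemma exists_sum_proj (x : V) : ∃ S : Finset ℤ, ∀ S', S ⊆ S' → ∑ n ∈ S', V.proj n x = x := by
  classical
  induction x using induction with
  | hom m x hx =>
    refine ⟨{m}, fun S' h => ?_⟩
    rw [Finset.sum_eq_single_of_mem m (h (Finset.mem_singleton_self m))
      fun n _ hn => proj_of_mem_ne hn.symm hx, proj_of_mem hx]
  | add x y hx hy =>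
    obtain ⟨S, hS⟩ := hx
    obtain ⟨T, hT⟩ := hy
    refine ⟨S ∪ T, fun S' h => ?_⟩
    simp_rw [map_add]
    rw [Finset.sum_add_distrib, hS _ (Finset.union_subset_left h),
      hT _ (Finset.union_subset_right h)]

lemma eq_zero_of_proj {x : V} (h : ∀ n, V.proj n x = 0) : x = 0 := by
  obtain ⟨S, hS⟩ := exists_sum_proj x
  rw [← hS S le_rfl]
  exact Finset.sum_eq_zero fun n _ => h n

lemma mem_of_proj {n : ℤ} {x : V} (h : ∀ m, m ≠ n → V.proj m x = 0) : x ∈ V.deg n := by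
  have : x = V.proj n x := by
    refine sub_eq_zero.1 (eq_zero_of_proj fun m => ?_)
    rw [map_sub]
    by_cases hm : m = n
    · rw [hm, proj_of_mem (proj_mem n x), sub_self]
    · rw [h m hm, proj_of_mem_ne (Ne.symm hm) (proj_mem n x), sub_self]
  rw [this]
  exact proj_mem n x

lemma proj_map {W : GrVect} {f : V →ₗ[ℚ] W} {k : ℤ}
    (hf : ∀ i, ∀ x ∈ V.deg i, f x ∈ W.deg (i + k)) (n : ℤ) (x : V) :
    W.proj (n + k) (f x) = f (V.proj n x) := by
  induction x using induction with
  | hom m x hx =>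
    by_cases h : m = n
    · subst h
      rw [proj_of_mem hx, proj_of_mem (hf _ x hx)]
    · rw [proj_of_mem_ne h hx, proj_of_mem_ne (by omega) (hf _ x hx), map_zero]
  | add x y hx hy => rw [map_add, map_add, map_add, map_add, hx, hy]

/-- A homogeneous map commutes with the projections, so the components of x in other degrees go to
zero, hence vanish. Lifts through injections inherit their homogeneity in this way. -/
lemma mem_of_map_mem {W : GrVect} {f : V →ₗ[ℚ] W} {k : ℤ}
    (hf : ∀ i, ∀ x ∈ V.deg i, f x ∈ W.deg (i + k)) (hinj : Function.Injective f) {n : ℤ} {x : V}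
    (hx : f x ∈ W.deg (n + k)) : x ∈ V.deg n := by
  refine mem_of_proj fun m hm => hinj ?_
  rw [map_zero, ← proj_map hf, proj_of_mem_ne (by omega) hx]

lemma exists_mem_of_map_mem {W : GrVect} {f : V →ₗ[ℚ] W} {k : ℤ}
    (hf : ∀ i, ∀ x ∈ V.deg i, f x ∈ W.deg (i + k)) {n : ℤ} {x : V}
    (hx : f x ∈ W.deg (n + k)) : ∃ y ∈ V.deg n, f y = f x :=
  ⟨V.proj n x, proj_mem n x, by rw [← proj_map hf, proj_of_mem hx]⟩

/-- The part of degree `k` of a linear map between graded vector spaces. -/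
def homPart {V W : GrVect} (f : V →ₗ[ℚ] W) (k : ℤ) : V →ₗ[ℚ] W :=
  DirectSum.toModule ℚ ℤ W (fun m => W.proj (m + k) ∘ₗ f ∘ₗ (V.deg m).subtype) ∘ₗ
    (LinearEquiv.ofBijective (DirectSum.coeLinearMap V.deg) V.isInternal).symm.toLinearMap

lemma homPart_of_mem {W : GrVect} (f : V →ₗ[ℚ] W) (k : ℤ) {m : ℤ} {x : V} (hx : x ∈ V.deg m) :
    homPart f k x = W.proj (m + k) (f x) := by
  have : (LinearEquiv.ofBijective (DirectSum.coeLinearMap V.deg) V.isInternal).symm x =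
      DirectSum.lof ℚ ℤ (fun i => V.deg i) m ⟨x, hx⟩ := by
    exact (LinearEquiv.symm_apply_eq _).2 (DirectSum.coeLinearMap_lof V.deg m ⟨x, hx⟩).symm
  refine (congrArg (DirectSum.toModule ℚ ℤ W
    (fun m => W.proj (m + k) ∘ₗ f ∘ₗ (V.deg m).subtype)) this).trans ?_
  exact DirectSum.toModule_lof ℚ m _

lemma homPart_mem {W : GrVect} (f : V →ₗ[ℚ] W) (k m : ℤ) {x : V} (hx : x ∈ V.deg m) :
    homPart f k x ∈ W.deg (m + k) := by
  rw [homPart_of_mem f k hx]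
  exact proj_mem _ _

/-- Extensions are found without regard to the grading; their part of degree k still extends a map
that was homogeneous of degree k. -/
lemma homPart_comp {U W : GrVect} (f : V →ₗ[ℚ] W) (k : ℤ) {i : U →ₗ[ℚ] V} {g : U →ₗ[ℚ] W}
    (hi : ∀ n, ∀ x ∈ U.deg n, i x ∈ V.deg n) (hg : ∀ n, ∀ x ∈ U.deg n, g x ∈ W.deg (n + k))
    (h : ∀ x, f (i x) = g x) (x : U) : homPart f k (i x) = g x := by
  induction x using induction with
  | hom m x hx => rw [homPart_of_mem f k (hi m x hx), h, proj_of_mem (hg m x hx)]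
  | add x y hx hy => rw [map_add, map_add, map_add, hx, hy]

variable (V)

/-- A homogeneous subspace of a graded vector space. -/
abbrev sub (K : Submodule ℚ V) (hK : ∀ n, ∀ x ∈ K, V.proj n x ∈ K) : GrVect where
  carrier := K
  deg n := (V.deg n).comap K.subtype
  isInternal := by
    refine isInternal_of_separating _ (fun n => V.proj n ∘ₗ K.subtype)
      (fun m n h x hx => proj_of_mem_ne h hx)
      (fun n x hx h => Subtype.ext ((proj_of_mem hx).symm.trans h)) ?_
    rw [eq_top_iff]
    rintro x -
    obtain ⟨S, hS⟩ := exists_sum_proj x.1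
    have : x = ∑ n ∈ S, (⟨V.proj n x.1, hK n x.1 x.2⟩ : K) := by
      refine Subtype.ext ?_
      rw [AddSubmonoidClass.coe_finsetSum]
      exact (hS S le_rfl).symm
    rw [this]
    exact sum_mem fun n _ => (le_iSup (fun n => (V.deg n).comap K.subtype) n) (proj_mem n x.1)

/-- The quotient of a graded vector space by a homogeneous subspace. -/
abbrev quot (K : Submodule ℚ V) (hK : ∀ n, ∀ x ∈ K, V.proj n x ∈ K) : GrVect where
  carrier := V ⧸ K
  deg n := (V.deg n).map K.mkQ
  isInternal := by
    refine isInternal_of_separating _ (fun n => Submodule.mapQ K K (V.proj n) (hK n)) ?_ ?_ ?_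
    · rintro m n hmn _ ⟨x, hx, rfl⟩
      rw [Submodule.mkQ_apply, Submodule.mapQ_apply, proj_of_mem_ne hmn hx]
      rfl
    · rintro n _ ⟨x, hx, rfl⟩ h
      rwa [Submodule.mkQ_apply, Submodule.mapQ_apply, proj_of_mem hx] at h
    · rw [← Submodule.map_iSup, V.isInternal.submodule_iSup_eq_top, Submodule.map_top,
        LinearMap.range_eq_top]
      exact K.mkQ_surjective

/-- The suspension `Σ^k V`, with `(Σ^k V)_n = V_{n-k}`. -/
abbrev shift (k : ℤ) : GrVect where
  carrier := V
  deg n := V.deg (n - k)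
  isInternal := by
    refine isInternal_of_separating _ (fun n => V.proj (n - k))
      (fun m n h x hx => proj_of_mem_ne (by omega) hx)
      (fun n x hx h => (proj_of_mem hx).symm.trans h) ?_
    rw [eq_top_iff]
    rintro x -
    induction x using induction with
    | hom m x hx =>
      refine (le_iSup (fun n => V.deg (n - k)) (m + k)) ?_
      rwa [add_sub_cancel_right]
    | add x y hx hy => exact add_mem hx hy

/-- The direct sum of two graded vector spaces. -/
abbrev prod (W : GrVect) : GrVect where
  carrier := V × W
  deg n := (V.deg n).prod (W.deg n)
  isInternal := by
    refine isInternal_of_separating _ (fun n => (V.proj n).prodMap (W.proj n))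
      (fun m n h x hx => Prod.ext (proj_of_mem_ne h hx.1) (proj_of_mem_ne h hx.2))
      (fun n x hx h => Prod.ext ((proj_of_mem hx.1).symm.trans (congrArg Prod.fst h))
        ((proj_of_mem hx.2).symm.trans (congrArg Prod.snd h))) ?_
    rw [eq_top_iff]
    rintro ⟨x, y⟩ -
    have hx : ((x, 0) : V × W) ∈ ⨆ n, (V.deg n).prod (W.deg n) := by
      induction x using induction with
      | hom m x hx =>
        exact (le_iSup (fun n => (V.deg n).prod (W.deg n)) m) ⟨hx, zero_mem _⟩
      | add x x' hx hx' => simpa using add_mem hx hx'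
    have hy : ((0, y) : V × W) ∈ ⨆ n, (V.deg n).prod (W.deg n) := by
      induction y using induction with
      | hom m y hy =>
        exact (le_iSup (fun n => (V.deg n).prod (W.deg n)) m) ⟨zero_mem _, hy⟩
      | add y y' hy hy' => simpa using add_mem hy hy'
    simpa using add_mem hx hy

open Classical in
/-- The direct sum of a family of graded vector spaces. -/
abbrev sum {ι : Type} (V : ι → GrVect) : GrVect where
  carrier := DirectSum ι fun i => V i
  deg n := ⨅ i, ((V i).deg n).comap (DirectSum.component ℚ ι (fun i => V i) i)
  isInternal := by
    refine isInternal_of_separating _ (fun n => DirectSum.lmap fun i => (V i).proj n)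
      (fun m n h x hx => ?_) (fun n x hx h => ?_) ?_
    · rw [Submodule.mem_iInf] at hx
      exact DirectSum.ext_component ℚ fun i => proj_of_mem_ne h (hx i)
    · rw [Submodule.mem_iInf] at hx
      refine DirectSum.ext_component ℚ fun i => ?_
      exact (proj_of_mem (hx i)).symm.trans
        (congrArg (DirectSum.component ℚ ι (fun i => (V i).carrier) i) h)
    · rw [eq_top_iff]
      rintro x -
      induction x using DirectSum.induction_on with
      | zero => exact zero_mem _
      | of i v =>
        induction v using induction with
        | hom m v hv =>
          refine Submodule.mem_iSup_of_mem m ?_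
          rw [Submodule.mem_iInf]
          intro j
          change (DirectSum.component ℚ ι (fun i => (V i).carrier) j)
            (DirectSum.lof ℚ ι (fun i => (V i).carrier) i v) ∈ (V j).deg m
          by_cases h : i = j
          · subst h
            rwa [DirectSum.component.lof_self]
          · rw [DirectSum.component.of, dif_neg h]
            exact zero_mem _
        | add x y hx hy =>
          rw [map_add]
          exact add_mem hx hy
      | add x y hx hy => exact add_mem hx hy

end GrVect

/-! ### Graded modules: homogeneous parts of maps, submodules, quotients, suspensions and sums -/

namespace GrMod

variable (M : GrMod)

lemma proj_smul {i : ℤ} {f : OF} (hf : f ∈ OF.deg i) (n : ℤ) (x : M) :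
    M.proj (i + n) (f • x) = f • M.proj n x := by
  have := GrVect.proj_map (V := M.toGrVect) (W := M.toGrVect) (k := i)
    (f := (LinearMap.lsmul OF M f).restrictScalars ℚ)
    (fun j x hx => by
      rw [add_comm]
      exact M.smul_mem hf hx) n x
  rwa [add_comm] at this

lemma _root_.CircleModel.OF.induction {p : OF → Prop} (f : OF) (hom : ∀ n, ∀ f ∈ OF.deg n, p f)
    (add : ∀ f g, p f → p g → p (f + g)) : p f :=
  GrVect.induction (V := grOF.toGrVect) f hom add

/-- The part of degree `k` of a map of modules between graded modules. -/
def homPart {M N : GrMod} (f : M →ₗ[OF] N) (k : ℤ) : M →ₗ[OF] N where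
  toFun := GrVect.homPart (V := M.toGrVect) (W := N.toGrVect) (f.restrictScalars ℚ) k
  map_add' x y := map_add _ x y
  map_smul' g x := by
    rw [RingHom.id_apply]
    induction g using OF.induction with
    | hom n g hg =>
      induction x using GrVect.induction with
      | hom m x hx =>
        rw [GrVect.homPart_of_mem _ _ hx, GrVect.homPart_of_mem _ _ (M.smul_mem hg hx),
          ← proj_smul N hg, LinearMap.restrictScalars_apply, map_smul, add_assoc]
        rfl
      | add x y hx hy => rw [smul_add, map_add, map_add, smul_add, hx, hy]
    | add f g hf hg => rw [add_smul, map_add, add_smul, hf, hg]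

lemma homPart_mem {M N : GrMod} (f : M →ₗ[OF] N) (k m : ℤ) {x : M} (hx : x ∈ M.deg m) :
    homPart f k x ∈ N.deg (m + k) :=
  GrVect.homPart_mem (f.restrictScalars ℚ) k m hx

lemma homPart_comp {L M N : GrMod} (f : M →ₗ[OF] N) (k : ℤ) {i : L →ₗ[OF] M} {g : L →ₗ[OF] N}
    (hi : ∀ n, ∀ x ∈ L.deg n, i x ∈ M.deg n) (hg : ∀ n, ∀ x ∈ L.deg n, g x ∈ N.deg (n + k))
    (h : ∀ x, f (i x) = g x) (x : L) : homPart f k (i x) = g x :=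
  GrVect.homPart_comp (U := L.toGrVect) (V := M.toGrVect) (W := N.toGrVect)
    (f.restrictScalars ℚ) k (i := i.restrictScalars ℚ) (g := g.restrictScalars ℚ) hi hg h x

/-- A homogeneous submodule of a graded module. -/
abbrev sub (K : Submodule OF M) (hK : ∀ n, ∀ x ∈ K, M.proj n x ∈ K) : GrMod where
  carrier := K
  deg n := (M.deg n).comap (K.subtype.restrictScalars ℚ)
  isInternal := (M.toGrVect.sub (K.restrictScalars ℚ) hK).isInternal
  smul_mem hf hx := M.smul_mem hf hx

/-- The quotient of a graded module by a homogeneous submodule. -/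
abbrev quotient (K : Submodule OF M) (hK : ∀ n, ∀ x ∈ K, M.proj n x ∈ K) : GrMod where
  carrier := M ⧸ K
  deg n := (M.deg n).map (K.mkQ.restrictScalars ℚ)
  isInternal := (M.toGrVect.quot (K.restrictScalars ℚ) hK).isInternal
  smul_mem := by
    rintro i j f _ hf ⟨x, hx, rfl⟩
    exact ⟨f • x, M.smul_mem hf hx, rfl⟩

/-- The suspension of a graded module. -/
abbrev susp (k : ℤ) : GrMod where
  carrier := M
  deg n := M.deg (n - k)
  isInternal := (M.toGrVect.shift k).isInternal
  smul_mem {i j f x} hf hx := by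
    have := M.smul_mem hf hx
    rwa [← add_sub_assoc] at this

/-- The direct sum of two graded modules. -/
abbrev biprod (N : GrMod) : GrMod where
  carrier := M × N
  deg n := (M.deg n).prod (N.deg n)
  isInternal := (M.toGrVect.prod N.toGrVect).isInternal
  smul_mem hf hx := ⟨M.smul_mem hf hx.1, N.smul_mem hf hx.2⟩

/-- The direct sum of a family of graded modules. -/
abbrev sum {ι : Type} (M : ι → GrMod) : GrMod where
  toGrVect := GrVect.sum fun i => (M i).toGrVect
  moduleOF := inferInstanceAs (Module OF (DirectSum ι fun i => M i))
  isScalarTower := inferInstanceAs (IsScalarTower ℚ OF (DirectSum ι fun i => M i))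
  smul_mem {i j f x} hf hx := by
    refine (Submodule.mem_iInf _).2 fun k => ?_
    exact (M k).smul_mem hf ((Submodule.mem_iInf _).1 hx k)

end GrMod

/-! ### The grading of `t_*^ℱ ⊗ V` -/

/-- The projection of `t_*^ℱ` onto its part of degree `n`. -/
def TF.proj (n : ℤ) : TF →ₗ[ℚ] TF := grTF.proj n

lemma TF.proj_of_mem {n : ℤ} {x : TF} (hx : x ∈ TF.deg n) : TF.proj n x = x :=
  GrVect.proj_of_mem (V := grTF.toGrVect) hx

lemma TF.proj_of_mem_ne {m n : ℤ} (h : m ≠ n) {x : TF} (hx : x ∈ TF.deg m) : TF.proj n x = 0 :=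
  GrVect.proj_of_mem_ne (V := grTF.toGrVect) h hx

lemma TF.induction {p : TF → Prop} (x : TF) (hom : ∀ n, ∀ x ∈ TF.deg n, p x)
    (add : ∀ x y, p x → p y → p (x + y)) : p x :=
  GrVect.induction (V := grTF.toGrVect) x hom add

/-- The map `t_*^ℱ ⊗ V → t_*^ℱ ⊗ W` induced by a linear map. -/
def tmap {V W : Type} [AddCommGroup V] [Module ℚ V] [AddCommGroup W] [Module ℚ W]
    (f : V →ₗ[ℚ] W) : TF ⊗[ℚ] V →ₗ[OF] TF ⊗[ℚ] W :=
  TensorProduct.AlgebraTensorModule.lTensor OF TF f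

lemma tmap_apply {V W : Type} [AddCommGroup V] [Module ℚ V] [AddCommGroup W] [Module ℚ W]
    (f : V →ₗ[ℚ] W) (z : TF ⊗[ℚ] V) : tmap f z = f.lTensor TF z := rfl

@[simp]
lemma tmap_tmul {V W : Type} [AddCommGroup V] [Module ℚ V] [AddCommGroup W] [Module ℚ W]
    (f : V →ₗ[ℚ] W) (x : TF) (v : V) : tmap f (x ⊗ₜ[ℚ] v) = x ⊗ₜ[ℚ] f v := rfl

lemma tensorDeg_induction {V : GrVect} {p : TF ⊗[ℚ] V → Prop} (z : TF ⊗[ℚ] V)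
    (tmul : ∀ i j, ∀ x ∈ TF.deg i, ∀ v ∈ V.deg j, p (x ⊗ₜ[ℚ] v))
    (add : ∀ y z, p y → p z → p (y + z)) : p z := by
  induction z using TensorProduct.induction_on with
  | zero => simpa using tmul 0 0 0 (zero_mem _) 0 (zero_mem _)
  | tmul x v =>
    induction x using TF.induction with
    | hom i x hx =>
      induction v using GrVect.induction with
      | hom j v hv => exact tmul i j x hx v hv
      | add v w hv hw =>
        rw [TensorProduct.tmul_add]
        exact add _ _ hv hw
    | add x y hx hy =>
      rw [TensorProduct.add_tmul]
      exact add _ _ hx hy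
  | add y z hy hz => exact add y z hy hz

lemma tmul_mem_tensorDeg {V : GrVect} {i j n : ℤ} (h : i + j = n) {x : TF} (hx : x ∈ TF.deg i)
    {v : V} (hv : v ∈ V.deg j) : x ⊗ₜ[ℚ] v ∈ tensorDeg V n :=
  Submodule.subset_span ⟨i, j, h, x, hx, v, hv, rfl⟩

/-- The graded module `t_*^ℱ ⊗ V`. -/
abbrev grTensor (V : GrVect) : GrMod where
  carrier := TF ⊗[ℚ] V
  deg := tensorDeg V
  isInternal := by
    have key (i j i' j' : ℤ) {x : TF} (hx : x ∈ TF.deg i') {v : V} (hv : v ∈ V.deg j')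
        (h : ¬ (i' = i ∧ j' = j)) :
        TensorProduct.map (TF.proj i) (V.proj j) (x ⊗ₜ[ℚ] v) = 0 := by
      rw [TensorProduct.map_tmul]
      by_cases hi : i' = i
      · rw [GrVect.proj_of_mem_ne (fun hj => h ⟨hi, hj⟩) hv, TensorProduct.tmul_zero]
      · rw [TF.proj_of_mem_ne hi hx, TensorProduct.zero_tmul]
    have hne (m : ℤ) (i j : ℤ) (hij : i + j ≠ m) (z : TF ⊗[ℚ] V) (hz : z ∈ tensorDeg V m) :
        TensorProduct.map (TF.proj i) (V.proj j) z = 0 := by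
      induction hz using Submodule.span_induction with
      | mem z hz =>
        obtain ⟨i', j', hm, x, hx, v, hv, rfl⟩ := hz
        exact key i j i' j' hx hv (fun h => hij (by omega))
      | zero => exact map_zero _
      | add y z _ _ hy hz => rw [map_add, hy, hz, add_zero]
      | smul a z _ hz => rw [map_smul, hz, smul_zero]
    have hsum (z : TF ⊗[ℚ] V) : ∃ S : Finset (ℤ × ℤ), ∀ S', S ⊆ S' →
        ∑ i ∈ S', TensorProduct.map (TF.proj i.1) (V.proj i.2) z = z := by
      classical
      induction z using tensorDeg_induction with
      | tmul i j x hx v hv =>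
        refine ⟨{(i, j)}, fun S' h => ?_⟩
        rw [Finset.sum_eq_single_of_mem (i, j) (h (Finset.mem_singleton_self _)) fun k _ hk =>
          key k.1 k.2 i j hx hv fun h => hk (Prod.ext h.1.symm h.2.symm), TensorProduct.map_tmul,
          GrVect.proj_of_mem hv, TF.proj_of_mem hx]
      | add x y hx hy =>
        obtain ⟨S, hS⟩ := hx
        obtain ⟨T, hT⟩ := hy
        refine ⟨S ∪ T, fun S' h => ?_⟩
        simp_rw [map_add]
        rw [Finset.sum_add_distrib, hS _ (Finset.union_subset_left h),
          hT _ (Finset.union_subset_right h)]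
    -- The total degree n is separated by all bidegrees (i, n - i) together.
    refine isInternal_of_separating _ (W := fun _ => ℤ → TF ⊗[ℚ] V)
      (fun n => LinearMap.pi fun i => TensorProduct.map (TF.proj i) (V.proj (n - i))) ?_ ?_ ?_
    · intro m n hmn x hx
      funext i
      exact hne m i (n - i) (by omega) x hx
    · intro n x hx h
      obtain ⟨S, hS⟩ := hsum x
      rw [← hS S le_rfl]
      refine Finset.sum_eq_zero fun i _ => ?_
      by_cases hi : i.1 + i.2 = n
      · have := congrFun h i.1
        rwa [LinearMap.pi_apply, ← hi, add_sub_cancel_left] at this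
      · exact hne n i.1 i.2 hi x hx
    · rw [eq_top_iff]
      rintro z -
      induction z using tensorDeg_induction with
      | tmul i j x hx v hv =>
        exact Submodule.mem_iSup_of_mem (i + j) (tmul_mem_tensorDeg rfl hx hv)
      | add x y hx hy => exact add_mem hx hy
  smul_mem {i j f z} hf hz := by
    induction hz using Submodule.span_induction with
    | mem z hz =>
      obtain ⟨i', j', hm, x, hx, v, hv, rfl⟩ := hz
      rw [TensorProduct.smul_tmul']
      exact tmul_mem_tensorDeg (by omega) (grTF.smul_mem hf hx) hv
    | zero =>
      rw [smul_zero]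
      exact zero_mem _
    | add y z _ _ hy hz =>
      rw [smul_add]
      exact add_mem hy hz
    | smul a z _ hz =>
      rw [smul_comm]
      exact Submodule.smul_mem _ _ hz

lemma tmap_mem {V W : GrVect} {f : V →ₗ[ℚ] W} {k : ℤ}
    (hf : ∀ i, ∀ x ∈ V.deg i, f x ∈ W.deg (i + k)) {n : ℤ} {z : TF ⊗[ℚ] V}
    (hz : z ∈ tensorDeg V n) : tmap f z ∈ tensorDeg W (n + k) := by
  induction hz using Submodule.span_induction with
  | mem z hz =>
    obtain ⟨i, j, hm, x, hx, v, hv, rfl⟩ := hz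
    exact tmul_mem_tensorDeg (by omega) hx (hf j v hv)
  | zero =>
    rw [map_zero]
    exact zero_mem _
  | add y z _ _ hy hz =>
    rw [map_add]
    exact add_mem hy hz
  | smul a z _ hz =>
    rw [LinearMap.map_smul_of_tower]
    exact Submodule.smul_mem _ _ hz

lemma tmap_injective {V W : Type} [AddCommGroup V] [Module ℚ V] [AddCommGroup W] [Module ℚ W]
    {f : V →ₗ[ℚ] W} (hf : Function.Injective f) : Function.Injective (tmap f) :=
  Module.Flat.lTensor_preserves_injective_linearMap (M := TF) f hf

lemma tmap_surjective {V W : Type} [AddCommGroup V] [Module ℚ V] [AddCommGroup W] [Module ℚ W]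
    {f : V →ₗ[ℚ] W} (hf : Function.Surjective f) : Function.Surjective (tmap f) :=
  LinearMap.lTensor_surjective TF hf

lemma tmap_exact {U V W : Type} [AddCommGroup U] [Module ℚ U] [AddCommGroup V] [Module ℚ V]
    [AddCommGroup W] [Module ℚ W] {f : U →ₗ[ℚ] V} {g : V →ₗ[ℚ] W} (h : Function.Exact f g) :
    Function.Exact (tmap f) (tmap g) :=
  Module.Flat.lTensor_exact TF h

lemma tmap_comp {U V W : Type} [AddCommGroup U] [Module ℚ U] [AddCommGroup V] [Module ℚ V]
    [AddCommGroup W] [Module ℚ W] (g : V →ₗ[ℚ] W) (f : U →ₗ[ℚ] V) (z : TF ⊗[ℚ] U) :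
    tmap (g ∘ₗ f) z = tmap g (tmap f z) := by
  rw [tmap_apply, LinearMap.lTensor_comp]
  rfl

lemma mem_tensorDeg_of_tmap {V W : GrVect} {f : V →ₗ[ℚ] W} {k : ℤ}
    (hf : ∀ i, ∀ x ∈ V.deg i, f x ∈ W.deg (i + k)) (hinj : Function.Injective f) {n : ℤ}
    {z : TF ⊗[ℚ] V} (hz : tmap f z ∈ tensorDeg W (n + k)) : z ∈ tensorDeg V n :=
  GrVect.mem_of_map_mem (V := (grTensor V).toGrVect) (W := (grTensor W).toGrVect)
    (f := (tmap f).restrictScalars ℚ) (fun _ _ hx => tmap_mem hf hx) (tmap_injective hinj) hz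


/-! ### Localization of the modules `t_*^ℱ ⊗ V` -/

section Tensor

variable {V : Type} [AddCommGroup V] [Module ℚ V]

lemma exists_inverse_eulerClass {s : OF} (hs : s ∈ eulerClasses) :
    ∃ u : TF, u * algebraMap OF TF s = 1 := by
  obtain ⟨u, hu⟩ := IsLocalization.map_units TF (⟨s, hs⟩ : eulerClasses)
  refine ⟨((u⁻¹ : TFˣ) : TF), ?_⟩
  rw [show algebraMap OF TF s = u from hu.symm, Units.inv_mul]

lemma exists_smul_tensor {s : OF} (hs : s ∈ eulerClasses) (y : TF ⊗[ℚ] V) :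
    ∃ z : TF ⊗[ℚ] V, s • z = y := by
  obtain ⟨u, hu⟩ := exists_inverse_eulerClass hs
  refine ⟨u • y, ?_⟩
  rw [← algebraMap_smul TF s, smul_smul, mul_comm, hu, one_smul]

lemma eq_zero_of_smul_tensor {s : OF} (hs : s ∈ eulerClasses) {y : TF ⊗[ℚ] V}
    (h : s • y = 0) : y = 0 := by
  obtain ⟨u, hu⟩ := exists_inverse_eulerClass hs
  rw [← one_smul TF y, ← hu, mul_smul, algebraMap_smul, h, smul_zero]

end Tensor

namespace AObj

/-! ### Constructions in the category `𝒜` -/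

section Basic

variable {X Y Z : AObj}

/-- The condition on ℰ⁻¹β is used through this lemma and `exists_β_eq`: kernel and cokernel of β are
ℰ-torsion. Conversely, `localizedMap_bijective` recovers the condition from these two facts. -/
lemma exists_smul_eq_zero {x : X.nub} (h : X.β x = 0) : ∃ s ∈ eulerClasses, s • x = 0 := by
  have h₁ : LocalizedModule.map eulerClasses X.β (LocalizedModule.mk x 1) =
      LocalizedModule.map eulerClasses X.β 0 := by
    rw [LocalizedModule.map_mk, h, map_zero, LocalizedModule.zero_mk]
  have h₂ := X.β_loc.1 h₁
  rw [← LocalizedModule.zero_mk (1 : eulerClasses), LocalizedModule.mk_eq] at h₂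
  obtain ⟨u, hu⟩ := h₂
  refine ⟨u, u.2, ?_⟩
  simpa using! hu

lemma exists_β_eq (y : TF ⊗[ℚ] X.vertex) : ∃ s ∈ eulerClasses, ∃ x, X.β x = s • y := by
  obtain ⟨z, hz⟩ := X.β_loc.2 (LocalizedModule.mk y 1)
  induction z using LocalizedModule.induction_on with
  | h x s =>
    rw [LocalizedModule.map_mk, LocalizedModule.mk_eq] at hz
    obtain ⟨u, hu⟩ := hz
    refine ⟨u * s, mul_mem u.2 s.2, (u : OF) • x, ?_⟩
    rw [map_smul, mul_smul]
    simpa using! hu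

lemma pairs_ext {f g : Pairs X Y} (h₁ : ∀ x, f.1 x = g.1 x) (h₂ : ∀ v, f.2 v = g.2 v) : f = g :=
  Prod.ext (LinearMap.ext h₁) (LinearMap.ext h₂)

/-- The identity. -/
abbrev one (X : AObj) : Pairs X X := (LinearMap.id, LinearMap.id)

lemma one_comp (f : Pairs X Y) : comp (one Y) f = f := rfl

lemma comp_one (f : Pairs X Y) : comp f (one X) = f := rfl

lemma one_mem (X : AObj) : one X ∈ homDeg X X 0 := ⟨by simp, by simp, by simp⟩

lemma nub_mem {f : Pairs X Y} {n : ℤ} (hf : f ∈ homDeg X Y n) (i : ℤ) (x : X.nub)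
    (hx : x ∈ X.nub.deg i) : f.1.restrictScalars ℚ x ∈ Y.nub.deg (i + n) := hf.1 i x hx

lemma vertex_mem {f : Pairs X Y} {n : ℤ} (hf : f ∈ homDeg X Y n) (i : ℤ) (x : X.vertex)
    (hx : x ∈ X.vertex.deg i) : f.2 x ∈ Y.vertex.deg (i + n) := hf.2.1 i x hx

lemma β_comm {f : Pairs X Y} {n : ℤ} (hf : f ∈ homDeg X Y n) (x : X.nub) :
    Y.β (f.1 x) = tmap f.2 (X.β x) := hf.2.2 x

/-- Injectivity of both components. -/
def Inj (f : Pairs X Y) : Prop := Function.Injective f.1 ∧ Function.Injective f.2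

/-- Surjectivity of both components. -/
def Surj (f : Pairs X Y) : Prop := Function.Surjective f.1 ∧ Function.Surjective f.2

lemma Inj.cancel {g : Pairs Y Z} (hg : Inj g) {f f' : Pairs X Y} (h : comp g f = comp g f') :
    f = f' :=
  pairs_ext (fun x => hg.1 (LinearMap.congr_fun (congrArg Prod.fst h) x))
    (fun x => hg.2 (LinearMap.congr_fun (congrArg Prod.snd h) x))

lemma Surj.cancel {f : Pairs X Y} (hf : Surj f) {g g' : Pairs Y Z} (h : comp g f = comp g' f) :
    g = g' := by
  refine pairs_ext (fun y => ?_) (fun y => ?_)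
  · obtain ⟨x, rfl⟩ := hf.1 y
    exact LinearMap.congr_fun (congrArg Prod.fst h) x
  · obtain ⟨x, rfl⟩ := hf.2 y
    exact LinearMap.congr_fun (congrArg Prod.snd h) x

/-- Degrees and compatibility with β may be tested after an injection; for β this uses that
tensoring over ℚ with t preserves injectivity. -/
lemma mem_of_inj_comp {g : Pairs Y Z} (hg : Inj g) {f : Pairs X Y} {m n k : ℤ}
    (hgm : g ∈ homDeg Y Z m) (h : comp g f ∈ homDeg X Z k) (hk : n + m = k) :
    f ∈ homDeg X Y n := by
  subst hk
  refine ⟨fun i x hx => ?_, fun i x hx => ?_, fun x => ?_⟩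
  · refine GrVect.mem_of_map_mem (V := Y.nub.toGrVect) (W := Z.nub.toGrVect)
      (f := g.1.restrictScalars ℚ) hgm.1 hg.1 ?_
    rw [add_assoc]
    exact h.1 i x hx
  · refine GrVect.mem_of_map_mem hgm.2.1 hg.2 ?_
    rw [add_assoc]
    exact h.2.1 i x hx
  · refine tmap_injective hg.2 ?_
    have h₁ := hgm.2.2 (f.1 x)
    have h₂ := h.2.2 x
    change Z.β (g.1 (f.1 x)) = tmap (g.2 ∘ₗ f.2) (X.β x) at h₂
    rw [tmap_comp] at h₂
    exact h₁.symm.trans h₂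

/-- A homogeneous element in the image of a homogeneous map has a homogeneous preimage, on which the
degree of g can be read off. -/
lemma mem_of_surj_comp {f : Pairs X Y} (hf : Surj f) {g : Pairs Y Z} {m n k : ℤ}
    (hfm : f ∈ homDeg X Y m) (h : comp g f ∈ homDeg X Z k) (hk : m + n = k) :
    g ∈ homDeg Y Z n := by
  subst hk
  refine ⟨fun i y hy => ?_, fun i y hy => ?_, fun y => ?_⟩
  · obtain ⟨x, rfl⟩ := hf.1 y
    have hy' : (f.1.restrictScalars ℚ) x ∈ Y.nub.deg (i - m + m) := by rwa [sub_add_cancel]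
    obtain ⟨x', hx', e⟩ := GrVect.exists_mem_of_map_mem (V := X.nub.toGrVect)
      (W := Y.nub.toGrVect) (f := f.1.restrictScalars ℚ) hfm.1 hy'
    have := h.1 _ x' hx'
    rw [show i - m + (m + n) = i + n by ring] at this
    change g.1 (f.1 x') ∈ _ at this
    have e : f.1 x' = f.1 x := e
    rwa [e] at this
  · obtain ⟨x, rfl⟩ := hf.2 y
    have hy' : f.2 x ∈ Y.vertex.deg (i - m + m) := by rwa [sub_add_cancel]
    obtain ⟨x', hx', e⟩ := GrVect.exists_mem_of_map_mem hfm.2.1 hy'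
    have := h.2.1 _ x' hx'
    rw [show i - m + (m + n) = i + n by ring] at this
    change g.2 (f.2 x') ∈ _ at this
    rwa [e] at this
  · obtain ⟨x, rfl⟩ := hf.1 y
    have h₂ := h.2.2 x
    change Z.β (g.1 (f.1 x)) = tmap (g.2 ∘ₗ f.2) (X.β x) at h₂
    rw [tmap_comp] at h₂
    rw [h₂]
    exact congrArg (tmap g.2) (hfm.2.2 x).symm

end Basic

/-! #### Kernels -/

section Kernel

variable {X Y : AObj} (p : Pairs X Y) {n : ℤ} (hp : p ∈ homDeg X Y n)

/-- The structure map of the kernel. -/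
def kerβ (h : ∀ x, Y.β (p.1 x) = tmap p.2 (X.β x)) :
    LinearMap.ker p.1 →ₗ[OF] TF ⊗[ℚ] LinearMap.ker p.2 :=
  (LinearEquiv.ofInjective (tmap (LinearMap.ker p.2).subtype)
    (tmap_injective (LinearMap.ker p.2).injective_subtype)).symm.toLinearMap ∘ₗ
  LinearMap.codRestrict (LinearMap.range (tmap (LinearMap.ker p.2).subtype))
    (X.β ∘ₗ (LinearMap.ker p.1).subtype) fun x =>
      (tmap_exact (LinearMap.exact_subtype_ker_map p.2) _).1 (by
        rw [LinearMap.comp_apply, ← h]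
        exact (congrArg Y.β x.2).trans (map_zero _))

lemma tmap_kerβ (h : ∀ x, Y.β (p.1 x) = tmap p.2 (X.β x)) (x : LinearMap.ker p.1) :
    tmap (LinearMap.ker p.2).subtype (kerβ p h x) = X.β x :=
  congrArg Subtype.val ((LinearEquiv.ofInjective (tmap (LinearMap.ker p.2).subtype)
    (tmap_injective (LinearMap.ker p.2).injective_subtype)).apply_symm_apply _)

variable {p}

include hp in
lemma ker_proj_mem (m : ℤ) (x : X.nub) (hx : x ∈ LinearMap.ker p.1) :
    X.nub.proj m x ∈ LinearMap.ker p.1 := by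
  have h : p.1.restrictScalars ℚ x = 0 := hx
  have := GrVect.proj_map (nub_mem hp) m x
  rw [h, map_zero] at this
  exact this.symm

include hp in
lemma ker_proj_mem' (m : ℤ) (x : X.vertex) (hx : x ∈ LinearMap.ker p.2) :
    X.vertex.proj m x ∈ LinearMap.ker p.2 := by
  rw [LinearMap.mem_ker] at hx ⊢
  rw [← GrVect.proj_map (vertex_mem hp), hx, map_zero]

-- Up to an Euler class an element y over the vertex of the kernel comes from some x in the nub.
-- Then β(p x) = 0, so p x is torsion, and a second Euler class moves x into the kernel of p.
include hp in
lemma kerβ_bijective :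
    Function.Bijective (LocalizedModule.map eulerClasses (kerβ p (β_comm hp))) := by
  refine localizedMap_bijective _ (fun x hx => ?_) (fun y => ?_)
  · obtain ⟨s, hs, h⟩ := X.exists_smul_eq_zero (x := x.1)
      (by rw [← tmap_kerβ p (β_comm hp), hx, map_zero])
    exact ⟨s, hs, Subtype.ext h⟩
  · obtain ⟨s, hs, x, hx⟩ := X.exists_β_eq (tmap (LinearMap.ker p.2).subtype y)
    have h₁ : Y.β (p.1 x) = 0 := by
      have h₂ := (tmap_exact (LinearMap.exact_subtype_ker_map p.2)
        (tmap (LinearMap.ker p.2).subtype y)).2 ⟨y, rfl⟩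
      rw [β_comm hp, hx, map_smul, h₂, smul_zero]
    obtain ⟨t, ht, h⟩ := Y.exists_smul_eq_zero h₁
    refine ⟨t * s, mul_mem ht hs, ⟨t • x, ?_⟩, ?_⟩
    · rw [LinearMap.mem_ker, map_smul, h]
    · refine tmap_injective (LinearMap.ker p.2).injective_subtype ?_
      rw [tmap_kerβ, map_smul, map_smul, hx, mul_smul]

/-- The kernel of a homogeneous map in `𝒜`. -/
abbrev ker : AObj where
  nub := X.nub.sub (LinearMap.ker p.1) (ker_proj_mem hp)
  vertex := X.vertex.sub (LinearMap.ker p.2) (ker_proj_mem' hp)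
  β := kerβ p (β_comm hp)
  β_mem {m x} hx := by
    refine mem_tensorDeg_of_tmap (W := X.vertex) (f := (LinearMap.ker p.2).subtype) (k := 0)
      (fun i x hx => ?_) (LinearMap.ker p.2).injective_subtype ?_
    · rw [add_zero]
      exact hx
    · rw [add_zero]
      refine (congrArg (· ∈ tensorDeg X.vertex m) (tmap_kerβ p (β_comm hp) x)).mpr ?_
      exact X.β_mem hx
  β_loc := kerβ_bijective hp

/-- The inclusion of the kernel. -/
abbrev kerι : Pairs (ker hp) X := ((LinearMap.ker p.1).subtype, (LinearMap.ker p.2).subtype)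

lemma kerι_mem : kerι hp ∈ homDeg (ker hp) X 0 :=
  ⟨fun i x hx => by rw [add_zero]; exact hx, fun i x hx => by rw [add_zero]; exact hx,
    fun x => (tmap_kerβ p (β_comm hp) x).symm⟩

lemma kerι_inj : Inj (kerι hp) := ⟨Subtype.val_injective, Subtype.val_injective⟩

lemma comp_kerι : comp p (kerι hp) = 0 := pairs_ext (fun x => x.2) (fun x => x.2)

lemma exists_kerLift {W : AObj} {m : ℤ} {g : Pairs W X} (hg : g ∈ homDeg W X m)
    (h : comp p g = 0) : ∃ l ∈ homDeg W (ker hp) m, comp (kerι hp) l = g := by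
  refine ⟨(LinearMap.codRestrict _ g.1 fun x => LinearMap.congr_fun (congrArg Prod.fst h) x,
    LinearMap.codRestrict _ g.2 fun x => LinearMap.congr_fun (congrArg Prod.snd h) x),
    mem_of_inj_comp (kerι_inj hp) (kerι_mem hp) ?_ (add_zero m), ?_⟩
  · exact hg
  · rfl

end Kernel

/-! #### Cokernels -/

section Cokernel

variable {X Y : AObj} {f : Pairs X Y} {n : ℤ} (hf : f ∈ homDeg X Y n)

include hf in
lemma range_proj_mem (m : ℤ) (y : Y.nub) (hy : y ∈ LinearMap.range f.1) :
    Y.nub.proj m y ∈ LinearMap.range f.1 := by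
  obtain ⟨x, rfl⟩ := hy
  have := GrVect.proj_map (nub_mem hf) (m - n) x
  rw [sub_add_cancel] at this
  exact ⟨_, this.symm⟩

include hf in
lemma range_proj_mem' (m : ℤ) (y : Y.vertex) (hy : y ∈ LinearMap.range f.2) :
    Y.vertex.proj m y ∈ LinearMap.range f.2 := by
  obtain ⟨x, rfl⟩ := hy
  have := GrVect.proj_map (vertex_mem hf) (m - n) x
  rw [sub_add_cancel] at this
  exact ⟨_, this.symm⟩

variable (f) in
/-- The structure map of the cokernel. -/
def cokerβ (h : ∀ x, Y.β (f.1 x) = tmap f.2 (X.β x)) :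
    (Y.nub ⧸ LinearMap.range f.1) →ₗ[OF] TF ⊗[ℚ] (Y.vertex ⧸ LinearMap.range f.2) :=
  (LinearMap.range f.1).liftQ (tmap (LinearMap.range f.2).mkQ ∘ₗ Y.β) (by
    rintro _ ⟨x, rfl⟩
    rw [LinearMap.mem_ker, LinearMap.comp_apply, h]
    exact (tmap_exact (LinearMap.exact_map_mkQ_range f.2) _).2 ⟨_, rfl⟩)

-- If the class of y goes to zero, then β y comes from t ⊗ X.vertex, hence up to an Euler class from
-- X.nub; the remaining difference lies in the kernel of β and is torsion.
include hf in
lemma cokerβ_bijective :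
    Function.Bijective (LocalizedModule.map eulerClasses (cokerβ f (β_comm hf))) := by
  refine localizedMap_bijective _ (fun y hy => ?_) (fun z => ?_)
  · obtain ⟨y, rfl⟩ := (LinearMap.range f.1).mkQ_surjective y
    obtain ⟨w, hw⟩ := (tmap_exact (LinearMap.exact_map_mkQ_range f.2) (Y.β y)).1 hy
    obtain ⟨s, hs, x, hx⟩ := X.exists_β_eq w
    have h₁ : Y.β (s • y - f.1 x) = 0 := by
      rw [map_sub, map_smul, ← hw, β_comm hf, hx, map_smul, sub_self]
    obtain ⟨t, ht, h⟩ := Y.exists_smul_eq_zero h₁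
    refine ⟨t * s, mul_mem ht hs, ?_⟩
    rw [← map_smul]
    refine (Submodule.Quotient.mk_eq_zero _).2 ⟨t • x, ?_⟩
    rw [smul_sub, sub_eq_zero] at h
    rw [map_smul, ← h, mul_smul]
  · obtain ⟨y, rfl⟩ := tmap_surjective (LinearMap.range f.2).mkQ_surjective z
    obtain ⟨s, hs, x, hx⟩ := Y.exists_β_eq y
    refine ⟨s, hs, (LinearMap.range f.1).mkQ x, ?_⟩
    rw [← map_smul, ← hx]
    rfl

/-- The cokernel of a homogeneous map in `𝒜`. -/
abbrev coker : AObj where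
  nub := Y.nub.quotient (LinearMap.range f.1) (range_proj_mem hf)
  vertex := Y.vertex.quot (LinearMap.range f.2) (range_proj_mem' hf)
  β := cokerβ f (β_comm hf)
  β_mem := by
    rintro m _ ⟨y, hy, rfl⟩
    have h₁ := tmap_mem (V := Y.vertex)
      (W := Y.vertex.quot (LinearMap.range f.2) (range_proj_mem' hf))
      (f := (LinearMap.range f.2).mkQ) (k := 0)
      (fun i x hx => ⟨x, by rw [add_zero]; exact hx, rfl⟩) (Y.β_mem hy)
    rw [add_zero] at h₁
    exact h₁
  β_loc := cokerβ_bijective hf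

/-- The projection to the cokernel. -/
abbrev cokerπ : Pairs Y (coker hf) := ((LinearMap.range f.1).mkQ, (LinearMap.range f.2).mkQ)

lemma cokerπ_mem : cokerπ hf ∈ homDeg Y (coker hf) 0 :=
  ⟨fun i x hx => ⟨x, by rwa [add_zero], rfl⟩, fun i x hx => ⟨x, by rwa [add_zero], rfl⟩,
    fun x => rfl⟩

lemma cokerπ_surj : Surj (cokerπ hf) :=
  ⟨Submodule.mkQ_surjective _, Submodule.mkQ_surjective _⟩

lemma cokerπ_comp : comp (cokerπ hf) f = 0 :=
  pairs_ext (fun x => (Submodule.Quotient.mk_eq_zero _).2 ⟨x, rfl⟩)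
    (fun x => (Submodule.Quotient.mk_eq_zero _).2 ⟨x, rfl⟩)

lemma exists_cokerDesc {W : AObj} {m : ℤ} {g : Pairs Y W} (hg : g ∈ homDeg Y W m)
    (h : comp g f = 0) : ∃ l ∈ homDeg (coker hf) W m, comp l (cokerπ hf) = g := by
  let l : Pairs (coker hf) W := ((LinearMap.range f.1).liftQ g.1 (by
      rintro _ ⟨x, rfl⟩
      exact LinearMap.congr_fun (congrArg Prod.fst h) x),
    (LinearMap.range f.2).liftQ g.2 (by
      rintro _ ⟨x, rfl⟩
      exact LinearMap.congr_fun (congrArg Prod.snd h) x))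
  exact ⟨l, mem_of_surj_comp (cokerπ_surj hf) (cokerπ_mem hf) (show comp l _ ∈ _ from hg)
    (zero_add m), rfl⟩

end Cokernel

end AObj

namespace AObj

/-! #### Suspensions and direct sums -/

section Susp

variable (X : AObj) (k : ℤ)

lemma tmap_id {V : Type} [AddCommGroup V] [Module ℚ V] (z : TF ⊗[ℚ] V) :
    tmap LinearMap.id z = z := by
  rw [tmap_apply, LinearMap.lTensor_id]
  rfl

/-- The suspension of an object of `𝒜`. -/
abbrev susp : AObj where
  nub := X.nub.susp k
  vertex := X.vertex.shift k
  β := X.β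
  β_mem {n x} hx := by
    have h := tmap_mem (V := X.vertex) (W := X.vertex.shift k) (f := LinearMap.id) (k := k)
      (fun i v hv => (congrArg (v ∈ X.vertex.deg ·) (add_sub_cancel_right i k)).mpr hv) (X.β_mem hx)
    rw [sub_add_cancel] at h
    exact (congrArg (· ∈ tensorDeg (X.vertex.shift k) n) (tmap_id (X.β x))).mp h
  β_loc := X.β_loc

/-- The identity, as a map of degree `k` to the suspension. -/
abbrev toSusp : Pairs X (susp X k) := (LinearMap.id, LinearMap.id)

/-- The identity, as a map of degree `-k` from the suspension. -/
abbrev ofSusp : Pairs (susp X k) X := (LinearMap.id, LinearMap.id)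

lemma toSusp_mem : toSusp X k ∈ homDeg X (susp X k) k :=
  ⟨fun i x hx => (congrArg (x ∈ X.nub.deg ·) (add_sub_cancel_right i k)).mpr hx,
    fun i x hx => (congrArg (x ∈ X.vertex.deg ·) (add_sub_cancel_right i k)).mpr hx, fun x => (tmap_id (X.β x)).symm⟩

lemma ofSusp_mem : ofSusp X k ∈ homDeg (susp X k) X (-k) :=
  ⟨fun i x hx => hx, fun i x hx => hx, fun x => (tmap_id (X.β x)).symm⟩

lemma mem_susp_iff {X Y : AObj} {f : Pairs X Y} {k m n : ℤ} (h : m + k = n) :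
    (f : Pairs X (susp Y k)) ∈ homDeg X (susp Y k) n ↔ f ∈ homDeg X Y m :=
  ⟨fun hf => comp_mem (by omega) (ofSusp_mem Y k) hf,
    fun hf => comp_mem (by omega) (toSusp_mem Y k) hf⟩

end Susp

section Prod

variable (X Y : AObj)

/-- The structure map of a direct sum. -/
def prodβ : (X.nub × Y.nub) →ₗ[OF] TF ⊗[ℚ] (X.vertex × Y.vertex) :=
  (tmap (LinearMap.inl ℚ X.vertex Y.vertex) ∘ₗ X.β).coprod
    (tmap (LinearMap.inr ℚ X.vertex Y.vertex) ∘ₗ Y.β)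

lemma prodβ_apply (x : X.nub × Y.nub) :
    prodβ X Y x = tmap (LinearMap.inl ℚ X.vertex Y.vertex) (X.β x.1) +
      tmap (LinearMap.inr ℚ X.vertex Y.vertex) (Y.β x.2) := rfl

lemma tmap_prod_ext {V W : Type} [AddCommGroup V] [Module ℚ V] [AddCommGroup W] [Module ℚ W]
    (z : TF ⊗[ℚ] (V × W)) : z = tmap (LinearMap.inl ℚ V W) (tmap (LinearMap.fst ℚ V W) z) +
      tmap (LinearMap.inr ℚ V W) (tmap (LinearMap.snd ℚ V W) z) := by
  induction z using TensorProduct.induction_on with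
  | zero => simp
  | tmul x v => simp [← TensorProduct.tmul_add]
  | add x y hx hy =>
    rw [map_add, map_add, map_add, map_add]
    nth_rewrite 1 [hx, hy]
    abel

lemma tmap_fst_prodβ (x : X.nub × Y.nub) :
    tmap (LinearMap.fst ℚ X.vertex Y.vertex) (prodβ X Y x) = X.β x.1 := by
  rw [prodβ_apply, map_add, ← tmap_comp, ← tmap_comp, LinearMap.fst_comp_inl,
    LinearMap.fst_comp_inr, tmap_id]
  simp [tmap_apply]

lemma tmap_snd_prodβ (x : X.nub × Y.nub) :
    tmap (LinearMap.snd ℚ X.vertex Y.vertex) (prodβ X Y x) = Y.β x.2 := by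
  rw [prodβ_apply, map_add, ← tmap_comp, ← tmap_comp, LinearMap.snd_comp_inl,
    LinearMap.snd_comp_inr, tmap_id]
  simp [tmap_apply]

lemma prodβ_bijective : Function.Bijective (LocalizedModule.map eulerClasses (prodβ X Y)) := by
  refine localizedMap_bijective _ (fun x hx => ?_) (fun z => ?_)
  · obtain ⟨s, hs, h⟩ := X.exists_smul_eq_zero (x := x.1)
      (by rw [← tmap_fst_prodβ, hx, map_zero])
    obtain ⟨t, ht, h'⟩ := Y.exists_smul_eq_zero (x := x.2)
      (by rw [← tmap_snd_prodβ, hx, map_zero])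
    refine ⟨s * t, mul_mem hs ht, Prod.ext ?_ ?_⟩
    · rw [Prod.smul_fst, mul_comm, mul_smul, h, smul_zero]
      rfl
    · rw [Prod.smul_snd, mul_smul, h', smul_zero]
      rfl
  · obtain ⟨s, hs, x, hx⟩ := X.exists_β_eq (tmap (LinearMap.fst ℚ X.vertex Y.vertex) z)
    obtain ⟨t, ht, y, hy⟩ := Y.exists_β_eq (tmap (LinearMap.snd ℚ X.vertex Y.vertex) z)
    refine ⟨s * t, mul_mem hs ht, (t • x, s • y), ?_⟩
    rw [prodβ_apply]
    dsimp only
    rw [map_smul, map_smul, map_smul, map_smul, hx, hy, map_smul, map_smul, smul_smul,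
      smul_smul, mul_comm t s, ← smul_add, ← tmap_prod_ext]

/-- The direct sum of two objects of `𝒜`. -/
abbrev prod : AObj where
  nub := X.nub.biprod Y.nub
  vertex := X.vertex.prod Y.vertex
  β := prodβ X Y
  β_mem {n x} hx := by
    have h₁ := tmap_mem (V := X.vertex) (W := X.vertex.prod Y.vertex)
      (f := LinearMap.inl ℚ X.vertex Y.vertex) (k := 0)
      (fun i x hx => ⟨by rw [add_zero]; exact hx, zero_mem _⟩) (X.β_mem hx.1)
    have h₂ := tmap_mem (V := Y.vertex) (W := X.vertex.prod Y.vertex)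
      (f := LinearMap.inr ℚ X.vertex Y.vertex) (k := 0)
      (fun i x hx => ⟨zero_mem _, by rw [add_zero]; exact hx⟩) (Y.β_mem hx.2)
    rw [add_zero] at h₁ h₂
    exact add_mem h₁ h₂
  β_loc := prodβ_bijective X Y

/-- The first injection. -/
abbrev inl : Pairs X (prod X Y) :=
  (LinearMap.inl OF X.nub Y.nub, LinearMap.inl ℚ X.vertex Y.vertex)

/-- The second injection. -/
abbrev inr : Pairs Y (prod X Y) :=
  (LinearMap.inr OF X.nub Y.nub, LinearMap.inr ℚ X.vertex Y.vertex)

/-- The first projection. -/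
abbrev fst : Pairs (prod X Y) X :=
  (LinearMap.fst OF X.nub Y.nub, LinearMap.fst ℚ X.vertex Y.vertex)

/-- The second projection. -/
abbrev snd : Pairs (prod X Y) Y :=
  (LinearMap.snd OF X.nub Y.nub, LinearMap.snd ℚ X.vertex Y.vertex)

lemma fst_mem : fst X Y ∈ homDeg (prod X Y) X 0 :=
  ⟨fun i x hx => by rw [add_zero]; exact hx.1, fun i x hx => by rw [add_zero]; exact hx.1,
    fun x => (tmap_fst_prodβ X Y x).symm⟩

lemma snd_mem : snd X Y ∈ homDeg (prod X Y) Y 0 :=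
  ⟨fun i x hx => by rw [add_zero]; exact hx.2, fun i x hx => by rw [add_zero]; exact hx.2,
    fun x => (tmap_snd_prodβ X Y x).symm⟩

lemma inl_mem : inl X Y ∈ homDeg X (prod X Y) 0 :=
  ⟨fun i x hx => ⟨by rw [add_zero]; exact hx, zero_mem _⟩,
    fun i x hx => ⟨by rw [add_zero]; exact hx, zero_mem _⟩, fun x => by
      refine (prodβ_apply X Y (x, 0)).trans ?_
      rw [map_zero, map_zero, add_zero]
      rfl⟩

lemma inr_mem : inr X Y ∈ homDeg Y (prod X Y) 0 :=
  ⟨fun i x hx => ⟨zero_mem _, by rw [add_zero]; exact hx⟩,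
    fun i x hx => ⟨zero_mem _, by rw [add_zero]; exact hx⟩, fun x => by
      refine (prodβ_apply X Y (0, x)).trans ?_
      rw [map_zero, map_zero, zero_add]
      rfl⟩

end Prod

/-! ### Direct sums of families -/

section Sum

section DirectSum

variable {R ι : Type} [Semiring R] [DecidableEq ι] {M : ι → Type} [∀ i, AddCommMonoid (M i)]
  [∀ i, Module R (M i)]

lemma lof_apply_self (i : ι) (x : M i) : DirectSum.lof R ι M i x i = x :=
  DirectSum.of_eq_same i x

lemma lof_apply_ne {i j : ι} (h : j ≠ i) (x : M i) : DirectSum.lof R ι M i x j = 0 :=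
  DirectSum.of_eq_of_ne i j x h

end DirectSum

open Classical in
/-- The structure map of the direct sum of a family. -/
def sumβ {ι : Type} (X : ι → AObj) :
    (DirectSum ι fun i => (X i).nub) →ₗ[OF] TF ⊗[ℚ] (DirectSum ι fun i => (X i).vertex) :=
  DirectSum.toModule OF ι _ fun i =>
    tmap (DirectSum.lof ℚ ι (fun i => ((X i).vertex : Type)) i) ∘ₗ (X i).β

variable {ι : Type} (X : ι → AObj)

open Classical in
lemma sumβ_lof (i : ι) (x : (X i).nub) :
    sumβ X (DirectSum.lof OF ι (fun i => ((X i).nub : Type)) i x) =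
      tmap (DirectSum.lof ℚ ι (fun i => ((X i).vertex : Type)) i) ((X i).β x) := by
  rw [sumβ, DirectSum.toModule_lof]
  rfl

lemma tmap_component_sumβ (i : ι) (x : DirectSum ι fun i => (X i).nub) :
    tmap (DirectSum.component ℚ ι (fun i => ((X i).vertex : Type)) i) (sumβ X x) =
      (X i).β (x i) := by
  classical
  induction x using DirectSum.induction_on with
  | zero => simp
  | of j x =>
    have h := sumβ_lof X j x
    refine (congrArg _ h).trans ?_
    rw [← tmap_comp]
    by_cases hij : j = i
    · subst hij
      have : DirectSum.component ℚ ι (fun i => ((X i).vertex : Type)) j ∘ₗ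
          DirectSum.lof ℚ ι (fun i => ((X i).vertex : Type)) j = LinearMap.id :=
        LinearMap.ext fun v => lof_apply_self (R := ℚ) (M := fun i => ((X i).vertex : Type)) j v
      rw [this, tmap_id, DirectSum.of_eq_same]
    · have : DirectSum.component ℚ ι (fun i => ((X i).vertex : Type)) i ∘ₗ
          DirectSum.lof ℚ ι (fun i => ((X i).vertex : Type)) j = 0 :=
        LinearMap.ext fun v => lof_apply_ne (R := ℚ) (M := fun i => ((X i).vertex : Type)) (Ne.symm hij) v
      have e := lof_apply_ne (R := OF) (M := fun i => ((X i).nub : Type)) (Ne.symm hij) x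
      refine Eq.trans ?_ ((congrArg (X i).β e).trans (map_zero _)).symm
      rw [this, tmap_apply, LinearMap.lTensor_zero]
      rfl
  | add x y hx hy => rw [map_add, map_add, hx, hy, DirectSum.add_apply, map_add]

open Classical in
lemma sumβ_bijective : Function.Bijective (LocalizedModule.map eulerClasses (sumβ X)) := by
  refine localizedMap_bijective _ (fun x hx => ?_) (fun z => ?_)
  · have h (i : ι) : ∃ s ∈ eulerClasses, s • x i = 0 :=
      (X i).exists_smul_eq_zero (by rw [← tmap_component_sumβ, hx, map_zero])
    choose s hs hsx using h
    -- The support is finite, so the product of the Euler classes that kill the components is again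
    -- an Euler class.
    refine ⟨∏ i ∈ x.support, s i, prod_mem fun i _ => hs i, ?_⟩
    refine DFinsupp.ext fun i => ?_
    change (∏ i ∈ x.support, s i) • x i = 0
    by_cases hi : i ∈ x.support
    · rw [← Finset.prod_erase_mul _ _ hi, mul_smul, hsx, smul_zero]
    · rw [DFinsupp.notMem_support_iff.1 hi, smul_zero]
  · induction z using TensorProduct.induction_on with
    | zero => exact ⟨1, Submonoid.one_mem _, 0, by simp⟩
    | tmul a v =>
      induction v using DirectSum.induction_on with
      | zero => exact ⟨1, Submonoid.one_mem _, 0, by simp⟩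
      | of i v =>
        obtain ⟨s, hs, x, hx⟩ := (X i).exists_β_eq (a ⊗ₜ[ℚ] v)
        refine ⟨s, hs, DirectSum.lof OF ι (fun i => ((X i).nub : Type)) i x, ?_⟩
        rw [sumβ_lof, hx, map_smul]
        rfl
      | add v w hv hw =>
        obtain ⟨s, hs, x, hx⟩ := hv
        obtain ⟨t, ht, y, hy⟩ := hw
        refine ⟨s * t, mul_mem hs ht, t • x + s • y, ?_⟩
        rw [map_add, map_smul, map_smul, hx, hy, TensorProduct.tmul_add, smul_add, mul_smul,
          mul_smul, smul_comm t s]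
    | add y z hy hz =>
      obtain ⟨s, hs, x, hx⟩ := hy
      obtain ⟨t, ht, y, hy⟩ := hz
      refine ⟨s * t, mul_mem hs ht, t • x + s • y, ?_⟩
      rw [map_add, map_smul, map_smul, hx, hy, smul_add, mul_smul, mul_smul, smul_comm t s]

lemma GrVect_mem_sum {V : ι → GrVect} {n : ℤ} {x : DirectSum ι fun i => V i} :
    x ∈ (GrVect.sum V).deg n ↔ ∀ i, x i ∈ (V i).deg n :=
  (Submodule.mem_iInf _).trans Iff.rfl

open Classical in
lemma GrVect_lof_mem_sum {V : ι → GrVect} {n : ℤ} (i : ι) {x : V i} (hx : x ∈ (V i).deg n) :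
    DirectSum.lof ℚ ι (fun i => (V i : Type)) i x ∈ (GrVect.sum V).deg n := by
  refine GrVect_mem_sum.2 fun j => ?_
  by_cases h : j = i
  · subst h
    refine (congrArg (· ∈ (V j).deg n) (lof_apply_self (R := ℚ) (M := fun i => (V i : Type)) j x)).mpr hx
  · exact (congrArg (· ∈ (V j).deg n) 
      (lof_apply_ne (R := ℚ) (M := fun i => (V i : Type)) h x)).mpr (zero_mem _)

open Classical in
lemma sumβ_mem {n : ℤ} (x : DirectSum ι fun i => (X i).nub) (hx : ∀ i, x i ∈ (X i).nub.deg n) :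
    sumβ X x ∈ tensorDeg (GrVect.sum fun i => (X i).vertex) n := by
  have : sumβ X x = ∑ i ∈ x.support,
      tmap (DirectSum.lof ℚ ι (fun i => ((X i).vertex : Type)) i) ((X i).β (x i)) := by
    conv_lhs => rw [← DirectSum.sum_support_of x, map_sum]
    exact Finset.sum_congr rfl fun i _ => sumβ_lof X i (x i)
  rw [this]
  refine sum_mem fun i _ => ?_
  have h := tmap_mem (V := (X i).vertex) (W := GrVect.sum fun i => (X i).vertex)
    (f := DirectSum.lof ℚ ι (fun i => ((X i).vertex : Type)) i) (k := 0)
    (fun j v hv => by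
      rw [add_zero]
      exact GrVect_lof_mem_sum (V := fun i => (X i).vertex) i hv) ((X i).β_mem (hx i))
  rwa [add_zero] at h

/-- The direct sum of a family of objects of `𝒜`. -/
abbrev sum : AObj where
  nub := GrMod.sum fun i => (X i).nub
  vertex := GrVect.sum fun i => (X i).vertex
  β := sumβ X
  β_mem {_ x} hx := sumβ_mem X x ((Submodule.mem_iInf _).1 hx)
  β_loc := sumβ_bijective X

open Classical in
/-- The injection of a summand. -/
abbrev sumι (i : ι) : Pairs (X i) (sum X) :=
  (DirectSum.lof OF ι (fun i => ((X i).nub : Type)) i,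
    DirectSum.lof ℚ ι (fun i => ((X i).vertex : Type)) i)

/-- The projection to a summand. -/
abbrev sumπ (i : ι) : Pairs (sum X) (X i) :=
  (DirectSum.component OF ι (fun i => ((X i).nub : Type)) i,
    DirectSum.component ℚ ι (fun i => ((X i).vertex : Type)) i)

lemma sumι_mem (i : ι) : sumι X i ∈ homDeg (X i) (sum X) 0 := by
  refine ⟨fun j x hx => ?_, fun j x hx => ?_, fun x => sumβ_lof X i x⟩
  · rw [add_zero]
    exact GrVect_lof_mem_sum (V := fun i => (X i).nub.toGrVect) i hx
  · rw [add_zero]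
    exact GrVect_lof_mem_sum (V := fun i => (X i).vertex) i hx

lemma sumπ_mem (i : ι) : sumπ X i ∈ homDeg (sum X) (X i) 0 := by
  refine ⟨fun j x hx => ?_, fun j x hx => ?_, fun x => (tmap_component_sumβ X i x).symm⟩
  · rw [add_zero]
    exact (Submodule.mem_iInf _).1 hx i
  · rw [add_zero]
    exact (Submodule.mem_iInf _).1 hx i

open Classical in
lemma exists_sumDesc {Y : AObj} {m : ℤ} {g : ∀ i, Pairs (X i) Y}
    (hg : ∀ i, g i ∈ homDeg (X i) Y m) :
    ∃ l ∈ homDeg (sum X) Y m, ∀ i, comp l (sumι X i) = g i := by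
  have h₁ (i : ι) (x : (X i).nub) : DirectSum.toModule OF ι Y.nub (fun i => (g i).1)
      (DirectSum.lof OF ι (fun i => ((X i).nub : Type)) i x) = (g i).1 x := by
    rw [DirectSum.toModule_lof]
  have h₂ (i : ι) (x : (X i).vertex) : DirectSum.toModule ℚ ι Y.vertex (fun i => (g i).2)
      (DirectSum.lof ℚ ι (fun i => ((X i).vertex : Type)) i x) = (g i).2 x := by
    rw [DirectSum.toModule_lof]
  refine ⟨(DirectSum.toModule OF ι Y.nub fun i => (g i).1,
    DirectSum.toModule ℚ ι Y.vertex fun i => (g i).2), ⟨fun n x hx => ?_, fun n x hx => ?_,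
    fun x => ?_⟩, fun i => pairs_ext (h₁ i) (h₂ i)⟩
  · have hx' : ∀ i, x i ∈ (X i).nub.deg n := (Submodule.mem_iInf _).1 hx
    have : DirectSum.toModule OF ι Y.nub (fun i => (g i).1) x =
        ∑ i ∈ DFinsupp.support x, (g i).1 (x i) := by
      conv_lhs => rw [← DirectSum.sum_support_of x, map_sum]
      exact Finset.sum_congr rfl fun i _ => h₁ i (x i)
    exact (congrArg (· ∈ Y.nub.deg (n + m)) this).mpr
      (sum_mem fun i _ => (hg i).1 n (x i) (hx' i))
  · have hx' : ∀ i, x i ∈ (X i).vertex.deg n := (Submodule.mem_iInf _).1 hx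
    have : DirectSum.toModule ℚ ι Y.vertex (fun i => (g i).2) x =
        ∑ i ∈ DFinsupp.support x, (g i).2 (x i) := by
      conv_lhs => rw [← DirectSum.sum_support_of x, map_sum]
      exact Finset.sum_congr rfl fun i _ => h₂ i (x i)
    exact (congrArg (· ∈ Y.vertex.deg (n + m)) this).mpr
      (sum_mem fun i _ => (hg i).2.1 n (x i) (hx' i))
  · suffices h : Y.β ∘ₗ DirectSum.toModule OF ι Y.nub (fun i => (g i).1) =
        tmap (DirectSum.toModule ℚ ι Y.vertex fun i => (g i).2) ∘ₗ sumβ X from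
      LinearMap.congr_fun h x
    refine DirectSum.linearMap_ext OF fun i => LinearMap.ext fun x => ?_
    refine (congrArg Y.β (h₁ i x)).trans ((β_comm (hg i) x).trans ?_)
    refine Eq.trans ?_ (congrArg (tmap _) (sumβ_lof X i x)).symm
    rw [← tmap_comp]
    congr 2
    exact LinearMap.ext fun v => (h₂ i v).symm

open Classical in
lemma sum_hom_ext {Y : AObj} {f g : Pairs (sum X) Y}
    (h : ∀ i, comp f (sumι X i) = comp g (sumι X i)) : f = g :=
  Prod.ext (DirectSum.linearMap_ext OF fun i => congrArg Prod.fst (h i))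
    (DirectSum.linearMap_ext ℚ fun i => congrArg Prod.snd (h i))

end Sum

end AObj

/-! ### Extension of maps into divisible modules -/

/-- The idempotent of `𝒪_ℱ` that projects to the factor at `H`. -/
def idem (H : FinSubgroup) : OF := C (QF.single H 1)

lemma OF.ext_component {f g : OF} (h : ∀ H, component H f = component H g) : f = g := by
  refine Polynomial.ext fun k => QF.ext fun H => ?_
  have := congrArg (fun p => Polynomial.coeff p k) (h H)
  simpa [component] using this

lemma component_idem_self (H : FinSubgroup) : component H (idem H) = 1 := by
  simp [component, idem, QF.proj_single_self]

lemma component_idem_of_ne {H K : FinSubgroup} (h : K ≠ H) : component K (idem H) = 0 := by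
  simp [component, idem, QF.proj_single_of_ne h]

lemma idem_mul_eq {H : FinSubgroup} {f g : OF} (h : component H f = component H g) :
    idem H * f = idem H * g := by
  refine OF.ext_component fun K => ?_
  rw [map_mul, map_mul]
  by_cases hK : K = H
  · rw [hK, h]
  · rw [component_idem_of_ne hK, zero_mul, zero_mul]

lemma component_X (H : FinSubgroup) : component H X = X := by
  simp [component]

lemma component_sum_idem (S : Finset FinSubgroup) {K : FinSubgroup} (hK : K ∈ S) :
    component K (∑ H ∈ S, idem H) = 1 := by
  rw [map_sum, Finset.sum_eq_single_of_mem K hK fun H _ hH => component_idem_of_ne hH.symm,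
    component_idem_self]

section Extension

variable {N : Type} [AddCommGroup N] [Module OF N]

/-- On the part at H the ring acts through ℚ[c_H], where a polynomial is its constant term plus a
multiple of the variable. -/
lemma smul_eq_of_idem_smul {H : FinSubgroup} [Module ℚ N] [IsScalarTower ℚ OF N] {y : N}
    (hy : idem H • y = y) (f : OF) :
    f • y = QF.proj H (f.coeff 0) • y + f.divX • (X : OF) • y := by
  have h : C (f.coeff 0) * idem H = QF.proj H (f.coeff 0) • idem H := by
    refine OF.ext_component fun K => ?_
    rw [map_mul, map_smul]
    by_cases hK : K = H
    · subst hK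
      simp [component, idem, QF.proj_single_self, Polynomial.smul_eq_C_mul]
    · rw [component_idem_of_ne hK, mul_zero, smul_zero]
  nth_rewrite 1 [← Polynomial.divX_mul_X_add f]
  rw [add_smul, mul_smul, add_comm]
  nth_rewrite 1 [← hy]
  rw [smul_smul, h, smul_assoc, hy]

/-- A non-zero torsion module has a non-zero element that is concentrated at one subgroup H and
killed by c_H; this is applied to N/M. -/
lemma exists_idem_smul_notMem {M : Submodule OF N} {x : N} (hx : x ∉ M) {s : OF}
    (hs : s ∈ eulerClasses) (hsx : s • x ∈ M) :
    ∃ (H : FinSubgroup) (y : N), idem H • y = y ∧ y ∉ M ∧ (X : OF) • y ∈ M := by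
  obtain ⟨v, hv⟩ := hs
  have h₁ : ∃ H ∈ v.support, idem H • x ∉ M := by
    by_contra! h
    refine hx ?_
    -- Outside the finite support of v the Euler class is 1, so s • x in M forces that part of x
    -- into M.
    have h₂ : (1 - ∑ H ∈ v.support, idem H) * s = 1 - ∑ H ∈ v.support, idem H := by
      refine OF.ext_component fun K => ?_
      rw [map_mul, hv]
      by_cases hK : K ∈ v.support
      · rw [map_sub, component_sum_idem _ hK, map_one, sub_self, zero_mul]
      · rw [Finsupp.notMem_support_iff.1 hK, pow_zero, mul_one]
    have h₃ : (1 - ∑ H ∈ v.support, idem H) • x ∈ M := by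
      rw [← h₂, mul_smul]
      exact M.smul_mem _ hsx
    rw [sub_smul, one_smul, Finset.sum_smul] at h₃
    have := M.add_mem h₃ (M.sum_mem fun H hH => h H hH)
    rwa [sub_add_cancel] at this
  obtain ⟨H, hH, hHx⟩ := h₁
  -- The last multiple by a power of X that is still outside M is the required element.
  have h₂ : ∃ k, ((X : OF) ^ k * idem H) • x ∈ M := by
    refine ⟨v H, ?_⟩
    rw [mul_comm, ← idem_mul_eq (f := s) (by rw [hv, map_pow, component_X]), mul_smul]
    exact M.smul_mem _ hsx
  classical
  obtain ⟨k, hk⟩ : ∃ k, Nat.find h₂ = k + 1 := by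
    refine Nat.exists_eq_succ_of_ne_zero fun h => hHx ?_
    have := Nat.find_spec h₂
    rwa [h, pow_zero, one_mul] at this
  refine ⟨H, ((X : OF) ^ k * idem H) • x, ?_, Nat.find_min h₂ (by omega), ?_⟩
  · rw [smul_smul, mul_left_comm]
    congr 2
    rw [← idem_mul_eq (f := 1) (by rw [component_idem_self, map_one]), mul_one]
  · have := Nat.find_spec h₂
    rwa [hk, pow_succ', mul_assoc, mul_smul] at this

/-- A map into a module on which Euler classes act surjectively extends along an injection with
torsion cokernel. -/
theorem exists_extension_of_torsion {M D : Type} [AddCommGroup M] [Module OF M]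
    [Module ℚ N] [IsScalarTower ℚ OF N]
    [AddCommGroup D] [Module OF D] [Module ℚ D] [IsScalarTower ℚ OF D]
    (j : M →ₗ[OF] N) (hj : Function.Injective j)
    (htors : ∀ x : N, ∃ s ∈ eulerClasses, s • x ∈ LinearMap.range j)
    (hD : ∀ s ∈ eulerClasses, ∀ x : D, ∃ y : D, s • y = x) (θ : M →ₗ[OF] D) :
    ∃ g : N →ₗ[OF] D, ∀ m, g (j m) = θ m := by
  have : Fact (Function.Injective j) := ⟨hj⟩
  -- A maximal partial extension, by Zorn's lemma. If its domain is not everything, it is enlarged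
  -- by an element y at one subgroup with X • y in the domain.
  let E := Module.Baer.extensionOfMax j θ
  have htop : E.domain = ⊤ := by
    rw [eq_top_iff]
    rintro x -
    by_contra hx
    obtain ⟨s, hs, hsx⟩ := htors x
    obtain ⟨H, y, hy, hyM, hXy⟩ := exists_idem_smul_notMem hx hs (E.le hsx)
    obtain ⟨t, ht, htH⟩ := exists_eulerClass H 1
    -- The value σ at y has to satisfy X • σ = E(X • y). Division by t, which agrees with X at H,
    -- gives a candidate, and the idempotent moves it to the part at H.
    obtain ⟨σ', hσ'⟩ := hD t ht (E.toLinearPMap ⟨(X : OF) • y, hXy⟩)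
    let σ := idem H • σ'
    have hσ : idem H • σ = σ := by
      rw [smul_smul, idem_mul_eq (g := 1) (by rw [component_idem_self, map_one]), mul_one]
    have hXσ : (X : OF) • σ = E.toLinearPMap ⟨(X : OF) • y, hXy⟩ := by
      rw [smul_smul, mul_comm, idem_mul_eq (g := t) (by rw [htH, component_X, pow_one]), mul_smul,
        hσ', ← LinearPMap.map_smul]
      congr 1
      refine Subtype.ext ?_
      change idem H • (X : OF) • y = (X : OF) • y
      rw [smul_comm, hy]
    -- If f • y lies in the domain, the constant term of f at H is zero, as otherwise y would lie
    -- there too. So f • y is a multiple of X • y, where E and σ agree by choice.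
    have key (f : OF) (hf : f • y ∈ E.domain) : f • σ = E.toLinearPMap ⟨f • y, hf⟩ := by
      have h₁ := smul_eq_of_idem_smul hy f
      have h₀ : QF.proj H (f.coeff 0) = 0 := by
        by_contra h
        refine hyM ?_
        have h₂ : QF.proj H (f.coeff 0) • y ∈ E.domain := by
          rw [h₁] at hf
          exact (E.domain.add_mem_iff_left (E.domain.smul_mem f.divX hXy)).1 hf
        have h₃ := E.domain.smul_mem (algebraMap ℚ OF (QF.proj H (f.coeff 0))⁻¹) h₂
        rwa [algebraMap_smul, smul_smul, inv_mul_cancel₀ h, one_smul] at h₃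
      rw [smul_eq_of_idem_smul hσ f, h₀, zero_smul, zero_add, hXσ, ← LinearPMap.map_smul]
      congr 1
      refine Subtype.ext ?_
      change f.divX • (X : OF) • y = f • y
      rw [h₁, h₀, zero_smul, zero_add]
    let g : N →ₗ.[OF] D := LinearPMap.mkSpanSingleton' (σ := RingHom.id OF) y σ (fun (f : OF) hf => by
      have hf' : f • y ∈ E.domain := by
        rw [hf]
        exact zero_mem _
      rw [RingHom.id_apply, key f hf']
      exact (congrArg _ (Subtype.ext hf : (⟨f • y, hf'⟩ : E.domain) = 0)).trans
        (map_zero E.toLinearPMap.toFun))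
    have hcompat (a : E.domain) (b : g.domain) (h : (a : N) = b) : E.toLinearPMap a = g b := by
      obtain ⟨b, hb⟩ := b
      obtain ⟨f, rfl⟩ := Submodule.mem_span_singleton.1 hb
      obtain ⟨a, ha⟩ := a
      change a = f • y at h
      subst h
      rw [LinearPMap.mkSpanSingleton'_apply]
      exact (key f ha).symm
    let E' : Module.Baer.ExtensionOf j θ :=
      { E.toLinearPMap.sup g hcompat with
        le := E.le.trans le_sup_left
        is_extension := fun m => (E.is_extension m).trans
          ((E.toLinearPMap.left_le_sup g hcompat).2 rfl) }
    have hE' : E' = E := Module.Baer.extensionOfMax_is_max j θ E'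
      (E.toLinearPMap.left_le_sup g hcompat)
    refine hyM ?_
    rw [← hE']
    exact (le_sup_right : g.domain ≤ _) (Submodule.mem_span_singleton_self y)
  refine ⟨E.toLinearPMap.toFun ∘ₗ LinearMap.codRestrict E.domain LinearMap.id
    fun x => htop ▸ Submodule.mem_top, fun m => (E.is_extension m).symm⟩

end Extension

/-! ### Divisible objects and their injectivity -/

namespace AObj

/-- The Euler classes act surjectively on the nub. -/
def IsDiv (X : AObj) : Prop := ∀ s ∈ eulerClasses, ∀ x : X.nub, ∃ y : X.nub, s • y = x

lemma IsDiv.of_surjective {X Y : AObj} (hX : IsDiv X) (f : X.nub →ₗ[OF] Y.nub)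
    (hf : Function.Surjective f) : IsDiv Y := by
  intro s hs y
  obtain ⟨x, rfl⟩ := hf y
  obtain ⟨z, rfl⟩ := hX s hs x
  exact ⟨f z, (map_smul f s z).symm⟩

lemma IsDiv.susp {X : AObj} (hX : IsDiv X) (k : ℤ) : IsDiv (susp X k) := hX

lemma IsDiv.prod {X Y : AObj} (hX : IsDiv X) (hY : IsDiv Y) : IsDiv (prod X Y) := by
  rintro s hs ⟨x, y⟩
  obtain ⟨x, rfl⟩ := hX s hs x
  obtain ⟨y, rfl⟩ := hY s hs y
  exact ⟨(x, y), rfl⟩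

lemma IsDiv.sum {ι : Type} {X : ι → AObj} (hX : ∀ i, IsDiv (X i)) : IsDiv (sum X) := by
  classical
  intro s hs x
  induction x using DirectSum.induction_on with
  | zero => exact ⟨0, smul_zero _⟩
  | of i x =>
    obtain ⟨y, rfl⟩ := hX i s hs x
    exact ⟨DirectSum.lof OF ι (fun i => ((X i).nub : Type)) i y,
      (map_smul (DirectSum.lof OF ι (fun i => ((X i).nub : Type)) i) s y).symm⟩
  | add x y hx hy =>
    obtain ⟨x', rfl⟩ := hx
    obtain ⟨y', rfl⟩ := hy
    exact ⟨x' + y', smul_add s x' y'⟩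

/-- Some s • y is β x; divide x by s in the nub and cancel s, which acts invertibly on the target.
-/
lemma IsDiv.β_surjective {X : AObj} (hX : IsDiv X) : Function.Surjective X.β := by
  intro y
  obtain ⟨s, hs, x, hx⟩ := X.exists_β_eq y
  obtain ⟨z, rfl⟩ := hX s hs x
  refine ⟨z, sub_eq_zero.1 (eq_zero_of_smul_tensor hs ?_)⟩
  rw [smul_sub, ← map_smul, hx, sub_self]

/-- Divisible objects are injective in `𝒜`. -/
theorem IsDiv.exists_extension {X Y D : AObj} (hD : IsDiv D) {i : Pairs X Y}
    (hi : i ∈ homDeg X Y 0) (hinj : Inj i) {f : Pairs X D} {n : ℤ} (hf : f ∈ homDeg X D n) :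
    ∃ g ∈ homDeg Y D n, comp g i = f := by
  have hi₁ (m : ℤ) (x : X.nub) (hx : x ∈ X.nub.deg m) : i.1 x ∈ Y.nub.deg m := by
    have := hi.1 m x hx
    rwa [add_zero] at this
  have hi₂ (m : ℤ) (x : X.vertex) (hx : x ∈ X.vertex.deg m) : i.2 x ∈ Y.vertex.deg m := by
    have := hi.2.1 m x hx
    rwa [add_zero] at this
  -- On vertices, compose with a linear retraction and keep the part of degree n.
  obtain ⟨r, hr⟩ := LinearMap.exists_leftInverse_of_injective i.2 (LinearMap.ker_eq_bot.2 hinj.2)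
  let ψ : Y.vertex →ₗ[ℚ] D.vertex := GrVect.homPart (f.2 ∘ₗ r) n
  have hψi (x : X.vertex) : ψ (i.2 x) = f.2 x :=
    GrVect.homPart_comp (f.2 ∘ₗ r) n hi₂ (vertex_mem hf)
      (fun x => congrArg f.2 (LinearMap.congr_fun hr x)) x
  -- To reduce to a torsion cokernel, enlarge X.nub by a free module. Its generators go to elements
  -- x k of Y.nub with β(x k) = s k • (1 ⊗ u k), where the u k lift a basis of the quotient of the
  -- vertices. Their images y k in D only have to be compatible with β, which is possible because β
  -- is surjective on D.
  let q := (LinearMap.range i.2).mkQ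
  let b := Module.Basis.ofVectorSpace ℚ (Y.vertex ⧸ LinearMap.range i.2)
  let ι := Module.Basis.ofVectorSpaceIndex ℚ (Y.vertex ⧸ LinearMap.range i.2)
  have hu (k : ι) : ∃ u : Y.vertex, q u = b k := (LinearMap.range i.2).mkQ_surjective (b k)
  choose u hu using hu
  have hx (k : ι) : ∃ s ∈ eulerClasses, ∃ x : Y.nub, Y.β x = s • ((1 : TF) ⊗ₜ[ℚ] u k) :=
    Y.exists_β_eq _
  choose s hs x hx using hx
  have hy (k : ι) : ∃ y : D.nub, D.β y = tmap ψ (Y.β (x k)) := hD.β_surjective _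
  choose y hy using hy
  let j : (X.nub × (ι →₀ OF)) →ₗ[OF] Y.nub := i.1.coprod (Finsupp.linearCombination OF x)
  let θ : (X.nub × (ι →₀ OF)) →ₗ[OF] D.nub := f.1.coprod (Finsupp.linearCombination OF y)
  have hqi (z : TF ⊗[ℚ] X.vertex) : tmap q (tmap i.2 z) = 0 :=
    (tmap_exact (LinearMap.exact_map_mkQ_range i.2) _).2 ⟨z, rfl⟩
  have hβj (m : X.nub × (ι →₀ OF)) : tmap q (Y.β (j m)) =
      m.2.sum fun k a => algebraMap OF TF (a * s k) ⊗ₜ[ℚ] b k := by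
    change tmap q (Y.β (i.1 m.1 + Finsupp.linearCombination OF x m.2)) = _
    rw [map_add, map_add, β_comm hi, hqi, zero_add, Finsupp.linearCombination_apply,
      map_finsuppSum, map_finsuppSum]
    refine Finsupp.sum_congr fun k _ => ?_
    rw [map_smul, map_smul, hx, map_smul, tmap_tmul, hu, smul_smul, TensorProduct.smul_tmul',
      Algebra.smul_def, mul_one]
  have hjinj : Function.Injective j := by
    rw [injective_iff_map_eq_zero]
    intro m hm
    have h₁ := hβj m
    rw [hm, map_zero, map_zero] at h₁
    classical
    have h₂ : m.2 = 0 := by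
      ext1 k
      -- The k-th coordinate of the relation is the coefficient times s k. Both s k and the map from
      -- 𝒪_ℱ to t are harmless: Euler classes become units, and are non-zero-divisors in 𝒪_ℱ.
      have h₃ := congrArg (TensorProduct.lift
        ((LinearMap.lsmul ℚ TF).flip.compl₂ (b.coord k))) h₁.symm
      rw [map_finsuppSum, map_zero] at h₃
      have h₄ (k' : ι) (a : OF) : TensorProduct.lift
          ((LinearMap.lsmul ℚ TF).flip.compl₂ (b.coord k))
          (algebraMap OF TF (a * s k') ⊗ₜ[ℚ] b k') =
            if k' = k then algebraMap OF TF (a * s k') else 0 := by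
        rw [TensorProduct.lift.tmul]
        simp [Finsupp.single_apply, ite_smul]
      simp only [h₄] at h₃
      rw [Finsupp.sum_ite_eq'] at h₃
      split_ifs at h₃ with hk
      · obtain ⟨v, hv⟩ := exists_inverse_eulerClass (hs k)
        have h₅ : algebraMap OF TF (m.2 k) = 0 := by
          rw [← mul_one (algebraMap OF TF (m.2 k)), ← hv, mul_left_comm, ← map_mul, h₃, mul_zero]
        obtain ⟨t, ht⟩ := (IsLocalization.map_eq_zero_iff eulerClasses TF _).1 h₅
        obtain ⟨w, hw⟩ := t.2
        refine OF.ext_component fun K => ?_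
        have := congrArg (component K) ht
        rw [map_mul, hw, map_zero] at this
        rw [Finsupp.zero_apply, map_zero]
        exact (mul_eq_zero.1 this).resolve_left (pow_ne_zero _ X_ne_zero)
      · simpa using hk
    have h₃ : i.1 m.1 = 0 := by
      have : i.1 m.1 + Finsupp.linearCombination OF x m.2 = 0 := hm
      rwa [h₂, map_zero, add_zero] at this
    exact Prod.ext (hinj.1 (h₃.trans (map_zero _).symm)) h₂
  have htors (z : Y.nub) : ∃ t ∈ eulerClasses, t • z ∈ LinearMap.range j := by
    have h₁ (w : TF ⊗[ℚ] (Y.vertex ⧸ LinearMap.range i.2)) :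
        ∃ t ∈ eulerClasses, ∃ m, tmap q (Y.β (j m)) = t • w := by
      induction w using TensorProduct.induction_on with
      | zero => exact ⟨1, Submonoid.one_mem _, 0, by simp⟩
      | tmul a v =>
        induction b.mem_span v using Submodule.span_induction with
        | zero => exact ⟨1, Submonoid.one_mem _, 0, by simp⟩
        | mem _ h =>
          obtain ⟨k, rfl⟩ := h
          obtain ⟨f, t, rfl⟩ := IsLocalization.exists_mk'_eq eulerClasses a
          refine ⟨t * s k, mul_mem t.2 (hs k), (0, Finsupp.single k f), ?_⟩
          rw [hβj, Finsupp.sum_single_index (by simp), TensorProduct.smul_tmul', Algebra.smul_def,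
            map_mul, map_mul, mul_comm (algebraMap OF TF t), mul_assoc, mul_comm _ (algebraMap OF TF (s k)),
            mul_comm (algebraMap OF TF t), IsLocalization.mk'_spec, mul_comm]
        | smul c v _ hv =>
          obtain ⟨t, ht, m, hm⟩ := hv
          refine ⟨t, ht, algebraMap ℚ OF c • m, ?_⟩
          rw [map_smul, map_smul, map_smul, hm, TensorProduct.tmul_smul, algebraMap_smul, smul_comm]
        | add v w _ _ hv hw =>
          obtain ⟨t, ht, m, hm⟩ := hv
          obtain ⟨t', ht', m', hm'⟩ := hw
          refine ⟨t * t', mul_mem ht ht', t' • m + t • m', ?_⟩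
          rw [map_add, map_add, map_add, map_smul, map_smul, map_smul, map_smul, map_smul,
            map_smul, hm, hm', TensorProduct.tmul_add, smul_add, mul_smul, mul_smul, smul_comm t' t]
      | add v w hv hw =>
        obtain ⟨t, ht, m, hm⟩ := hv
        obtain ⟨t', ht', m', hm'⟩ := hw
        refine ⟨t * t', mul_mem ht ht', t' • m + t • m', ?_⟩
        rw [map_add, map_add, map_add, map_smul, map_smul, map_smul, map_smul, map_smul, map_smul,
          hm, hm', smul_add, mul_smul, mul_smul, smul_comm t' t]
    -- Up to an Euler class the free part matches the image of z over the quotient of the vertices.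
    -- The difference has its β over X.vertex, so after two further Euler classes it comes from
    -- X.nub.
    obtain ⟨t, ht, m, hm⟩ := h₁ (tmap q (Y.β z))
    have h₂ : tmap q (Y.β (t • z - j m)) = 0 := by
      rw [map_sub, map_sub, map_smul, map_smul, hm, sub_self]
    obtain ⟨w, hw⟩ := (tmap_exact (LinearMap.exact_map_mkQ_range i.2) _).1 h₂
    obtain ⟨t', ht', x', hx'⟩ := X.exists_β_eq w
    have h₃ : Y.β (t' • (t • z - j m) - i.1 x') = 0 := by
      rw [map_sub, map_smul, ← hw, β_comm hi, hx', map_smul, sub_self]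
    obtain ⟨t'', ht'', h₄⟩ := Y.exists_smul_eq_zero h₃
    refine ⟨t'' * t' * t, mul_mem (mul_mem ht'' ht') ht, t'' • ((x', 0) + t' • m), ?_⟩
    have h₅ : j (x', 0) = i.1 x' := by
      change i.1 x' + Finsupp.linearCombination OF x 0 = _
      rw [map_zero, add_zero]
    rw [map_smul, map_add, h₅, map_smul]
    rw [smul_sub, smul_sub, smul_sub, sub_sub, sub_eq_zero] at h₄
    rw [mul_smul, mul_smul, h₄, smul_add, add_comm]
  obtain ⟨g, hg⟩ := exists_extension_of_torsion j hjinj htors hD θ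
  let g' := GrMod.homPart g n
  have hgi (z : X.nub) : g (i.1 z) = f.1 z := by
    have := hg (z, 0)
    change g (i.1 z + Finsupp.linearCombination OF x 0) =
      f.1 z + Finsupp.linearCombination OF y 0 at this
    rwa [map_zero, map_zero, add_zero, add_zero] at this
  -- Compatibility with β holds on the range of j by construction. It propagates to Y.nub because
  -- the cokernel of j is torsion and Euler classes act injectively on t ⊗ D.vertex.
  have hβg (z : Y.nub) : D.β (g z) = tmap ψ (Y.β z) := by
    have h₁ (m) : D.β (g (j m)) = tmap ψ (Y.β (j m)) := by
      rw [hg]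
      change D.β (f.1 m.1 + Finsupp.linearCombination OF y m.2) =
        tmap ψ (Y.β (i.1 m.1 + Finsupp.linearCombination OF x m.2))
      rw [map_add, map_add, map_add, β_comm hf, β_comm hi, ← tmap_comp,
        show ψ ∘ₗ i.2 = f.2 from LinearMap.ext hψi, Finsupp.linearCombination_apply,
        Finsupp.linearCombination_apply, map_finsuppSum, map_finsuppSum, map_finsuppSum]
      congr 1
      refine Finsupp.sum_congr fun k _ => ?_
      rw [map_smul, map_smul, map_smul, hy]
    obtain ⟨t, ht, m, hm⟩ := htors z
    refine sub_eq_zero.1 (eq_zero_of_smul_tensor ht ?_)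
    rw [smul_sub, ← map_smul, ← map_smul, ← map_smul, ← map_smul, ← hm, h₁, sub_self]
  refine ⟨(g', ψ), ⟨fun m z hz => GrMod.homPart_mem g n m hz,
    fun m z hz => GrVect.homPart_mem _ n m hz, fun z => ?_⟩,
    pairs_ext (fun z => GrMod.homPart_comp g n hi₁ (nub_mem hf) hgi z) hψi⟩
  change D.β (g' z) = tmap ψ (Y.β z)
  induction z using GrVect.induction with
  | hom m z hz =>
    -- The extension g need not be homogeneous. As β preserves degrees and ψ has degree n,
    -- projecting the identity for g to degree m + n gives the one for its homogeneous part.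
    have h₁ : g' z = D.nub.proj (m + n) (g z) := GrVect.homPart_of_mem (g.restrictScalars ℚ) n hz
    have h₂ : (D.β.restrictScalars ℚ) (D.nub.proj (m + n) (g z)) =
        (grTensor D.vertex).proj (m + n) (D.β (g z)) := by
      have := GrVect.proj_map (V := D.nub.toGrVect) (W := (grTensor D.vertex).toGrVect) (k := 0)
        (f := D.β.restrictScalars ℚ) (fun l w hw => by rw [add_zero]; exact D.β_mem hw) (m + n) (g z)
      rw [add_zero] at this
      exact this.symm
    rw [h₁]
    refine h₂.trans ?_
    rw [hβg]
    exact GrVect.proj_of_mem (V := (grTensor D.vertex).toGrVect)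
      (tmap_mem (fun l w hw => GrVect.homPart_mem _ n l hw) (Y.β_mem hz))
  | add z w hz hw => rw [map_add, map_add, map_add, map_add, hz, hw]

end AObj

/-! ### Embedding into divisible objects -/

lemma Laurent.mul_mem_deg {H : FinSubgroup} {i j : ℤ} {x y : Laurent H}
    (hx : x ∈ Laurent.deg H i) (hy : y ∈ Laurent.deg H j) : x * y ∈ Laurent.deg H (i + j) := by
  by_cases h : ∀ k, Laurent.coeff H k x = 0
  · have : x = 0 := LaurentPolynomial.ext h
    rw [this, zero_mul]
    exact zero_mem _
  push Not at h
  obtain ⟨k, hk⟩ := h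
  have hik : -2 * k = i := hx k hk
  have e : x = Laurent.mono H (Laurent.coeff H k x) k := by
    refine LaurentPolynomial.ext fun l => ?_
    have h₁ := Laurent.coeff_mono_mul H (Laurent.coeff H k x) k l 1
    rw [mul_one] at h₁
    refine Eq.trans ?_ h₁.symm
    have h₂ : Laurent.coeff H (l - k) 1 = if 0 = l - k then 1 else 0 := by
      have := LaurentPolynomial.T_apply (R := ℚ) (l - k) 0
      rw [LaurentPolynomial.T_zero] at this
      exact this
    rw [h₂]
    split_ifs with hl
    · rw [mul_one, show l = k by omega]
      rfl
    · rw [mul_zero]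
      by_contra h'
      have : -2 * l = i := hx l h'
      omega
  rw [e]
  intro l hl
  rw [Laurent.coeff_mono_mul] at hl
  have : -2 * (l - k) = j := hy (l - k) (right_ne_zero_of_mul hl)
  change -2 * l = i + j
  omega

lemma TF.mul_mem_deg {i j : ℤ} {x y : TF} (hx : x ∈ TF.deg i) (hy : y ∈ TF.deg j) :
    x * y ∈ TF.deg (i + j) := by
  rw [TF.mem_deg_iff] at hx hy ⊢
  intro H
  rw [map_mul]
  exact Laurent.mul_mem_deg (hx H) (hy H)

lemma TF_smul_mem_tensorDeg {V : GrVect} {i j n : ℤ} (h : i + j = n) {x : TF} (hx : x ∈ TF.deg i)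
    {z : TF ⊗[ℚ] V} (hz : z ∈ tensorDeg V j) : x • z ∈ tensorDeg V n := by
  induction hz using Submodule.span_induction with
  | mem z hz =>
    obtain ⟨k, l, hj, y, hy, v, hv, rfl⟩ := hz
    rw [TensorProduct.smul_tmul', smul_eq_mul]
    exact tmul_mem_tensorDeg (by omega) (TF.mul_mem_deg hx hy) hv
  | zero => rw [smul_zero]; exact zero_mem _
  | add y z _ _ hy hz => rw [smul_add]; exact add_mem hy hz
  | smul c z _ hz => rw [smul_comm]; exact Submodule.smul_mem _ c hz

/-! ### A divisible module that contains a given module -/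

section Hull

variable (N : Type) [AddCommGroup N] [Module OF N] [Module ℚ N]

/-- The relations `f ⊗ n = 1 ⊗ f n` in `t_*^ℱ ⊗_ℚ N`, for `f` in `𝒪_ℱ`. -/
def hullRel : Submodule OF (TF ⊗[ℚ] N) :=
  Submodule.span OF {z | ∃ (f : OF) (n : N),
    z = algebraMap OF TF f ⊗ₜ[ℚ] n - (1 : TF) ⊗ₜ[ℚ] (f • n)}

variable {N}

lemma hullRel_gen (f : OF) (n : N) :
    algebraMap OF TF f ⊗ₜ[ℚ] n - (1 : TF) ⊗ₜ[ℚ] (f • n) ∈ hullRel N :=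
  Submodule.subset_span ⟨f, n, rfl⟩

variable [IsScalarTower ℚ OF N]

/-- The multiplication map. -/
def smulTensor : OF ⊗[ℚ] N →ₗ[OF] N :=
  TensorProduct.AlgebraTensorModule.lift
    { toFun := fun f => (LinearMap.lsmul OF N f).restrictScalars ℚ
      map_add' := fun f g => LinearMap.ext fun n => add_smul f g n
      map_smul' := fun f g => LinearMap.ext fun n => mul_smul f g n }

lemma smulTensor_tmul (f : OF) (n : N) : smulTensor (f ⊗ₜ[ℚ] n) = f • n := rfl

lemma algebraMap_OF_TF_injective : Function.Injective (algebraMap OF TF) := by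
  rw [injective_iff_map_eq_zero]
  intro f hf
  obtain ⟨t, ht⟩ := (IsLocalization.map_eq_zero_iff eulerClasses TF _).1 hf
  obtain ⟨w, hw⟩ := t.2
  refine OF.ext_component fun K => ?_
  have := congrArg (component K) ht
  rw [map_mul, hw, map_zero] at this
  rw [map_zero]
  exact (mul_eq_zero.1 this).resolve_left (pow_ne_zero _ X_ne_zero)

/-- The map `𝒪_ℱ ⊗ N → t_*^ℱ ⊗ N`. -/
def extendTensor : OF ⊗[ℚ] N →ₗ[OF] TF ⊗[ℚ] N :=
  TensorProduct.AlgebraTensorModule.map (Algebra.linearMap OF TF) LinearMap.id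

omit [Module OF N] [IsScalarTower ℚ OF N] in
lemma extendTensor_injective : Function.Injective (extendTensor (N := N)) :=
  Module.Flat.rTensor_preserves_injective_linearMap (M := N)
    ((Algebra.linearMap OF TF).restrictScalars ℚ) algebraMap_OF_TF_injective

/-- The relations are spanned over 𝒪_ℱ, not over t, so they lie in the image of the kernel of the
multiplication 𝒪_ℱ ⊗ N → N. The quotient is therefore the pushout of t ⊗ N and N over 𝒪_ℱ ⊗ N
(tensor products over ℚ). Unlike a localization it keeps the torsion of N. -/
lemma exists_of_mem_hullRel {z : TF ⊗[ℚ] N} (hz : z ∈ hullRel N) :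
    ∃ w, extendTensor w = z ∧ smulTensor w = 0 := by
  induction hz using Submodule.span_induction with
  | mem z hz =>
    obtain ⟨f, n, rfl⟩ := hz
    refine ⟨f ⊗ₜ[ℚ] n - (1 : OF) ⊗ₜ[ℚ] (f • n), ?_, ?_⟩
    · rw [map_sub]
      change algebraMap OF TF f ⊗ₜ[ℚ] n - algebraMap OF TF 1 ⊗ₜ[ℚ] (f • n) = _
      rw [map_one]
    · rw [map_sub, smulTensor_tmul, smulTensor_tmul, one_smul, sub_self]
  | zero => exact ⟨0, map_zero _, map_zero _⟩
  | add y z _ _ hy hz =>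
    obtain ⟨v, rfl, hv⟩ := hy
    obtain ⟨w, rfl, hw⟩ := hz
    exact ⟨v + w, map_add _ _ _, by rw [map_add, hv, hw, add_zero]⟩
  | smul f z _ hz =>
    obtain ⟨w, rfl, hw⟩ := hz
    exact ⟨f • w, map_smul _ _ _, by rw [map_smul, hw, smul_zero]⟩

/-- The map 𝒪_ℱ ⊗ N → t ⊗ N is injective by flatness over ℚ, so a pushout along it leaves N
embedded. -/
lemma one_tmul_mem_hullRel {n : N} (h : (1 : TF) ⊗ₜ[ℚ] n ∈ hullRel N) : n = 0 := by
  obtain ⟨w, hw, hw'⟩ := exists_of_mem_hullRel h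
  have h₁ : extendTensor ((1 : OF) ⊗ₜ[ℚ] n) = (1 : TF) ⊗ₜ[ℚ] n := by
    change algebraMap OF TF 1 ⊗ₜ[ℚ] n = _
    rw [map_one]
  rw [← extendTensor_injective (h₁.trans hw.symm), smulTensor_tmul, one_smul] at hw'
  exact hw'

-- Clearing denominators: modulo the relations, t ⊗ N agrees with N up to Euler classes.
omit [IsScalarTower ℚ OF N] in
lemma exists_smul_sub_mem_hullRel (z : TF ⊗[ℚ] N) :
    ∃ s ∈ eulerClasses, ∃ n : N, s • z - (1 : TF) ⊗ₜ[ℚ] n ∈ hullRel N := by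
  induction z using TensorProduct.induction_on with
  | zero => exact ⟨1, Submonoid.one_mem _, 0, by simp⟩
  | tmul x n =>
    obtain ⟨f, s, rfl⟩ := IsLocalization.exists_mk'_eq eulerClasses x
    refine ⟨s, s.2, f • n, ?_⟩
    rw [TensorProduct.smul_tmul', Algebra.smul_def, mul_comm, IsLocalization.mk'_spec]
    exact hullRel_gen f n
  | add y z hy hz =>
    obtain ⟨s, hs, m, hm⟩ := hy
    obtain ⟨t, ht, n, hn⟩ := hz
    refine ⟨s * t, mul_mem hs ht, t • m + s • n, ?_⟩
    have h (f : OF) (n : N) : f • (1 : TF) ⊗ₜ[ℚ] n - (1 : TF) ⊗ₜ[ℚ] (f • n) ∈ hullRel N := by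
      rw [TensorProduct.smul_tmul', Algebra.smul_def, mul_one]
      exact hullRel_gen f n
    have := add_mem (add_mem ((hullRel N).smul_mem t hm) ((hullRel N).smul_mem s hn))
      (add_mem (h t m) (h s n))
    convert this using 1
    rw [smul_add, TensorProduct.tmul_add, smul_sub, smul_sub, mul_smul, mul_smul,
      smul_comm t s y]
    abel

/-- The extension of a map `N → t_*^ℱ ⊗ V` to `t_*^ℱ ⊗ N`. -/
def extendβ {V : Type} [AddCommGroup V] [Module ℚ V] (β : N →ₗ[OF] TF ⊗[ℚ] V) :
    TF ⊗[ℚ] N →ₗ[OF] TF ⊗[ℚ] V :=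
  TensorProduct.AlgebraTensorModule.lift
    { toFun := fun x => (LinearMap.lsmul TF (TF ⊗[ℚ] V) x).restrictScalars ℚ ∘ₗ
        β.restrictScalars ℚ
      map_add' := fun x y => LinearMap.ext fun n => add_smul x y (β n)
      map_smul' := fun f x => LinearMap.ext fun n => smul_assoc f x (β n) }

lemma extendβ_tmul {V : Type} [AddCommGroup V] [Module ℚ V] (β : N →ₗ[OF] TF ⊗[ℚ] V) (x : TF)
    (n : N) : extendβ β (x ⊗ₜ[ℚ] n) = x • β n := rfl

lemma hullRel_le_ker {V : Type} [AddCommGroup V] [Module ℚ V] (β : N →ₗ[OF] TF ⊗[ℚ] V) :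
    hullRel N ≤ LinearMap.ker (extendβ β) := by
  refine Submodule.span_le.2 ?_
  rintro _ ⟨f, n, rfl⟩
  change extendβ β _ = 0
  rw [map_sub, extendβ_tmul, extendβ_tmul, one_smul, map_smul, algebraMap_smul, sub_self]

end Hull

/-! ### The embedding of an object of 𝒜 in a divisible object -/

namespace AObj

variable (X : AObj)

/-- By additivity all of f, n and the scalar g may be taken homogeneous, and then the multiple of
the relation is itself homogeneous. -/
lemma hullRel_proj (m : ℤ) (z : TF ⊗[ℚ] X.nub) (hz : z ∈ hullRel X.nub) :
    (grTensor X.nub.toGrVect).proj m z ∈ hullRel X.nub := by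
  let P : Submodule ℚ (TF ⊗[ℚ] X.nub) := (hullRel X.nub).restrictScalars ℚ
  have key (f : OF) (n : X.nub) (g : OF) (m : ℤ) : (grTensor X.nub.toGrVect).proj m
      (g • (algebraMap OF TF f ⊗ₜ[ℚ] n - (1 : TF) ⊗ₜ[ℚ] (f • n))) ∈ P := by
    induction g using OF.induction with
    | hom k g hg =>
      induction f using OF.induction with
      | hom i f hf =>
        induction n using GrVect.induction with
        | hom j n hn =>
          have h₁ : algebraMap OF TF f ⊗ₜ[ℚ] n - (1 : TF) ⊗ₜ[ℚ] (f • n) ∈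
              (grTensor X.nub.toGrVect).deg (i + j) := by
            refine sub_mem (tmul_mem_tensorDeg rfl (TF.algebraMap_mem_deg hf) hn)
              (tmul_mem_tensorDeg (i := 0) (zero_add _) ?_ (X.nub.smul_mem hf hn))
            rw [← map_one (algebraMap OF TF)]
            refine TF.algebraMap_mem_deg ?_
            simpa using OF.monomial_mem_deg 0 1
          have h₂ := (grTensor X.nub.toGrVect).smul_mem hg h₁
          by_cases h : k + (i + j) = m
          · rw [← h]
            refine (congrArg (· ∈ P) (GrVect.proj_of_mem h₂)).mpr ?_
            exact (hullRel X.nub).smul_mem g (hullRel_gen f n)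
          · refine (congrArg (· ∈ P) (GrVect.proj_of_mem_ne h h₂)).mpr (zero_mem _)
        | add n n' hn hn' =>
          have : (g • (algebraMap OF TF f ⊗ₜ[ℚ] (n + n') - (1 : TF) ⊗ₜ[ℚ] (f • (n + n')))) =
              g • (algebraMap OF TF f ⊗ₜ[ℚ] n - (1 : TF) ⊗ₜ[ℚ] (f • n)) +
              g • (algebraMap OF TF f ⊗ₜ[ℚ] n' - (1 : TF) ⊗ₜ[ℚ] (f • n')) := by
            rw [← smul_add, TensorProduct.tmul_add, smul_add, TensorProduct.tmul_add]
            congr 1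
            abel
          rw [this, map_add]
          exact add_mem hn hn'
      | add f f' hf hf' =>
        have : (g • (algebraMap OF TF (f + f') ⊗ₜ[ℚ] n - (1 : TF) ⊗ₜ[ℚ] ((f + f') • n))) =
            g • (algebraMap OF TF f ⊗ₜ[ℚ] n - (1 : TF) ⊗ₜ[ℚ] (f • n)) +
            g • (algebraMap OF TF f' ⊗ₜ[ℚ] n - (1 : TF) ⊗ₜ[ℚ] (f' • n)) := by
          rw [← smul_add, map_add, TensorProduct.add_tmul, add_smul, TensorProduct.tmul_add]
          congr 1
          abel
        rw [this, map_add]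
        exact add_mem hf hf'
    | add g g' hg hg' =>
      rw [add_smul, map_add]
      exact add_mem hg hg'
  -- The scalar g is carried through the span induction because the projections do not commute with
  -- multiplication by elements of 𝒪_ℱ.
  have main : ∀ (g : OF) (m : ℤ), (grTensor X.nub.toGrVect).proj m (g • z) ∈ P := by
    induction hz using Submodule.span_induction with
    | mem z hz =>
      obtain ⟨f, n, rfl⟩ := hz
      exact key f n
    | zero =>
      intro g m
      rw [smul_zero, map_zero]
      exact zero_mem _
    | add y z _ _ hy hz =>
      intro g m
      rw [smul_add, map_add]
      exact add_mem (hy g m) (hz g m)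
    | smul f z _ hz =>
      intro g m
      rw [smul_smul]
      exact hz (g * f) m
  have := main 1 m
  rwa [one_smul] at this

/-- Up to an Euler class and the relations every element is 1 ⊗ n, on which the extended map is β n;
so torsion kernel and cokernel are inherited from β. -/
lemma hullβ_bijective : Function.Bijective (LocalizedModule.map eulerClasses
    ((hullRel X.nub).liftQ (extendβ X.β) (hullRel_le_ker X.β))) := by
  refine localizedMap_bijective _ (fun z hz => ?_) (fun y => ?_)
  · obtain ⟨z, rfl⟩ := (hullRel X.nub).mkQ_surjective z
    have hz : extendβ X.β z = 0 := hz
    obtain ⟨s, hs, n, hn⟩ := exists_smul_sub_mem_hullRel z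
    have h₁ : X.β n = 0 := by
      have := hullRel_le_ker X.β hn
      rw [LinearMap.mem_ker, map_sub, map_smul, hz, smul_zero, zero_sub, neg_eq_zero,
        extendβ_tmul, one_smul] at this
      exact this
    obtain ⟨t, ht, htn⟩ := X.exists_smul_eq_zero h₁
    refine ⟨t * s, mul_mem ht hs, ?_⟩
    rw [← map_smul]
    refine (Submodule.Quotient.mk_eq_zero _).2 ?_
    have h₂ := (hullRel X.nub).smul_mem t hn
    have h₃ := hullRel_gen t n
    rw [htn, TensorProduct.tmul_zero, sub_zero] at h₃
    have := add_mem h₂ h₃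
    rw [smul_sub, TensorProduct.smul_tmul', Algebra.smul_def, mul_one, sub_add_cancel,
      smul_smul] at this
    exact this
  · obtain ⟨s, hs, x, hx⟩ := X.exists_β_eq y
    refine ⟨s, hs, (hullRel X.nub).mkQ ((1 : TF) ⊗ₜ[ℚ] x), ?_⟩
    rw [← hx]
    exact one_smul TF (X.β x)

/-- The extension of scalars of `X` to `t_*^ℱ` on nubs, a divisible object. -/
abbrev hull : AObj where
  nub := (grTensor X.nub.toGrVect).quotient (hullRel X.nub) (hullRel_proj X)
  vertex := X.vertex
  β := (hullRel X.nub).liftQ (extendβ X.β) (hullRel_le_ker X.β)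
  β_mem := by
    rintro m _ ⟨z, hz, rfl⟩
    change extendβ X.β z ∈ _
    replace hz : z ∈ tensorDeg X.nub.toGrVect m := hz
    induction hz using Submodule.span_induction with
    | mem z hz =>
      obtain ⟨i, j, h, x, hx, n, hn, rfl⟩ := hz
      exact TF_smul_mem_tensorDeg h hx (X.β_mem hn)
    | zero => rw [map_zero]; exact zero_mem _
    | add y z _ _ hy hz =>
      rw [map_add]
      exact add_mem hy hz
    | smul c z _ hz =>
      have : extendβ X.β (c • z) = c • extendβ X.β z := (extendβ X.β).map_smul_of_tower c z
      rw [this]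
      exact Submodule.smul_mem _ c hz
  β_loc := hullβ_bijective X

lemma hull_isDiv : IsDiv (hull X) := by
  intro s hs z
  obtain ⟨z, rfl⟩ := (hullRel X.nub).mkQ_surjective z
  obtain ⟨y, rfl⟩ := exists_smul_tensor hs z
  exact ⟨(hullRel X.nub).mkQ y, (map_smul _ s y).symm⟩

/-- The map from `X` to its hull. -/
def toHull : Pairs X (hull X) :=
  ({ toFun := fun n => (hullRel X.nub).mkQ ((1 : TF) ⊗ₜ[ℚ] n)
     map_add' := fun m n => by rw [TensorProduct.tmul_add, map_add]
     map_smul' := fun f n => by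
       rw [RingHom.id_apply, ← map_smul, ← sub_eq_zero, ← map_sub]
       refine (Submodule.Quotient.mk_eq_zero _).2 ?_
       rw [TensorProduct.smul_tmul', Algebra.smul_def, mul_one, ← neg_sub]
       exact neg_mem (hullRel_gen f n) }, LinearMap.id)

lemma toHull_mem : toHull X ∈ homDeg X (hull X) 0 := by
  refine ⟨fun i x hx => ⟨(1 : TF) ⊗ₜ[ℚ] x, ?_, rfl⟩, fun i v hv => by rwa [add_zero], fun x => ?_⟩
  · refine tmul_mem_tensorDeg (i := 0) (j := i) (by omega) ?_ hx
    rw [← map_one (algebraMap OF TF)]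
    refine TF.algebraMap_mem_deg ?_
    simpa using OF.monomial_mem_deg 0 1
  · exact (one_smul TF (X.β x)).trans (tmap_id (X.β x)).symm

lemma toHull_inj : Inj (toHull X) := by
  refine ⟨?_, Function.injective_id⟩
  refine (injective_iff_map_eq_zero (toHull X).1).2 fun n hn => ?_
  exact one_tmul_mem_hullRel ((Submodule.Quotient.mk_eq_zero _).1 hn)

end AObj

/-! ### Homology isomorphisms -/

namespace DgA

section Homology

variable {A B C : Type} [AddCommGroup A] [AddCommGroup B] [AddCommGroup C]
  {dA : A →+ A} {dB : B →+ B} {dC : C →+ C} {f : A →+ B} {g : B →+ C}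

/-- Every cycle is a boundary. -/
def IsAcyclic {A : Type} [AddCommGroup A] (d : A → A) : Prop := ∀ x, d x = 0 → ∃ y, d y = x

lemma IsHomologyIso.comp (hf : ∀ x, dB (f x) = f (dA x)) (hg : ∀ x, dC (g x) = g (dB x))
    (h₁ : IsHomologyIso dA dB f) (h₂ : IsHomologyIso dB dC g) :
    IsHomologyIso dA dC (g.comp f) := by
  refine ⟨fun x hx ⟨z, hz⟩ => ?_, fun z hz => ?_⟩
  · exact h₁.1 x hx (h₂.1 (f x) (by rw [hf, hx, map_zero]) ⟨z, hz⟩)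
  · obtain ⟨y, hy, w, hw⟩ := h₂.2 z hz
    obtain ⟨x, hx, v, hv⟩ := h₁.2 y hy
    refine ⟨x, hx, g v + w, ?_⟩
    rw [map_add, hg, hv, hw, map_sub]
    simp

lemma IsHomologyIso.of_comp_left (hf : ∀ x, dB (f x) = f (dA x)) (hg : ∀ x, dC (g x) = g (dB x))
    (h₁ : IsHomologyIso dA dB f) (h : IsHomologyIso dA dC (g.comp f)) :
    IsHomologyIso dB dC g := by
  refine ⟨fun y hy ⟨z, hz⟩ => ?_, fun z hz => ?_⟩
  · obtain ⟨x, hx, v, hv⟩ := h₁.2 y hy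
    obtain ⟨w, hw⟩ := h.1 x hx ⟨g v + z, by
      rw [map_add, hg, hv, hz, map_sub]
      simp⟩
    refine ⟨f w - v, ?_⟩
    rw [map_sub, hf, hw, hv]
    abel
  · obtain ⟨x, hx, w, hw⟩ := h.2 z hz
    exact ⟨f x, by rw [hf, hx, map_zero], w, hw⟩

lemma IsHomologyIso.of_comp_right (hf : ∀ x, dB (f x) = f (dA x)) (hg : ∀ x, dC (g x) = g (dB x))
    (h₂ : IsHomologyIso dB dC g) (h : IsHomologyIso dA dC (g.comp f)) :
    IsHomologyIso dA dB f := by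
  refine ⟨fun x hx ⟨y, hy⟩ => ?_, fun y hy => ?_⟩
  · exact h.1 x hx ⟨g y, by rw [hg, hy]; rfl⟩
  · obtain ⟨x, hx, w, hw⟩ := h.2 (g y) (by rw [hg, hy, map_zero])
    have h₃ : dB (f x - y) = 0 := by rw [map_sub, hf, hx, map_zero, hy, sub_zero]
    obtain ⟨v, hv⟩ := h₂.1 (f x - y) h₃ ⟨w, by rw [hw, map_sub]; rfl⟩
    exact ⟨x, hx, v, hv⟩

lemma IsHomologyIso.of_retract {A' B' : Type} [AddCommGroup A'] [AddCommGroup B']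
    {dA' : A' →+ A'} {dB' : B' →+ B'} {f' : A' →+ B'} {i : A' →+ A} {r : A →+ A'}
    {j : B' →+ B} {s : B →+ B'} (hi : ∀ x, dA (i x) = i (dA' x)) (hr : ∀ x, dA' (r x) = r (dA x))
    (hj : ∀ x, dB (j x) = j (dB' x)) (hs : ∀ x, dB' (s x) = s (dB x))
    (hri : ∀ x, r (i x) = x) (hsj : ∀ x, s (j x) = x) (hfi : ∀ x, f (i x) = j (f' x))
    (hfr : ∀ x, f' (r x) = s (f x)) (h : IsHomologyIso dA dB f) : IsHomologyIso dA' dB' f' := by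
  refine ⟨fun x hx ⟨y, hy⟩ => ?_, fun y hy => ?_⟩
  · obtain ⟨z, hz⟩ := h.1 (i x) (by rw [hi, hx, map_zero]) ⟨j y, by rw [hj, hy, hfi]⟩
    exact ⟨r z, by rw [hr, hz, hri]⟩
  · obtain ⟨x, hx, w, hw⟩ := h.2 (j y) (by rw [hj, hy, map_zero])
    exact ⟨r x, by rw [hr, hx, map_zero], s w, by rw [hs, hw, map_sub, hsj, hfr]⟩

/-- The quotient by a subcomplex is acyclic if the inclusion is a homology isomorphism. -/
lemma IsHomologyIso.acyclic_quotient (hf : ∀ x, dB (f x) = f (dA x))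
    (hg : ∀ x, dC (g x) = g (dB x)) (hdB : ∀ x, dB (dB x) = 0) (hinj : Function.Injective f)
    (hex : Function.Exact f g) (hsurj : Function.Surjective g) (h : IsHomologyIso dA dB f) :
    IsAcyclic dC := by
  intro z hz
  obtain ⟨y, rfl⟩ := hsurj z
  rw [hg] at hz
  obtain ⟨x, hx⟩ := (hex _).1 hz
  obtain ⟨w, hw⟩ := h.1 x (hinj (by rw [← hf, hx, hdB, map_zero])) ⟨y, hx.symm⟩
  obtain ⟨x', hx', v, hv⟩ := h.2 (y - f w) (by rw [map_sub, hf, hw, hx, sub_self])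
  refine ⟨g (-v), ?_⟩
  rw [hg, map_neg, hv, map_neg, map_sub, map_sub, hex.apply_apply_eq_zero,
    hex.apply_apply_eq_zero]
  abel

lemma IsHomologyIso.of_acyclic_quotient (hf : ∀ x, dB (f x) = f (dA x))
    (hg : ∀ x, dC (g x) = g (dB x)) (hdB : ∀ x, dB (dB x) = 0) (hinj : Function.Injective f)
    (hex : Function.Exact f g) (hsurj : Function.Surjective g) (h : IsAcyclic dC) :
    IsHomologyIso dA dB f := by
  refine ⟨fun x hx ⟨y, hy⟩ => ?_, fun y hy => ?_⟩
  · obtain ⟨z, hz⟩ := h (g y) (by rw [hg, hy, hex.apply_apply_eq_zero])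
    obtain ⟨w, rfl⟩ := hsurj z
    obtain ⟨v, hv⟩ := (hex (y - dB w)).1 (by rw [map_sub, ← hg, hz, sub_self])
    refine ⟨v, hinj ?_⟩
    rw [← hf, hv, map_sub, hy, hdB, sub_zero]
  · obtain ⟨z, hz⟩ := h (g y) (by rw [hg, hy, map_zero])
    obtain ⟨w, rfl⟩ := hsurj z
    obtain ⟨v, hv⟩ := (hex (y - dB w)).1 (by rw [map_sub, ← hg, hz, sub_self])
    refine ⟨v, hinj ?_, -w, ?_⟩
    · rw [← hf, hv, map_sub, hy, hdB, sub_zero, map_zero]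
    · rw [hv, map_neg]
      abel

/-- The kernel of a surjective homology isomorphism is acyclic. -/
lemma IsHomologyIso.acyclic_kernel (hf : ∀ x, dB (f x) = f (dA x))
    (hg : ∀ x, dC (g x) = g (dB x)) (hdB : ∀ x, dB (dB x) = 0) (hinj : Function.Injective f)
    (hex : Function.Exact f g) (hsurj : Function.Surjective g) (h : IsHomologyIso dB dC g) :
    IsAcyclic dA := by
  intro x hx
  obtain ⟨y, hy⟩ := h.1 (f x) (by rw [hf, hx, map_zero])
    ⟨0, by rw [map_zero, hex.apply_apply_eq_zero]⟩
  obtain ⟨y', hy', w, hw⟩ := h.2 (g y) (by rw [hg, hy, hex.apply_apply_eq_zero])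
  obtain ⟨v, rfl⟩ := hsurj w
  rw [hg, ← map_sub] at hw
  obtain ⟨u, hu⟩ := (hex (y - y' + dB v)).1 (by
    rw [map_add, hw, map_sub, map_sub]
    abel)
  exact ⟨u, hinj (by rw [← hf, hu, map_add, map_sub, hy, hy', hdB, sub_zero, add_zero])⟩

lemma IsHomologyIso.of_acyclic_kernel (hf : ∀ x, dB (f x) = f (dA x))
    (hg : ∀ x, dC (g x) = g (dB x)) (hdB : ∀ x, dB (dB x) = 0) (hinj : Function.Injective f)
    (hex : Function.Exact f g) (hsurj : Function.Surjective g) (h : IsAcyclic dA) :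
    IsHomologyIso dB dC g := by
  refine ⟨fun y hy ⟨z, hz⟩ => ?_, fun z hz => ?_⟩
  · obtain ⟨w, rfl⟩ := hsurj z
    obtain ⟨u, hu⟩ := (hex (y - dB w)).1 (by rw [map_sub, ← hg, hz, sub_self])
    obtain ⟨v, hv⟩ := h u (hinj (by rw [← hf, hu, map_sub, hy, hdB, sub_zero, map_zero]))
    exact ⟨w + f v, by rw [map_add, hf, hv, hu]; abel⟩
  · obtain ⟨y, rfl⟩ := hsurj z
    rw [hg] at hz
    obtain ⟨u, hu⟩ := (hex _).1 hz
    obtain ⟨v, hv⟩ := h u (hinj (by rw [← hf, hu, hdB, map_zero]))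
    refine ⟨y - f v, by rw [map_sub, hf, hv, hu, sub_self], 0, ?_⟩
    rw [map_zero, map_sub, hex.apply_apply_eq_zero]
    abel

/-- In a short exact sequence, the third term is acyclic if the first two are. -/
lemma IsAcyclic.quotient (hf : ∀ x, dB (f x) = f (dA x))
    (hg : ∀ x, dC (g x) = g (dB x)) (hdB : ∀ x, dB (dB x) = 0) (hinj : Function.Injective f)
    (hex : Function.Exact f g) (hsurj : Function.Surjective g) (hA : IsAcyclic dA)
    (hB : IsAcyclic dB) : IsAcyclic dC :=
  IsHomologyIso.acyclic_quotient hf hg hdB hinj hex hsurj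
    ⟨fun x hx _ => hA x hx, fun y hy => ⟨0, map_zero _, by
      obtain ⟨z, hz⟩ := hB y hy
      exact ⟨-z, by rw [map_neg, hz, map_zero, zero_sub]⟩⟩⟩

end Homology

/-! ### Short exact sequences of dg objects and quasi-isomorphisms -/

open AObj

variable {X Y Z : DgA}

@[ext]
lemma hom_ext {f g : X ⟶ Y} (h : Hom.pair f = Hom.pair g) : f = g := Hom.ext h

/-- Morphisms are the cycles of degree zero in the hom complex. -/
def homEquiv (X Y : DgA) :
    (X ⟶ Y) ≃ (homDeg X.toAObj Y.toAObj 0 ⊓ LinearMap.ker (diff X Y 0) : Submodule ℚ _) where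
  toFun f := ⟨Hom.pair f, Hom.mem f, by
    change diff X Y 0 (Hom.pair f) = 0
    rw [diff_apply, sgn_zero, one_smul, Hom.comm, sub_self]⟩
  invFun f := ⟨f.1, f.2.1, by
    have : diff X Y 0 f.1 = 0 := f.2.2
    rw [diff_apply, sgn_zero, one_smul] at this
    exact sub_eq_zero.1 this⟩
  left_inv _ := rfl
  right_inv _ := rfl

instance : Preadditive DgA where
  homGroup X Y := (homEquiv X Y).addCommGroup
  add_comp _ _ _ f f' g := hom_ext (map_add (comp (Hom.pair g)) (Hom.pair f) (Hom.pair f'))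
  comp_add _ _ _ f g g' := hom_ext (LinearMap.congr_fun
    (map_add AObj.comp (Hom.pair g) (Hom.pair g')) (Hom.pair f))

lemma sub_pair (f g : X ⟶ Y) : Hom.pair (f - g) = Hom.pair f - Hom.pair g := rfl
lemma zero_pair (X Y : DgA) : Hom.pair (0 : X ⟶ Y) = 0 := rfl

lemma d_d (x : X.nub) : X.d.1 (X.d.1 x) = 0 :=
  LinearMap.congr_fun (congrArg Prod.fst X.d_comp_d) x

lemma d_d' (x : X.vertex) : X.d.2 (X.d.2 x) = 0 :=
  LinearMap.congr_fun (congrArg Prod.snd X.d_comp_d) x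

lemma d_apply (f : X ⟶ Y) (x : X.nub) : Y.d.1 ((Hom.pair f).1 x) = (Hom.pair f).1 (X.d.1 x) :=
  LinearMap.congr_fun (congrArg Prod.fst (Hom.comm f)) x

lemma d_apply' (f : X ⟶ Y) (x : X.vertex) : Y.d.2 ((Hom.pair f).2 x) = (Hom.pair f).2 (X.d.2 x) :=
  LinearMap.congr_fun (congrArg Prod.snd (Hom.comm f)) x

/-- The object has trivial homology. -/
def Acyclic (X : DgA) : Prop := IsAcyclic X.d.1 ∧ IsAcyclic X.d.2

/-- The sequence is exact on nubs and on vertices. -/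
def Exact {X Y Z : AObj} (f : Pairs X Y) (g : Pairs Y Z) : Prop :=
  Function.Exact f.1 g.1 ∧ Function.Exact f.2 g.2

/-- A short exact sequence of dg objects. -/
structure IsSES (f : X ⟶ Y) (g : Y ⟶ Z) : Prop where
  inj : Inj (Hom.pair f)
  exact : Exact (Hom.pair f) (Hom.pair g)
  surj : Surj (Hom.pair g)

lemma IsSES.acyclic_right {f : X ⟶ Y} {g : Y ⟶ Z} (h : IsSES f g) (hf : weakEquivalences DgA f) :
    Acyclic Z :=
  ⟨IsHomologyIso.acyclic_quotient (dA := X.d.1.toAddMonoidHom) (dB := Y.d.1.toAddMonoidHom)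
      (dC := Z.d.1.toAddMonoidHom) (f := (Hom.pair f).1.toAddMonoidHom)
      (g := (Hom.pair g).1.toAddMonoidHom) (d_apply f) (d_apply g) d_d h.inj.1 h.exact.1 h.surj.1
      hf.1,
    IsHomologyIso.acyclic_quotient (dA := X.d.2.toAddMonoidHom) (dB := Y.d.2.toAddMonoidHom)
      (dC := Z.d.2.toAddMonoidHom) (f := (Hom.pair f).2.toAddMonoidHom)
      (g := (Hom.pair g).2.toAddMonoidHom) (d_apply' f) (d_apply' g) d_d' h.inj.2 h.exact.2 h.surj.2
      hf.2⟩

lemma IsSES.weakEquivalence_left {f : X ⟶ Y} {g : Y ⟶ Z} (h : IsSES f g) (hZ : Acyclic Z) :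
    weakEquivalences DgA f :=
  ⟨IsHomologyIso.of_acyclic_quotient (dA := X.d.1.toAddMonoidHom) (dB := Y.d.1.toAddMonoidHom)
      (dC := Z.d.1.toAddMonoidHom) (f := (Hom.pair f).1.toAddMonoidHom)
      (g := (Hom.pair g).1.toAddMonoidHom) (d_apply f) (d_apply g) d_d h.inj.1 h.exact.1 h.surj.1
      hZ.1,
    IsHomologyIso.of_acyclic_quotient (dA := X.d.2.toAddMonoidHom) (dB := Y.d.2.toAddMonoidHom)
      (dC := Z.d.2.toAddMonoidHom) (f := (Hom.pair f).2.toAddMonoidHom)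
      (g := (Hom.pair g).2.toAddMonoidHom) (d_apply' f) (d_apply' g) d_d' h.inj.2 h.exact.2 h.surj.2
      hZ.2⟩

lemma IsSES.acyclic_left {f : X ⟶ Y} {g : Y ⟶ Z} (h : IsSES f g) (hg : weakEquivalences DgA g) :
    Acyclic X :=
  ⟨IsHomologyIso.acyclic_kernel (dA := X.d.1.toAddMonoidHom) (dB := Y.d.1.toAddMonoidHom)
      (dC := Z.d.1.toAddMonoidHom) (f := (Hom.pair f).1.toAddMonoidHom)
      (g := (Hom.pair g).1.toAddMonoidHom) (d_apply f) (d_apply g) d_d h.inj.1 h.exact.1 h.surj.1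
      hg.1,
    IsHomologyIso.acyclic_kernel (dA := X.d.2.toAddMonoidHom) (dB := Y.d.2.toAddMonoidHom)
      (dC := Z.d.2.toAddMonoidHom) (f := (Hom.pair f).2.toAddMonoidHom)
      (g := (Hom.pair g).2.toAddMonoidHom) (d_apply' f) (d_apply' g) d_d' h.inj.2 h.exact.2 h.surj.2
      hg.2⟩

lemma IsSES.weakEquivalence_right {f : X ⟶ Y} {g : Y ⟶ Z} (h : IsSES f g) (hX : Acyclic X) :
    weakEquivalences DgA g :=
  ⟨IsHomologyIso.of_acyclic_kernel (dA := X.d.1.toAddMonoidHom) (dB := Y.d.1.toAddMonoidHom)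
      (dC := Z.d.1.toAddMonoidHom) (f := (Hom.pair f).1.toAddMonoidHom)
      (g := (Hom.pair g).1.toAddMonoidHom) (d_apply f) (d_apply g) d_d h.inj.1 h.exact.1 h.surj.1
      hX.1,
    IsHomologyIso.of_acyclic_kernel (dA := X.d.2.toAddMonoidHom) (dB := Y.d.2.toAddMonoidHom)
      (dC := Z.d.2.toAddMonoidHom) (f := (Hom.pair f).2.toAddMonoidHom)
      (g := (Hom.pair g).2.toAddMonoidHom) (d_apply' f) (d_apply' g) d_d' h.inj.2 h.exact.2 h.surj.2
      hX.2⟩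

lemma IsSES.acyclic_of_acyclic {f : X ⟶ Y} {g : Y ⟶ Z} (h : IsSES f g) (hX : Acyclic X)
    (hY : Acyclic Y) : Acyclic Z :=
  ⟨IsAcyclic.quotient (dA := X.d.1.toAddMonoidHom) (dB := Y.d.1.toAddMonoidHom)
      (dC := Z.d.1.toAddMonoidHom) (f := (Hom.pair f).1.toAddMonoidHom)
      (g := (Hom.pair g).1.toAddMonoidHom) (d_apply f) (d_apply g) d_d h.inj.1 h.exact.1 h.surj.1
      hX.1 hY.1,
    IsAcyclic.quotient (dA := X.d.2.toAddMonoidHom) (dB := Y.d.2.toAddMonoidHom)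
      (dC := Z.d.2.toAddMonoidHom) (f := (Hom.pair f).2.toAddMonoidHom)
      (g := (Hom.pair g).2.toAddMonoidHom) (d_apply' f) (d_apply' g) d_d' h.inj.2 h.exact.2 h.surj.2
      hX.2 hY.2⟩

instance : (weakEquivalences DgA).HasTwoOutOfThreeProperty where
  comp_mem {X Y Z} f g hf hg :=
    ⟨IsHomologyIso.comp (dA := X.d.1.toAddMonoidHom) (dB := Y.d.1.toAddMonoidHom)
        (dC := Z.d.1.toAddMonoidHom) (f := (Hom.pair f).1.toAddMonoidHom)
        (g := (Hom.pair g).1.toAddMonoidHom) (d_apply f) (d_apply g) hf.1 hg.1,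
      IsHomologyIso.comp (dA := X.d.2.toAddMonoidHom) (dB := Y.d.2.toAddMonoidHom)
        (dC := Z.d.2.toAddMonoidHom) (f := (Hom.pair f).2.toAddMonoidHom)
        (g := (Hom.pair g).2.toAddMonoidHom) (d_apply' f) (d_apply' g) hf.2 hg.2⟩
  of_precomp {X Y Z} f g hf h :=
    ⟨IsHomologyIso.of_comp_left (dA := X.d.1.toAddMonoidHom) (dB := Y.d.1.toAddMonoidHom)
        (dC := Z.d.1.toAddMonoidHom) (f := (Hom.pair f).1.toAddMonoidHom)
        (g := (Hom.pair g).1.toAddMonoidHom) (d_apply f) (d_apply g) hf.1 h.1,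
      IsHomologyIso.of_comp_left (dA := X.d.2.toAddMonoidHom) (dB := Y.d.2.toAddMonoidHom)
        (dC := Z.d.2.toAddMonoidHom) (f := (Hom.pair f).2.toAddMonoidHom)
        (g := (Hom.pair g).2.toAddMonoidHom) (d_apply' f) (d_apply' g) hf.2 h.2⟩
  of_postcomp {X Y Z} f g hg h :=
    ⟨IsHomologyIso.of_comp_right (dA := X.d.1.toAddMonoidHom) (dB := Y.d.1.toAddMonoidHom)
        (dC := Z.d.1.toAddMonoidHom) (f := (Hom.pair f).1.toAddMonoidHom)
        (g := (Hom.pair g).1.toAddMonoidHom) (d_apply f) (d_apply g) hg.1 h.1,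
      IsHomologyIso.of_comp_right (dA := X.d.2.toAddMonoidHom) (dB := Y.d.2.toAddMonoidHom)
        (dC := Z.d.2.toAddMonoidHom) (f := (Hom.pair f).2.toAddMonoidHom)
        (g := (Hom.pair g).2.toAddMonoidHom) (d_apply' f) (d_apply' g) hg.2 h.2⟩

instance : (weakEquivalences DgA).IsStableUnderRetracts where
  of_retract {A B X Y f g} h hg := by
    have e₁ := congrArg Hom.pair h.left.retract
    have e₂ := congrArg Hom.pair h.right.retract
    have e₃ := congrArg Hom.pair h.i_w
    have e₄ := congrArg Hom.pair h.r_w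
    exact ⟨IsHomologyIso.of_retract (dA := X.d.1.toAddMonoidHom) (dB := Y.d.1.toAddMonoidHom)
        (dA' := A.d.1.toAddMonoidHom) (dB' := B.d.1.toAddMonoidHom)
        (f := (Hom.pair g).1.toAddMonoidHom) (f' := (Hom.pair f).1.toAddMonoidHom)
        (i := (Hom.pair h.left.i).1.toAddMonoidHom) (r := (Hom.pair h.left.r).1.toAddMonoidHom)
        (j := (Hom.pair h.right.i).1.toAddMonoidHom) (s := (Hom.pair h.right.r).1.toAddMonoidHom)
        (d_apply _) (d_apply _) (d_apply _) (d_apply _)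
        (fun x => LinearMap.congr_fun (congrArg Prod.fst e₁) x)
        (fun x => LinearMap.congr_fun (congrArg Prod.fst e₂) x)
        (fun x => LinearMap.congr_fun (congrArg Prod.fst e₃) x)
        (fun x => (LinearMap.congr_fun (congrArg Prod.fst e₄) x)) hg.1,
      IsHomologyIso.of_retract (dA := X.d.2.toAddMonoidHom) (dB := Y.d.2.toAddMonoidHom)
        (dA' := A.d.2.toAddMonoidHom) (dB' := B.d.2.toAddMonoidHom)
        (f := (Hom.pair g).2.toAddMonoidHom) (f' := (Hom.pair f).2.toAddMonoidHom)
        (i := (Hom.pair h.left.i).2.toAddMonoidHom) (r := (Hom.pair h.left.r).2.toAddMonoidHom)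
        (j := (Hom.pair h.right.i).2.toAddMonoidHom) (s := (Hom.pair h.right.r).2.toAddMonoidHom)
        (d_apply' _) (d_apply' _) (d_apply' _) (d_apply' _)
        (fun x => LinearMap.congr_fun (congrArg Prod.snd e₁) x)
        (fun x => LinearMap.congr_fun (congrArg Prod.snd e₂) x)
        (fun x => LinearMap.congr_fun (congrArg Prod.snd e₃) x)
        (fun x => (LinearMap.congr_fun (congrArg Prod.snd e₄) x)) hg.2⟩

end DgA

/-! ### Lifts, descents and splittings along exact sequences -/

namespace AObj

lemma exists_lift {A B C W : AObj} {i : Pairs A B} (hi : Inj i) (him : i ∈ homDeg A B 0)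
    {p : Pairs B C} (hex : DgA.Exact i p) {g : Pairs W B} {m : ℤ} (hg : g ∈ homDeg W B m)
    (h : comp p g = 0) : ∃ l ∈ homDeg W A m, comp i l = g := by
  have h₁ (x : W.nub) : g.1 x ∈ LinearMap.range i.1 :=
    (hex.1 _).1 (LinearMap.congr_fun (congrArg Prod.fst h) x)
  have h₂ (x : W.vertex) : g.2 x ∈ LinearMap.range i.2 :=
    (hex.2 _).1 (LinearMap.congr_fun (congrArg Prod.snd h) x)
  let l : Pairs W A := ((LinearEquiv.ofInjective i.1 hi.1).symm.toLinearMap ∘ₗ g.1.codRestrict _ h₁,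
    (LinearEquiv.ofInjective i.2 hi.2).symm.toLinearMap ∘ₗ g.2.codRestrict _ h₂)
  have hl : comp i l = g := pairs_ext
    (fun x => congrArg Subtype.val ((LinearEquiv.ofInjective i.1 hi.1).apply_symm_apply
      ⟨g.1 x, h₁ x⟩))
    (fun x => congrArg Subtype.val ((LinearEquiv.ofInjective i.2 hi.2).apply_symm_apply
      ⟨g.2 x, h₂ x⟩))
  exact ⟨l, mem_of_inj_comp hi him (hl.symm ▸ hg) (add_zero m), hl⟩

lemma exists_desc {A B C W : AObj} {i : Pairs A B} {p : Pairs B C} (hp : Surj p) {k : ℤ}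
    (hpm : p ∈ homDeg B C k) (hex : DgA.Exact i p) {g : Pairs B W} {m n : ℤ}
    (hg : g ∈ homDeg B W m) (h : comp g i = 0) (hn : k + n = m) :
    ∃ l ∈ homDeg C W n, comp l p = g := by
  have h₁ : LinearMap.ker p.1 ≤ LinearMap.ker g.1 := by
    intro x hx
    obtain ⟨y, rfl⟩ := (hex.1 _).1 hx
    exact LinearMap.congr_fun (congrArg Prod.fst h) y
  have h₂ : LinearMap.ker p.2 ≤ LinearMap.ker g.2 := by
    intro x hx
    obtain ⟨y, rfl⟩ := (hex.2 _).1 hx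
    exact LinearMap.congr_fun (congrArg Prod.snd h) y
  let l : Pairs C W :=
    ((LinearMap.ker p.1).liftQ g.1 h₁ ∘ₗ (p.1.quotKerEquivOfSurjective hp.1).symm.toLinearMap,
      (LinearMap.ker p.2).liftQ g.2 h₂ ∘ₗ (p.2.quotKerEquivOfSurjective hp.2).symm.toLinearMap)
  have hl : comp l p = g := by
    refine pairs_ext (fun x => ?_) (fun x => ?_)
    · have : (p.1.quotKerEquivOfSurjective hp.1).symm (p.1 x) = (LinearMap.ker p.1).mkQ x :=
        (LinearEquiv.symm_apply_eq _).2 rfl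
      exact (congrArg ((LinearMap.ker p.1).liftQ g.1 h₁) this)
    · have : (p.2.quotKerEquivOfSurjective hp.2).symm (p.2 x) = (LinearMap.ker p.2).mkQ x :=
        (LinearEquiv.symm_apply_eq _).2 rfl
      exact (congrArg ((LinearMap.ker p.2).liftQ g.2 h₂) this)
  exact ⟨l, mem_of_surj_comp hp hpm (hl.symm ▸ hg) hn, hl⟩

/-- A short exact sequence with divisible kernel splits. -/
lemma IsDiv.exists_splitting {A B C : AObj} (hA : IsDiv A) {i : Pairs A B} (hi : Inj i)
    (him : i ∈ homDeg A B 0) {p : Pairs B C} {n : ℤ} (hp : Surj p) (hpm : p ∈ homDeg B C n)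
    (hex : DgA.Exact i p) :
    ∃ r ∈ homDeg B A 0, ∃ s ∈ homDeg C B (-n), comp r i = one A ∧ comp p s = one C ∧
      comp i r + comp s p = one B := by
  obtain ⟨r, hr, hri⟩ := hA.exists_extension him hi (one_mem A)
  have hpi : comp p i = 0 := pairs_ext (fun x => hex.1.apply_apply_eq_zero x)
    (fun x => hex.2.apply_apply_eq_zero x)
  -- With r a retraction, 1 - i r vanishes on the image of i and so descends along p to a section.
  obtain ⟨s, hs, hsp⟩ := exists_desc hp hpm hex
    (g := one B - comp i r) (sub_mem (one_mem B) (comp_mem (add_zero 0) him hr))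
    (by rw [map_sub, LinearMap.sub_apply, comp_assoc, hri]; exact sub_self i) (n := -n) (by omega)
  refine ⟨r, hr, s, hs, hri, hp.cancel ?_, by rw [hsp]; abel⟩
  rw [comp_assoc, hsp, map_sub, ← comp_assoc, hpi, map_zero, LinearMap.zero_apply, sub_zero]
  rfl

end AObj

namespace DgA

open AObj

/-! ### Constructions with dg objects -/

section Kernel

variable {X Y : DgA} (f : X ⟶ Y)

lemma exists_ker_d : ∃ l ∈ homDeg (AObj.ker (Hom.mem f)) (AObj.ker (Hom.mem f)) (-1),
    AObj.comp (AObj.kerι (Hom.mem f)) l = AObj.comp X.d (AObj.kerι (Hom.mem f)) :=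
  exists_kerLift (Hom.mem f) (comp_mem (add_zero _) X.d_mem (kerι_mem _)) (by
    rw [← comp_assoc, ← Hom.comm, comp_assoc, comp_kerι, map_zero])

/-- The kernel of a morphism. -/
abbrev ker : DgA where
  toAObj := AObj.ker (Hom.mem f)
  d := (exists_ker_d f).choose
  d_mem := (exists_ker_d f).choose_spec.1
  d_comp_d := (kerι_inj (Hom.mem f)).cancel (by
    rw [← comp_assoc, (exists_ker_d f).choose_spec.2, comp_assoc,
      (exists_ker_d f).choose_spec.2, ← comp_assoc, X.d_comp_d, map_zero, map_zero,
      LinearMap.zero_apply])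

/-- The inclusion of the kernel. -/
def kerι : ker f ⟶ X := ⟨AObj.kerι (Hom.mem f), kerι_mem _, (exists_ker_d f).choose_spec.2.symm⟩

lemma kerι_inj : Inj (Hom.pair (kerι f)) := AObj.kerι_inj (Hom.mem f)

lemma kerι_comp : kerι f ≫ f = 0 := hom_ext (comp_kerι (Hom.mem f))

lemma kerι_exact : Exact (Hom.pair (kerι f)) (Hom.pair f) :=
  ⟨fun x => ⟨fun hx => ⟨⟨x, hx⟩, rfl⟩, by rintro ⟨y, rfl⟩; exact y.2⟩,
    fun x => ⟨fun hx => ⟨⟨x, hx⟩, rfl⟩, by rintro ⟨y, rfl⟩; exact y.2⟩⟩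

lemma ker_isSES (hf : Surj (Hom.pair f)) : IsSES (kerι f) f := ⟨kerι_inj f, kerι_exact f, hf⟩

lemma exists_hom_of_inj {X Y Z : DgA} (i : X ⟶ Y) (hi : Inj (Hom.pair i)) (g : Z ⟶ Y)
    (l : Pairs Z.toAObj X.toAObj) (hl : AObj.comp (Hom.pair i) l = Hom.pair g) :
    ∃ φ : Z ⟶ X, φ ≫ i = g ∧ Hom.pair φ = l :=
  ⟨⟨l, mem_of_inj_comp hi (Hom.mem i) (hl.symm ▸ Hom.mem g) (add_zero 0), hi.cancel (by
    rw [← comp_assoc, ← comp_assoc, ← Hom.comm, comp_assoc, hl, Hom.comm])⟩, hom_ext hl, rfl⟩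

lemma exists_hom_of_surj {X Y Z : DgA} (p : X ⟶ Y) (hp : Surj (Hom.pair p)) (g : X ⟶ Z)
    (l : Pairs Y.toAObj Z.toAObj) (hl : AObj.comp l (Hom.pair p) = Hom.pair g) :
    ∃ φ : Y ⟶ Z, p ≫ φ = g ∧ Hom.pair φ = l :=
  ⟨⟨l, mem_of_surj_comp hp (Hom.mem p) (hl.symm ▸ Hom.mem g) (add_zero 0), hp.cancel (by
    rw [comp_assoc, comp_assoc, Hom.comm, ← comp_assoc l, hl, Hom.comm])⟩, hom_ext hl, rfl⟩

lemma exists_lift_of_exact {X Y Z W : DgA} {i : X ⟶ Y} {p : Y ⟶ Z} (hi : Inj (Hom.pair i))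
    (hex : Exact (Hom.pair i) (Hom.pair p)) (g : W ⟶ Y) (h : g ≫ p = 0) :
    ∃ φ : W ⟶ X, φ ≫ i = g := by
  obtain ⟨l, _, hl⟩ := exists_lift hi (Hom.mem i) hex (Hom.mem g) (congrArg Hom.pair h)
  obtain ⟨φ, hφ, _⟩ := exists_hom_of_inj i hi g l hl
  exact ⟨φ, hφ⟩

lemma exists_desc_of_exact {X Y Z W : DgA} {i : X ⟶ Y} {p : Y ⟶ Z} (hp : Surj (Hom.pair p))
    (hex : Exact (Hom.pair i) (Hom.pair p)) (g : Y ⟶ W) (h : i ≫ g = 0) :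
    ∃ φ : Z ⟶ W, p ≫ φ = g := by
  obtain ⟨l, _, hl⟩ := exists_desc hp (Hom.mem p) hex (Hom.mem g) (congrArg Hom.pair h)
    (add_zero 0)
  obtain ⟨φ, hφ, _⟩ := exists_hom_of_surj p hp g l hl
  exact ⟨φ, hφ⟩

lemma mono_of_inj (hf : Inj (Hom.pair f)) : Mono f :=
  ⟨fun g h e => hom_ext (hf.cancel (congrArg Hom.pair e))⟩

lemma epi_of_surj (hf : Surj (Hom.pair f)) : Epi f :=
  ⟨fun g h e => hom_ext (hf.cancel (congrArg Hom.pair e))⟩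

/-- The inclusion of the kernel composes to zero with f, hence is zero. Together with `mono_of_inj`
this identifies the cofibrations with the maps injective on nubs and vertices. -/
lemma inj_of_mono [Mono f] : Inj (Hom.pair f) := by
  have h : kerι f = 0 := (cancel_mono f).1 (by rw [kerι_comp, Limits.zero_comp])
  have h' := congrArg Hom.pair h
  refine ⟨(injective_iff_map_eq_zero (Hom.pair f).1).2 fun x hx => ?_,
    (injective_iff_map_eq_zero (Hom.pair f).2).2 fun x hx => ?_⟩
  · exact LinearMap.congr_fun (congrArg Prod.fst h') (⟨x, hx⟩ : LinearMap.ker (Hom.pair f).1)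
  · exact LinearMap.congr_fun (congrArg Prod.snd h') (⟨x, hx⟩ : LinearMap.ker (Hom.pair f).2)

end Kernel

section Cokernel

variable {X Y : DgA} (f : X ⟶ Y)

lemma exists_coker_d : ∃ l ∈ homDeg (AObj.coker (Hom.mem f)) (AObj.coker (Hom.mem f)) (-1),
    AObj.comp l (AObj.cokerπ (Hom.mem f)) = AObj.comp (AObj.cokerπ (Hom.mem f)) Y.d :=
  exists_cokerDesc (Hom.mem f) (comp_mem (zero_add _) (cokerπ_mem _) Y.d_mem) (by
    rw [comp_assoc, Hom.comm, ← comp_assoc, cokerπ_comp, map_zero, LinearMap.zero_apply])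

/-- The cokernel of a morphism. -/
abbrev coker : DgA where
  toAObj := AObj.coker (Hom.mem f)
  d := (exists_coker_d f).choose
  d_mem := (exists_coker_d f).choose_spec.1
  d_comp_d := (cokerπ_surj (Hom.mem f)).cancel (by
    rw [comp_assoc, (exists_coker_d f).choose_spec.2, ← comp_assoc,
      (exists_coker_d f).choose_spec.2, comp_assoc, Y.d_comp_d, map_zero, map_zero,
      LinearMap.zero_apply])

/-- The projection to the cokernel. -/
def cokerπ : Y ⟶ coker f := ⟨AObj.cokerπ (Hom.mem f), cokerπ_mem _, (exists_coker_d f).choose_spec.2⟩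

lemma cokerπ_surj : Surj (Hom.pair (cokerπ f)) := AObj.cokerπ_surj (Hom.mem f)

lemma comp_cokerπ : f ≫ cokerπ f = 0 := hom_ext (cokerπ_comp (Hom.mem f))

lemma cokerπ_exact : Exact (Hom.pair f) (Hom.pair (cokerπ f)) :=
  ⟨LinearMap.exact_map_mkQ_range (Hom.pair f).1, LinearMap.exact_map_mkQ_range (Hom.pair f).2⟩

lemma coker_isSES (hf : Inj (Hom.pair f)) : IsSES f (cokerπ f) :=
  ⟨hf, cokerπ_exact f, cokerπ_surj f⟩

instance : Limits.HasKernels DgA where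
  has_limit {X Y} f := ⟨⟨⟨Limits.KernelFork.ofι (kerι f) (kerι_comp f),
    Limits.KernelFork.IsLimit.ofι' _ _ (fun {A} k hk =>
      ⟨(exists_lift_of_exact (kerι_inj f) (kerι_exact f) k hk).choose,
        (exists_lift_of_exact (kerι_inj f) (kerι_exact f) k hk).choose_spec⟩) (hi := mono_of_inj _ (kerι_inj f))⟩⟩⟩

instance : Limits.HasCokernels DgA where
  has_colimit {X Y} f := ⟨⟨⟨Limits.CokernelCofork.ofπ (cokerπ f) (comp_cokerπ f),
    Limits.CokernelCofork.IsColimit.ofπ' _ _ (fun {A} k hk =>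
      ⟨(exists_desc_of_exact (cokerπ_surj f) (cokerπ_exact f) k hk).choose,
        (exists_desc_of_exact (cokerπ_surj f) (cokerπ_exact f) k hk).choose_spec⟩) (hp := epi_of_surj _ (cokerπ_surj f))⟩⟩⟩

end Cokernel

/-! ### Direct sums of dg objects -/

section Sum

variable {ι : Type} (X : ι → DgA)

lemma exists_sum_d : ∃ l ∈ homDeg (AObj.sum fun i => (X i).toAObj)
    (AObj.sum fun i => (X i).toAObj) (-1),
    ∀ i, AObj.comp l (AObj.sumι (fun i => (X i).toAObj) i) =
      AObj.comp (AObj.sumι (fun i => (X i).toAObj) i) (X i).d :=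
  exists_sumDesc (fun i => (X i).toAObj)
    fun i => comp_mem (zero_add _) (sumι_mem (fun i => (X i).toAObj) i) (X i).d_mem

/-- The direct sum of a family of dg objects. -/
abbrev sum : DgA where
  toAObj := AObj.sum fun i => (X i).toAObj
  d := (exists_sum_d X).choose
  d_mem := (exists_sum_d X).choose_spec.1
  d_comp_d := sum_hom_ext (fun i => (X i).toAObj) fun i => by
    rw [comp_assoc, (exists_sum_d X).choose_spec.2, ← comp_assoc, (exists_sum_d X).choose_spec.2,
      comp_assoc, (X i).d_comp_d, map_zero, map_zero, LinearMap.zero_apply]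

/-- The injection of a summand. -/
def sumι (i : ι) : X i ⟶ sum X :=
  ⟨AObj.sumι (fun i => (X i).toAObj) i, sumι_mem (fun i => (X i).toAObj) i,
    (exists_sum_d X).choose_spec.2 i⟩

lemma sum_ext {Y : DgA} {f g : sum X ⟶ Y} (h : ∀ i, sumι X i ≫ f = sumι X i ≫ g) : f = g :=
  hom_ext (sum_hom_ext (fun i => (X i).toAObj) fun i => congrArg Hom.pair (h i))

lemma exists_sum_desc {Y : DgA} (g : ∀ i, X i ⟶ Y) :
    ∃ φ : sum X ⟶ Y, ∀ i, sumι X i ≫ φ = g i := by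
  obtain ⟨l, hl, h⟩ := exists_sumDesc (fun i => (X i).toAObj) (g := fun i => Hom.pair (g i))
    fun i => Hom.mem (g i)
  refine ⟨⟨l, hl, sum_hom_ext (fun i => (X i).toAObj) fun i => ?_⟩, fun i => hom_ext (h i)⟩
  rw [comp_assoc, comp_assoc, (exists_sum_d X).choose_spec.2, ← comp_assoc l, h, Hom.comm]

instance : Limits.HasCoproducts.{0} DgA :=
  Limits.hasCoproducts_of_colimit_cofans (fun X => Limits.Cofan.mk (sum X) (sumι X)) fun X =>
    Limits.Cofan.IsColimit.mk _ (fun t => (exists_sum_desc X t.inj).choose)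
      (fun t i => (exists_sum_desc X t.inj).choose_spec i)
      (fun t m h => sum_ext X fun i => (h i).trans ((exists_sum_desc X t.inj).choose_spec i).symm)

end Sum

section Preadd

variable (C : Type*) [Category C] [Preadditive C] [Limits.HasCoproducts.{0} C]

lemma _root_.CircleModel.hasFiniteBiproducts_of_hasCoproducts : Limits.HasFiniteBiproducts C :=
  have : Limits.HasFiniteCoproducts C := Limits.hasFiniteCoproducts_of_hasCoproducts C
  Limits.HasFiniteBiproducts.of_hasFiniteCoproducts

lemma _root_.CircleModel.hasFiniteLimits_of_hasKernels [Limits.HasKernels C] :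
    Limits.HasFiniteLimits C := by
  have := hasFiniteBiproducts_of_hasCoproducts C
  have := Preadditive.hasEqualizers_of_hasKernels (C := C)
  exact Limits.hasFiniteLimits_of_hasEqualizers_and_finite_products

lemma _root_.CircleModel.hasFiniteColimits_of_hasCokernels [Limits.HasCokernels C] :
    Limits.HasFiniteColimits C := by
  have := hasFiniteBiproducts_of_hasCoproducts C
  have := Preadditive.hasCoequalizers_of_hasCokernels (C := C)
  exact Limits.hasFiniteColimits_of_hasCoequalizers_and_finite_coproducts

end Preadd

instance : Limits.HasFiniteLimits DgA := hasFiniteLimits_of_hasKernels DgA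
instance : Limits.HasFiniteColimits DgA := hasFiniteColimits_of_hasCokernels DgA

/-! #### Suspensions and twisted direct sums -/

lemma comp_smul_smul {X Y Z : AObj} (a b : ℚ) (g : Pairs Y Z) (f : Pairs X Y) :
    AObj.comp (a • g) (b • f) = (a * b) • AObj.comp g f := by
  rw [map_smul AObj.comp, LinearMap.smul_apply, map_smul, smul_smul]

/-- The suspension of a dg object. -/
abbrev susp (X : DgA) (k : ℤ) : DgA where
  toAObj := AObj.susp X.toAObj k
  d := sgn k • X.d
  d_mem := Submodule.smul_mem _ _ ((mem_susp_iff (by omega)).2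
    (comp_mem (p := -1) (q := -k) (n := -1 - k) (by omega) X.d_mem (ofSusp_mem _ _)))
  d_comp_d := by
    refine (comp_smul_smul (X := X.toAObj) (Y := X.toAObj) (Z := X.toAObj)
      (sgn k) (sgn k) X.d X.d).trans ?_
    rw [X.d_comp_d]
    exact smul_zero _

section Twist

variable (X Y : DgA) {q : Pairs X.toAObj Y.toAObj} (hq : q ∈ homDeg X.toAObj Y.toAObj (-1))
  (h : AObj.comp Y.d q + AObj.comp q X.d = 0)

lemma snd_inl {X Y : AObj} : AObj.comp (snd X Y) (inl X Y) = 0 := rfl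
lemma fst_inr {X Y : AObj} : AObj.comp (fst X Y) (inr X Y) = 0 := rfl

/-- The pair of maps into a product. -/
abbrev pairing {W X Y : AObj} (f : Pairs W X) (g : Pairs W Y) : Pairs W (prod X Y) :=
  (f.1.prod g.1, f.2.prod g.2)

lemma pairing_eq {W X Y : AObj} (f : Pairs W X) (g : Pairs W Y) :
    pairing f g = AObj.comp (inl X Y) f + AObj.comp (inr X Y) g :=
  pairs_ext (fun x => Prod.ext (add_zero _).symm (zero_add _).symm)
    (fun x => Prod.ext (add_zero _).symm (zero_add _).symm)

lemma pairing_mem {W X Y : AObj} {f : Pairs W X} {g : Pairs W Y} {n : ℤ} (hf : f ∈ homDeg W X n)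
    (hg : g ∈ homDeg W Y n) : pairing f g ∈ homDeg W (prod X Y) n := by
  rw [pairing_eq]
  exact add_mem (comp_mem (by omega) (inl_mem X Y) hf) (comp_mem (by omega) (inr_mem X Y) hg)

/-- The direct sum with differential `d(x, y) = (d x, q x + d y)`. -/
abbrev twist : DgA where
  toAObj := prod X.toAObj Y.toAObj
  d := pairing (AObj.comp X.d (fst X.toAObj Y.toAObj))
    (AObj.comp q (fst X.toAObj Y.toAObj) + AObj.comp Y.d (snd X.toAObj Y.toAObj))
  d_mem := pairing_mem (comp_mem (by omega) X.d_mem (fst_mem _ _))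
    (add_mem (comp_mem (by omega) hq (fst_mem _ _)) (comp_mem (by omega) Y.d_mem (snd_mem _ _)))
  d_comp_d := by
    have h₁ (x : X.nub) : Y.d.1 (q.1 x) + q.1 (X.d.1 x) = 0 :=
      LinearMap.congr_fun (congrArg Prod.fst h) x
    have h₂ (x : X.vertex) : Y.d.2 (q.2 x) + q.2 (X.d.2 x) = 0 :=
      LinearMap.congr_fun (congrArg Prod.snd h) x
    refine pairs_ext (fun x => Prod.ext (d_d x.1) ?_) (fun x => Prod.ext (d_d' x.1) ?_)
    · change q.1 (X.d.1 x.1) + Y.d.1 (q.1 x.1 + Y.d.1 x.2) = 0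
      rw [map_add, d_d, add_zero, add_comm, h₁]
    · change q.2 (X.d.2 x.1) + Y.d.2 (q.2 x.1 + Y.d.2 x.2) = 0
      rw [map_add, d_d', add_zero, add_comm, h₂]

/-- The projection to the base of a twisted direct sum. -/
def twistFst : twist X Y hq h ⟶ X := ⟨fst _ _, fst_mem _ _, rfl⟩

/-- The inclusion of the fibre of a twisted direct sum. -/
def twistInr : Y ⟶ twist X Y hq h := ⟨inr _ _, inr_mem _ _,
  pairs_ext (fun x => Prod.ext (map_zero X.d.1)
      ((congrArg (· + Y.d.1 x) (map_zero q.1)).trans (zero_add _)))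
    (fun x => Prod.ext (map_zero X.d.2)
      ((congrArg (· + Y.d.2 x) (map_zero q.2)).trans (zero_add _)))⟩

lemma twist_isSES : IsSES (twistInr X Y hq h) (twistFst X Y hq h) :=
  ⟨⟨fun x y e => congrArg (fun z : X.nub × Y.nub => z.2) e,
      fun x y e => congrArg (fun z : X.vertex × Y.vertex => z.2) e⟩,
    ⟨fun x => ⟨fun hx => ⟨(x : X.nub × Y.nub).2, Prod.ext (Eq.symm (b := (0 : X.nub)) hx) rfl⟩,
        by rintro ⟨y, rfl⟩; rfl⟩,
      fun x => ⟨fun hx => ⟨(x : X.vertex × Y.vertex).2,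
        Prod.ext (Eq.symm (b := (0 : X.vertex)) hx) rfl⟩, by rintro ⟨y, rfl⟩; rfl⟩⟩,
    ⟨fun x => ⟨(x, 0), rfl⟩, fun x => ⟨(x, 0), rfl⟩⟩⟩


end Twist

/-- The direct sum of two dg objects. -/
abbrev dprod (X Y : DgA) : DgA := twist X Y (q := 0) (zero_mem _) (by simp)

/-! ### Homotopy fibres and contractible objects -/

section Fib

variable {X Y : DgA} (f : X ⟶ Y)

lemma fib_comm : AObj.comp (Y.susp (-1)).d (AObj.comp (toSusp Y.toAObj (-1)) (Hom.pair f)) +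
    AObj.comp (AObj.comp (toSusp Y.toAObj (-1)) (Hom.pair f)) X.d = 0 := by
  have h : sgn (-1) = -1 := by simp [sgn]
  refine pairs_ext (fun x => ?_) (fun x => ?_)
  · change sgn (-1) • Y.d.1 ((Hom.pair f).1 x) + (Hom.pair f).1 (X.d.1 x) = 0
    rw [h, d_apply, neg_one_smul]
    exact neg_add_cancel _
  · change sgn (-1) • Y.d.2 ((Hom.pair f).2 x) + (Hom.pair f).2 (X.d.2 x) = 0
    rw [h, d_apply', neg_one_smul]
    exact neg_add_cancel _

/-- The homotopy fibre of a morphism. -/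
abbrev fib : DgA := twist X (Y.susp (-1)) (q := AObj.comp (toSusp Y.toAObj (-1)) (Hom.pair f))
  (comp_mem (add_zero _) (toSusp_mem _ _) (Hom.mem f)) (fib_comm f)

lemma fib_d (x : X.nub) (y : Y.nub) :
    (fib f).d.1 ((x, y) : X.nub × Y.nub) = (X.d.1 x, (Hom.pair f).1 x - Y.d.1 y) := by
  have h : sgn (-1) = -1 := by simp [sgn]
  refine Prod.ext rfl ?_
  change (Hom.pair f).1 x + sgn (-1) • Y.d.1 y = _
  rw [h, neg_one_smul]
  exact (sub_eq_add_neg _ _).symm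

lemma fib_d' (x : X.vertex) (y : Y.vertex) :
    (fib f).d.2 ((x, y) : X.vertex × Y.vertex) = (X.d.2 x, (Hom.pair f).2 x - Y.d.2 y) := by
  have h : sgn (-1) = -1 := by simp [sgn]
  refine Prod.ext rfl ?_
  change (Hom.pair f).2 x + sgn (-1) • Y.d.2 y = _
  rw [h, neg_one_smul]
  exact (sub_eq_add_neg _ _).symm

/-- The object is contractible. -/
def Contractible (X : DgA) : Prop :=
  ∃ σ ∈ homDeg X.toAObj X.toAObj 1, AObj.comp X.d σ + AObj.comp σ X.d = one X.toAObj

lemma Contractible.acyclic {X : DgA} (h : Contractible X) : Acyclic X := by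
  obtain ⟨σ, _, hσ⟩ := h
  refine ⟨fun x hx => ⟨σ.1 x, ?_⟩, fun x hx => ⟨σ.2 x, ?_⟩⟩
  · have := LinearMap.congr_fun (congrArg Prod.fst hσ) x
    change X.d.1 (σ.1 x) + σ.1 (X.d.1 x) = x at this
    rwa [hx, map_zero, add_zero] at this
  · have := LinearMap.congr_fun (congrArg Prod.snd hσ) x
    change X.d.2 (σ.2 x) + σ.2 (X.d.2 x) = x at this
    rwa [hx, map_zero, add_zero] at this

/-- The contraction is (x, y) ↦ (y, 0). -/
lemma fib_id_contractible (X : DgA) : Contractible (fib (𝟙 X)) := by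
  refine ⟨AObj.comp (inl _ _) (AObj.comp (ofSusp X.toAObj (-1)) (snd _ _)),
    comp_mem (zero_add 1) (inl_mem _ _)
      (comp_mem (p := 1) (add_zero 1) (ofSusp_mem X.toAObj (-1)) (snd_mem _ _)),
    pairs_ext (fun x => ?_) (fun x => ?_)⟩
  · obtain ⟨x, y⟩ := x
    have h₁ := fib_d (𝟙 X) y 0
    have h₂ := fib_d (𝟙 X) x y
    change (fib (𝟙 X)).d.1 (y, 0) + (((fib (𝟙 X)).d.1 (x, y)).2, 0) = (x, y)
    refine (congrArg₂ (fun a b => (a + (b.2, 0) : X.nub × X.nub)) h₁ h₂).trans ?_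
    change (X.d.1 y + (x - X.d.1 y), (y - X.d.1 0) + 0) = (x, y)
    rw [map_zero, sub_zero, add_zero, add_sub_cancel]
  · obtain ⟨x, y⟩ := x
    have h₁ := fib_d' (𝟙 X) y 0
    have h₂ := fib_d' (𝟙 X) x y
    change (fib (𝟙 X)).d.2 (y, 0) + (((fib (𝟙 X)).d.2 (x, y)).2, 0) = (x, y)
    refine (congrArg₂ (fun a b => (a + (b.2, 0) : X.vertex × X.vertex)) h₁ h₂).trans ?_
    change (X.d.2 y + (x - X.d.2 y), (y - X.d.2 0) + 0) = (x, y)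
    rw [map_zero, sub_zero, add_zero, add_sub_cancel]

end Fib

/-- An object of `𝒜` with zero differential. -/
abbrev triv (X : AObj) : DgA := ⟨X, 0, zero_mem _, by simp⟩

/-! ### Embedding in divisible contractible objects -/

section Envelope

variable (D : AObj)

/-- The contractible object with underlying object `ΣD ⊕ D`. -/
abbrev cone : DgA := fib (𝟙 (susp (triv D) 1))

lemma cone_d (x : D.nub × D.nub) : (cone D).d.1 x = ((0, x.1) : D.nub × D.nub) := by
  refine (fib_d (𝟙 (susp (triv D) 1)) x.1 x.2).trans (Prod.ext ?_ ?_)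
  · exact smul_zero (A := D.nub) (sgn 1)
  · exact (congrArg (x.1 - ·) (smul_zero (A := D.nub) (sgn 1))).trans (sub_zero x.1)

lemma cone_d' (x : D.vertex × D.vertex) :
    (cone D).d.2 x = ((0, x.1) : D.vertex × D.vertex) := by
  refine (fib_d' (𝟙 (susp (triv D) 1)) x.1 x.2).trans (Prod.ext ?_ ?_)
  · exact smul_zero (A := D.vertex) (sgn 1)
  · exact (congrArg (x.1 - ·) (smul_zero (A := D.vertex) (sgn 1))).trans (sub_zero x.1)

/-- The map to a cone determined by a map in `𝒜`. -/
def toCone {D : AObj} {X : DgA} {a : Pairs X.toAObj D} (ha : a ∈ homDeg X.toAObj D 0) :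
    X ⟶ cone D where
  pair := pairing (AObj.comp a X.d) a
  mem := pairing_mem ((mem_susp_iff (by omega)).2 (comp_mem (zero_add (-1)) ha X.d_mem))
    ((mem_susp_iff (k := -1) (m := 1) (by omega)).2
      ((mem_susp_iff (k := 1) (m := 0) (by omega)).2 ha))
  comm := by
    refine pairs_ext (fun x => (cone_d D _).trans (Prod.ext ?_ rfl))
      (fun x => (cone_d' D _).trans (Prod.ext ?_ rfl))
    · exact ((congrArg a.1 (d_d x)).trans (map_zero a.1)).symm
    · exact ((congrArg a.2 (d_d' x)).trans (map_zero a.2)).symm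

lemma toCone_inj {D : AObj} {X : DgA} {a : Pairs X.toAObj D} (ha : a ∈ homDeg X.toAObj D 0)
    (hinj : Inj a) : Inj (Hom.pair (toCone ha)) :=
  ⟨fun x y e => hinj.1 (congrArg (fun z : D.nub × D.nub => z.2) e),
    fun x y e => hinj.2 (congrArg (fun z : D.vertex × D.vertex => z.2) e)⟩

/-- Every object embeds in a divisible contractible object. -/
theorem exists_envelope (X : DgA) :
    ∃ (E : DgA) (j : X ⟶ E), IsDiv E.toAObj ∧ Contractible E ∧ Inj (Hom.pair j) := by
  -- The embedding in the hull ignores differentials; the cone turns it into a chain map x ↦ (a d x,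
  -- a x), which stays injective.
  obtain ⟨D, a, ha, hinj, hD⟩ : ∃ (D : AObj) (a : Pairs X.toAObj D), a ∈ homDeg X.toAObj D 0 ∧
      Inj a ∧ IsDiv D := ⟨_, _, toHull_mem _, toHull_inj _, hull_isDiv _⟩
  exact ⟨cone D, toCone ha, hD.prod hD, fib_id_contractible _, toCone_inj ha hinj⟩

end Envelope

end DgA

namespace DgA

open AObj

/-! ### The model structure on dg objects -/

/-- Divisible acyclic objects are contractible. -/
lemma Acyclic.contractible {Y : DgA} (h : Acyclic Y) (hY : IsDiv Y.toAObj) : Contractible Y := by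
  -- The differential as a map δ to the object of cycles, onto by acyclicity.
  obtain ⟨δ, hδ, hιδ⟩ := exists_kerLift Y.d_mem Y.d_mem Y.d_comp_d
  have hδs : Surj δ := by
    refine ⟨fun z => ?_, fun z => ?_⟩
    · obtain ⟨y, hy⟩ := h.1 z.1 z.2
      exact ⟨y, Subtype.ext ((LinearMap.congr_fun (congrArg Prod.fst hιδ) y).trans hy)⟩
    · obtain ⟨y, hy⟩ := h.2 z.1 z.2
      exact ⟨y, Subtype.ext ((LinearMap.congr_fun (congrArg Prod.snd hιδ) y).trans hy)⟩
  have hex : Exact (AObj.kerι Y.d_mem) δ := by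
    refine ⟨fun y => ⟨fun hy => ⟨⟨y, ?_⟩, rfl⟩, ?_⟩, fun y => ⟨fun hy => ⟨⟨y, ?_⟩, rfl⟩, ?_⟩⟩
    · refine (LinearMap.congr_fun (congrArg Prod.fst hιδ) y).symm.trans ?_
      exact congrArg Subtype.val hy
    · rintro ⟨z, rfl⟩
      exact Subtype.ext ((LinearMap.congr_fun (congrArg Prod.fst hιδ) z.1).trans z.2)
    · refine (LinearMap.congr_fun (congrArg Prod.snd hιδ) y).symm.trans ?_
      exact congrArg Subtype.val hy
    · rintro ⟨z, rfl⟩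
      exact Subtype.ext ((LinearMap.congr_fun (congrArg Prod.snd hιδ) z.1).trans z.2)
  -- The object of cycles is a quotient of Y, hence divisible, so Y splits as cycles plus a
  -- complement. A section of δ after a retraction to the cycles is a contraction.
  obtain ⟨r, hr, s, hs, hri, hps, hsum⟩ := (hY.of_surjective δ.1 hδs.1).exists_splitting
    (AObj.kerι_inj Y.d_mem) (kerι_mem Y.d_mem) hδs hδ hex
  refine ⟨AObj.comp s r, comp_mem (by omega) hs hr, ?_⟩
  refine Eq.trans (congrArg₂ (· + ·) ?_ ?_) hsum
  · refine (congrArg (fun t => AObj.comp t (AObj.comp s r)) hιδ).symm.trans ?_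
    rw [AObj.comp_assoc, ← AObj.comp_assoc δ, hps, AObj.one_comp]
  · refine (congrArg (fun t => AObj.comp (AObj.comp s r) t) hιδ).symm.trans ?_
    rw [AObj.comp_assoc, ← AObj.comp_assoc r, hri, AObj.one_comp]

/-- Every cycle of degree `n` in the hom complex is a boundary. -/
def HomAcyclic (X Y : DgA) (n : ℤ) : Prop :=
  ∀ f ∈ homDeg X.toAObj Y.toAObj n, diff X Y n f = 0 →
    ∃ h ∈ homDeg X.toAObj Y.toAObj (n + 1), diff X Y (n + 1) h = f

lemma sgn_one : sgn 1 = -1 := by simp [sgn]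

lemma diff_contraction {X : DgA} {σ : Pairs X.toAObj X.toAObj}
    (h : AObj.comp X.d σ + AObj.comp σ X.d = one X.toAObj) : diff X X 1 σ = one X.toAObj := by
  rw [diff_apply, sgn_one, neg_one_smul, sub_neg_eq_add, h]

lemma Contractible.homAcyclic_source {X Y : DgA} (h : Contractible X) (n : ℤ) :
    HomAcyclic X Y n := by
  obtain ⟨σ, hσ, e⟩ := h
  intro f hf hdf
  refine ⟨sgn n • AObj.comp f σ, Submodule.smul_mem _ _ (comp_mem rfl hf hσ), ?_⟩
  rw [map_smul, diff_comp rfl, hdf, diff_contraction e, map_zero, LinearMap.zero_apply, zero_add,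
    smul_smul, sgn_mul_self, one_smul, AObj.comp_one]

lemma Contractible.homAcyclic_target {X Y : DgA} (h : Contractible Y) (n : ℤ) :
    HomAcyclic X Y n := by
  obtain ⟨σ, hσ, e⟩ := h
  intro f hf hdf
  refine ⟨AObj.comp σ f, comp_mem (add_comm 1 n) hσ hf, ?_⟩
  rw [diff_comp (add_comm 1 n), hdf, diff_contraction e, map_zero, smul_zero, add_zero,
    AObj.one_comp]

lemma diff_comp_hom {X Y Z : DgA} (f : X ⟶ Y) (n : ℤ) (g : Pairs Y.toAObj Z.toAObj) :
    diff X Z n (AObj.comp g (Hom.pair f)) = AObj.comp (diff Y Z n g) (Hom.pair f) := by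
  have h : diff X Y 0 (Hom.pair f) = 0 := ((homEquiv X Y) f).2.2
  rw [diff_comp (add_zero n), h, map_zero, smul_zero, add_zero]

lemma diff_hom_comp {X Y Z : DgA} (g : Y ⟶ Z) (n : ℤ) (f : Pairs X.toAObj Y.toAObj) :
    diff X Z n (AObj.comp (Hom.pair g) f) = AObj.comp (Hom.pair g) (diff X Y n f) := by
  have h : diff Y Z 0 (Hom.pair g) = 0 := ((homEquiv Y Z) g).2.2
  rw [diff_comp (zero_add n), h, map_zero, LinearMap.zero_apply, zero_add, sgn_zero, one_smul]

/-- If cycles `Z → K` are boundaries, then cycles `X → K` extend to cycles `Y → K`. -/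
lemma IsSES.exists_cycle_extension {X Y Z K : DgA} {i : X ⟶ Y} {p : Y ⟶ Z} (h : IsSES i p)
    (hK : IsDiv K.toAObj) {n m : ℤ} (hm : m + 1 = n) (hZK : HomAcyclic Z K m)
    {f : Pairs X.toAObj K.toAObj}
    (hf : f ∈ homDeg X.toAObj K.toAObj n) (hdf : diff X K n f = 0) :
    ∃ g ∈ homDeg Y.toAObj K.toAObj n, diff Y K n g = 0 ∧ AObj.comp g (Hom.pair i) = f := by
  have hpi : AObj.comp (Hom.pair p) (Hom.pair i) = 0 :=
    pairs_ext (fun x => h.exact.1.apply_apply_eq_zero x) (fun x => h.exact.2.apply_apply_eq_zero x)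
  -- Extend f without regard to differentials. The boundary of the extension vanishes on X, so it
  -- descends to a cycle on Z, and a primitive of that cycle is the correction.
  obtain ⟨g, hg, hgi⟩ := hK.exists_extension (Hom.mem i) h.inj hf
  obtain ⟨c, hc, hcp⟩ := exists_desc h.surj (Hom.mem p) h.exact (diff_mem hm hg)
    (by rw [← diff_comp_hom, hgi, hdf]) (zero_add m)
  obtain ⟨e, he, hde⟩ := hZK c hc (h.surj.cancel (by
    rw [← diff_comp_hom, hcp, diff_diff hm, map_zero, LinearMap.zero_apply]))
  rw [hm] at he hde
  refine ⟨g - AObj.comp e (Hom.pair p), sub_mem hg (comp_mem (add_zero n) he (Hom.mem p)), ?_, ?_⟩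
  · rw [map_sub, diff_comp_hom, hde, hcp, sub_self]
  · rw [map_sub, LinearMap.sub_apply, hgi, comp_assoc, hpi, map_zero, sub_zero]

/-- Maps from acyclic objects to divisible objects have acyclic hom complexes. -/
lemma Acyclic.homAcyclic {X K : DgA} (hX : Acyclic X) (hK : IsDiv K.toAObj) (n : ℤ) :
    HomAcyclic X K n := by
  obtain ⟨E, j, hE, hE', hj⟩ := exists_envelope X
  have hses := coker_isSES j hj
  -- Injective dimension one: the cokernel of X in its envelope is divisible, and it is acyclic,
  -- hence contractible. Thus a cycle on X extends to a cycle on the contractible envelope, where it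
  -- bounds.
  have hQ : IsDiv (coker j).toAObj := hE.of_surjective _ (cokerπ_surj j).1
  have hQ' := (hses.acyclic_of_acyclic hX hE'.acyclic).contractible hQ
  intro f hf hdf
  obtain ⟨g, hg, hdg, hgj⟩ := hses.exists_cycle_extension hK (sub_add_cancel n 1)
    (hQ'.homAcyclic_source (n - 1)) hf hdf
  obtain ⟨h, hh, hdh⟩ := hE'.homAcyclic_source n g hg hdg
  exact ⟨AObj.comp h (Hom.pair j), comp_mem (add_zero _) hh (Hom.mem j), by
    rw [diff_comp_hom, hdh, hgj]⟩

/-- A surjective morphism with divisible kernel. -/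
structure IsDivFib {X Y : DgA} (p : X ⟶ Y) : Prop where
  surj : Surj (Hom.pair p)
  div : ∀ s ∈ eulerClasses, ∀ x : X.nub, (Hom.pair p).1 x = 0 →
    ∃ y : X.nub, (Hom.pair p).1 y = 0 ∧ s • y = x

lemma IsDivFib.isDiv_ker {X Y : DgA} {p : X ⟶ Y} (h : IsDivFib p) : IsDiv (ker p).toAObj := by
  intro s hs x
  obtain ⟨y, hy, e⟩ := h.div s hs x.1 x.2
  exact ⟨⟨y, hy⟩, Subtype.ext e⟩

/-- Injectivity of K gives a lift of graded objects. Its boundary factors through a cycle Q → K of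
degree -1, and a primitive of that cycle corrects the lift. -/
lemma hasLiftingProperty_of_homAcyclic {A B Q K X Y : DgA} {i : A ⟶ B} {π : B ⟶ Q}
    (hses : IsSES i π) {ι : K ⟶ X} {p : X ⟶ Y} (hses' : IsSES ι p) (hK : IsDiv K.toAObj)
    (h : HomAcyclic Q K (-1)) :
    HasLiftingProperty i p where
  sq_hasLift {u v} sq := by
    obtain ⟨r, hr, s, hs, hri, hps, hsum⟩ := hK.exists_splitting hses'.inj
      (Hom.mem ι) hses'.surj (Hom.mem p) hses'.exact
    have hpι : AObj.comp (Hom.pair p) (Hom.pair ι) = 0 := 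
      pairs_ext (fun x => hses'.exact.1.apply_apply_eq_zero x)
        (fun x => hses'.exact.2.apply_apply_eq_zero x)
    obtain ⟨k, hk, hki⟩ := hK.exists_extension (Hom.mem i) hses.inj
      (comp_mem (add_zero 0) hr (Hom.mem u))
    have hsq : AObj.comp (Hom.pair p) (Hom.pair u) = AObj.comp (Hom.pair v) (Hom.pair i) :=
      congrArg Hom.pair sq.w
    have hπi : AObj.comp (Hom.pair π) (Hom.pair i) = 0 :=
      pairs_ext (fun x => hses.exact.1.apply_apply_eq_zero x)
        (fun x => hses.exact.2.apply_apply_eq_zero x)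
    -- A lift in 𝒜: in the splitting of p its K-component extends that of u, and its Y-component is
    -- v.
    let l₀ := AObj.comp (Hom.pair ι) k + AObj.comp s (Hom.pair v)
    have hl₀ : l₀ ∈ homDeg B.toAObj X.toAObj 0 :=
      add_mem (comp_mem (add_zero 0) (Hom.mem ι) hk) (comp_mem (by omega) hs (Hom.mem v))
    have hl₀i : AObj.comp l₀ (Hom.pair i) = Hom.pair u := by
      simp only [l₀, map_add, LinearMap.add_apply]
      rw [comp_assoc, hki, comp_assoc, ← hsq, ← comp_assoc, ← comp_assoc,
        ← LinearMap.add_apply, ← map_add, hsum, AObj.one_comp]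
    have hpl₀ : AObj.comp (Hom.pair p) l₀ = Hom.pair v := by
      simp only [l₀, map_add]
      rw [← comp_assoc, hpι, map_zero, LinearMap.zero_apply, zero_add, ← comp_assoc, hps,
        AObj.one_comp]
    have hdu : diff A X 0 (Hom.pair u) = 0 := ((homEquiv A X) u).2.2
    have hdv : diff B Y 0 (Hom.pair v) = 0 := ((homEquiv B Y) v).2.2
    -- The boundary of l₀ vanishes after p and after restriction along i, because u and v are chain
    -- maps; so it comes from Q and lands in K.
    obtain ⟨c, hc, hcι⟩ := exists_lift hses'.inj (Hom.mem ι) hses'.exact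
      (diff_mem (j := -1) (by omega) hl₀) (by rw [← diff_hom_comp, hpl₀, hdv])
    obtain ⟨e, he, hep⟩ := exists_desc hses.surj (Hom.mem π) hses.exact hc
      (hses'.inj.cancel (by
        rw [← comp_assoc, hcι, ← diff_comp_hom, hl₀i, hdu, map_zero])) (zero_add (-1))
    obtain ⟨t, ht, hdt⟩ := h e he (hses.surj.cancel (hses'.inj.cancel (by
      rw [← diff_comp_hom, hep, ← diff_hom_comp, hcι, diff_diff (by omega), map_zero,
        LinearMap.zero_apply, map_zero])))
    have ht : t ∈ homDeg Q.toAObj K.toAObj 0 := ht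
    have hdt : diff Q K 0 t = e := hdt
    let l := l₀ - AObj.comp (Hom.pair ι) (AObj.comp t (Hom.pair π))
    have hl : l ∈ homDeg B.toAObj X.toAObj 0 := sub_mem hl₀
      (comp_mem (add_zero 0) (Hom.mem ι) (comp_mem (add_zero 0) ht (Hom.mem _)))
    have hdl : diff B X 0 l = 0 := by
      simp only [l, map_sub]
      rw [diff_hom_comp, diff_comp_hom, hdt, hep, hcι, sub_self]
    rw [diff_apply, sgn_zero, one_smul, sub_eq_zero] at hdl
    refine ⟨⟨⟨⟨l, hl, hdl⟩, hom_ext ?_, hom_ext ?_⟩⟩⟩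
    · change AObj.comp l (Hom.pair i) = _
      simp only [l, map_sub, LinearMap.sub_apply]
      rw [hl₀i, AObj.comp_assoc, AObj.comp_assoc, hπi, map_zero, map_zero, sub_zero]
    · change AObj.comp (Hom.pair p) l = _
      simp only [l, map_sub]
      rw [hpl₀, ← AObj.comp_assoc, hpι, map_zero, LinearMap.zero_apply, sub_zero]

/-- Here the cokernel of the trivial cofibration is acyclic, so every cycle from it to the divisible
kernel bounds. -/
lemma IsDivFib.fibration {X Y : DgA} {p : X ⟶ Y} (hp : IsDivFib p) : fibrations DgA p := by
  rintro A B i ⟨hi, hw⟩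
  have : Mono i := hi
  have hi' := inj_of_mono i
  exact hasLiftingProperty_of_homAcyclic (coker_isSES i hi') (ker_isSES p hp.surj) hp.isDiv_ker
    (((coker_isSES i hi').acyclic_right hw).homAcyclic hp.isDiv_ker (-1))

/-- Here the kernel of p is acyclic and divisible, hence contractible, and the obstruction vanishes
for every monomorphism. -/
lemma IsDivFib.hasLiftingProperty {A B X Y : DgA} {p : X ⟶ Y} (hp : IsDivFib p)
    (hw : weakEquivalences DgA p) (i : A ⟶ B) [Mono i] : HasLiftingProperty i p :=
  hasLiftingProperty_of_homAcyclic (coker_isSES i (inj_of_mono i)) (ker_isSES p hp.surj)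
    hp.isDiv_ker
    ((((ker_isSES p hp.surj).acyclic_left hw).contractible hp.isDiv_ker).homAcyclic_target (-1))

/-- Factorization of `f` as a monomorphism followed by a divisible acyclic fibration. -/
lemma exists_factorization {X Y : DgA} (f : X ⟶ Y) :
    ∃ (J : DgA) (i : X ⟶ dprod Y J), i ≫ twistFst Y J _ _ = f ∧ Inj (Hom.pair i) ∧
      IsDiv J.toAObj ∧ Contractible J := by
  obtain ⟨J, j, hJ, hJ', hj⟩ := exists_envelope X
  refine ⟨J, ⟨pairing (Hom.pair f) (Hom.pair j), pairing_mem (Hom.mem f) (Hom.mem j),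
    pairs_ext (fun x => Prod.ext (d_apply f x) ?_) (fun x => Prod.ext (d_apply' f x) ?_)⟩,
    rfl, ⟨fun x y e => hj.1 (congrArg (fun z : Y.nub × J.nub => z.2) e),
      fun x y e => hj.2 (congrArg (fun z : Y.vertex × J.vertex => z.2) e)⟩, hJ, hJ'⟩
  · exact (zero_add (J.d.1 ((Hom.pair j).1 x))).trans (d_apply j x)
  · exact (zero_add (J.d.2 ((Hom.pair j).2 x))).trans (d_apply' j x)

lemma twistFst_isDivFib (Y J : DgA) {q : Pairs Y.toAObj J.toAObj}
    (hq : q ∈ homDeg Y.toAObj J.toAObj (-1)) (h : AObj.comp J.d q + AObj.comp q Y.d = 0)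
    (hJ : IsDiv J.toAObj) : IsDivFib (twistFst Y J hq h) := by
  refine ⟨(twist_isSES Y J hq h).surj, fun s hs x hx => ?_⟩
  obtain ⟨y, hy⟩ := hJ s hs (x : Y.nub × J.nub).2
  have hx : (x : Y.nub × J.nub).1 = 0 := hx
  exact ⟨((0, y) : Y.nub × J.nub), rfl, Prod.ext ((smul_zero s).trans hx.symm) hy⟩

instance : MorphismProperty.HasFactorization (cofibrations DgA) (trivialFibrations DgA) where
  nonempty_mapFactorizationData {X Y} f := by
    obtain ⟨J, i, hi, hinj, hJ, hJ'⟩ := exists_factorization f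
    exact ⟨{
      Z := dprod Y J
      i := i
      p := twistFst Y J _ _
      fac := hi
      hi := mono_of_inj i hinj
      hp := ⟨(twistFst_isDivFib Y J _ _ hJ).fibration,
        (twist_isSES Y J _ _).weakEquivalence_right hJ'.acyclic⟩ }⟩

/-! ### The kernel of a surjection and its homotopy fibre -/

section Fib

variable {X W Q : DgA} {i : X ⟶ W} {q : W ⟶ Q} (h : IsSES i q)

/-- The map from the kernel of a surjection to its homotopy fibre. -/
def toFib (hq : i ≫ q = 0) : X ⟶ fib q where
  pair := AObj.comp (inl _ _) (Hom.pair i)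
  mem := comp_mem (add_zero 0) (inl_mem _ _) (Hom.mem i)
  comm := by
    have h₁ (x : X.nub) : (Hom.pair q).1 ((Hom.pair i).1 x) = 0 :=
      LinearMap.congr_fun (congrArg (fun f => (Hom.pair f).1) hq) x
    have h₂ (x : X.vertex) : (Hom.pair q).2 ((Hom.pair i).2 x) = 0 :=
      LinearMap.congr_fun (congrArg (fun f => (Hom.pair f).2) hq) x
    refine pairs_ext (fun x => (fib_d q _ _).trans (Prod.ext (d_apply i x) ?_))
      (fun x => (fib_d' q _ _).trans (Prod.ext (d_apply' i x) ?_))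
    · exact (congrArg₂ (· - ·) (h₁ x) (map_zero Q.d.1)).trans (sub_zero 0)
    · exact (congrArg₂ (· - ·) (h₂ x) (map_zero Q.d.2)).trans (sub_zero 0)

lemma isHomologyIso_fib {A B C : Type} [AddCommGroup A] [AddCommGroup B] [AddCommGroup C]
    {dA : A →+ A} {dB : B →+ B} {dC : C →+ C} {f : A →+ B} {g : B →+ C}
    (hf : ∀ x, dB (f x) = f (dA x)) (hg : ∀ x, dC (g x) = g (dB x))
    (hdB : ∀ x, dB (dB x) = 0) (hinj : Function.Injective f)
    (hex : Function.Exact f g) (hsurj : Function.Surjective g) :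
    IsHomologyIso dA (fun z : B × C => (dB z.1, g z.1 - dC z.2)) (fun x => (f x, 0)) := by
  refine ⟨fun x hx ⟨⟨w, c⟩, h⟩ => ?_, fun ⟨w, c⟩ h => ?_⟩
  · obtain ⟨h₁, h₂⟩ := Prod.ext_iff.1 h
    obtain ⟨w', rfl⟩ := hsurj c
    obtain ⟨x', hx'⟩ := (hex (w - dB w')).1 (by rw [map_sub, ← hg]; exact h₂)
    refine ⟨x', hinj ?_⟩
    rw [← hf, hx', map_sub, hdB, sub_zero]
    exact h₁
  · obtain ⟨h₁, h₂⟩ := Prod.ext_iff.1 h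
    obtain ⟨w', rfl⟩ := hsurj c
    obtain ⟨x, hx⟩ := (hex (w - dB w')).1 (by rw [map_sub, ← hg]; exact h₂)
    have h₁ : dB w = 0 := h₁
    refine ⟨x, hinj ?_, (-w', 0), Prod.ext ?_ ?_⟩
    · rw [← hf, hx, map_sub, hdB, sub_zero, h₁, map_zero]
    · change dB (-w') = f x - w
      rw [hx, map_neg]
      abel
    · change g (-w') - dC 0 = 0 - g w'
      rw [map_neg, map_zero, sub_zero, zero_sub]

include h in
lemma toFib_weakEquivalence (hq : i ≫ q = 0) : weakEquivalences DgA (toFib hq) := by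
  have h₁ := isHomologyIso_fib (dA := X.d.1.toAddMonoidHom) (dB := W.d.1.toAddMonoidHom)
      (dC := Q.d.1.toAddMonoidHom) (f := (Hom.pair i).1.toAddMonoidHom)
      (g := (Hom.pair q).1.toAddMonoidHom) (d_apply i) (d_apply q) d_d h.inj.1 h.exact.1 h.surj.1
  have h₂ := isHomologyIso_fib (dA := X.d.2.toAddMonoidHom) (dB := W.d.2.toAddMonoidHom)
      (dC := Q.d.2.toAddMonoidHom) (f := (Hom.pair i).2.toAddMonoidHom)
      (g := (Hom.pair q).2.toAddMonoidHom) (d_apply' i) (d_apply' q) d_d' h.inj.2 h.exact.2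
      h.surj.2
  have e₁ : ⇑(fib q).d.1 = fun z : W.nub × Q.nub =>
    (W.d.1 z.1, (Hom.pair q).1 z.1 - Q.d.1 z.2) := funext fun z => fib_d q z.1 z.2
  have e₂ : ⇑(fib q).d.2 = fun z : W.vertex × Q.vertex =>
    (W.d.2 z.1, (Hom.pair q).2 z.1 - Q.d.2 z.2) := funext fun z => fib_d' q z.1 z.2
  constructor
  · exact e₁.symm ▸ h₁
  · exact e₂.symm ▸ h₂

end Fib

/-- Factorization of a surjective map as a trivial cofibration followed by a fibration. -/
lemma exists_factorization_of_surj {X Y : DgA} (f : X ⟶ Y) (hf : Surj (Hom.pair f)) :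
    ∃ (Z : DgA) (i : X ⟶ Z) (p : Z ⟶ Y), i ≫ p = f ∧ Inj (Hom.pair i) ∧
      weakEquivalences DgA i ∧ IsDivFib p := by
  obtain ⟨J, i, hi, hinj, hJ, hJ'⟩ := exists_factorization f
  have hses := coker_isSES i hinj
  have hif (x : X.nub) : ((Hom.pair i).1 x : Y.nub × J.nub).1 = (Hom.pair f).1 x :=
    LinearMap.congr_fun (congrArg (fun f => (Hom.pair f).1) hi) x
  -- Since f is onto, every class in the cokernel has a representative in J, so the cokernel is
  -- divisible although Y need not be.
  have hQ : IsDiv (coker i).toAObj := by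
    intro s hs z
    obtain ⟨⟨y, j⟩, rfl⟩ := (cokerπ_surj i).1 z
    obtain ⟨x, rfl⟩ := hf.1 y
    obtain ⟨j', hj'⟩ := hJ s hs (j - ((Hom.pair i).1 x : Y.nub × J.nub).2)
    refine ⟨(Hom.pair (cokerπ i)).1 ((0, j') : Y.nub × J.nub), ?_⟩
    rw [← map_smul, ← sub_eq_zero, ← map_sub]
    refine (hses.exact.1 _).2 ⟨-x, ?_⟩
    refine Prod.ext ?_ ?_
    · refine (hif (-x)).trans ?_
      change _ = s • 0 - (Hom.pair f).1 x
      rw [map_neg, smul_zero, zero_sub]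
    · change ((Hom.pair i).1 (-x) : Y.nub × J.nub).2 = s • j' - j
      rw [hj', map_neg]
      exact (sub_sub_cancel_left _ _).symm
  -- X is the kernel of the projection to the cokernel, so it maps to the homotopy fibre by a
  -- quasi-isomorphism. The kernel of the homotopy fibre over Y is built from J and a desuspension
  -- of the cokernel, both divisible.
  refine ⟨fib (cokerπ i), toFib (comp_cokerπ i), twistFst _ _ _ _ ≫ twistFst Y J _ _, ?_, ?_,
    toFib_weakEquivalence hses _, ⟨⟨?_, ?_⟩, fun s hs x hx => ?_⟩⟩
  · exact hom_ext (congrArg Hom.pair hi)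
  · exact ⟨fun x y e => hinj.1 (congrArg Prod.fst e), fun x y e => hinj.2 (congrArg Prod.fst e)⟩
  · exact fun y => ⟨((y, 0), 0), rfl⟩
  · exact fun y => ⟨((y, 0), 0), rfl⟩
  · obtain ⟨⟨y, j⟩, c⟩ := x
    have hy : y = 0 := hx
    obtain ⟨j', hj'⟩ := hJ s hs j
    obtain ⟨c', hc'⟩ := hQ s hs c
    exact ⟨((0, j'), c'), rfl, Prod.ext (Prod.ext ((smul_zero s).trans hy.symm) hj') hc'⟩

/-! ### Contractible objects that map onto a given object -/

section FromFib

variable {Z Y : DgA} {f : Pairs Z.toAObj Y.toAObj} (hf : f ∈ homDeg Z.toAObj Y.toAObj 0)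

/-- The pair underlying the map `fib (𝟙 Z) ⟶ Y` determined by a map of degree zero. -/
abbrev fromFibPair (f : Pairs Z.toAObj Y.toAObj) : Pairs (fib (𝟙 Z)).toAObj Y.toAObj :=
  AObj.comp f (fst Z.toAObj (Z.susp (-1)).toAObj) +
    AObj.comp (AObj.comp (diff Z Y 0 f) (ofSusp Z.toAObj (-1)))
      (snd Z.toAObj (Z.susp (-1)).toAObj)

lemma fromFibPair_apply (x : Z.nub × Z.nub) : (fromFibPair f).1 x =
    f.1 x.1 + (Y.d.1 (f.1 x.2) - f.1 (Z.d.1 x.2)) := by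
  change f.1 x.1 + (Y.d.1 (f.1 x.2) - sgn 0 • f.1 (Z.d.1 x.2)) = _
  rw [sgn_zero, one_smul]

lemma fromFibPair_apply' (x : Z.vertex × Z.vertex) : (fromFibPair f).2 x =
    f.2 x.1 + (Y.d.2 (f.2 x.2) - f.2 (Z.d.2 x.2)) := by
  change f.2 x.1 + (Y.d.2 (f.2 x.2) - sgn 0 • f.2 (Z.d.2 x.2)) = _
  rw [sgn_zero, one_smul]

include hf in
lemma fromFibPair_mem : fromFibPair f ∈ homDeg (fib (𝟙 Z)).toAObj Y.toAObj 0 :=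
  add_mem (comp_mem (add_zero 0) hf (fst_mem _ _))
    (comp_mem (p := 0) (q := 0) (add_zero 0)
      (comp_mem (p := -1) (q := - -1) (by omega) (diff_mem (by omega) hf) (ofSusp_mem _ _))
      (snd_mem _ _))

lemma fromFibPair_comm :
    AObj.comp Y.d (fromFibPair f) = AObj.comp (fromFibPair f) (fib (𝟙 Z)).d := by
  refine pairs_ext (fun x => ?_) (fun x => ?_)
  · obtain ⟨x, y⟩ := x
    refine (congrArg Y.d.1 (fromFibPair_apply (x, y))).trans
      (Eq.trans ?_ (congrArg (fromFibPair f).1 (fib_d (𝟙 Z) x y)).symm)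
    refine Eq.trans ?_ (fromFibPair_apply (Z := Z) (Z.d.1 x, x - Z.d.1 y)).symm
    dsimp only
    rw [map_add, map_sub, d_d, map_sub, map_sub, map_sub, map_sub, d_d, map_zero]
    abel
  · obtain ⟨x, y⟩ := x
    refine (congrArg Y.d.2 (fromFibPair_apply' (x, y))).trans
      (Eq.trans ?_ (congrArg (fromFibPair f).2 (fib_d' (𝟙 Z) x y)).symm)
    refine Eq.trans ?_ (fromFibPair_apply' (Z := Z) (Z.d.2 x, x - Z.d.2 y)).symm
    dsimp only
    rw [map_add, map_sub, d_d', map_sub, map_sub, map_sub, map_sub, d_d', map_zero]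
    abel

/-- The map `fib (𝟙 Z) ⟶ Y` determined by a map `Z → Y` of degree zero. -/
def fromFib : fib (𝟙 Z) ⟶ Y := ⟨fromFibPair f, fromFibPair_mem hf, fromFibPair_comm⟩

end FromFib

/-- Forget the differential of Y and take the homotopy fibre of the identity: a map in 𝒜 of degree
zero extends freely to a chain map out of it. -/
lemma exists_contractible_surj (Y : DgA) :
    ∃ (P : DgA) (a : P ⟶ Y), Contractible P ∧ Surj (Hom.pair a) :=
  ⟨fib (𝟙 (triv Y.toAObj)), fromFib (Z := triv Y.toAObj) (one_mem Y.toAObj),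
    fib_id_contractible _,
    fun y => ⟨(y, 0), (fromFibPair_apply (Z := triv Y.toAObj) (f := one Y.toAObj) (y, 0)).trans (by
      change y + (Y.d.1 0 - 0) = y
      rw [map_zero, sub_zero, add_zero])⟩,
    fun y => ⟨(y, 0), (fromFibPair_apply' (Z := triv Y.toAObj) (f := one Y.toAObj) (y, 0)).trans (by
      change y + (Y.d.2 0 - 0) = y
      rw [map_zero, sub_zero, add_zero])⟩⟩

/-- Every map becomes surjective after adding a contractible summand to its source. -/
lemma exists_surj {X Y : DgA} (f : X ⟶ Y) :
    ∃ (W : DgA) (g : W ⟶ Y) (i : X ⟶ W), i ≫ g = f ∧ Surj (Hom.pair g) ∧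
      Inj (Hom.pair i) ∧ weakEquivalences DgA i := by
  obtain ⟨P, a, hP, ha⟩ := exists_contractible_surj Y
  let g : dprod P X ⟶ Y :=
    ⟨AObj.comp (Hom.pair a) (fst _ _) + AObj.comp (Hom.pair f) (snd _ _),
      add_mem (comp_mem (add_zero 0) (Hom.mem a) (fst_mem _ _))
        (comp_mem (add_zero 0) (Hom.mem f) (snd_mem _ _)),
      pairs_ext (fun x => by
        change Y.d.1 ((Hom.pair a).1 x.1 + (Hom.pair f).1 x.2) =
          (Hom.pair a).1 (P.d.1 x.1) + (Hom.pair f).1 (0 + X.d.1 x.2)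
        rw [map_add, d_apply, d_apply, zero_add])
      (fun x => by
        change Y.d.2 ((Hom.pair a).2 x.1 + (Hom.pair f).2 x.2) =
          (Hom.pair a).2 (P.d.2 x.1) + (Hom.pair f).2 (0 + X.d.2 x.2)
        rw [map_add, d_apply', d_apply', zero_add])⟩
  refine ⟨dprod P X, g, twistInr P X _ _, hom_ext (pairs_ext (fun x => ?_) (fun x => ?_)),
    ⟨fun y => ?_, fun y => ?_⟩, (twist_isSES P X _ _).inj,
    (twist_isSES P X _ _).weakEquivalence_left hP.acyclic⟩
  · change (Hom.pair a).1 0 + (Hom.pair f).1 x = _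
    rw [map_zero, zero_add]
  · change (Hom.pair a).2 0 + (Hom.pair f).2 x = _
    rw [map_zero, zero_add]
  · obtain ⟨x, rfl⟩ := ha.1 y
    refine ⟨(x, 0), ?_⟩
    change (Hom.pair a).1 x + (Hom.pair f).1 0 = _
    rw [map_zero, add_zero]
  · obtain ⟨x, rfl⟩ := ha.2 y
    refine ⟨(x, 0), ?_⟩
    change (Hom.pair a).2 x + (Hom.pair f).2 0 = _
    rw [map_zero, add_zero]

/-- Factorization of a map as a trivial cofibration followed by a fibration. -/
lemma exists_factorization' {X Y : DgA} (f : X ⟶ Y) :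
    ∃ (Z : DgA) (i : X ⟶ Z) (p : Z ⟶ Y), i ≫ p = f ∧ Inj (Hom.pair i) ∧
      weakEquivalences DgA i ∧ IsDivFib p := by
  obtain ⟨W, g, i, hig, hg, hi, hiw⟩ := exists_surj f
  obtain ⟨Z, j, p, hjp, hj, hjw, hp⟩ := exists_factorization_of_surj g hg
  exact ⟨Z, i ≫ j, p, by rw [Category.assoc, hjp, hig], ⟨hj.1.comp hi.1, hj.2.comp hi.2⟩,
    (weakEquivalences DgA).comp_mem _ _ hiw hjw, hp⟩

instance : MorphismProperty.HasFactorization (trivialCofibrations DgA) (fibrations DgA) where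
  nonempty_mapFactorizationData {X Y} f := by
    obtain ⟨Z, i, p, hip, hi, hiw, hp⟩ := exists_factorization' f
    exact ⟨{ Z := Z, i := i, p := p, fac := hip, hi := ⟨mono_of_inj i hi, hiw⟩,
             hp := hp.fibration }⟩

/-- A trivial fibration is a retract of a trivial fibration with divisible kernel. -/
lemma exists_retract_of_trivialFibration {X Y : DgA} (p : X ⟶ Y) (hp : fibrations DgA p)
    (hw : weakEquivalences DgA p) :
    ∃ (W : DgA) (π : W ⟶ Y), IsDivFib π ∧ weakEquivalences DgA π ∧ Nonempty (RetractArrow p π) := by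
  obtain ⟨J, i, hi, hinj, hJ, hJ'⟩ := exists_factorization p
  have h₁ := twistFst_isDivFib Y J (zero_mem _) (by simp) hJ
  have h₂ := (twist_isSES Y J (zero_mem _) (by simp)).weakEquivalence_right hJ'.acyclic
  -- By two out of three the cofibration is trivial, so p lifts against it and becomes a retract of
  -- the divisible fibration.
  have h₃ : weakEquivalences DgA i :=
    (weakEquivalences DgA).of_postcomp i (twistFst Y J _ _) h₂ (by rw [hi]; exact hw)
  have : HasLiftingProperty i p := hp i ⟨mono_of_inj i hinj, h₃⟩
  exact ⟨_, _, h₁, h₂, ⟨RetractArrow.ofRightLiftingProperty hi⟩⟩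

/-- A fibration is a retract of a fibration with divisible kernel. -/
lemma exists_retract_of_fibration {X Y : DgA} (p : X ⟶ Y) (hp : fibrations DgA p) :
    ∃ (W : DgA) (π : W ⟶ Y), IsDivFib π ∧ Nonempty (RetractArrow p π) := by
  obtain ⟨Z, i, π, hi, hinj, hw, hπ⟩ := exists_factorization' p
  have : HasLiftingProperty i p := hp i ⟨mono_of_inj i hinj, hw⟩
  exact ⟨_, _, hπ, ⟨RetractArrow.ofRightLiftingProperty hi⟩⟩

/-- The model structure on dg objects. -/
instance modelCategory : ModelCategory DgA where
  categoryWithFibrations := inferInstance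
  categoryWithCofibrations := inferInstance
  categoryWithWeakEquivalences := inferInstance
  cm3b := (inferInstance : (trivialCofibrations DgA).rlp.IsStableUnderRetracts)
  cm3c := (inferInstance : (MorphismProperty.monomorphisms DgA).IsStableUnderRetracts)
  cm4a i p hi hi' hp := (hp.mem : (trivialCofibrations DgA).rlp p) i ⟨hi.mem, hi'.mem⟩
  cm4b {A B X Y} i p hi hp hp' := by
    obtain ⟨W, π, hπ, hπw, ⟨r⟩⟩ := exists_retract_of_trivialFibration p hp.mem hp'.mem
    have : Mono i := hi.mem
    have := hπ.hasLiftingProperty hπw i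
    exact r.rightLiftingProperty i

end DgA

namespace DGMod

/-! #### Modules and their elements -/

/-- The criteria for monomorphisms and epimorphisms in homology are stated up to refinements of a
test object. Elements correspond to the test object ℚ. -/
lemma quasiIso_iff_elementwise {K L : ChainComplex (ModuleCat.{0} ℚ) ℤ} (f : K ⟶ L) :
    QuasiIso f ↔ ∀ i j k : ℤ, j + 1 = i → k + 1 = j →
      (∀ x : K.X j, K.d j k x = 0 → (∃ y : L.X i, L.d i j y = f.f j x) → ∃ z : K.X i, K.d i j z = x) ∧
      ∀ y : L.X j, L.d j k y = 0 → ∃ x : K.X j, K.d j k x = 0 ∧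
        ∃ z : L.X i, L.d i j z = f.f j x - y := by
  have key : QuasiIso f ↔ ∀ i j k : ℤ, j + 1 = i → k + 1 = j →
      Mono (HomologicalComplex.homologyMap f j) ∧ Epi (HomologicalComplex.homologyMap f j) := by
    rw [quasiIso_iff]
    constructor
    · intro h i j k _ _
      have := (quasiIsoAt_iff_isIso_homologyMap f j).1 (h j)
      exact ⟨inferInstance, inferInstance⟩
    · intro h j
      rw [quasiIsoAt_iff_isIso_homologyMap]
      have := (h _ j (j - 1) rfl (by omega)).1
      have := (h _ j (j - 1) rfl (by omega)).2
      exact isIso_of_mono_of_epi _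
  rw [key]
  refine forall_congr' fun i => forall_congr' fun j => forall_congr' fun k =>
    forall_congr' fun hij => forall_congr' fun hjk => ?_
  have hi : (ComplexShape.down ℤ).prev j = i := by simp [hij]
  have hk : (ComplexShape.down ℤ).next j = k := by simp; omega
  rw [HomologicalComplex.mono_homologyMap_iff_up_to_refinements f i j k hi hk,
    HomologicalComplex.epi_homologyMap_iff_up_to_refinements f i j k hi hk]
  refine and_congr ⟨fun h x hx ⟨y, hy⟩ => ?_, fun h A x hx y hy => ?_⟩
    ⟨fun h y hy => ?_, fun h A y hy => ?_⟩
  -- Apply the criterion to the maps ℚ → K, L given by x and y, and evaluate at a preimage of 1 in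
  -- the refinement.
  · obtain ⟨A', π, hπ, z, hz⟩ := h (ModuleCat.ofHom (LinearMap.toSpanSingleton ℚ (K.X j) x))
      (by ext; simpa using hx) (ModuleCat.ofHom (LinearMap.toSpanSingleton ℚ (L.X i) y))
      (by ext; simpa using hy.symm)
    obtain ⟨a, ha⟩ := (ModuleCat.epi_iff_surjective π).1 hπ (1 : ℚ)
    refine ⟨z a, ?_⟩
    have := ConcreteCategory.congr_hom hz a
    simp only [ModuleCat.comp_apply, ha] at this
    rw [← this]
    exact one_smul ℚ x
  -- The refinement is the space of all solutions over A; the statement about elements says that it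
  -- maps onto A.
  · let P : Submodule ℚ (A × K.X i) :=
      LinearMap.eqLocus (x.hom ∘ₗ LinearMap.fst ℚ A (K.X i)) ((K.d i j).hom ∘ₗ LinearMap.snd ℚ A (K.X i))
    refine ⟨ModuleCat.of ℚ P, ModuleCat.ofHom (LinearMap.fst ℚ A (K.X i) ∘ₗ P.subtype), ?_,
      ModuleCat.ofHom (LinearMap.snd ℚ A (K.X i) ∘ₗ P.subtype), ?_⟩
    · rw [ModuleCat.epi_iff_surjective]
      intro a
      obtain ⟨z, hz⟩ := h (x a) (ConcreteCategory.congr_hom hx a)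
        ⟨y a, (ConcreteCategory.congr_hom hy a).symm⟩
      exact ⟨⟨(a, z), hz.symm⟩, rfl⟩
    · exact ModuleCat.hom_ext (LinearMap.ext fun p => p.2)
  · obtain ⟨A', π, hπ, x, hx, z, hz⟩ := h (ModuleCat.ofHom (LinearMap.toSpanSingleton ℚ (L.X j) y))
      (by ext; simpa using hy)
    obtain ⟨a, ha⟩ := (ModuleCat.epi_iff_surjective π).1 hπ (1 : ℚ)
    have := ConcreteCategory.congr_hom hz a
    simp only [ModuleCat.comp_apply, ha] at this
    refine ⟨x a, ConcreteCategory.congr_hom hx a, - z a, ?_⟩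
    have h1 : y = f.f j (x a) + L.d i j (z a) := (one_smul ℚ y).symm.trans this
    rw [map_neg, h1]
    abel
  · let P : Submodule ℚ (A × K.X j × L.X i) :=
      LinearMap.ker ((K.d j k).hom ∘ₗ LinearMap.fst ℚ _ _ ∘ₗ LinearMap.snd ℚ A (K.X j × L.X i)) ⊓
      LinearMap.eqLocus (y.hom ∘ₗ LinearMap.fst ℚ A (K.X j × L.X i))
        (((f.f j).hom.coprod (L.d i j).hom) ∘ₗ LinearMap.snd ℚ A (K.X j × L.X i))
    refine ⟨ModuleCat.of ℚ P, ModuleCat.ofHom (LinearMap.fst ℚ A (K.X j × L.X i) ∘ₗ P.subtype), ?_,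
      ModuleCat.ofHom (LinearMap.fst ℚ _ _ ∘ₗ LinearMap.snd ℚ A (K.X j × L.X i) ∘ₗ P.subtype), ?_,
      ModuleCat.ofHom (LinearMap.snd ℚ _ _ ∘ₗ LinearMap.snd ℚ A (K.X j × L.X i) ∘ₗ P.subtype), ?_⟩
    · rw [ModuleCat.epi_iff_surjective]
      intro a
      obtain ⟨x, hx, z, hz⟩ := h (y a) (ConcreteCategory.congr_hom hy a)
      refine ⟨⟨(a, x, -z), hx, ?_⟩, rfl⟩
      change y a = f.f j x + L.d i j (-z)
      rw [map_neg, hz]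
      abel
    · exact ModuleCat.hom_ext (LinearMap.ext fun p => p.2.1)
    · exact ModuleCat.hom_ext (LinearMap.ext fun p => p.2.2)

variable {G : Type} {R : DGRing G}

/-- The elements of degree `n` of a module at the object `a`. -/
abbrev El (M : DGMod R) (a : G) (n : ℤ) : Type := (M.obj a).X n

/-- The differential of a module. -/
abbrev dl (M : DGMod R) (a : G) (i j : ℤ) : El M a i →ₗ[ℚ] El M a j := ((M.obj a).d i j).hom

/-- The linear maps that underlie a morphism of modules. -/
abbrev ap {M N : DGMod R} (f : M ⟶ N) (a : G) (n : ℤ) : El M a n →ₗ[ℚ] El N a n :=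
  ((Hom.app f a).f n).hom

/-! ### Morphisms of modules in terms of elements -/

section Basic

variable {M N P : DGMod R}

lemma dl_dl (a : G) (i j k : ℤ) (x : El M a i) : dl M a j k (dl M a i j x) = 0 :=
  ConcreteCategory.congr_hom ((M.obj a).d_comp_d i j k) x

lemma dl_shape (M : DGMod R) (a : G) {i j : ℤ} (h : j + 1 ≠ i) : dl M a i j = 0 :=
  congrArg ModuleCat.Hom.hom ((M.obj a).shape i j h)

lemma dl_act {a b : G} {p q n p' q' n' : ℤ} (h : p + q = n) (h₁ : p' + q = n')
    (h₂ : p + q' = n') (h₃ : n' + 1 = n) (m : El M b p) (g : (R.hom a b).X q) :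
    dl M a n n' (M.act h m g) =
      M.act h₁ (dl M b p p' m) g + sgn p • M.act h₂ m ((R.hom a b).d q q' g) :=
  M.leibniz h h₁ h₂ h₃ m g

lemma ap_dl (f : M ⟶ N) (a : G) (i j : ℤ) (x : El M a i) :
    ap f a j (dl M a i j x) = dl N a i j (ap f a i x) :=
  (ConcreteCategory.congr_hom ((Hom.app f a).comm i j) x).symm

lemma ap_act (f : M ⟶ N) {a b : G} {p q n : ℤ} (h : p + q = n) (m : El M b p)
    (g : (R.hom a b).X q) : ap f a n (M.act h m g) = N.act h (ap f b p m) g :=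
  Hom.app_act f h m g

lemma ap_id (a : G) (n : ℤ) (x : El M a n) : ap (𝟙 M) a n x = x := rfl

lemma ap_comp (f : M ⟶ N) (g : N ⟶ P) (a : G) (n : ℤ) (x : El M a n) :
    ap (f ≫ g) a n x = ap g a n (ap f a n x) := rfl

lemma hom_ext {f g : M ⟶ N} (h : ∀ a n x, ap f a n x = ap g a n x) : f = g :=
  Hom.ext (funext fun a => HomologicalComplex.hom_ext _ _ fun n =>
    ModuleCat.hom_ext (LinearMap.ext (h a n)))

/-- A morphism of modules from its underlying linear maps. -/
def homMk (φ : ∀ a n, El M a n →ₗ[ℚ] El N a n)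
    (hd : ∀ a i j, j + 1 = i → ∀ x, φ a j (dl M a i j x) = dl N a i j (φ a i x))
    (hact : ∀ {a b : G} {p q n : ℤ} (h : p + q = n) (m : El M b p) (g : (R.hom a b).X q),
      φ a n (M.act h m g) = N.act h (φ b p m) g) : M ⟶ N where
  app a :=
    { f := fun n => ModuleCat.ofHom (φ a n)
      comm' := fun i j h => ModuleCat.hom_ext (LinearMap.ext fun x => (hd a i j h x).symm) }
  app_act h m g := hact h m g

lemma weakEquivalence_iff (f : M ⟶ N) : WeakEquivalence f ↔ ∀ a, ∀ i j k : ℤ, j + 1 = i → k + 1 = j →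
    (∀ x : El M a j, dl M a j k x = 0 → (∃ y, dl N a i j y = ap f a j x) → ∃ z, dl M a i j z = x) ∧
      ∀ y : El N a j, dl N a j k y = 0 → ∃ x, dl M a j k x = 0 ∧ ∃ z, dl N a i j z = ap f a j x - y :=
  (HomotopicalAlgebra.weakEquivalence_iff f).trans
    (forall_congr' fun a => quasiIso_iff_elementwise (Hom.app f a))

instance : (weakEquivalences (DGMod R)).HasTwoOutOfThreeProperty where
  comp_mem f g hf hg a := by
    have := hf a
    have := hg a
    exact quasiIso_comp (Hom.app f a) (Hom.app g a)
  of_postcomp f g hg hfg a := by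
    have := hg a
    have : QuasiIso (Hom.app f a ≫ Hom.app g a) := hfg a
    exact quasiIso_of_comp_right (Hom.app f a) (Hom.app g a)
  of_precomp f g hf hfg a := by
    have := hf a
    have : QuasiIso (Hom.app f a ≫ Hom.app g a) := hfg a
    exact quasiIso_of_comp_left (Hom.app f a) (Hom.app g a)

/-- Evaluation at an object. -/
def evalFunctor (a : G) : DGMod R ⥤ ChainComplex (ModuleCat.{0} ℚ) ℤ where
  obj M := M.obj a
  map f := Hom.app f a

instance : (weakEquivalences (DGMod R)).IsStableUnderRetracts where
  of_retract {_ _ _ _ f g} h hg a := by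
    have : QuasiIso ((evalFunctor a).map (Arrow.mk g).hom) := hg a
    exact quasiIso_of_retractArrow (Retract.map h (evalFunctor a).mapArrow)

/-- The additive group of morphisms. -/
def homSubgroup (M N : DGMod R) : AddSubgroup (∀ a, M.obj a ⟶ N.obj a) where
  carrier := {φ | ∀ {a b : G} {p q n : ℤ} (h : p + q = n) (m : El M b p) (g : (R.hom a b).X q),
    (φ a).f n (M.act h m g) = N.act h ((φ b).f p m) g}
  zero_mem' := by
    intro a b p q n h m g
    change (0 : El N a n) = N.act h (0 : El N b p) g
    rw [map_zero, LinearMap.zero_apply]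
  add_mem' {φ ψ} hφ hψ := by
    intro a b p q n h m g
    change (φ a).f n (M.act h m g) + (ψ a).f n (M.act h m g) =
      N.act h ((φ b).f p m + (ψ b).f p m) g
    rw [map_add, LinearMap.add_apply, hφ, hψ]
  neg_mem' {φ} hφ := by
    intro a b p q n h m g
    change - (φ a).f n (M.act h m g) = N.act h (- (φ b).f p m) g
    rw [map_neg, LinearMap.neg_apply, hφ]

/-- Morphisms form an additive group. -/
def homEquiv (M N : DGMod R) : (M ⟶ N) ≃ homSubgroup M N where
  toFun f := ⟨Hom.app f, Hom.app_act f⟩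
  invFun f := ⟨f.1, f.2⟩
  left_inv _ := rfl
  right_inv _ := rfl

instance : AddCommGroup (M ⟶ N) := (homEquiv M N).addCommGroup

lemma ap_add (f g : M ⟶ N) (a : G) (n : ℤ) (x : El M a n) :
    ap (f + g) a n x = ap f a n x + ap g a n x := rfl
lemma ap_sub (f g : M ⟶ N) (a : G) (n : ℤ) (x : El M a n) :
    ap (f - g) a n x = ap f a n x - ap g a n x := rfl
lemma ap_zero (a : G) (n : ℤ) (x : El M a n) : ap (0 : M ⟶ N) a n x = 0 := rfl

instance : Preadditive (DGMod R) where
  add_comp _ _ _ f f' g := hom_ext fun a n x => by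
    rw [ap_comp, ap_add, map_add, ap_add, ap_comp, ap_comp]
  comp_add _ _ _ f g g' := hom_ext fun a n x => by
    rw [ap_comp, ap_add, ap_add, ap_comp, ap_comp]

end Basic

/-! ### Submodules, quotients, kernels and cokernels of modules -/

section Constructions

variable {M N : DGMod R}

/-- A module from its underlying vector spaces. -/
abbrev ofData (A : G → ℤ → Type) [∀ a n, AddCommGroup (A a n)] [∀ a n, Module ℚ (A a n)]
    (d : ∀ a i j, A a i →ₗ[ℚ] A a j) (shape : ∀ a i j, j + 1 ≠ i → d a i j = 0)
    (dd : ∀ a i j k x, d a j k (d a i j x) = 0)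
    (act : ∀ {a b : G} {p q n : ℤ}, p + q = n → (A b p →ₗ[ℚ] (R.hom a b).X q →ₗ[ℚ] A a n))
    (act_one : ∀ {a : G} {p : ℤ} (m : A a p), act (add_zero p) m (R.one a) = m)
    (act_comp : ∀ {a b c : G} {p q r pq qr n : ℤ} (hpq : p + q = pq) (hqr : q + r = qr)
      (h : pq + r = n) (h' : p + qr = n) (m : A c p) (g : (R.hom b c).X q)
      (k : (R.hom a b).X r), act h (act hpq m g) k = act h' m (R.comp hqr g k))
    (leibniz : ∀ {a b : G} {p q n p' q' n' : ℤ} (h : p + q = n) (h₁ : p' + q = n')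
      (h₂ : p + q' = n') (_ : n' + 1 = n) (m : A b p) (g : (R.hom a b).X q),
      d a n n' (act h m g) =
        act h₁ (d b p p' m) g + sgn p • act h₂ m ((R.hom a b).d q q' g)) : DGMod R where
  obj a :=
    { X := fun n => ModuleCat.of ℚ (A a n)
      d := fun i j => ModuleCat.ofHom (d a i j)
      shape := fun i j h => ModuleCat.hom_ext (shape a i j h)
      d_comp_d' := fun i j k _ _ => ModuleCat.hom_ext (LinearMap.ext fun x => dd a i j k x) }
  act h := act h
  act_one m := act_one m
  act_comp hpq hqr h h' m g k := act_comp hpq hqr h h' m g k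
  leibniz h h₁ h₂ h₃ m g := leibniz h h₁ h₂ h₃ m g

/-- A submodule: a family of subspaces closed under differential and action. -/
structure Sub (M : DGMod R) where
  S : ∀ a n, Submodule ℚ (El M a n)
  d_mem : ∀ a i j, ∀ x ∈ S a i, dl M a i j x ∈ S a j
  act_mem : ∀ {a b : G} {p q n : ℤ} (h : p + q = n) (m : El M b p) (g : (R.hom a b).X q),
    m ∈ S b p → M.act h m g ∈ S a n

/-- The module structure of a submodule. -/
def Sub.toDGMod (S : Sub M) : DGMod R :=
  ofData (fun a n => S.S a n) (fun a i j => (dl M a i j).restrict (S.d_mem a i j))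
    (fun a i j h => LinearMap.ext fun x => Subtype.ext (LinearMap.congr_fun (dl_shape M a h) x.1))
    (fun a i j k x => Subtype.ext (dl_dl a i j k x.1))
    (fun {a b p q n} h => LinearMap.mk₂ ℚ (fun m g => ⟨M.act h m.1 g, S.act_mem h _ _ m.2⟩)
      (fun m m' g => Subtype.ext (by simp)) (fun c m g => Subtype.ext (by simp))
      (fun m g g' => Subtype.ext (by simp)) (fun c m g => Subtype.ext (by simp)))
    (fun m => Subtype.ext (M.act_one m.1))
    (fun hpq hqr h h' m g k => Subtype.ext (M.act_comp hpq hqr h h' m.1 g k))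
    (fun h h₁ h₂ h₃ m g => Subtype.ext (M.leibniz h h₁ h₂ h₃ m.1 g))

/-- The inclusion of a submodule. -/
def Sub.ι (S : Sub M) : S.toDGMod ⟶ M :=
  homMk (fun a n => (S.S a n).subtype) (fun _ _ _ _ _ => rfl) (fun _ _ _ => rfl)

/-- The quotient by a submodule. -/
def Sub.quo (S : Sub M) : DGMod R :=
  ofData (fun a n => El M a n ⧸ S.S a n)
    (fun a i j => Submodule.mapQ _ _ (dl M a i j) (S.d_mem a i j))
    (fun a i j h => Submodule.linearMap_qext _ (LinearMap.ext fun x => by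
      change Submodule.Quotient.mk (dl M a i j x) = 0
      rw [dl_shape M a h]
      rfl))
    (fun a i j k x => by
      obtain ⟨x, rfl⟩ := Submodule.Quotient.mk_surjective _ x
      change Submodule.Quotient.mk (dl M a j k (dl M a i j x)) = 0
      rw [dl_dl]
      rfl)
    (fun {a b p q n} h => Submodule.liftQ (S.S b p) ((M.act h).compr₂ (S.S a n).mkQ)
      (fun m hm => LinearMap.ext fun g =>
        (Submodule.Quotient.mk_eq_zero _).2 (S.act_mem h m g hm)))
    (fun m => by
      obtain ⟨m, rfl⟩ := Submodule.Quotient.mk_surjective _ m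
      exact congrArg Submodule.Quotient.mk (M.act_one m))
    (fun hpq hqr h h' m g k => by
      obtain ⟨m, rfl⟩ := Submodule.Quotient.mk_surjective _ m
      exact congrArg Submodule.Quotient.mk (M.act_comp hpq hqr h h' m g k))
    (fun h h₁ h₂ h₃ m g => by
      obtain ⟨m, rfl⟩ := Submodule.Quotient.mk_surjective _ m
      exact congrArg Submodule.Quotient.mk (M.leibniz h h₁ h₂ h₃ m g))

/-- The projection to the quotient by a submodule. -/
def Sub.π (S : Sub M) : M ⟶ S.quo :=
  homMk (fun a n => (S.S a n).mkQ) (fun _ _ _ _ _ => rfl) (fun _ _ _ => rfl)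

lemma Sub.π_surjective (S : Sub M) (a : G) (n : ℤ) : Function.Surjective (ap S.π a n) :=
  Submodule.mkQ_surjective _

lemma Sub.π_eq_zero_iff (S : Sub M) {a : G} {n : ℤ} {x : El M a n} : ap S.π a n x = 0 ↔ x ∈ S.S a n :=
  Submodule.Quotient.mk_eq_zero _

/-- The kernel of a morphism. -/
def kerSub (f : M ⟶ N) : Sub M where
  S a n := LinearMap.ker (ap f a n)
  d_mem a i j x hx := by
    rw [LinearMap.mem_ker] at hx ⊢
    rw [ap_dl, hx, map_zero]
  act_mem h m g hm := by
    rw [LinearMap.mem_ker] at hm ⊢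
    rw [ap_act, hm, map_zero, LinearMap.zero_apply]

/-- The image of a morphism. -/
def rangeSub (f : M ⟶ N) : Sub N where
  S a n := LinearMap.range (ap f a n)
  d_mem := by
    rintro a i j _ ⟨x, rfl⟩
    exact ⟨dl M a i j x, ap_dl f a i j x⟩
  act_mem := by
    rintro a b p q n h _ g ⟨m, rfl⟩
    exact ⟨M.act h m g, ap_act f h m g⟩

lemma exists_lift_of_exact {A B C T : DGMod R} {f : A ⟶ B} {g : B ⟶ C}
    (hf : ∀ a n, Function.Injective (ap f a n))
    (hfg : ∀ a n y, ap g a n y = 0 → ∃ x, ap f a n x = y) (t : T ⟶ B) (ht : t ≫ g = 0) :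
    ∃ s : T ⟶ A, s ≫ f = t := by
  have h0 : ∀ a n x, ∃ y, ap f a n y = ap t a n x := fun a n x => hfg a n _ (by
    rw [← ap_comp, ht, ap_zero])
  choose φ hφ using h0
  refine ⟨homMk (fun a n => {
      toFun := φ a n
      map_add' := fun x y => hf a n ?_
      map_smul' := fun c x => hf a n ?_ })
    (fun a i j h x => hf a j ?_) (fun {a b p q n} h m g => hf a n ?_), hom_ext fun a n x => hφ a n x⟩
  · rw [hφ, map_add, map_add, hφ, hφ]
  · rw [hφ, map_smul, RingHom.id_apply, map_smul, hφ]
  · change ap f a j (φ a j _) = ap f a j (dl A a i j (φ a i x))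
    rw [hφ, ap_dl, ap_dl, hφ]
  · change ap f a n (φ a n _) = ap f a n (A.act h (φ b p m) g)
    rw [hφ, ap_act, ap_act, hφ]

lemma exists_desc_of_exact {A B C T : DGMod R} {f : A ⟶ B} {g : B ⟶ C}
    (hg : ∀ a n, Function.Surjective (ap g a n))
    (hfg : ∀ a n y, ap g a n y = 0 → ∃ x, ap f a n x = y) (t : B ⟶ T) (ht : f ≫ t = 0) :
    ∃ s : C ⟶ T, g ≫ s = t := by
  have key : ∀ a n x y, ap g a n x = ap g a n y → ap t a n x = ap t a n y := by
    intro a n x y h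
    obtain ⟨z, hz⟩ := hfg a n (x - y) (by rw [map_sub, h, sub_self])
    rw [← sub_eq_zero, ← map_sub, ← hz, ← ap_comp, ht, ap_zero]
  choose σ hσ using hg
  refine ⟨homMk (fun a n => {
      toFun := fun x => ap t a n (σ a n x)
      map_add' := fun x y => ?_
      map_smul' := fun c x => ?_ }) (fun a i j h x => ?_) (fun {a b p q n} h m k => ?_), hom_ext fun a n x => ?_⟩
  · rw [← map_add]; apply key; rw [hσ, map_add, hσ, hσ]
  · rw [RingHom.id_apply, ← map_smul]; apply key; rw [hσ, map_smul, hσ]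
  · change ap t a j (σ a j _) = dl T a i j (ap t a i (σ a i x))
    rw [← ap_dl]; apply key; rw [hσ, ap_dl, hσ]
  · change ap t a n (σ a n _) = T.act h (ap t b p (σ b p m)) k
    rw [← ap_act]; apply key; rw [hσ, ap_act, hσ]
  · exact key a n _ _ (hσ a n _)

lemma Sub.ι_comp_eq_zero (f : M ⟶ N) : (kerSub f).ι ≫ f = 0 :=
  hom_ext fun a n x => x.2

lemma rangeSub_comp (f : M ⟶ N) : f ≫ (rangeSub f).π = 0 :=
  hom_ext fun a n x => ((rangeSub f).π_eq_zero_iff).2 ⟨x, rfl⟩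

lemma mono_of_injective {f : M ⟶ N} (h : ∀ a n, Function.Injective (ap f a n)) : Mono f :=
  ⟨fun u v huv => hom_ext fun a n x => h a n (by rw [← ap_comp, huv, ap_comp])⟩

lemma epi_of_surjective {f : M ⟶ N} (h : ∀ a n, Function.Surjective (ap f a n)) : Epi f :=
  ⟨fun u v huv => hom_ext fun a n y => by
    obtain ⟨x, rfl⟩ := h a n y
    rw [← ap_comp, huv, ap_comp]⟩

/-- An epimorphism has zero projection to its cokernel. So fibrations of modules are the surjections
in each degree. -/
lemma epi_iff_surjective {f : M ⟶ N} : Epi f ↔ ∀ a n, Function.Surjective (ap f a n) := by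
  refine ⟨fun h a n y => ?_, epi_of_surjective⟩
  have : (rangeSub f).π = 0 := by
    rw [← cancel_epi f, rangeSub_comp, Limits.comp_zero]
  have h0 : ap (rangeSub f).π a n y = 0 := by rw [this, ap_zero]
  exact ((rangeSub f).π_eq_zero_iff).1 h0

instance : Limits.HasKernels (DGMod R) where
  has_limit {M N} f := by
    have hl := fun {T : DGMod R} (t : T ⟶ M) (ht : t ≫ f = 0) =>
      exists_lift_of_exact (f := (kerSub f).ι) (g := f) (fun a n => Subtype.val_injective)
        (fun a n y hy => ⟨⟨y, hy⟩, rfl⟩) t ht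
    have hm : Mono (kerSub f).ι := mono_of_injective fun a n => Subtype.val_injective
    exact ⟨⟨⟨_, Limits.KernelFork.IsLimit.ofι (kerSub f).ι (Sub.ι_comp_eq_zero f)
      (fun t ht => (hl t ht).choose) (fun t ht => (hl t ht).choose_spec)
      (fun t ht m h => by rw [← cancel_mono (kerSub f).ι, h, (hl t ht).choose_spec])⟩⟩⟩

instance : Limits.HasCokernels (DGMod R) where
  has_colimit {M N} f := by
    have hl := fun {T : DGMod R} (t : N ⟶ T) (ht : f ≫ t = 0) =>
      exists_desc_of_exact (f := f) (g := (rangeSub f).π) (rangeSub f).π_surjective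
        (fun a n y hy => ((rangeSub f).π_eq_zero_iff).1 hy) t ht
    have hm : Epi (rangeSub f).π := epi_of_surjective (rangeSub f).π_surjective
    exact ⟨⟨⟨_, Limits.CokernelCofork.IsColimit.ofπ (rangeSub f).π (rangeSub_comp f)
      (fun t ht => (hl t ht).choose) (fun t ht => (hl t ht).choose_spec)
      (fun t ht m h => by rw [← cancel_epi (rangeSub f).π, h, (hl t ht).choose_spec])⟩⟩⟩

end Constructions

/-! ### Direct sums of modules -/

section Sum

variable {ι : Type} (X : ι → DGMod R)

/-- The underlying vector spaces of a direct sum. -/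
abbrev SumEl (a : G) (n : ℤ) : Type := DirectSum ι fun i => El (X i) a n

open Classical in
/-- The inclusion of a summand. -/
def sumIn (a : G) (n : ℤ) (i : ι) : El (X i) a n →ₗ[ℚ] SumEl X a n :=
  DirectSum.lof ℚ ι (fun i => El (X i) a n) i

open Classical in
/-- The linear map out of a direct sum with given components. -/
def sumOut {T : Type} [AddCommGroup T] [Module ℚ T] {a : G} {n : ℤ} (f : ∀ i, El (X i) a n →ₗ[ℚ] T) :
    SumEl X a n →ₗ[ℚ] T :=
  DirectSum.toModule ℚ ι T f

variable {X} in
lemma sumOut_in {T : Type} [AddCommGroup T] [Module ℚ T] {a : G} {n : ℤ}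
    (f : ∀ i, El (X i) a n →ₗ[ℚ] T) (i : ι) (x : El (X i) a n) :
    sumOut X f (sumIn X a n i x) = f i x := by
  classical exact DirectSum.toModule_lof ℚ (φ := f) i x

variable {X} in
lemma sumEl_hom_ext {T : Type} [AddCommGroup T] [Module ℚ T] {a : G} {n : ℤ} {f g : SumEl X a n →ₗ[ℚ] T}
    (h : ∀ i x, f (sumIn X a n i x) = g (sumIn X a n i x)) (x : SumEl X a n) : f x = g x := by
  classical exact LinearMap.congr_fun (DirectSum.linearMap_ext _ fun i => LinearMap.ext (h i)) x

/-- The direct sum of a family of modules. -/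
def sum : DGMod R :=
  ofData (SumEl X)
    (fun a i j => sumOut X fun k => sumIn X a j k ∘ₗ dl (X k) a i j)
    (fun a i j h => LinearMap.ext <| sumEl_hom_ext fun k x => by
      rw [sumOut_in, dl_shape (X k) a h, LinearMap.comp_zero]
      rfl)
    (fun a i j k x => by
      refine sumEl_hom_ext (f := (sumOut X fun l => sumIn X a k l ∘ₗ dl (X l) a j k) ∘ₗ
        (sumOut X fun l => sumIn X a j l ∘ₗ dl (X l) a i j)) (g := 0) (fun l x => ?_) x
      rw [LinearMap.comp_apply, sumOut_in, LinearMap.comp_apply, sumOut_in, LinearMap.comp_apply, dl_dl, map_zero]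
      rfl)
    (fun {a b p q n} h => sumOut X fun i => ((X i).act h).compr₂ (sumIn X a n i))
    (fun {a p} m => by
      refine sumEl_hom_ext (f := LinearMap.flip
        (sumOut X fun i => ((X i).act (add_zero p)).compr₂ (sumIn X a p i)) (R.one a))
        (g := LinearMap.id) (fun l x => ?_) m
      rw [LinearMap.flip_apply, sumOut_in, LinearMap.compr₂_apply, (X l).act_one]
      rfl)
    (fun {a b c p q r pq qr n} hpq hqr h h' m g k => by
      refine sumEl_hom_ext (f := LinearMap.flip
        (sumOut X fun i => ((X i).act h).compr₂ (sumIn X a n i)) k ∘ₗ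
        LinearMap.flip (sumOut X fun i => ((X i).act hpq).compr₂ (sumIn X b pq i)) g)
        (g := LinearMap.flip (sumOut X fun i => ((X i).act h').compr₂ (sumIn X a n i))
          (R.comp hqr g k)) (fun l x => ?_) m
      rw [LinearMap.comp_apply, LinearMap.flip_apply, LinearMap.flip_apply, sumOut_in,
        LinearMap.compr₂_apply, sumOut_in, LinearMap.compr₂_apply, (X l).act_comp hpq hqr h h',
        LinearMap.flip_apply, sumOut_in, LinearMap.compr₂_apply])
    (fun {a b p q n p' q' n'} h h₁ h₂ h₃ m g => by
      refine sumEl_hom_ext (f := (sumOut X fun k => sumIn X a n' k ∘ₗ dl (X k) a n n') ∘ₗ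
        LinearMap.flip (sumOut X fun i => ((X i).act h).compr₂ (sumIn X a n i)) g)
        (g := LinearMap.flip (sumOut X fun i => ((X i).act h₁).compr₂ (sumIn X a n' i)) g ∘ₗ
          (sumOut X fun k => sumIn X b p' k ∘ₗ dl (X k) b p p') +
          sgn p • LinearMap.flip (sumOut X fun i => ((X i).act h₂).compr₂ (sumIn X a n' i))
            ((R.hom a b).d q q' g)) (fun l x => ?_) m
      rw [LinearMap.comp_apply, LinearMap.flip_apply, sumOut_in, LinearMap.compr₂_apply, sumOut_in,
        LinearMap.comp_apply, dl_act h h₁ h₂ h₃, LinearMap.add_apply, LinearMap.comp_apply,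
        LinearMap.flip_apply, sumOut_in, LinearMap.comp_apply, sumOut_in, LinearMap.compr₂_apply,
        LinearMap.smul_apply, LinearMap.flip_apply, sumOut_in, LinearMap.compr₂_apply, map_add, map_smul])

/-- The inclusion of a summand. -/
def sumι (i : ι) : X i ⟶ sum X :=
  homMk (fun a n => sumIn X a n i)
    (fun a k j h x => (sumOut_in (fun l => sumIn X a j l ∘ₗ dl (X l) a k j) i x).symm)
    (fun {a b p q n} h m g => (LinearMap.congr_fun (sumOut_in
      (fun i => ((X i).act h).compr₂ (sumIn X a n i)) i m) g).symm)

lemma sum_induction {a : G} {n : ℤ} (p : El (sum X) a n → Prop) (x : El (sum X) a n) (h0 : p 0)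
    (hι : ∀ i y, p (ap (sumι X i) a n y)) (hadd : ∀ x y, p x → p y → p (x + y)) : p x := by
  classical exact DirectSum.induction_on (β := fun i => El (X i) a n) (motive := p) x h0 hι hadd

lemma sum_ext {T : DGMod R} {f g : sum X ⟶ T} (h : ∀ i, sumι X i ≫ f = sumι X i ≫ g) : f = g := by
  refine hom_ext fun a n x => sumEl_hom_ext (f := ap f a n) (g := ap g a n) (fun i x => ?_) x
  exact congrArg (fun k => ap k a n x) (h i)

lemma exists_sum_desc {T : DGMod R} (f : ∀ i, X i ⟶ T) : ∃ g : sum X ⟶ T, ∀ i, sumι X i ≫ g = f i := by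
  let φ : ∀ a n, El (sum X) a n →ₗ[ℚ] El T a n := fun a n => sumOut X fun i => ap (f i) a n
  have hφ : ∀ a n i y, φ a n (ap (sumι X i) a n y) = ap (f i) a n y := fun a n i y =>
    sumOut_in (fun i => ap (f i) a n) i y
  refine ⟨homMk φ (fun a i j h x => ?_) (fun {a b p q n} h m g => ?_), fun i => hom_ext fun a n x => hφ a n i x⟩
  · refine sum_induction X (fun x => φ a j (dl (sum X) a i j x) = dl T a i j (φ a i x)) x
      (by simp only [map_zero]) (fun k y => ?_)
      (fun x y hx hy => by rw [map_add, map_add, map_add, map_add, hx, hy])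
    rw [← ap_dl, hφ, hφ, ap_dl]
  · refine sum_induction X (fun m => φ a n ((sum X).act h m g) = T.act h (φ b p m) g) m
      (by simp only [map_zero, LinearMap.zero_apply]) (fun k y => ?_)
      (fun x y hx hy => by
        rw [map_add, LinearMap.add_apply, map_add, map_add, map_add, LinearMap.add_apply, hx, hy])
    rw [← ap_act, hφ, hφ, ap_act]

instance : Limits.HasCoproducts.{0} (DGMod R) :=
  Limits.hasCoproducts_of_colimit_cofans (fun X => Limits.Cofan.mk (sum X) (sumι X)) fun X =>
    Limits.Cofan.IsColimit.mk _ (fun t => (exists_sum_desc X t.inj).choose)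
      (fun t i => (exists_sum_desc X t.inj).choose_spec i)
      (fun t m h => sum_ext X fun i => (h i).trans ((exists_sum_desc X t.inj).choose_spec i).symm)

instance : Limits.HasFiniteLimits (DGMod R) := hasFiniteLimits_of_hasKernels (DGMod R)
instance : Limits.HasFiniteColimits (DGMod R) := hasFiniteColimits_of_hasCokernels (DGMod R)

end Sum

end DGMod


namespace DgA

open AObj

/-! #### Spheres and disks -/

lemma sgn_neg (n : ℤ) : sgn (-n) = sgn n := by simp [sgn]

lemma sgn_one_sub (n : ℤ) : sgn (1 - n) = - sgn n := by
  rw [sub_eq_add_neg, sgn_add, sgn_one, sgn_neg, neg_one_mul]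

/-- An object that is isomorphic to `X` by a cycle of degree `n`. -/
structure Sphere (X : DgA) (n : ℤ) where
  Z : DgA
  u : Pairs X.toAObj Z.toAObj
  w : Pairs Z.toAObj X.toAObj
  u_mem : u ∈ homDeg X.toAObj Z.toAObj n
  w_mem : w ∈ homDeg Z.toAObj X.toAObj (-n)
  wu : AObj.comp w u = one X.toAObj
  uw : AObj.comp u w = one Z.toAObj
  diff_u : diff X Z n u = 0

/-- The suspension, as a sphere. -/
def sphere (X : DgA) (n : ℤ) : Sphere X n where
  Z := susp X n
  u := toSusp _ _
  w := ofSusp _ _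
  u_mem := toSusp_mem _ _
  w_mem := ofSusp_mem _ _
  wu := rfl
  uw := rfl
  diff_u := sub_self (sgn n • X.d)

/-- Differentiate w u = 1 and cancel the isomorphism u. -/
lemma Sphere.diff_w {X : DgA} {n : ℤ} (S : Sphere X n) : diff S.Z X (-n) S.w = 0 := by
  have h := diff_comp (neg_add_cancel n) S.w S.u
  rw [S.wu, S.diff_u, map_zero, smul_zero, add_zero] at h
  have h1 : diff X X 0 (one X.toAObj) = 0 := ((homEquiv X X) (𝟙 X)).2.2
  rw [h1] at h
  rw [← comp_one (diff S.Z X (-n) S.w), ← S.uw, ← AObj.comp_assoc, ← h, map_zero, LinearMap.zero_apply]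

/-- An object that is freely generated by an element of degree `n` over `X`. -/
structure Disk (X : DgA) (n : ℤ) where
  Z : DgA
  u : Pairs X.toAObj Z.toAObj
  w₀ : Pairs Z.toAObj X.toAObj
  w₁ : Pairs Z.toAObj X.toAObj
  u_mem : u ∈ homDeg X.toAObj Z.toAObj n
  w₀_mem : w₀ ∈ homDeg Z.toAObj X.toAObj (-n)
  w₁_mem : w₁ ∈ homDeg Z.toAObj X.toAObj (1 - n)
  w₀u : AObj.comp w₀ u = one X.toAObj
  w₁u : AObj.comp w₁ u = 0
  w₀du : AObj.comp w₀ (diff X Z n u) = 0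
  w₁du : AObj.comp w₁ (diff X Z n u) = one X.toAObj
  uw : AObj.comp u w₀ + AObj.comp (diff X Z n u) w₁ = one Z.toAObj
  diff_w₀ : diff Z X (-n) w₀ = 0
  diff_w₁ : diff Z X (1 - n) w₁ = sgn n • w₀

/-! ### The homotopy fibre of the identity as a disk -/

section FibId

variable {X Z : DgA} {n : ℤ}

lemma diff_fib_inl {u : Pairs X.toAObj Z.toAObj} (hu : diff X Z n u = 0) :
    diff X (fib (𝟙 Z)) n (AObj.comp (inl Z.toAObj (Z.susp (-1)).toAObj) u) =
      AObj.comp (inr Z.toAObj (Z.susp (-1)).toAObj) (AObj.comp (toSusp Z.toAObj (-1)) u) := by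
  have h : diff Z (fib (𝟙 Z)) 0 (inl Z.toAObj (Z.susp (-1)).toAObj) =
      AObj.comp (inr Z.toAObj (Z.susp (-1)).toAObj) (toSusp Z.toAObj (-1)) := by
    rw [diff_apply, sgn_zero, one_smul]
    refine pairs_ext (fun x => ?_) (fun x => ?_)
    · refine (congrArg (· - ((Z.d.1 x, 0) : Z.nub × Z.nub)) (fib_d (𝟙 Z) x 0)).trans ?_
      refine Prod.ext (sub_self (Z.d.1 x)) ?_
      change x - Z.d.1 0 - 0 = x
      rw [map_zero, sub_zero, sub_zero]
    · refine (congrArg (· - ((Z.d.2 x, 0) : Z.vertex × Z.vertex)) (fib_d' (𝟙 Z) x 0)).trans ?_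
      refine Prod.ext (sub_self (Z.d.2 x)) ?_
      change x - Z.d.2 0 - 0 = x
      rw [map_zero, sub_zero, sub_zero]
  rw [diff_comp (zero_add n), hu, map_zero, smul_zero, add_zero, h]
  rfl

lemma diff_fib_snd {w : Pairs Z.toAObj X.toAObj} (hw : diff Z X (-n) w = 0) :
    diff (fib (𝟙 Z)) X (1 - n)
        (AObj.comp w (AObj.comp (ofSusp Z.toAObj (-1)) (snd Z.toAObj (Z.susp (-1)).toAObj))) =
      sgn n • AObj.comp w (fst Z.toAObj (Z.susp (-1)).toAObj) := by
  have h : diff (fib (𝟙 Z)) Z 1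
      (AObj.comp (ofSusp Z.toAObj (-1)) (snd Z.toAObj (Z.susp (-1)).toAObj)) =
      fst Z.toAObj (Z.susp (-1)).toAObj := by
    rw [diff_apply, sgn_one, neg_one_smul, sub_neg_eq_add]
    refine pairs_ext (fun x => ?_) (fun x => ?_)
    · obtain ⟨x, y⟩ := x
      refine (congrArg (fun z : Z.nub × Z.nub => Z.d.1 y + z.2) (fib_d (𝟙 Z) x y)).trans ?_
      exact add_sub_cancel (Z.d.1 y) x
    · obtain ⟨x, y⟩ := x
      refine (congrArg (fun z : Z.vertex × Z.vertex => Z.d.2 y + z.2) (fib_d' (𝟙 Z) x y)).trans ?_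
      exact add_sub_cancel (Z.d.2 y) x
  rw [diff_comp (show -n + 1 = 1 - n by ring), hw, map_zero, LinearMap.zero_apply, zero_add, h, sgn_neg]

lemma fib_id_decomposition {u : Pairs X.toAObj Z.toAObj} {w : Pairs Z.toAObj X.toAObj}
    (h : AObj.comp u w = one Z.toAObj) :
    AObj.comp (AObj.comp (inl Z.toAObj (Z.susp (-1)).toAObj) u)
        (AObj.comp w (fst Z.toAObj (Z.susp (-1)).toAObj)) +
      AObj.comp (AObj.comp (inr Z.toAObj (Z.susp (-1)).toAObj) (AObj.comp (toSusp Z.toAObj (-1)) u))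
        (AObj.comp w (AObj.comp (ofSusp Z.toAObj (-1)) (snd Z.toAObj (Z.susp (-1)).toAObj))) =
      one (fib (𝟙 Z)).toAObj := by
  have h1 (x : Z.nub) : u.1 (w.1 x) = x := LinearMap.congr_fun (congrArg Prod.fst h) x
  have h2 (x : Z.vertex) : u.2 (w.2 x) = x := LinearMap.congr_fun (congrArg Prod.snd h) x
  exact pairs_ext
    (fun x => Prod.ext ((add_zero (u.1 (w.1 (x : Z.nub × Z.nub).1))).trans (h1 _))
      ((zero_add (u.1 (w.1 (x : Z.nub × Z.nub).2))).trans (h1 _)))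
    (fun x => Prod.ext ((add_zero (u.2 (w.2 (x : Z.vertex × Z.vertex).1))).trans (h2 _))
      ((zero_add (u.2 (w.2 (x : Z.vertex × Z.vertex).2))).trans (h2 _)))

/-- The homotopy fibre of the identity of a sphere, as a disk. -/
def Sphere.disk (S : Sphere X n) : Disk X n where
  Z := fib (𝟙 S.Z)
  u := AObj.comp (inl _ _) S.u
  w₀ := AObj.comp S.w (fst _ _)
  w₁ := AObj.comp S.w (AObj.comp (ofSusp S.Z.toAObj (-1)) (snd _ _))
  u_mem := comp_mem (zero_add n) (inl_mem _ _) S.u_mem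
  w₀_mem := comp_mem (add_zero (-n)) S.w_mem (fst_mem _ _)
  w₁_mem := comp_mem (by omega) S.w_mem
    (comp_mem (p := 1) (add_zero 1) (ofSusp_mem S.Z.toAObj (-1)) (snd_mem _ _))
  w₀u := S.wu
  w₁u := by
    rw [AObj.comp_assoc, AObj.comp_assoc, ← AObj.comp_assoc (snd _ _), snd_inl, map_zero,
      LinearMap.zero_apply, map_zero, map_zero]
  w₀du := by
    rw [diff_fib_inl S.diff_u, AObj.comp_assoc, ← AObj.comp_assoc (fst _ _), fst_inr, map_zero,
      LinearMap.zero_apply, map_zero]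
  w₁du := by
    rw [diff_fib_inl S.diff_u]
    exact S.wu
  uw := by
    rw [diff_fib_inl S.diff_u]
    exact fib_id_decomposition S.uw
  diff_w₀ := (diff_comp_hom (twistFst _ _ _ _) (-n) S.w).trans (by
    rw [S.diff_w, map_zero, LinearMap.zero_apply])
  diff_w₁ := diff_fib_snd S.diff_w

end FibId

/-- The disk on the suspension. -/
def disk (X : DgA) (n : ℤ) : Disk X n := (sphere X n).disk

lemma disk_contractible (X : DgA) (n : ℤ) : Contractible (disk X n).Z := fib_id_contractible _

lemma disk_isDiv {X : DgA} (h : IsDiv X.toAObj) (n : ℤ) : IsDiv (disk X n).Z.toAObj :=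
  (h.susp n).prod ((h.susp n).susp (-1))

lemma sphere_isDiv {X : DgA} (h : IsDiv X.toAObj) (n : ℤ) : IsDiv (sphere X n).Z.toAObj := h.susp n

end DgA

namespace DGMod

open DgA

variable {G : Type} {B : G → DgA}

/-! ### Elements of the modules of homomorphisms -/

section El

variable {Z Y : DgA} {a b : G} {n : ℤ}

/-- A homogeneous map, as an element of the associated module. -/
def elMk (f : AObj.Pairs (B a).toAObj Z.toAObj) (hf : f ∈ AObj.homDeg (B a).toAObj Z.toAObj n) :
    El ((homFunctor B).obj Z) a n := (⟨f, hf⟩ : AObj.homDeg (B a).toAObj Z.toAObj n)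

/-- The map that underlies an element of a module of homomorphisms. -/
def elVal : El ((homFunctor B).obj Z) a n →ₗ[ℚ] AObj.Pairs (B a).toAObj Z.toAObj :=
  (AObj.homDeg (B a).toAObj Z.toAObj n).subtype

/-- The map that underlies an element of the endomorphism ring. -/
def rVal : ((endRing B).hom a b).X n →ₗ[ℚ] AObj.Pairs (B a).toAObj (B b).toAObj :=
  (AObj.homDeg (B a).toAObj (B b).toAObj n).subtype

lemma elVal_elMk (f : AObj.Pairs (B a).toAObj Z.toAObj) (hf : f ∈ AObj.homDeg (B a).toAObj Z.toAObj n) :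
    elVal (elMk f hf) = f := rfl

lemma elVal_mem (x : El ((homFunctor B).obj Z) a n) : elVal x ∈ AObj.homDeg (B a).toAObj Z.toAObj n :=
  x.2

lemma elVal_injective : Function.Injective (elVal : El ((homFunctor B).obj Z) a n →ₗ[ℚ] _) :=
  Subtype.val_injective

lemma rVal_injective : Function.Injective (rVal : ((endRing B).hom a b).X n →ₗ[ℚ] _) :=
  Subtype.val_injective

lemma elVal_dl {i j : ℤ} (h : j + 1 = i) (x : El ((homFunctor B).obj Z) a i) :
    elVal (dl ((homFunctor B).obj Z) a i j x) = diff (B a) Z i (elVal x) :=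
  congrArg Subtype.val (homComplex_d h x)

lemma rVal_d {i j : ℤ} (h : j + 1 = i) (x : ((endRing B).hom a b).X i) :
    rVal (((endRing B).hom a b).d i j x) = diff (B a) (B b) i (rVal x) :=
  congrArg Subtype.val (homComplex_d h x)

lemma elVal_act {p q : ℤ} (h : p + q = n) (x : El ((homFunctor B).obj Z) b p)
    (g : ((endRing B).hom a b).X q) :
    elVal (((homFunctor B).obj Z).act h x g) = AObj.comp (elVal x) (rVal g) := rfl

lemma elVal_ap (φ : Z ⟶ Y) (x : El ((homFunctor B).obj Z) a n) :
    elVal (ap ((homFunctor B).map φ) a n x) = AObj.comp (DgA.Hom.pair φ) (elVal x) := rfl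

end El

/-! ### Modules of spheres and disks are free -/

section Free

variable {Z Y : DgA} {a : G} {n : ℤ} {M : DGMod (endRing B)}

/-- Composition with a map to an object of the family. -/
def post {w : AObj.Pairs Z.toAObj (B a).toAObj} {m : ℤ} (hw : w ∈ AObj.homDeg Z.toAObj (B a).toAObj m)
    {k q : ℤ} (h : m + k = q) (b : G) :
    El ((homFunctor B).obj Z) b k →ₗ[ℚ] ((endRing B).hom b a).X q :=
  homComp h (⟨w, hw⟩ : AObj.homDeg Z.toAObj (B a).toAObj m)

lemma rVal_post {w : AObj.Pairs Z.toAObj (B a).toAObj} {m : ℤ}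
    (hw : w ∈ AObj.homDeg Z.toAObj (B a).toAObj m) {k q : ℤ} (h : m + k = q) (b : G)
    (x : El ((homFunctor B).obj Z) b k) : rVal (post hw h b x) = AObj.comp w (elVal x) := rfl

lemma post_act {w : AObj.Pairs Z.toAObj (B a).toAObj} {m : ℤ}
    (hw : w ∈ AObj.homDeg Z.toAObj (B a).toAObj m) {k q l k' q' : ℤ} (h : m + k = q) (hl : k + l = k')
    (h' : m + k' = q') (h'' : q + l = q') {b c : G} (x : El ((homFunctor B).obj Z) b k)
    (g : ((endRing B).hom c b).X l) :
    post hw h' c (((homFunctor B).obj Z).act hl x g) = (endRing B).comp h'' (post hw h b x) g := rfl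

lemma d_post {w : AObj.Pairs Z.toAObj (B a).toAObj} {m : ℤ}
    (hw : w ∈ AObj.homDeg Z.toAObj (B a).toAObj m) {k q k' q' : ℤ} (h : m + k = q) (hk : k' + 1 = k)
    (h' : m + k' = q') (b : G) (x : El ((homFunctor B).obj Z) b k) :
    rVal (((endRing B).hom b a).d q q' (post hw h b x)) =
      AObj.comp (diff Z (B a) m w) (elVal x) +
        sgn m • rVal (post hw h' b (dl ((homFunctor B).obj Z) b k k' x)) := by
  rw [rVal_d (by omega), rVal_post, diff_comp h, rVal_post, elVal_dl hk]

/-- The element `u` of the module of a sphere. -/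
def _root_.CircleModel.DgA.Sphere.gen (S : Sphere (B a) n) : El ((homFunctor B).obj S.Z) a n :=
  elMk S.u S.u_mem

/-- The element `u` of the module of a disk. -/
def _root_.CircleModel.DgA.Disk.gen (D : Disk (B a) n) : El ((homFunctor B).obj D.Z) a n :=
  elMk D.u D.u_mem

lemma _root_.CircleModel.DgA.Sphere.dl_gen (S : Sphere (B a) n) {j : ℤ} :
    dl ((homFunctor B).obj S.Z) a n j S.gen = 0 := by
  by_cases hj : j + 1 = n
  · exact elVal_injective ((elVal_dl hj _).trans S.diff_u)
  · rw [dl_shape _ _ hj]; rfl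

/-- Because u w = 1, every element x is the generator acted on by the endomorphism-ring element w x.
-/
lemma _root_.CircleModel.DgA.Sphere.hom_ext (S : Sphere (B a) n) {φ ψ : (homFunctor B).obj S.Z ⟶ M}
    (h : ap φ a n S.gen = ap ψ a n S.gen) : φ = ψ := by
  refine DGMod.hom_ext fun b k x => ?_
  have hx : x = ((homFunctor B).obj S.Z).act (show n + (-n + k) = k by omega) S.gen
      (post S.w_mem rfl b x) := by
    refine elVal_injective ?_
    rw [elVal_act, rVal_post, ← AObj.comp_assoc, Sphere.gen, elVal_elMk, S.uw, AObj.one_comp]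
  rw [hx, ap_act, ap_act, h]

/-- The Yoneda lemma for a shifted representable module: f is sent to x acted on by w f. The sign
from moving d past x cancels the sign from moving it past w. -/
lemma _root_.CircleModel.DgA.Sphere.exists_hom (S : Sphere (B a) n) (x : El M a n)
    (hx : ∀ j, dl M a n j x = 0) : ∃ φ : (homFunctor B).obj S.Z ⟶ M, ap φ a n S.gen = x := by
  refine ⟨homMk (fun b k => (M.act (show n + (-n + k) = k by omega) x) ∘ₗ post S.w_mem rfl b)
    (fun b i j h f => ?_) (fun {b c p q m} h f g => ?_), ?_⟩
  · rw [LinearMap.comp_apply, LinearMap.comp_apply, dl_act (q' := -n + j) _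
      (show (j - (-n + i)) + (-n + i) = j by omega) (by omega) h, hx, map_zero, LinearMap.zero_apply, zero_add]
    have e : ((endRing B).hom b a).d (-n + i) (-n + j) (post S.w_mem rfl b f) =
        sgn n • post S.w_mem rfl b (dl ((homFunctor B).obj S.Z) b i j f) := by
      refine rVal_injective ?_
      rw [d_post S.w_mem rfl h rfl, S.diff_w, map_zero, LinearMap.zero_apply, zero_add, map_smul, sgn_neg]
    rw [e, map_smul, smul_smul, sgn_mul_self, one_smul]
  · rw [LinearMap.comp_apply, LinearMap.comp_apply, post_act S.w_mem rfl h rfl (show -n + p + q = -n + m by omega),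
      ← M.act_comp (show n + (-n + p) = p by omega) _ h]
  · change M.act _ x (post S.w_mem rfl a S.gen) = x
    have e : post S.w_mem (neg_add_cancel n) a S.gen = (endRing B).one a :=
      rVal_injective S.wu
    -- The degree -n + n is zero only propositionally, so the unit law is applied after generalizing
    -- the degree.
    have : ∀ (q : ℤ) (h : -n + n = q) (h' : n + q = n), M.act h' x (post S.w_mem h a S.gen) = x := by
      intro q h h'
      obtain rfl : q = 0 := by omega
      rw [e]
      exact M.act_one x
    exact this _ rfl _

lemma _root_.CircleModel.DgA.Disk.dl_gen (D : Disk (B a) n) {j : ℤ} (hj : j + 1 = n) :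
    elVal (dl ((homFunctor B).obj D.Z) a n j D.gen) = diff (B a) D.Z n D.u := elVal_dl hj _

/-- The decomposition u w₀ + (du) w₁ = 1 writes every element in terms of the generator and its
boundary. -/
lemma _root_.CircleModel.DgA.Disk.hom_ext (D : Disk (B a) n) {φ ψ : (homFunctor B).obj D.Z ⟶ M}
    (h : ap φ a n D.gen = ap ψ a n D.gen) : φ = ψ := by
  refine DGMod.hom_ext fun b k x => ?_
  have hx : x = ((homFunctor B).obj D.Z).act (show n + (-n + k) = k by omega) D.gen
      (post D.w₀_mem rfl b x) + ((homFunctor B).obj D.Z).act (show (n - 1) + (1 - n + k) = k by omega)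
        (dl ((homFunctor B).obj D.Z) a n (n - 1) D.gen) (post D.w₁_mem rfl b x) := by
    refine elVal_injective ?_
    rw [map_add, elVal_act, elVal_act, rVal_post, rVal_post, ← AObj.comp_assoc, ← AObj.comp_assoc,
      D.dl_gen (by omega), Disk.gen, elVal_elMk, ← LinearMap.add_apply, ← map_add, D.uw, AObj.one_comp]
  rw [hx, map_add, map_add, ap_act, ap_act, ap_act, ap_act, ap_dl, ap_dl, h]

/-- Send f to y acted on by w₀ f plus dy acted on by w₁ f. As w₀ is a cycle and w₁ has boundary ±
w₀, this commutes with differentials for arbitrary y. -/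
lemma _root_.CircleModel.DgA.Disk.exists_hom (D : Disk (B a) n) (y : El M a n) :
    ∃ φ : (homFunctor B).obj D.Z ⟶ M, ap φ a n D.gen = y := by
  refine ⟨homMk (fun b k => (M.act (show n + (-n + k) = k by omega) y) ∘ₗ post D.w₀_mem rfl b +
      (M.act (show (n - 1) + (1 - n + k) = k by omega) (dl M a n (n - 1) y)) ∘ₗ post D.w₁_mem rfl b)
    (fun b i j h f => ?_) (fun {b c p q m} h f g => ?_), ?_⟩
  · have e₀ : ((endRing B).hom b a).d (-n + i) (-n + j) (post D.w₀_mem rfl b f) =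
        sgn n • post D.w₀_mem rfl b (dl ((homFunctor B).obj D.Z) b i j f) := by
      refine rVal_injective ?_
      rw [d_post D.w₀_mem rfl h rfl, D.diff_w₀, map_zero, LinearMap.zero_apply, zero_add, map_smul, sgn_neg]
    have e₁ : ((endRing B).hom b a).d (1 - n + i) (1 - n + j) (post D.w₁_mem rfl b f) =
        sgn n • post D.w₀_mem (show -n + i = 1 - n + j by omega) b f -
        sgn n • post D.w₁_mem rfl b (dl ((homFunctor B).obj D.Z) b i j f) := by
      refine rVal_injective ?_
      rw [d_post D.w₁_mem rfl h rfl, D.diff_w₁, map_sub, map_smul, map_smul, map_smul,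
        LinearMap.smul_apply, rVal_post (h := show -n + i = 1 - n + j by omega), sgn_one_sub, neg_smul, ← sub_eq_add_neg]
    simp only [LinearMap.add_apply, LinearMap.comp_apply]
    rw [map_add, dl_act (q' := -n + j) _ (show (n - 1) + (-n + i) = j by omega) (by omega) h,
      dl_act (q' := 1 - n + j) _ (show (n - 2) + (1 - n + i) = j by omega) (by omega) h, dl_dl, map_zero,
      LinearMap.zero_apply, zero_add, e₀, e₁, map_sub, map_smul, map_smul, map_smul, smul_sub, smul_smul,
      smul_smul, smul_smul, sgn_sub_one, sgn_mul_self, neg_mul, sgn_mul_self, one_smul, neg_one_smul, neg_one_smul,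
      sub_neg_eq_add]
    have : ∀ (q q' : ℤ) (h : -n + i = q) (h' : -n + i = q') (k : (n - 1) + q = j) (k' : (n - 1) + q' = j),
        M.act k (dl M a n (n - 1) y) (post D.w₀_mem h b f) =
        M.act k' (dl M a n (n - 1) y) (post D.w₀_mem h' b f) := by
      intro q q' h h' k k'
      subst h; subst h'; rfl
    rw [this _ _ (show -n + i = 1 - n + j by omega) rfl _ (by omega)]
    abel
  · simp only [LinearMap.add_apply, LinearMap.comp_apply]
    rw [post_act D.w₀_mem rfl h rfl (show -n + p + q = -n + m by omega),
      post_act D.w₁_mem rfl h rfl (show 1 - n + p + q = 1 - n + m by omega),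
      ← M.act_comp (show n + (-n + p) = p by omega) _ h,
      ← M.act_comp (show (n - 1) + (1 - n + p) = p by omega) _ h, map_add, LinearMap.add_apply]
  · change M.act _ y (post D.w₀_mem rfl a D.gen) + M.act _ _ (post D.w₁_mem rfl a D.gen) = y
    have e₀ : post D.w₀_mem (neg_add_cancel n) a D.gen = (endRing B).one a := rVal_injective D.w₀u
    have e₁ : post D.w₁_mem rfl a D.gen = 0 := rVal_injective D.w₁u
    have : ∀ (q : ℤ) (h : -n + n = q) (h' : n + q = n), M.act h' y (post D.w₀_mem h a D.gen) = y := by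
      intro q h h'
      obtain rfl : q = 0 := by omega
      rw [e₀]
      exact M.act_one y
    rw [e₁, map_zero, add_zero]
    exact this _ rfl _

/-- Both sides are the cycles of degree n in Hom(B a, Y), by evaluation at u. Hence the identity of
the module of a sphere is a universal arrow; likewise for disks. -/
lemma _root_.CircleModel.DgA.Sphere.map_bijective (S : Sphere (B a) n) (Y : DgA) :
    Function.Bijective ((homFunctor B).map : (S.Z ⟶ Y) → _) := by
  constructor
  · intro f g h
    refine DgA.hom_ext ?_
    have h1 : AObj.comp (DgA.Hom.pair f) S.u = AObj.comp (DgA.Hom.pair g) S.u :=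
      congrArg elVal (congrArg (fun k => ap k a n S.gen) h)
    rw [← AObj.comp_one (DgA.Hom.pair f), ← AObj.comp_one (DgA.Hom.pair g), ← S.uw, ← AObj.comp_assoc, h1,
      AObj.comp_assoc]
  · intro φ
    let y := elVal (ap φ a n S.gen)
    have hy : y ∈ AObj.homDeg (B a).toAObj Y.toAObj n := elVal_mem _
    have hdy : diff (B a) Y n y = 0 := by
      rw [← elVal_dl (show n - 1 + 1 = n by omega), ← ap_dl, S.dl_gen, map_zero, map_zero]
    have hmem : AObj.comp y S.w ∈ AObj.homDeg S.Z.toAObj Y.toAObj 0 :=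
      AObj.comp_mem (add_neg_cancel n) hy S.w_mem
    have hd : diff S.Z Y 0 (AObj.comp y S.w) = 0 := by
      rw [diff_comp (add_neg_cancel n), hdy, S.diff_w, map_zero, map_zero, smul_zero, LinearMap.zero_apply, add_zero]
    refine ⟨(DgA.homEquiv S.Z Y).symm ⟨_, hmem, hd⟩, S.hom_ext (elVal_injective ?_)⟩
    rw [elVal_ap]
    change AObj.comp (AObj.comp y S.w) S.u = y
    rw [AObj.comp_assoc, S.wu, AObj.comp_one]

lemma _root_.CircleModel.DgA.Disk.map_bijective (D : Disk (B a) n) (Y : DgA) :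
    Function.Bijective ((homFunctor B).map : (D.Z ⟶ Y) → _) := by
  constructor
  · intro f g h
    refine DgA.hom_ext ?_
    have h1 : AObj.comp (DgA.Hom.pair f) D.u = AObj.comp (DgA.Hom.pair g) D.u :=
      congrArg elVal (congrArg (fun k => ap k a n D.gen) h)
    have h2 : AObj.comp (DgA.Hom.pair f) (diff (B a) D.Z n D.u) =
        AObj.comp (DgA.Hom.pair g) (diff (B a) D.Z n D.u) := by
      rw [← diff_hom_comp, h1, diff_hom_comp]
    rw [← AObj.comp_one (DgA.Hom.pair f), ← AObj.comp_one (DgA.Hom.pair g), ← D.uw, map_add, map_add,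
      ← AObj.comp_assoc, ← AObj.comp_assoc, h1, h2, AObj.comp_assoc, AObj.comp_assoc]
  · intro φ
    let y := elVal (ap φ a n D.gen)
    have hy : y ∈ AObj.homDeg (B a).toAObj Y.toAObj n := elVal_mem _
    have hdy : diff (B a) Y n y ∈ AObj.homDeg (B a).toAObj Y.toAObj (n - 1) := diff_mem (by omega) hy
    have hmem : AObj.comp y D.w₀ + AObj.comp (diff (B a) Y n y) D.w₁ ∈
        AObj.homDeg D.Z.toAObj Y.toAObj 0 :=
      add_mem (AObj.comp_mem (add_neg_cancel n) hy D.w₀_mem) (AObj.comp_mem (by omega) hdy D.w₁_mem)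
    have hd : diff D.Z Y 0 (AObj.comp y D.w₀ + AObj.comp (diff (B a) Y n y) D.w₁) = 0 := by
      rw [map_add, diff_comp (add_neg_cancel n), diff_comp (show n - 1 + (1 - n) = 0 by omega),
        diff_diff (show n - 1 + 1 = n by omega), D.diff_w₀, D.diff_w₁, map_zero, map_zero, smul_zero,
        LinearMap.zero_apply, add_zero, zero_add, map_smul, smul_smul, sgn_sub_one, neg_mul, sgn_mul_self,
        neg_one_smul, add_neg_cancel]
    refine ⟨(DgA.homEquiv D.Z Y).symm ⟨_, hmem, hd⟩, D.hom_ext (elVal_injective ?_)⟩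
    rw [elVal_ap]
    change AObj.comp (AObj.comp y D.w₀ + AObj.comp (diff (B a) Y n y) D.w₁) D.u = y
    rw [map_add, LinearMap.add_apply, AObj.comp_assoc, AObj.comp_assoc, D.w₀u, D.w₁u, AObj.comp_one, map_zero,
      add_zero]

end Free

end DGMod


namespace DGMod

/-! #### Projections of direct sums -/

section Sum

variable {G : Type} {R : DGRing G} {ι : Type} (X : ι → DGMod R)

open Classical in
lemma exists_sumπ (i : ι) : ∃ p : sum X ⟶ X i, sumι X i ≫ p = 𝟙 (X i) ∧ ∀ j, j ≠ i → sumι X j ≫ p = 0 := by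
  obtain ⟨p, hp⟩ := exists_sum_desc X (T := X i) fun j => if h : j = i then eqToHom (congrArg X h) else 0
  exact ⟨p, by rw [hp, dif_pos rfl, eqToHom_refl], fun j hj => by rw [hp, dif_neg hj]⟩

/-- The projection of a direct sum to a summand. -/
def sumπ (i : ι) : sum X ⟶ X i := (exists_sumπ X i).choose

lemma sumι_sumπ (i : ι) : sumι X i ≫ sumπ X i = 𝟙 (X i) := (exists_sumπ X i).choose_spec.1

lemma sumι_sumπ_ne {i j : ι} (h : j ≠ i) : sumι X j ≫ sumπ X i = 0 :=
  (exists_sumπ X i).choose_spec.2 j h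

lemma ap_sumπ_sumι (i : ι) (a : G) (n : ℤ) (x : El (X i) a n) :
    ap (sumπ X i) a n (ap (sumι X i) a n x) = x := by
  rw [← ap_comp, sumι_sumπ, ap_id]

lemma ap_sumπ_sumι_ne {i j : ι} (h : j ≠ i) (a : G) (n : ℤ) (x : El (X j) a n) :
    ap (sumπ X i) a n (ap (sumι X j) a n x) = 0 := by
  rw [← ap_comp, sumι_sumπ_ne X h, ap_zero]

lemma sumι_injective (i : ι) (a : G) (n : ℤ) : Function.Injective (ap (sumι X i) a n) :=
  Function.LeftInverse.injective (ap_sumπ_sumι X i a n)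

open Classical in
-- The support of an element of a direct sum; in the induction the sum is taken over any larger
-- finite set, so that two supports can be merged.
lemma exists_finset_sum {a : G} {n : ℤ} (x : El (sum X) a n) :
    ∃ s : Finset ι, (∀ i, i ∉ s → ap (sumπ X i) a n x = 0) ∧
      x = ∑ i ∈ s, ap (sumι X i) a n (ap (sumπ X i) a n x) := by
  suffices h : ∃ s : Finset ι, ∀ t, s ⊆ t → (∀ i, i ∉ s → ap (sumπ X i) a n x = 0) ∧
      x = ∑ i ∈ t, ap (sumι X i) a n (ap (sumπ X i) a n x) by
    obtain ⟨s, hs⟩ := h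
    exact ⟨s, hs s subset_rfl⟩
  refine sum_induction X (fun x => ∃ s : Finset ι, ∀ t, s ⊆ t → (∀ i, i ∉ s → ap (sumπ X i) a n x = 0) ∧
      x = ∑ i ∈ t, ap (sumι X i) a n (ap (sumπ X i) a n x)) x ?_ (fun j y => ?_) ?_
  · exact ⟨∅, fun t _ => ⟨fun i _ => map_zero _, by simp only [map_zero, Finset.sum_const_zero]⟩⟩
  · refine ⟨{j}, fun t ht => ⟨fun i hi => ap_sumπ_sumι_ne X (fun e => hi (by simp [e])) a n y, ?_⟩⟩
    rw [Finset.sum_eq_single_of_mem j (ht (by simp)), ap_sumπ_sumι]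
    intro i _ hij
    rw [ap_sumπ_sumι_ne X hij.symm, map_zero]
  · rintro x y ⟨s, hs⟩ ⟨t, ht⟩
    refine ⟨s ∪ t, fun r hr => ⟨fun i hi => ?_, ?_⟩⟩
    · rw [map_add, (hs s subset_rfl).1 i (fun h => hi (Finset.mem_union_left _ h)),
        (ht t subset_rfl).1 i (fun h => hi (Finset.mem_union_right _ h)), add_zero]
    · simp only [map_add, Finset.sum_add_distrib]
      rw [← (hs r (Finset.union_subset_left hr)).2, ← (ht r (Finset.union_subset_right hr)).2]

lemma sum_eq_zero {a : G} {n : ℤ} {x : El (sum X) a n} (h : ∀ i, ap (sumπ X i) a n x = 0) : x = 0 := by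
  obtain ⟨s, -, hs⟩ := exists_finset_sum X x
  rw [hs]
  exact Finset.sum_eq_zero fun i _ => by rw [h, map_zero]

lemma sum_boundary {a : G} {i j : ℤ} {x : El (sum X) a j}
    (h : ∀ k, ∃ y, dl (X k) a i j y = ap (sumπ X k) a j x) : ∃ y, dl (sum X) a i j y = x := by
  obtain ⟨s, -, hs⟩ := exists_finset_sum X x
  choose y hy using h
  refine ⟨∑ k ∈ s, ap (sumι X k) a i (y k), ?_⟩
  rw [map_sum, hs]
  refine Finset.sum_congr rfl fun k _ => ?_
  rw [← ap_dl, hy]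

end Sum

/-! #### Short exact sequences, cell attachments, telescopes -/

/-- A short exact sequence of modules. -/
structure IsSES {G : Type} {R : DGRing G} {A B C : DGMod R} (f : A ⟶ B) (g : B ⟶ C) : Prop where
  inj : ∀ a n, Function.Injective (ap f a n)
  zero : f ≫ g = 0
  exact : ∀ a n y, ap g a n y = 0 → ∃ x, ap f a n x = y
  surj : ∀ a n, Function.Surjective (ap g a n)

lemma IsSES.mk_coker {G : Type} {R : DGRing G} {A B : DGMod R} {f : A ⟶ B}
    (h : ∀ a n, Function.Injective (ap f a n)) : IsSES f (rangeSub f).π :=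
  ⟨h, rangeSub_comp f, fun a n y hy => ((rangeSub f).π_eq_zero_iff).1 hy, (rangeSub f).π_surjective⟩

section Telescope

variable {G : Type} {R : DGRing G}

/-- `W` is the telescope of the sequence of maps `j`. -/
structure IsTelescope (X : ℕ → DGMod R) (j : ∀ n, X n ⟶ X (n + 1)) {W : DGMod R} (i : ∀ n, X n ⟶ W)
    (φ : sum X ⟶ sum X) (π : sum X ⟶ W) : Prop where
  ses : IsSES φ π
  φ_eq : ∀ n, sumι X n ≫ φ = sumι X n - j n ≫ sumι X (n + 1)
  π_eq : ∀ n, sumι X n ≫ π = i n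

lemma injective_iff {M N : DGMod R} {f : M ⟶ N} {a : G} {n : ℤ} :
    Function.Injective (ap f a n) ↔ ∀ x, ap f a n x = 0 → x = 0 :=
  injective_iff_map_eq_zero (ap f a n)

section

variable {X : ℕ → DGMod R} {j : ∀ n, X n ⟶ X (n + 1)} {φ : sum X ⟶ sum X}
  (hφ : ∀ n, sumι X n ≫ φ = sumι X n - j n ≫ sumι X (n + 1))

include hφ

lemma telescope_comp_zero : φ ≫ sumπ X 0 = sumπ X 0 := by
  refine sum_ext X fun n => ?_
  rw [← Category.assoc, hφ, Preadditive.sub_comp, Category.assoc, sumι_sumπ_ne X (Nat.succ_ne_zero n),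
    Limits.comp_zero, sub_zero]

lemma telescope_comp_succ (m : ℕ) : φ ≫ sumπ X (m + 1) = sumπ X (m + 1) - sumπ X m ≫ j m := by
  refine sum_ext X fun n => ?_
  rw [← Category.assoc, hφ, Preadditive.sub_comp, Category.assoc, Preadditive.comp_sub]
  congr 1
  by_cases h : n = m
  · subst h
    rw [sumι_sumπ, ← Category.assoc, sumι_sumπ, Category.comp_id, Category.id_comp]
  · rw [sumι_sumπ_ne X (by omega), ← Category.assoc, sumι_sumπ_ne X h, Limits.comp_zero, Limits.zero_comp]

/-- The map is the identity minus a shift, so the components of an element of its kernel vanish one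
after the other. -/
lemma telescope_injective (a : G) (n : ℤ) : Function.Injective (ap φ a n) := by
  rw [injective_iff]
  intro x hx
  refine sum_eq_zero X fun m => ?_
  induction m with
  | zero => rw [← telescope_comp_zero hφ, ap_comp, hx, map_zero]
  | succ m ih =>
    have := congrArg (fun k => ap k a n x) (telescope_comp_succ hφ m)
    change ap (sumπ X (m + 1)) a n (ap φ a n x) =
      ap (sumπ X (m + 1)) a n x - ap (j m) a n (ap (sumπ X m) a n x) at this
    rw [hx, ih, map_zero, map_zero, sub_zero] at this
    exact this.symm

end

lemma exists_telescope (X : ℕ → DGMod R) (j : ∀ n, X n ⟶ X (n + 1)) :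
    ∃ (W : DGMod R) (i : ∀ n, X n ⟶ W) (φ : sum X ⟶ sum X) (π : sum X ⟶ W), IsTelescope X j i φ π := by
  obtain ⟨φ, hφ⟩ := exists_sum_desc X fun n => sumι X n - j n ≫ sumι X (n + 1)
  exact ⟨_, _, φ, _, .mk_coker (telescope_injective hφ), hφ, fun n => rfl⟩

variable {X : ℕ → DGMod R} {j : ∀ n, X n ⟶ X (n + 1)} {W : DGMod R} {i : ∀ n, X n ⟶ W}
    {φ : sum X ⟶ sum X} {π : sum X ⟶ W} (h : IsTelescope X j i φ π)

include h

lemma IsTelescope.comm (n : ℕ) : j n ≫ i (n + 1) = i n := by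
  have := (sumι X n ≫= h.ses.zero)
  rw [← Category.assoc, h.φ_eq, Preadditive.sub_comp, h.π_eq, Category.assoc, h.π_eq, Limits.comp_zero,
    sub_eq_zero] at this
  exact this.symm

lemma IsTelescope.hom_ext {T : DGMod R} {f g : W ⟶ T} (hfg : ∀ n, i n ≫ f = i n ≫ g) : f = g := by
  have := epi_of_surjective h.ses.surj
  rw [← cancel_epi π]
  refine sum_ext X fun n => ?_
  rw [← Category.assoc, h.π_eq, hfg, ← h.π_eq, Category.assoc]

lemma IsTelescope.exists_desc {T : DGMod R} (l : ∀ n, X n ⟶ T) (hl : ∀ n, j n ≫ l (n + 1) = l n) :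
    ∃ f : W ⟶ T, ∀ n, i n ≫ f = l n := by
  obtain ⟨g, hg⟩ := exists_sum_desc X l
  obtain ⟨f, hf⟩ := exists_desc_of_exact h.ses.surj h.ses.exact g (sum_ext X fun n => by
    rw [← Category.assoc, h.φ_eq, Preadditive.sub_comp, hg, Category.assoc, hg, hl, sub_self, Limits.comp_zero])
  exact ⟨f, fun n => by rw [← h.π_eq, Category.assoc, hf, hg]⟩

lemma IsTelescope.exists_eq_of_le {m n : ℕ} (hmn : m ≤ n) {a : G} {k : ℤ} (x : El (X m) a k) :
    ∃ y : El (X n) a k, ap (i n) a k y = ap (i m) a k x := by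
  induction n, hmn using Nat.le_induction with
  | base => exact ⟨x, rfl⟩
  | succ n _ ih =>
    obtain ⟨y, hy⟩ := ih
    exact ⟨ap (j n) a k y, by rw [← ap_comp, h.comm, hy]⟩

/-- Elements live at a finite stage. This is the smallness that lets the small object argument stop
after countably many steps. -/
lemma IsTelescope.exists_eq {a : G} {k : ℤ} (w : El W a k) : ∃ n, ∃ x, ap (i n) a k x = w := by
  obtain ⟨x, rfl⟩ := h.ses.surj a k w
  refine sum_induction X (fun x => ∃ n, ∃ y, ap (i n) a k y = ap π a k x) x ⟨0, 0, by rw [map_zero, map_zero]⟩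
    (fun n y => ⟨n, y, by rw [← ap_comp, h.π_eq]⟩) ?_
  rintro x y ⟨m, x', hx⟩ ⟨n, y', hy⟩
  obtain ⟨x'', hx''⟩ := h.exists_eq_of_le (le_max_left m n) x'
  obtain ⟨y'', hy''⟩ := h.exists_eq_of_le (le_max_right m n) y'
  exact ⟨max m n, x'' + y'', by rw [map_add, map_add, hx'', hy'', hx, hy]⟩

/-- If x at stage n dies, it equals φ s for some s. The components of s are zero before n, equal to
x at n, and the successive images of x afterwards. They are eventually zero, and the transition maps
are injective, so x = 0. -/
lemma IsTelescope.injective (hj : ∀ n a k, Function.Injective (ap (j n) a k)) (n : ℕ) (a : G) (k : ℤ) :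
    Function.Injective (ap (i n) a k) := by
  rw [injective_iff]
  intro x hx
  rw [← h.π_eq, ap_comp] at hx
  obtain ⟨s, hs⟩ := h.ses.exact a k _ hx
  have h0 : ap (sumπ X 0) a k s = ap (sumπ X 0) a k (ap (sumι X n) a k x) := by
    rw [← hs, ← ap_comp, telescope_comp_zero h.φ_eq]
  have hsucc (m : ℕ) : ap (sumπ X (m + 1)) a k s =
      ap (sumπ X (m + 1)) a k (ap (sumι X n) a k x) + ap (j m) a k (ap (sumπ X m) a k s) := by
    have := congrArg (fun t => ap t a k s) (telescope_comp_succ h.φ_eq m)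
    change ap (sumπ X (m + 1)) a k (ap φ a k s) =
      ap (sumπ X (m + 1)) a k s - ap (j m) a k (ap (sumπ X m) a k s) at this
    rw [← hs, this, sub_add_cancel]
  have hlt : ∀ m, m < n → ap (sumπ X m) a k s = 0 := by
    intro m
    induction m with
    | zero => exact fun hm => by rw [h0, ap_sumπ_sumι_ne X (by omega)]
    | succ m ih =>
      intro hm
      rw [hsucc, ap_sumπ_sumι_ne X (by omega), ih (by omega), map_zero, add_zero]
  have hn : ap (sumπ X n) a k s = x := by
    cases n with
    | zero => rw [h0, ap_sumπ_sumι]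
    | succ n => rw [hsucc, hlt n (by omega), map_zero, add_zero, ap_sumπ_sumι]
  have hge : ∀ m, n ≤ m → ap (sumπ X m) a k s = 0 → x = 0 := by
    intro m hm
    induction m, hm using Nat.le_induction with
    | base => exact fun e => hn.symm.trans e
    | succ m hm ih =>
      intro e
      rw [hsucc, ap_sumπ_sumι_ne X (by omega), zero_add] at e
      exact ih (injective_iff.1 (hj m a k) _ e)
  obtain ⟨t, ht, -⟩ := exists_finset_sum X s
  obtain ⟨m, hm⟩ := Finset.exists_nat_subset_range t
  refine hge (max n m) (le_max_left _ _) (ht _ fun hmem => ?_)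
  have := Finset.mem_range.1 (hm hmem)
  omega

end Telescope

/-! ### Attachment of cells -/

section Cells

variable {G : Type} {B : G → DgA}

open DgA

/-- The module of a sphere. -/
abbrev Sp (B : G → DgA) (c : G × ℤ) : DGMod (endRing B) := (homFunctor B).obj (sphere (B c.1) (c.2 - 1)).Z

/-- The module of a disk. -/
abbrev Dk (B : G → DgA) (c : G × ℤ) : DGMod (endRing B) := (homFunctor B).obj (disk (B c.1) c.2).Z

/-- The generator of the module of a sphere. -/
abbrev spGen (B : G → DgA) (c : G × ℤ) : El (Sp B c) c.1 (c.2 - 1) := (sphere (B c.1) (c.2 - 1)).gen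

/-- The generator of the module of a disk. -/
abbrev dkGen (B : G → DgA) (c : G × ℤ) : El (Dk B c) c.1 c.2 := (disk (B c.1) c.2).gen

lemma exists_bd (c : G × ℤ) : ∃ f : Sp B c ⟶ Dk B c,
    ap f c.1 (c.2 - 1) (spGen B c) = dl (Dk B c) c.1 c.2 (c.2 - 1) (dkGen B c) :=
  (sphere (B c.1) (c.2 - 1)).exists_hom _ fun j => dl_dl _ _ _ _ _

/-- The inclusion of the boundary of a disk. -/
def bd (B : G → DgA) (c : G × ℤ) : Sp B c ⟶ Dk B c := (exists_bd c).choose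

lemma bd_gen (c : G × ℤ) : ap (bd B c) c.1 (c.2 - 1) (spGen B c) =
    dl (Dk B c) c.1 c.2 (c.2 - 1) (dkGen B c) := (exists_bd c).choose_spec

lemma exists_bdHom (c : G × ℤ) :
    ∃ f : (sphere (B c.1) (c.2 - 1)).Z ⟶ (disk (B c.1) c.2).Z, (homFunctor B).map f = bd B c :=
  ((sphere (B c.1) (c.2 - 1)).map_bijective _).2 _

/-- The map of dg objects that induces the inclusion of the boundary of a disk. -/
def bdHom (B : G → DgA) (c : G × ℤ) : (sphere (B c.1) (c.2 - 1)).Z ⟶ (disk (B c.1) c.2).Z :=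
  (exists_bdHom c).choose

lemma map_bdHom (c : G × ℤ) : (homFunctor B).map (bdHom B c) = bd B c := (exists_bdHom c).choose_spec

/-- The retraction is a map in 𝒜 that need not commute with differentials. That is enough for the
boundary inclusion to be injective on modules and a monomorphism of dg objects. -/
lemma bdHom_retraction (c : G × ℤ) :
    AObj.comp (AObj.comp (sphere (B c.1) (c.2 - 1)).u (disk (B c.1) c.2).w₁) (DgA.Hom.pair (bdHom B c)) =
      AObj.one _ := by
  have h : AObj.comp (DgA.Hom.pair (bdHom B c)) (sphere (B c.1) (c.2 - 1)).u =
      diff (B c.1) (disk (B c.1) c.2).Z c.2 (disk (B c.1) c.2).u := by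
    have := bd_gen (B := B) c
    rw [← map_bdHom] at this
    exact (congrArg elVal this).trans ((disk (B c.1) c.2).dl_gen (by omega))
  rw [← AObj.comp_one (DgA.Hom.pair (bdHom B c)), ← (sphere (B c.1) (c.2 - 1)).uw,
    ← AObj.comp_assoc (DgA.Hom.pair (bdHom B c)), h, ← AObj.comp_assoc, AObj.comp_assoc _ _ (diff _ _ _ _),
    (disk (B c.1) c.2).w₁du, AObj.comp_one]

lemma bd_injective (c : G × ℤ) (a : G) (n : ℤ) : Function.Injective (ap (bd B c) a n) := by
  intro x y h
  rw [← map_bdHom] at h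
  have h' : AObj.comp (DgA.Hom.pair (bdHom B c)) (elVal x) = AObj.comp (DgA.Hom.pair (bdHom B c)) (elVal y) :=
    congrArg elVal h
  refine elVal_injective ?_
  rw [← AObj.one_comp (elVal x), ← AObj.one_comp (elVal y), ← bdHom_retraction c, AObj.comp_assoc, h',
    ← AObj.comp_assoc]

/-- The direct sum of a module and of disks. -/
abbrev withDisks {ι : Type} (c : ι → G × ℤ) (X : DGMod (endRing B)) : Option ι → DGMod (endRing B)
  | none => X
  | some i => Dk B (c i)

/-- `j : X ⟶ X'` is the attachment of cells along the maps `t`. -/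
structure IsAttachment {ι : Type} (c : ι → G × ℤ) {X X' : DGMod (endRing B)} (t : ∀ i, Sp B (c i) ⟶ X)
    (j : X ⟶ X') (φ : sum (fun i => Sp B (c i)) ⟶ sum (withDisks c X)) (π : sum (withDisks c X) ⟶ X') :
    Prop where
  ses : IsSES φ π
  φ_eq : ∀ i, sumι _ i ≫ φ = bd B (c i) ≫ sumι (withDisks c X) (some i) - t i ≫ sumι (withDisks c X) none
  π_eq : sumι (withDisks c X) none ≫ π = j

section

variable {ι : Type} {c : ι → G × ℤ} {X X' : DGMod (endRing B)} {t : ∀ i, Sp B (c i) ⟶ X}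
  {j : X ⟶ X'} {φ : sum (fun i => Sp B (c i)) ⟶ sum (withDisks c X)} {π : sum (withDisks c X) ⟶ X'}

/-- The disk coordinates of φ are the boundary inclusions, so φ is injective whatever the attaching
maps are, and the pushout is part of a short exact sequence. -/
lemma attachment_comp
    (hφ : ∀ i, sumι _ i ≫ φ = bd B (c i) ≫ sumι (withDisks c X) (some i) - t i ≫ sumι (withDisks c X) none)
    (i : ι) : φ ≫ sumπ (withDisks c X) (some i) = sumπ (fun i => Sp B (c i)) i ≫ bd B (c i) := by
  refine sum_ext _ fun k => ?_
  rw [← Category.assoc, hφ, Preadditive.sub_comp, Category.assoc, Category.assoc,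
    sumι_sumπ_ne _ (Option.some_ne_none i).symm, Limits.comp_zero, sub_zero]
  by_cases h : k = i
  · subst h
    rw [sumι_sumπ (withDisks c X) (some k), ← Category.assoc (sumι _ k), sumι_sumπ]
    exact (Category.comp_id _).trans (Category.id_comp _).symm
  · rw [sumι_sumπ_ne _ (fun e => h (Option.some.inj e)), ← Category.assoc (sumι _ k), sumι_sumπ_ne _ h, Limits.comp_zero, Limits.zero_comp]

lemma attachment_zero_of_comp
    (hφ : ∀ i, sumι _ i ≫ φ = bd B (c i) ≫ sumι (withDisks c X) (some i) - t i ≫ sumι (withDisks c X) none)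
    {a : G} {n : ℤ} {x : El (sum fun i => Sp B (c i)) a n}
    (hx : ∀ i, ap (sumπ (withDisks c X) (some i)) a n (ap φ a n x) = 0) : x = 0 := by
  refine sum_eq_zero _ fun i => injective_iff.1 (bd_injective (c i) a n) _ ?_
  rw [← ap_comp, ← attachment_comp hφ, ap_comp, hx]

lemma exists_attachment {ι : Type} (c : ι → G × ℤ) {X : DGMod (endRing B)} (t : ∀ i, Sp B (c i) ⟶ X) :
    ∃ (X' : DGMod (endRing B)) (j : X ⟶ X') (φ : _) (π : _), IsAttachment c t j φ π := by
  obtain ⟨φ, hφ⟩ := exists_sum_desc (fun i => Sp B (c i)) fun i =>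
    bd B (c i) ≫ sumι (withDisks c X) (some i) - t i ≫ sumι (withDisks c X) none
  refine ⟨_, _, φ, _, .mk_coker fun a n => injective_iff.2 fun x hx => ?_, hφ, rfl⟩
  exact attachment_zero_of_comp hφ fun i => by rw [hx, map_zero]

variable (h : IsAttachment c t j φ π)

include h

lemma IsAttachment.comm (i : ι) : bd B (c i) ≫ sumι (withDisks c X) (some i) ≫ π = t i ≫ j := by
  have := (sumι _ i ≫= h.ses.zero)
  rw [← Category.assoc, h.φ_eq, Preadditive.sub_comp, Category.assoc, Category.assoc, h.π_eq,
    Limits.comp_zero, sub_eq_zero] at this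
  exact this

lemma IsAttachment.injective (a : G) (n : ℤ) : Function.Injective (ap j a n) := by
  rw [injective_iff]
  intro x hx
  rw [← h.π_eq, ap_comp] at hx
  obtain ⟨s, hs⟩ := h.ses.exact a n _ hx
  have : s = 0 := attachment_zero_of_comp h.φ_eq fun i => by
    rw [hs, ap_sumπ_sumι_ne _ (Option.some_ne_none i).symm]
  rw [this, map_zero] at hs
  exact injective_iff.1 (sumι_injective (withDisks c X) none a n) _ hs.symm

lemma IsAttachment.hom_ext {T : DGMod (endRing B)} {f g : X' ⟶ T} (hj : j ≫ f = j ≫ g)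
    (hc : ∀ i, ap (sumι (withDisks c X) (some i) ≫ π ≫ f) _ _ (dkGen B (c i)) =
      ap (sumι (withDisks c X) (some i) ≫ π ≫ g) _ _ (dkGen B (c i))) : f = g := by
  have := epi_of_surjective h.ses.surj
  rw [← cancel_epi π]
  refine sum_ext _ fun o => ?_
  match o with
  | none => rw [← Category.assoc, h.π_eq, hj, ← h.π_eq, Category.assoc]
  | some i => exact (disk (B (c i).1) (c i).2).hom_ext (hc i)

lemma IsAttachment.exists_desc {T : DGMod (endRing B)} (u : X ⟶ T) (y : ∀ i, El T (c i).1 (c i).2)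
    (hy : ∀ i, dl T _ _ ((c i).2 - 1) (y i) = ap (t i ≫ u) _ _ (spGen B (c i))) :
    ∃ f : X' ⟶ T, j ≫ f = u ∧
      ∀ i, ap (sumι (withDisks c X) (some i) ≫ π ≫ f) _ _ (dkGen B (c i)) = y i := by
  choose l hl using fun i => (disk (B (c i).1) (c i).2).exists_hom (y i)
  obtain ⟨g, hg⟩ := exists_sum_desc (withDisks c X) (T := T) fun o => match o with
    | none => u
    | some i => l i
  have hn : sumι (withDisks c X) none ≫ g = u := hg none
  have hs (i : ι) : sumι (withDisks c X) (some i) ≫ g = l i := hg (some i)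
  obtain ⟨f, hf⟩ := exists_desc_of_exact h.ses.surj h.ses.exact g (sum_ext _ fun i => by
    rw [← Category.assoc, h.φ_eq, Preadditive.sub_comp, Category.assoc, Category.assoc, hn, hs,
      Limits.comp_zero, sub_eq_zero]
    refine (sphere (B (c i).1) ((c i).2 - 1)).hom_ext ?_
    have e := bd_gen (B := B) (c i)
    refine Eq.trans ?_ (hy i)
    refine (congrArg (ap (l i) _ _) e).trans ?_
    refine (ap_dl (l i) _ _ _ _).trans ?_
    rw [hl])
  refine ⟨f, by rw [← h.π_eq, Category.assoc, hf, hn], fun i => ?_⟩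
  rw [hf, hs, hl]

end

/-! #### The model structure on modules -/

/-- The lifting property with respect to the boundary inclusions of disks, in terms of elements. -/
def IsCellInj {G : Type} {R : DGRing G} {X Y : DGMod R} (f : X ⟶ Y) : Prop :=
  ∀ (a : G) (i j k : ℤ), j + 1 = i → k + 1 = j → ∀ (z : El X a j) (y : El Y a i), dl X a j k z = 0 →
    ap f a j z = dl Y a i j y → ∃ w, dl X a i j w = z ∧ ap f a i w = y

lemma IsCellInj.lift_cycle {G : Type} {R : DGRing G} {X Y : DGMod R} {f : X ⟶ Y} (h : IsCellInj f)
    {a : G} {i j : ℤ} (hij : j + 1 = i) (y : El Y a i) (hy : dl Y a i j y = 0) :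
    ∃ w, dl X a i j w = 0 ∧ ap f a i w = y :=
  h a i j (j - 1) hij (by omega) 0 y (map_zero _) (by rw [map_zero, hy])

lemma isCellInj_iff {G : Type} {R : DGRing G} {X Y : DGMod R} (f : X ⟶ Y) :
    IsCellInj f ↔ trivialFibrations (DGMod R) f := by
  constructor
  · intro h
    refine ⟨(epi_iff_surjective.2 fun a i y => ?_ : Epi f), ?_⟩
    · obtain ⟨z, hz, hzy⟩ := h.lift_cycle (show i - 2 + 1 = i - 1 by omega) (dl Y a i (i - 1) y) (dl_dl _ _ _ _ _)
      obtain ⟨w, -, hw⟩ := h a i (i - 1) (i - 2) (by omega) (by omega) z y hz hzy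
      exact ⟨w, hw⟩
    · refine ((weakEquivalence_iff f).2 fun a i j k hij hjk => ⟨fun x hx ⟨y, hy⟩ => ?_, fun y hy => ?_⟩).mem
      · obtain ⟨w, hw, -⟩ := h a i j k hij hjk x y hx hy.symm
        exact ⟨w, hw⟩
      · obtain ⟨x, hx, hxy⟩ := h.lift_cycle hjk y hy
        exact ⟨x, hx, 0, by rw [map_zero, hxy, sub_self]⟩
  · rintro ⟨hf, hw⟩ a i j k hij hjk z y hz hzy
    have hs := epi_iff_surjective.1 (show Epi f from hf)
    have hq := (weakEquivalence_iff f).1 ⟨hw⟩ a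
    obtain ⟨w, hw⟩ := (hq i j k hij hjk).1 z hz ⟨y, hzy.symm⟩
    -- The primitive w of z has an image that differs from y by a cycle. This cycle is homologous to
    -- the image of a cycle x, and a preimage v of the remaining primitive finishes the correction.
    obtain ⟨x, hx, v, hv⟩ := (hq (i + 1) i j rfl hij).2 (ap f a i w - y) (by
      rw [map_sub, ← ap_dl, hw, hzy, sub_self])
    obtain ⟨v, rfl⟩ := hs _ _ v
    refine ⟨w - x + dl X a (i + 1) i v, ?_, ?_⟩
    · rw [map_add, map_sub, hw, hx, dl_dl, sub_zero, add_zero]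
    · rw [map_add, map_sub, ap_dl, hv]
      abel

lemma IsAttachment.cofibration {ι : Type} {c : ι → G × ℤ} {X X' : DGMod (endRing B)}
    {t : ∀ i, Sp B (c i) ⟶ X} {j : X ⟶ X'} {φ : sum (fun i => Sp B (c i)) ⟶ sum (withDisks c X)}
    {π : sum (withDisks c X) ⟶ X'} (h : IsAttachment c t j φ π) : cofibrations (DGMod (endRing B)) j := by
  intro E Y p hp
  rw [← isCellInj_iff] at hp
  refine ⟨fun {u v} sq => ?_⟩
  choose w hw hw' using fun i => hp (c i).1 (c i).2 ((c i).2 - 1) ((c i).2 - 2) (by omega) (by omega)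
    (ap (t i ≫ u) _ _ (spGen B (c i))) (ap (sumι (withDisks c X) (some i) ≫ π ≫ v) _ _ (dkGen B (c i)))
    (by rw [← ap_dl, (sphere (B (c i).1) ((c i).2 - 1)).dl_gen, map_zero]) (by
      rw [← ap_dl]
      have e := bd_gen (B := B) (c i)
      refine Eq.trans ?_ (congrArg (ap (sumι (withDisks c X) (some i) ≫ π ≫ v) _ _) e)
      have e' := h.comm i
      have : (t i ≫ u) ≫ p = bd B (c i) ≫ sumι (withDisks c X) (some i) ≫ π ≫ v := by
        rw [Category.assoc, sq.w, ← Category.assoc, ← e', Category.assoc, Category.assoc]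
      exact congrArg (fun k => ap k _ _ (spGen B (c i))) this)
  obtain ⟨l, hl, hl'⟩ := h.exists_desc u w hw
  refine ⟨⟨l, hl, h.hom_ext ?_ fun i => ?_⟩⟩
  · rw [← Category.assoc, hl, sq.w]
  · refine Eq.trans ?_ (hw' i)
    exact congrArg (ap p _ _) (hl' i)

lemma IsTelescope.cofibration {R : DGRing G} {X : ℕ → DGMod R} {j : ∀ n, X n ⟶ X (n + 1)} {W : DGMod R}
    {i : ∀ n, X n ⟶ W} {φ : sum X ⟶ sum X} {π : sum X ⟶ W} (h : IsTelescope X j i φ π)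
    (hj : ∀ n, cofibrations (DGMod R) (j n)) : cofibrations (DGMod R) (i 0) := by
  intro E Y p hp
  refine ⟨fun {u v} sq => ?_⟩
  have step (n : ℕ) (l : {l : X n ⟶ E // l ≫ p = i n ≫ v}) :
      ∃ l' : {l : X (n + 1) ⟶ E // l ≫ p = i (n + 1) ≫ v}, j n ≫ l'.1 = l.1 := by
    have := hj n p hp
    have sq' : CommSq l.1 (j n) p (i (n + 1) ≫ v) := ⟨by rw [l.2, ← Category.assoc, h.comm]⟩
    exact ⟨⟨sq'.lift, sq'.fac_right⟩, sq'.fac_left⟩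
  choose s hs using step
  let l : ∀ n, {l : X n ⟶ E // l ≫ p = i n ≫ v} := fun n => Nat.rec ⟨u, sq.w⟩ (fun n l => s n l) n
  obtain ⟨f, hf⟩ := h.exists_desc (fun n => (l n).1) fun n => hs n (l n)
  exact ⟨⟨f, hf 0, h.hom_ext fun n => by rw [← Category.assoc, hf, (l n).2]⟩⟩

/-- A property of modules that is inherited by cell attachments and by telescopes. -/
structure IsCellular (P : DGMod (endRing B) → Prop) : Prop where
  attachment : ∀ {ι : Type} {c : ι → G × ℤ} {X X' : DGMod (endRing B)} {t : ∀ i, Sp B (c i) ⟶ X}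
    {j : X ⟶ X'} {φ : sum (fun i => Sp B (c i)) ⟶ sum (withDisks c X)} {π : sum (withDisks c X) ⟶ X'},
    IsAttachment c t j φ π → P X → P X'
  telescope : ∀ {X : ℕ → DGMod (endRing B)} {j : ∀ n, X n ⟶ X (n + 1)} {W : DGMod (endRing B)}
    {i : ∀ n, X n ⟶ W} {φ : sum X ⟶ sum X} {π : sum X ⟶ W}, IsTelescope X j i φ π → (∀ n, P (X n)) → P W

/-- One step of the small object argument: a cell is attached for every lifting problem over Y at
once. The last clause lets properties of modules be propagated along the construction. -/
lemma exists_attachment_lifting {Y : DGMod (endRing B)} (T : Over Y) : ∃ (T' : Over Y) (j : T ⟶ T'),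
    cofibrations (DGMod (endRing B)) j.left ∧ (∀ a n, Function.Injective (ap j.left a n)) ∧
    (∀ (a : G) (n : ℤ) (z : El T.left a (n - 1)) (y : El Y a n), (∀ k, dl T.left a (n - 1) k z = 0) →
      ap T.hom a (n - 1) z = dl Y a n (n - 1) y →
      ∃ w, dl T'.left a n (n - 1) w = ap j.left a (n - 1) z ∧ ap T'.hom a n w = y) ∧
    ∀ P : DGMod (endRing B) → Prop, IsCellular P → P T.left → P T'.left := by
  let ι : Type := Σ c : G × ℤ, {zy : El T.left c.1 (c.2 - 1) × El Y c.1 c.2 //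
    (∀ k, dl T.left c.1 (c.2 - 1) k zy.1 = 0) ∧ ap T.hom c.1 (c.2 - 1) zy.1 = dl Y c.1 c.2 (c.2 - 1) zy.2}
  let c : ι → G × ℤ := fun i => i.1
  choose t ht using fun i : ι => (sphere (B (c i).1) ((c i).2 - 1)).exists_hom i.2.1.1 i.2.2.1
  obtain ⟨X', j, φ, π, h⟩ := exists_attachment c t
  obtain ⟨f, hf, hf'⟩ := h.exists_desc T.hom (fun i : ι => i.2.1.2) (fun i => by
    refine i.2.2.2.symm.trans ?_
    exact (congrArg (ap T.hom _ _) (ht i)).symm)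
  refine ⟨Over.mk f, Over.homMk j hf, h.cofibration, h.injective, fun a n z y hz hzy => ?_,
    fun P hP => hP.attachment h⟩
  let i : ι := ⟨(a, n), (z, y), hz, hzy⟩
  refine ⟨ap (sumι (withDisks c T.left) (some i) ≫ π) a n (dkGen B (a, n)), ?_, hf' i⟩
  refine (ap_dl _ _ _ _ _).symm.trans ?_
  refine (congrArg (ap (sumι (withDisks c T.left) (some i) ≫ π) a (n - 1)) (bd_gen (B := B) (a, n))).symm.trans ?_
  refine (congrArg (fun k => ap k a (n - 1) (spGen B (a, n))) (h.comm i)).trans ?_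
  exact congrArg (ap j a (n - 1)) (ht i)

/-- Factorization of a map as a relative cell complex followed by a trivial fibration. -/
lemma exists_cell_factorization {X Y : DGMod (endRing B)} (f : X ⟶ Y) :
    ∃ (W : DGMod (endRing B)) (i : X ⟶ W) (p : W ⟶ Y), i ≫ p = f ∧
      cofibrations (DGMod (endRing B)) i ∧ trivialFibrations (DGMod (endRing B)) p ∧
      ∀ P : DGMod (endRing B) → Prop, IsCellular P → P X → P W := by
  choose s j hj hinj hlift hP using exists_attachment_lifting (B := B) (Y := Y)
  -- Countably many steps, assembled in a telescope over Y.
  let T : ℕ → Over Y := fun n => Nat.rec (Over.mk f) (fun _ T => s T) n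
  obtain ⟨W, i, φ, π, h⟩ := exists_telescope (fun n => (T n).left) fun n => (j (T n)).left
  obtain ⟨p, hp⟩ := h.exists_desc (fun n => (T n).hom) fun n => Over.w (j (T n))
  refine ⟨W, i 0, p, hp 0, h.cofibration fun n => hj (T n), (isCellInj_iff p).1 ?_, fun P hPc hX => ?_⟩
  · intro a m l k hml hlk z y hz hzy
    obtain rfl : l = m - 1 := by omega
    obtain ⟨n, x, rfl⟩ := h.exists_eq z
    -- A cycle of the telescope comes from a cycle at a finite stage, because the stages embed; its
    -- lifting problem is solved one stage later.
    have hx : ∀ k', dl (T n).left a (m - 1) k' x = 0 := by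
      intro k'
      by_cases hk : k' + 1 = m - 1
      · obtain rfl : k' = k := by omega
        refine injective_iff.1 (h.injective (fun n => hinj (T n)) n a k') _ ?_
        rw [ap_dl, hz]
      · rw [dl_shape _ _ hk]; rfl
    obtain ⟨w, hw, hw'⟩ := hlift (T n) a m x y hx (by rw [← hzy, ← ap_comp, hp])
    refine ⟨ap (i (n + 1)) a m w, ?_, ?_⟩
    · rw [← ap_dl]
      refine (congrArg (ap (i (n + 1)) a (m - 1)) hw).trans ?_
      rw [← ap_comp, h.comm]
    · rw [← ap_comp, hp]
      exact hw'
  · refine hPc.telescope h fun n => ?_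
    induction n with
    | zero => exact hX
    | succ n ih => exact hP (T n) P hPc ih

lemma dk_acyclic (c : G × ℤ) {a : G} {i j k : ℤ} (hij : j + 1 = i) (hjk : k + 1 = j) (x : El (Dk B c) a j)
    (hx : dl (Dk B c) a j k x = 0) : ∃ y, dl (Dk B c) a i j y = x := by
  subst hij
  obtain ⟨h, hh, hd⟩ := (disk_contractible (B c.1) c.2).homAcyclic_target (X := B a) j (elVal x) (elVal_mem x)
    ((elVal_dl hjk x).symm.trans ((congrArg elVal hx).trans (map_zero _)))
  exact ⟨elMk h hh, elVal_injective ((elVal_dl rfl _).trans hd)⟩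

/-- Factorization of a map as a trivial cofibration followed by a fibration. -/
lemma exists_disk_factorization {X Y : DGMod (endRing B)} (f : X ⟶ Y) :
    ∃ (W : DGMod (endRing B)) (i : X ⟶ W) (p : W ⟶ Y), i ≫ p = f ∧
      (fibrations (DGMod (endRing B))).llp i ∧ weakEquivalences (DGMod (endRing B)) i ∧ Epi p := by
  -- One disk for every element of Y makes the map surjective. Disks are acyclic and lift against
  -- surjections, so adding them to X is a trivial cofibration.
  let ι : Type := Σ c : G × ℤ, El Y c.1 c.2
  let c : ι → G × ℤ := fun i => i.1
  choose l hl using fun i : ι => (disk (B (c i).1) (c i).2).exists_hom i.2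
  obtain ⟨p, hp⟩ := exists_sum_desc (withDisks c X) (T := Y) fun o => match o with
    | none => f
    | some i => l i
  have hs (i : ι) : sumι (withDisks c X) (some i) ≫ p = l i := hp (some i)
  refine ⟨_, sumι (withDisks c X) none, p, hp none, ?_, ?_, epi_of_surjective fun a n y => ?_⟩
  · intro E Z q hq
    have hq := epi_iff_surjective.1 (show Epi q from hq)
    refine ⟨fun {u v} sq => ?_⟩
    choose e he using fun i : ι => hq _ _ (ap (sumι (withDisks c X) (some i) ≫ v) _ _ (dkGen B (c i)))
    choose l' hl' using fun i : ι => (disk (B (c i).1) (c i).2).exists_hom (e i)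
    obtain ⟨g, hg⟩ := exists_sum_desc (withDisks c X) (T := E) fun o => match o with
      | none => u
      | some i => l' i
    refine ⟨⟨g, hg none, sum_ext _ fun o => ?_⟩⟩
    match o with
    | none => rw [← Category.assoc, hg none, sq.w]
    | some i =>
      refine (disk (B (c i).1) (c i).2).hom_ext ?_
      rw [← Category.assoc, hg (some i)]
      exact (congrArg (ap q _ _) (hl' i)).trans (he i)
  · suffices h : WeakEquivalence (sumι (withDisks c X) none) from h.mem
    refine (weakEquivalence_iff _).2 fun a i j k hij hjk => ⟨fun x hx ⟨y, hy⟩ => ?_, fun y hy => ?_⟩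
    · refine ⟨ap (sumπ (withDisks c X) none) a i y, ?_⟩
      refine (ap_dl _ _ _ _ _).symm.trans ?_
      rw [hy, ap_sumπ_sumι]
    · refine ⟨ap (sumπ (withDisks c X) none) a j y, ?_, sum_boundary _ fun o => ?_⟩
      · refine (ap_dl _ _ _ _ _).symm.trans ?_
        rw [hy, map_zero]
      · match o with
        | none => exact ⟨0, by rw [map_zero, map_sub, ap_sumπ_sumι, sub_self]⟩
        | some i =>
          rw [map_sub, ap_sumπ_sumι_ne _ (Option.some_ne_none i).symm, zero_sub]
          refine dk_acyclic (c i) hij hjk _ ?_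
          rw [map_neg]
          refine neg_eq_zero.2 ((ap_dl _ _ _ _ _).symm.trans ?_)
          rw [hy, map_zero]
  · refine ⟨ap (sumι (withDisks c X) (some ⟨(a, n), y⟩)) a n (dkGen B (a, n)), ?_⟩
    refine (congrArg (fun k => ap k a n (dkGen B (a, n))) (hs ⟨(a, n), y⟩)).trans ?_
    exact hl ⟨(a, n), y⟩

instance : MorphismProperty.HasFactorization (cofibrations (DGMod (endRing B)))
    (trivialFibrations (DGMod (endRing B))) where
  nonempty_mapFactorizationData f := by
    obtain ⟨W, i, p, hip, hi, hp, -⟩ := exists_cell_factorization f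
    exact ⟨{ Z := W, i := i, p := p, fac := hip, hi := hi, hp := hp }⟩

instance : MorphismProperty.HasFactorization (trivialCofibrations (DGMod (endRing B)))
    (fibrations (DGMod (endRing B))) where
  nonempty_mapFactorizationData f := by
    obtain ⟨W, i, p, hip, hi, hw, hp⟩ := exists_disk_factorization f
    exact ⟨{ Z := W, i := i, p := p, fac := hip, hi := ⟨fun _ _ q hq => hi q hq.1, hw⟩, hp := hp }⟩

/-- The model structure on modules over an endomorphism ring. -/
instance modelCategory : ModelCategory (DGMod (endRing B)) where
  categoryWithFibrations := inferInstance
  categoryWithCofibrations := inferInstance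
  categoryWithWeakEquivalences := inferInstance
  cm3b := (inferInstance : (MorphismProperty.epimorphisms (DGMod (endRing B))).IsStableUnderRetracts)
  cm3c := (inferInstance : (trivialFibrations (DGMod (endRing B))).llp.IsStableUnderRetracts)
  cm4a {_ _ _ _} i p hi hi' hp := by
    -- The retract argument: q is a trivial fibration by two out of three, so i lifts against it and
    -- is a retract of k, which lifts against all fibrations.
    obtain ⟨W, k, q, hkq, hk, hw, hq⟩ := exists_disk_factorization i
    have hqw : weakEquivalences (DGMod (endRing B)) q :=
      (weakEquivalences (DGMod (endRing B))).of_precomp k q hw (by rw [hkq]; exact hi'.mem)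
    have : HasLiftingProperty i q := hi.mem q ⟨hq, hqw⟩
    have : HasLiftingProperty k p := hk p hp.mem
    exact (RetractArrow.ofLeftLiftingProperty hkq).leftLiftingProperty p
  cm4b i p hi hp hp' := hi.mem p ⟨hp.mem, hp'.mem⟩

end Cells

end DGMod


namespace DgA

open AObj

/-! #### Projections of direct sums of dg objects -/

section Sum

variable {ι : Type} (X : ι → DgA)

lemma _root_.CircleModel.AObj.sumπ_sumι {ι : Type} (X : ι → AObj) (i : ι) :
    AObj.comp (AObj.sumπ X i) (AObj.sumι X i) = one (X i) := by
  classical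
  exact pairs_ext (fun x => lof_apply_self (R := OF) (M := fun i => ((X i).nub : Type)) i x)
    (fun x => lof_apply_self (R := ℚ) (M := fun i => ((X i).vertex : Type)) i x)

lemma _root_.CircleModel.AObj.sumπ_sumι_ne {ι : Type} (X : ι → AObj) {i j : ι} (h : i ≠ j) :
    AObj.comp (AObj.sumπ X i) (AObj.sumι X j) = 0 := by
  classical
  exact pairs_ext (fun x => lof_apply_ne (R := OF) (M := fun i => ((X i).nub : Type)) h x)
    (fun x => lof_apply_ne (R := ℚ) (M := fun i => ((X i).vertex : Type)) h x)

lemma sumι_pair (i : ι) : Hom.pair (sumι X i) = AObj.sumι (fun i => (X i).toAObj) i := rfl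

/-- The projection of a direct sum to a summand. -/
def sumπ (i : ι) : sum X ⟶ X i :=
  ⟨AObj.sumπ (fun i => (X i).toAObj) i, sumπ_mem (fun i => (X i).toAObj) i, by
    refine sum_hom_ext (fun i => (X i).toAObj) fun j => ?_
    have h := Hom.comm (sumι X j)
    rw [sumι_pair] at h
    rw [comp_assoc, comp_assoc, h, ← comp_assoc (AObj.sumπ _ i)]
    by_cases hij : i = j
    · subst hij
      rw [sumπ_sumι (fun i => (X i).toAObj)]
      exact (AObj.comp_one _).trans (AObj.one_comp _).symm
    · rw [sumπ_sumι_ne (fun i => (X i).toAObj) hij, map_zero, map_zero, LinearMap.zero_apply]⟩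

lemma sumι_sumπ (i : ι) : sumι X i ≫ sumπ X i = 𝟙 (X i) :=
  hom_ext (sumπ_sumι (fun i => (X i).toAObj) i)

lemma sumι_sumπ_ne {i j : ι} (h : i ≠ j) : sumι X j ≫ sumπ X i = 0 :=
  hom_ext (sumπ_sumι_ne (fun i => (X i).toAObj) h)

end Sum

/-- Maps out of the object to a direct sum factor through a finite subsum. -/
def IsSmall (L : AObj) : Prop := ∀ {ι : Type} (Z : ι → AObj) (f : Pairs L (AObj.sum Z)),
  ∃ s : Finset ι, f = ∑ i ∈ s, AObj.comp (AObj.sumι Z i) (AObj.comp (AObj.sumπ Z i) f)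

open Classical in
lemma directSum_eq_sum {R ι : Type} [Semiring R] {M : ι → Type} [∀ i, AddCommGroup (M i)]
    [∀ i, Module R (M i)] (z : DirectSum ι M) {s : Finset ι} (hs : DFinsupp.support z ⊆ s) :
    z = ∑ i ∈ s, DirectSum.lof R ι M i (z i) := by
  refine (DirectSum.sum_support_of z).symm.trans ?_
  refine Finset.sum_subset hs fun i _ hi => ?_
  rw [DFinsupp.notMem_support_iff.1 hi]
  exact map_zero _

/-- A map out of L is determined by the images of the two generators, each of finite support. -/
lemma isSmall_of_cyclic {L : AObj} (x : L.nub) (hx : ∀ y : L.nub, ∃ r : OF, r • x = y) (v : L.vertex)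
    (hv : ∀ w : L.vertex, ∃ q : ℚ, q • v = w) : IsSmall L := by
  classical
  intro ι Z f
  let zx : DirectSum ι fun i => (Z i).nub := f.1 x
  let zv : DirectSum ι fun i => (Z i).vertex := f.2 v
  refine ⟨DFinsupp.support zx ∪ DFinsupp.support zv, pairs_ext (fun y => ?_) (fun w => ?_)⟩
  · obtain ⟨r, rfl⟩ := hx y
    rw [map_smul, map_smul]
    congr 1
    rw [Prod.fst_sum, LinearMap.sum_apply]
    exact directSum_eq_sum (R := OF) zx Finset.subset_union_left
  · obtain ⟨r, rfl⟩ := hv w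
    rw [map_smul, map_smul]
    congr 1
    rw [Prod.snd_sum, LinearMap.sum_apply]
    exact directSum_eq_sum (R := ℚ) zv Finset.subset_union_right

/-- A dg object with a small subobject that has the same homology. -/
def IsCompactUpToQuasiIso (X : DgA) : Prop :=
  ∃ (L : DgA) (i : L ⟶ X), Inj (Hom.pair i) ∧ weakEquivalences DgA i ∧ IsSmall L.toAObj

/-- A cycle to a direct sum of divisible objects is homologous to one that factors through a finite
subsum. -/
lemma IsCompactUpToQuasiIso.exists_finset {X : DgA} (hX : IsCompactUpToQuasiIso X) {ι : Type}
    {Z : ι → DgA} (hZ : ∀ i, IsDiv (Z i).toAObj) {n : ℤ} {f : Pairs X.toAObj (sum Z).toAObj}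
    (hf : f ∈ homDeg X.toAObj (sum Z).toAObj n) (hdf : diff X (sum Z) n f = 0) :
    ∃ s : Finset ι, ∃ h ∈ homDeg X.toAObj (sum Z).toAObj (n + 1), diff X (sum Z) (n + 1) h =
      (∑ i ∈ s, AObj.comp (Hom.pair (sumι Z i)) (AObj.comp (Hom.pair (sumπ Z i)) f)) - f := by
  obtain ⟨L, i, hi, hiw, hL⟩ := hX
  have hses := coker_isSES i hi
  obtain ⟨s, hs⟩ := hL (fun i => (Z i).toAObj) (AObj.comp f (Hom.pair i))
  -- By smallness the defect f' vanishes on L, so it descends to a cycle on the acyclic quotient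
  -- X/L. There it bounds, since a direct sum of divisible objects is divisible.
  let f' := (∑ i ∈ s, AObj.comp (Hom.pair (sumι Z i)) (AObj.comp (Hom.pair (sumπ Z i)) f)) - f
  have hf' : f' ∈ homDeg X.toAObj (sum Z).toAObj n := sub_mem (sum_mem fun k _ =>
    comp_mem (zero_add n) (Hom.mem _) (comp_mem (zero_add n) (Hom.mem _) hf)) hf
  have hdf' : diff X (sum Z) n f' = 0 := by
    rw [map_sub, map_sum, hdf, sub_zero]
    refine Finset.sum_eq_zero fun k _ => ?_
    rw [diff_hom_comp, diff_hom_comp, hdf, map_zero, map_zero]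
  have h0 : AObj.comp f' (Hom.pair i) = 0 := by
    rw [map_sub, LinearMap.sub_apply, map_sum, LinearMap.sum_apply, sub_eq_zero]
    exact hs.symm
  obtain ⟨g, hg, hgf⟩ := AObj.exists_desc hses.surj (Hom.mem (cokerπ i)) hses.exact hf' h0 (zero_add n)
  obtain ⟨h, hh, hd⟩ := (hses.acyclic_right hiw).homAcyclic (IsDiv.sum hZ) n g hg (hses.surj.cancel (by
    rw [← diff_comp_hom, hgf, hdf', map_zero, LinearMap.zero_apply]))
  exact ⟨s, AObj.comp h (Hom.pair (cokerπ i)), comp_mem (add_zero _) hh (Hom.mem _), by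
    rw [diff_comp_hom, hd, hgf]⟩

end DgA

namespace DGMod

open DgA

variable {G : Type} {B : G → DgA}

/-! #### Universal arrows and the left adjoint -/

lemma homFunctor_map_zero (Y Z : DgA) : (homFunctor B).map (0 : Y ⟶ Z) = 0 :=
  hom_ext fun a n x => elVal_injective (by
    rw [elVal_ap, ap_zero, map_zero, zero_pair, map_zero, LinearMap.zero_apply])

/-- `η` is a universal arrow from `M` to the functor of homomorphisms. -/
def IsUniv {M : DGMod (endRing B)} {Z : DgA} (η : M ⟶ (homFunctor B).obj Z) : Prop :=
  ∀ Y : DgA, Function.Bijective fun f : Z ⟶ Y => η ≫ (homFunctor B).map f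

lemma isUniv_id {Z : DgA} (h : ∀ Y, Function.Bijective ((homFunctor B).map : (Z ⟶ Y) → _)) :
    IsUniv (𝟙 ((homFunctor B).obj Z)) := by
  intro Y
  simp only [Category.id_comp]
  exact h Y

section Closure

lemma IsUniv.sum {ι : Type} {M : ι → DGMod (endRing B)} {Z : ι → DgA} {η : ∀ i, M i ⟶ (homFunctor B).obj (Z i)}
    (h : ∀ i, IsUniv (η i)) {θ : DGMod.sum M ⟶ (homFunctor B).obj (DgA.sum Z)}
    (hθ : ∀ i, DGMod.sumι M i ≫ θ = η i ≫ (homFunctor B).map (DgA.sumι Z i)) : IsUniv θ := by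
  intro Y
  constructor
  · intro f g hfg
    refine DgA.sum_ext Z fun i => (h i Y).1 ?_
    have := DGMod.sumι M i ≫= hfg
    simp only [← Category.assoc, hθ] at this
    simpa only [Functor.map_comp, ← Category.assoc] using this
  · intro ψ
    choose g hg using fun i => (h i Y).2 (DGMod.sumι M i ≫ ψ)
    obtain ⟨f, hf⟩ := DgA.exists_sum_desc Z g
    refine ⟨f, DGMod.sum_ext M fun i => ?_⟩
    rw [← hg]
    change DGMod.sumι M i ≫ θ ≫ (homFunctor B).map f = _
    rw [← Category.assoc, hθ, Category.assoc, ← Functor.map_comp, hf]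

variable {M N P : DGMod (endRing B)} {φ : M ⟶ N} {π : N ⟶ P} {Z W : DgA}
  {η : M ⟶ (homFunctor B).obj Z} {θ : N ⟶ (homFunctor B).obj W} {f : Z ⟶ W}

/-- Maps out of P are the maps out of N that vanish on M; through the universal arrows these are the
maps out of W that vanish on Z, that is, the maps out of the cokernel of f. -/
lemma exists_univ_coker (hη : IsUniv η) (hθ : IsUniv θ) (hf : η ≫ (homFunctor B).map f = φ ≫ θ)
    (hπ : ∀ a n, Function.Surjective (ap π a n))
    (hex : ∀ a n y, ap π a n y = 0 → ∃ x, ap φ a n x = y) (h0 : φ ≫ π = 0) :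
    ∃ κ : P ⟶ (homFunctor B).obj (DgA.coker f), IsUniv κ ∧ π ≫ κ = θ ≫ (homFunctor B).map (DgA.cokerπ f) := by
  obtain ⟨κ, hκ⟩ := exists_desc_of_exact hπ hex (θ ≫ (homFunctor B).map (DgA.cokerπ f)) (by
    rw [← Category.assoc, ← hf, Category.assoc, ← Functor.map_comp, DgA.comp_cokerπ, homFunctor_map_zero,
      Limits.comp_zero])
  have := epi_of_surjective hπ
  have := DgA.epi_of_surj _ (DgA.cokerπ_surj f)
  refine ⟨κ, fun Y => ⟨fun u v huv => ?_, fun ψ => ?_⟩, hκ⟩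
  · rw [← cancel_epi (DgA.cokerπ f)]
    refine (hθ Y).1 ?_
    have := π ≫= huv
    simp only [← Category.assoc, hκ] at this
    simpa only [Functor.map_comp, ← Category.assoc] using this
  · obtain ⟨u, hu⟩ := (hθ Y).2 (π ≫ ψ)
    have hu : θ ≫ (homFunctor B).map u = π ≫ ψ := hu
    obtain ⟨v, hv⟩ := DgA.exists_desc_of_exact (DgA.cokerπ_surj f) (DgA.cokerπ_exact f) u ((hη Y).1 (by
      change η ≫ (homFunctor B).map (f ≫ u) = η ≫ (homFunctor B).map 0
      rw [Functor.map_comp, ← Category.assoc, hf, Category.assoc, hu, ← Category.assoc, h0, Limits.zero_comp,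
        homFunctor_map_zero, Limits.comp_zero]))
    refine ⟨v, ?_⟩
    change κ ≫ (homFunctor B).map v = ψ
    rw [← cancel_epi π, ← Category.assoc, hκ, Category.assoc, ← Functor.map_comp, hv, hu]

end Closure

lemma exists_sumComparison {ι : Type} (Z : ι → DgA) :
    ∃ κ : sum (fun i => (homFunctor B).obj (Z i)) ⟶ (homFunctor B).obj (DgA.sum Z),
      ∀ i, sumι _ i ≫ κ = (homFunctor B).map (DgA.sumι Z i) :=
  exists_sum_desc (fun i => (homFunctor B).obj (Z i)) fun i => (homFunctor B).map (DgA.sumι Z i)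

lemma exists_univ_sum {ι : Type} (Z : ι → DgA)
    (h : ∀ i Y, Function.Bijective ((homFunctor B).map : (Z i ⟶ Y) → _)) :
    ∃ (W : DgA) (η : sum (fun i => (homFunctor B).obj (Z i)) ⟶ (homFunctor B).obj W), IsUniv η := by
  obtain ⟨κ, hκ⟩ := exists_sumComparison (B := B) Z
  exact ⟨_, κ, IsUniv.sum (fun i => isUniv_id (h i)) fun i => by rw [hκ, Category.id_comp]⟩

lemma exists_disk_cover (M : DGMod (endRing B)) : ∃ (P : DGMod (endRing B)) (π : P ⟶ M) (Z : DgA)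
    (η : P ⟶ (homFunctor B).obj Z), IsUniv η ∧ ∀ a n, Function.Surjective (ap π a n) := by
  let ι : Type := Σ c : G × ℤ, El M c.1 c.2
  choose l hl using fun i : ι => (disk (B i.1.1) i.1.2).exists_hom i.2
  obtain ⟨π, hπ⟩ := exists_sum_desc (fun i : ι => Dk B i.1) l
  obtain ⟨W, η, hη⟩ := exists_univ_sum (B := B) (fun i : ι => (disk (B i.1.1) i.1.2).Z)
    fun i => (disk (B i.1.1) i.1.2).map_bijective
  refine ⟨_, π, W, η, hη, fun a n y => ?_⟩
  refine ⟨ap (sumι (fun i : ι => Dk B i.1) ⟨(a, n), y⟩) a n (dkGen B (a, n)), ?_⟩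
  refine (congrArg (fun k => ap k a n (dkGen B (a, n))) (hπ ⟨(a, n), y⟩)).trans ?_
  exact hl ⟨(a, n), y⟩

/-- Cover M by disks, and cover the kernel by disks again: M is a cokernel of a map between sums of
disks, for which universal arrows are known. -/
lemma exists_univ (M : DGMod (endRing B)) : ∃ (Z : DgA) (η : M ⟶ (homFunctor B).obj Z), IsUniv η := by
  obtain ⟨P, π, Z, η, hη, hπ⟩ := exists_disk_cover M
  obtain ⟨P', π', Z', η', hη', hπ'⟩ := exists_disk_cover (kerSub π).toDGMod
  obtain ⟨f, hf⟩ := (hη' Z).2 ((π' ≫ (kerSub π).ι) ≫ η)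
  obtain ⟨κ, hκ, -⟩ := exists_univ_coker (φ := π' ≫ (kerSub π).ι) hη' hη hf hπ (fun a n y hy => by
    obtain ⟨x, hx⟩ := hπ' a n ⟨y, hy⟩
    exact ⟨x, congrArg Subtype.val hx⟩) (by rw [Category.assoc, Sub.ι_comp_eq_zero, Limits.comp_zero])
  exact ⟨_, κ, hκ⟩

/-- The functor of homomorphisms has a left adjoint. -/
lemma exists_leftAdjoint (B : G → DgA) :
    ∃ (F : DGMod (endRing B) ⥤ DgA), Nonempty (F ⊣ homFunctor B) := by
  choose Z η hη using exists_univ (B := B)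
  let e (M : DGMod (endRing B)) (Y : DgA) : (Z M ⟶ Y) ≃ (M ⟶ (homFunctor B).obj Y) :=
    Equiv.ofBijective (fun f => η M ≫ (homFunctor B).map f) (hη M Y)
  exact ⟨_, ⟨Adjunction.adjunctionOfEquivLeft e fun M Y Y' g h => by
    change η M ≫ (homFunctor B).map (h ≫ g) = (η M ≫ (homFunctor B).map h) ≫ (homFunctor B).map g
    rw [Functor.map_comp, Category.assoc]⟩⟩

lemma isUniv_unit {F : DGMod (endRing B) ⥤ DgA} (adj : F ⊣ homFunctor B) (M : DGMod (endRing B)) :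
    IsUniv (adj.unit.app M) := by
  intro Y
  have : (fun f : F.obj M ⟶ Y => adj.unit.app M ≫ (homFunctor B).map f) = adj.homEquiv M Y := by
    funext f
    rw [Adjunction.homEquiv_unit]
  rw [this]
  exact (adj.homEquiv M Y).bijective

/-! #### Weak equivalences and exact sequences of modules -/

section Five

variable {R : DGRing G} {A₁ A₂ A₃ C₁ C₂ C₃ : DGMod R} {f : A₁ ⟶ A₂} {g : A₂ ⟶ A₃} {f' : C₁ ⟶ C₂}
  {g' : C₂ ⟶ C₃} {α₁ : A₁ ⟶ C₁} {α₂ : A₂ ⟶ C₂} {α₃ : A₃ ⟶ C₃}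

lemma IsSES.exists_cycle {f : A₁ ⟶ A₂} {g : A₂ ⟶ A₃} (h : IsSES f g) {a : G} {i j k : ℤ} (b : El A₂ a i)
    (hb : dl A₃ a i j (ap g a i b) = 0) : ∃ x, ap f a j x = dl A₂ a i j b ∧ dl A₁ a j k x = 0 := by
  obtain ⟨x, hx⟩ := h.exact a j (dl A₂ a i j b) (by rw [ap_dl, hb])
  exact ⟨x, hx, injective_iff.1 (h.inj a k) _ (by rw [ap_dl, hx, dl_dl])⟩

/-- The third of three compatible maps of short exact sequences is a weak equivalence if the other
two are. -/
lemma IsSES.weakEquivalence (h : IsSES f g) (h' : IsSES f' g') (e₁ : f ≫ α₂ = α₁ ≫ f')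
    (e₂ : g ≫ α₃ = α₂ ≫ g') (w₁ : WeakEquivalence α₁) (w₂ : WeakEquivalence α₂) : WeakEquivalence α₃ := by
  rw [weakEquivalence_iff] at w₁ w₂ ⊢
  have e₁ (a n x) : ap α₂ a n (ap f a n x) = ap f' a n (ap α₁ a n x) :=
    congrArg (fun k => ap k a n x) e₁
  have e₂ (a n x) : ap α₃ a n (ap g a n x) = ap g' a n (ap α₂ a n x) :=
    congrArg (fun k => ap k a n x) e₂
  have z (a n x) : ap g a n (ap f a n x) = 0 := congrArg (fun k => ap k a n x) h.zero
  have z' (a n x) : ap g' a n (ap f' a n x) = 0 := congrArg (fun k => ap k a n x) h'.zero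
  intro a i j k hij hjk
  constructor
  · rintro c hc ⟨c', hc'⟩
    -- Both halves are the five lemma by diagram chase: the connecting cycle x of b is treated by
    -- the first weak equivalence, and the corrected b by the second.
    obtain ⟨b, rfl⟩ := h.surj a j c
    obtain ⟨b', rfl⟩ := h'.surj a i c'
    obtain ⟨x, hx, hdx⟩ := h.exists_cycle (k := k - 1) b hc
    obtain ⟨x', hx'⟩ := h'.exact a j (ap α₂ a j b - dl C₂ a i j b') (by
      rw [map_sub, ← e₂, ← hc', ap_dl, sub_self])
    obtain ⟨y, hy⟩ := (w₁ a j k (k - 1) hjk (by omega)).1 x hdx ⟨x', h'.inj a k (by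
      rw [ap_dl, hx', map_sub, dl_dl, sub_zero, ← e₁, hx, ap_dl])⟩
    obtain ⟨y', hy'⟩ : ∃ y', ap f' a j y' = ap α₂ a j (b - ap f a j y) - dl C₂ a i j b' :=
      ⟨x' - ap α₁ a j y, by rw [map_sub, hx', map_sub, e₁]; abel⟩
    have hcyc : dl A₂ a j k (b - ap f a j y) = 0 := by
      rw [map_sub, ← ap_dl, hy, hx, sub_self]
    obtain ⟨v, hv, e, he⟩ := (w₁ a i j k hij hjk).2 y' (injective_iff.1 (h'.inj a k) _ (by
      rw [ap_dl, hy', map_sub, dl_dl, ← ap_dl, hcyc, map_zero, sub_zero]))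
    obtain ⟨t, ht⟩ := (w₂ a i j k hij hjk).1 (b - ap f a j y - ap f a j v)
      (by rw [map_sub, hcyc, ← ap_dl, hv, map_zero, sub_zero])
      ⟨b' - ap f' a i e, by
        rw [map_sub, ← ap_dl, he, map_sub, hy']; simp only [map_sub, e₁]; abel⟩
    exact ⟨ap g a i t, by rw [← ap_dl, ht, map_sub, map_sub, z, z, sub_zero, sub_zero]⟩
  · intro c' hc'
    obtain ⟨b', rfl⟩ := h'.surj a j c'
    obtain ⟨x', hx', hdx'⟩ := h'.exists_cycle (k := k - 1) b' hc'
    obtain ⟨x, hx, e, he⟩ := (w₁ a j k (k - 1) hjk (by omega)).2 x' hdx'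
    obtain ⟨b, hb⟩ := (w₂ a j k (k - 1) hjk (by omega)).1 (ap f a k x) (by rw [← ap_dl, hx, map_zero])
      ⟨b' + ap f' a j e, by rw [map_add, ← ap_dl, he, map_sub, hx', e₁]; abel⟩
    obtain ⟨v, hv, t, ht⟩ := (w₂ a i j k hij hjk).2 (ap α₂ a j b - b' - ap f' a j e) (by
      rw [map_sub, map_sub, ← ap_dl, hb, ← ap_dl, he, map_sub, hx', e₁]; abel)
    refine ⟨ap g a j (b - v), ?_, - ap g' a i t, ?_⟩
    · rw [← ap_dl, map_sub, hb, hv, sub_zero, z]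
    · rw [map_neg, ← ap_dl, ht, e₂, map_sub, map_sub, map_sub, map_sub, map_sub, z']
      abel

lemma weakEquivalence_sum {ι : Type} {M N : ι → DGMod R} {φ : ∀ i, M i ⟶ N i} (h : ∀ i, WeakEquivalence (φ i))
    {ψ : sum M ⟶ sum N} (hψ : ∀ i, sumι M i ≫ ψ = φ i ≫ sumι N i) : WeakEquivalence ψ := by
  have hπ (i : ι) : ψ ≫ sumπ N i = sumπ M i ≫ φ i := by
    refine sum_ext M fun k => ?_
    rw [← Category.assoc, hψ, Category.assoc, ← Category.assoc (sumι M k)]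
    by_cases hk : k = i
    · subst hk
      rw [sumι_sumπ, sumι_sumπ, Category.comp_id, Category.id_comp]
    · rw [sumι_sumπ_ne _ hk, sumι_sumπ_ne _ hk, Limits.comp_zero, Limits.zero_comp]
  have hπ (i a n x) : ap (sumπ N i) a n (ap ψ a n x) = ap (φ i) a n (ap (sumπ M i) a n x) :=
    congrArg (fun k => ap k a n x) (hπ i)
  have hψ (i a n x) : ap ψ a n (ap (sumι M i) a n x) = ap (sumι N i) a n (ap (φ i) a n x) :=
    congrArg (fun k => ap k a n x) (hψ i)
  rw [weakEquivalence_iff]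
  intro a i j k hij hjk
  have h' := fun l => (weakEquivalence_iff (φ l)).1 (h l) a i j k hij hjk
  constructor
  · rintro x hx ⟨y, hy⟩
    refine sum_boundary M fun l => (h' l).1 _ (by rw [← ap_dl, hx, map_zero]) ⟨ap (sumπ N l) a i y, ?_⟩
    rw [← ap_dl, hy, hπ]
  · intro y hy
    choose x hx z hz using fun l => (h' l).2 (ap (sumπ N l) a j y) (by rw [← ap_dl, hy, map_zero])
    obtain ⟨s, -, hs⟩ := exists_finset_sum N y
    refine ⟨∑ l ∈ s, ap (sumι M l) a j (x l), ?_, ∑ l ∈ s, ap (sumι N l) a i (z l), ?_⟩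
    · rw [map_sum]
      exact Finset.sum_eq_zero fun l _ => by rw [← ap_dl, hx, map_zero]
    · conv_rhs => rw [hs]
      rw [map_sum, map_sum, ← Finset.sum_sub_distrib]
      exact Finset.sum_congr rfl fun l _ => by rw [← ap_dl, hz, map_sub, hψ]

end Five

end DGMod


namespace DgA

open AObj

lemma sum_lift_ext {ι : Type} (Z : ι → DgA) {T : DgA} {u v : T ⟶ sum Z}
    (h : ∀ i, u ≫ sumπ Z i = v ≫ sumπ Z i) : u = v := by
  refine hom_ext (pairs_ext (fun x => ?_) (fun x => ?_))
  · exact DFinsupp.ext fun i => LinearMap.congr_fun (congrArg (fun f => (Hom.pair f).1) (h i)) x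
  · exact DFinsupp.ext fun i => LinearMap.congr_fun (congrArg (fun f => (Hom.pair f).2) (h i)) x

lemma telescope_mono {Z : ℕ → DgA} {j : ∀ n, Z n ⟶ Z (n + 1)} {f : sum Z ⟶ sum Z}
    (hf : ∀ n, sumι Z n ≫ f = sumι Z n - j n ≫ sumι Z (n + 1)) : Mono f := by
  have h0 : f ≫ sumπ Z 0 = sumπ Z 0 := by
    refine sum_ext Z fun n => ?_
    rw [← Category.assoc, hf, Preadditive.sub_comp, Category.assoc,
      sumι_sumπ_ne Z (Nat.succ_ne_zero n).symm, Limits.comp_zero, sub_zero]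
  have hs (m : ℕ) : f ≫ sumπ Z (m + 1) = sumπ Z (m + 1) - sumπ Z m ≫ j m := by
    refine sum_ext Z fun n => ?_
    rw [← Category.assoc, hf, Preadditive.sub_comp, Category.assoc, Preadditive.comp_sub]
    congr 1
    by_cases h : n = m
    · subst h
      rw [sumι_sumπ, ← Category.assoc, sumι_sumπ, Category.comp_id, Category.id_comp]
    · rw [sumι_sumπ_ne Z (by omega), ← Category.assoc, sumι_sumπ_ne Z (by omega), Limits.comp_zero,
        Limits.zero_comp]
  refine Preadditive.mono_of_cancel_zero _ fun {T} u hu => sum_lift_ext Z fun m => ?_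
  rw [Limits.zero_comp]
  induction m with
  | zero => rw [← h0, ← Category.assoc, hu, Limits.zero_comp]
  | succ m ih =>
    have := u ≫= hs m
    rw [← Category.assoc, hu, Limits.zero_comp, Preadditive.comp_sub, ← Category.assoc u (sumπ Z m), ih,
      Limits.zero_comp, sub_zero] at this
    exact this.symm

/-- The family of dg objects that consists of `Z` and of further objects. -/
abbrev consFamily {ι : Type} (Z : DgA) (D : ι → DgA) : Option ι → DgA
  | none => Z
  | some i => D i

/-- With `telescope_mono`, this is the counterpart for dg objects of the injectivity of the
attaching map. It keeps the sequence of representing objects short exact, so that the five lemma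
applies in `good_coker`. -/
lemma attachment_mono {ι : Type} {S D : ι → DgA} {Z : DgA} {b : ∀ i, S i ⟶ D i} (hb : ∀ i, Mono (b i))
    {t : ∀ i, S i ⟶ Z} {f : sum S ⟶ sum (consFamily Z D)}
    (hf : ∀ i, sumι S i ≫ f = b i ≫ sumι (consFamily Z D) (some i) - t i ≫ sumι (consFamily Z D) none) :
    Mono f := by
  have h (i : ι) : f ≫ sumπ (consFamily Z D) (some i) = sumπ S i ≫ b i := by
    refine sum_ext S fun k => ?_
    rw [← Category.assoc, hf, Preadditive.sub_comp, Category.assoc, Category.assoc,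
      sumι_sumπ_ne (consFamily Z D) (Option.some_ne_none i), Limits.comp_zero, sub_zero]
    by_cases h : k = i
    · subst h
      rw [sumι_sumπ (consFamily Z D) (some k), ← Category.assoc (sumι S k), sumι_sumπ]
      exact (Category.comp_id _).trans (Category.id_comp _).symm
    · rw [sumι_sumπ_ne (consFamily Z D) (fun e => h (Option.some.inj e).symm), ← Category.assoc (sumι S k),
        sumι_sumπ_ne S (fun e => h e.symm), Limits.comp_zero, Limits.zero_comp]
  refine Preadditive.mono_of_cancel_zero _ fun {T} u hu => sum_lift_ext S fun i => ?_
  have := hb i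
  rw [← cancel_mono (b i), Category.assoc, ← h, ← Category.assoc, hu, Limits.zero_comp, Limits.zero_comp,
    Limits.zero_comp]

end DgA

namespace DGMod

open DgA

variable {G : Type} {B : G → DgA}

/-! #### Modules whose unit is a weak equivalence -/

lemma homFunctor_map_sub {Y Z : DgA} (f g : Y ⟶ Z) :
    (homFunctor B).map (f - g) = (homFunctor B).map f - (homFunctor B).map g :=
  hom_ext fun a n x => elVal_injective (by
    rw [ap_sub, map_sub, elVal_ap, elVal_ap, elVal_ap, sub_pair, map_sub, LinearMap.sub_apply])

/-- The divisible kernel splits the sequence in 𝒜, so Hom(B a, -) remains exact on the right. -/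
lemma homFunctor_isSES {X Y Z : DgA} {f : X ⟶ Y} {g : Y ⟶ Z} (h : DgA.IsSES f g)
    (hX : AObj.IsDiv X.toAObj) : IsSES ((homFunctor B).map f) ((homFunctor B).map g) := by
  obtain ⟨r, hr, s, hs, hrf, hgs, hfs⟩ := hX.exists_splitting h.inj (DgA.Hom.mem f) h.surj (DgA.Hom.mem g) h.exact
  refine ⟨fun a n x y hxy => elVal_injective (h.inj.cancel (congrArg elVal hxy)), ?_, fun a n y hy => ?_,
    fun a n z => ?_⟩
  · rw [← Functor.map_comp, ← homFunctor_map_zero]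
    congr 1
    refine DgA.hom_ext (AObj.pairs_ext (fun x => ?_) (fun x => ?_))
    · exact (h.exact.1 _).2 ⟨x, rfl⟩
    · exact (h.exact.2 _).2 ⟨x, rfl⟩
  · obtain ⟨l, hl, hfl⟩ := AObj.exists_lift h.inj (DgA.Hom.mem f) h.exact (elVal_mem y) (congrArg elVal hy)
    exact ⟨elMk l hl, elVal_injective hfl⟩
  · have hm : AObj.comp s (elVal z) ∈ AObj.homDeg (B a).toAObj Y.toAObj n :=
      AObj.comp_mem (by omega) hs (elVal_mem z)
    refine ⟨elMk _ hm, elVal_injective ?_⟩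
    rw [elVal_ap, elVal_elMk, ← AObj.comp_assoc, hgs, AObj.one_comp]

/-- Injectivity in homology follows from the projections to the summands; surjectivity in homology
is compactness. -/
lemma weakEquivalence_sumComparison (hc : ∀ a, IsCompactUpToQuasiIso (B a)) {ι : Type} {Z : ι → DgA}
    (hZ : ∀ i, AObj.IsDiv (Z i).toAObj)
    {κ : sum (fun i => (homFunctor B).obj (Z i)) ⟶ (homFunctor B).obj (DgA.sum Z)}
    (hκ : ∀ i, sumι _ i ≫ κ = (homFunctor B).map (DgA.sumι Z i)) : WeakEquivalence κ := by
  have hπ (i : ι) : κ ≫ (homFunctor B).map (DgA.sumπ Z i) = sumπ (fun i => (homFunctor B).obj (Z i)) i := by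
    refine sum_ext _ fun k => ?_
    rw [← Category.assoc, hκ, ← Functor.map_comp]
    by_cases h : i = k
    · subst h
      rw [DgA.sumι_sumπ, sumι_sumπ, CategoryTheory.Functor.map_id]
    · rw [DgA.sumι_sumπ_ne _ h, sumι_sumπ_ne _ (fun e => h e.symm), homFunctor_map_zero]
  have hκ (i a n x) : ap κ a n (ap (sumι _ i) a n x) = ap ((homFunctor B).map (DgA.sumι Z i)) a n x :=
    congrArg (fun k => ap k a n x) (hκ i)
  rw [weakEquivalence_iff]
  rintro a i j k rfl hjk
  constructor
  · rintro x hx ⟨y, hy⟩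
    refine sum_boundary _ fun l => ⟨ap ((homFunctor B).map (DgA.sumπ Z l)) a (j + 1) y, ?_⟩
    rw [← ap_dl, hy, ← ap_comp, hπ]
  · intro y hy
    obtain ⟨s, h, hh, hd⟩ := (hc a).exists_finset hZ (elVal_mem y)
      ((elVal_dl hjk y).symm.trans ((congrArg elVal hy).trans (map_zero _)))
    refine ⟨∑ l ∈ s, ap (sumι _ l) a j (ap ((homFunctor B).map (DgA.sumπ Z l)) a j y), ?_, elMk h hh,
      elVal_injective ?_⟩
    · rw [map_sum]
      exact Finset.sum_eq_zero fun l _ => by rw [← ap_dl, ← ap_dl, hy, map_zero, map_zero]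
    · rw [elVal_dl rfl, elVal_elMk, hd, map_sub, map_sum, map_sum]
      congr 1
      refine Finset.sum_congr rfl fun l _ => ?_
      rw [hκ, elVal_ap, elVal_ap]

/-- The module has a universal arrow to a divisible object, and it is a weak equivalence. -/
def Good (M : DGMod (endRing B)) : Prop :=
  ∃ (Z : DgA) (η : M ⟶ (homFunctor B).obj Z), IsUniv η ∧ AObj.IsDiv Z.toAObj ∧ WeakEquivalence η

instance {R : DGRing G} (M : DGMod R) : WeakEquivalence (𝟙 M) :=
  ⟨fun a => (inferInstance : QuasiIso (𝟙 (M.obj a)))⟩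

lemma good_sum_of (hc : ∀ a, IsCompactUpToQuasiIso (B a)) {ι : Type} {M : ι → DGMod (endRing B)}
    {Z : ι → DgA} {η : ∀ i, M i ⟶ (homFunctor B).obj (Z i)} (hη : ∀ i, IsUniv (η i))
    (hZ : ∀ i, AObj.IsDiv (Z i).toAObj) (hw : ∀ i, WeakEquivalence (η i)) :
    ∃ θ : sum M ⟶ (homFunctor B).obj (DgA.sum Z), IsUniv θ ∧ WeakEquivalence θ ∧
      ∀ i, sumι M i ≫ θ = η i ≫ (homFunctor B).map (DgA.sumι Z i) := by
  obtain ⟨κ, hκ⟩ := exists_sumComparison (B := B) Z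
  obtain ⟨ψ, hψ⟩ := exists_sum_desc M fun i => η i ≫ sumι (fun i => (homFunctor B).obj (Z i)) i
  have h (i : ι) : sumι M i ≫ ψ ≫ κ = η i ≫ (homFunctor B).map (DgA.sumι Z i) := by
    rw [← Category.assoc, hψ, Category.assoc, hκ]
  have := weakEquivalence_sum hw hψ
  have := weakEquivalence_sumComparison hc hZ hκ
  exact ⟨ψ ≫ κ, IsUniv.sum hη h, inferInstance, h⟩

/-- The cokernel of f is divisible as a quotient of W and represents P. Since Z is divisible, Hom(B
a, -) keeps the sequence exact, and the five lemma compares it with the given one. -/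
lemma good_coker {M N P : DGMod (endRing B)} {φ : M ⟶ N} {π : N ⟶ P} (hses : IsSES φ π) {Z W : DgA}
    {η : M ⟶ (homFunctor B).obj Z} {θ : N ⟶ (homFunctor B).obj W} (hη : IsUniv η) (hθ : IsUniv θ)
    (hηw : WeakEquivalence η) (hθw : WeakEquivalence θ) (hZ : AObj.IsDiv Z.toAObj)
    (hW : AObj.IsDiv W.toAObj) {f : Z ⟶ W} (hf : η ≫ (homFunctor B).map f = φ ≫ θ) (hfm : Mono f) :
    Good P := by
  obtain ⟨κ, hκ, hπκ⟩ := exists_univ_coker hη hθ hf hses.surj hses.exact hses.zero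
  have hs := DgA.coker_isSES f (DgA.inj_of_mono f)
  exact ⟨_, κ, hκ, hW.of_surjective _ (DgA.cokerπ_surj f).1,
    hses.weakEquivalence (homFunctor_isSES hs hZ) hf.symm hπκ hηw hθw⟩

/-- Retracts of good modules are good, for any universal arrow. -/
lemma Good.of_retract {M W : DGMod (endRing B)} (hW : Good W) (r : Retract M W) {Z : DgA}
    {η : M ⟶ (homFunctor B).obj Z} (hη : IsUniv η) : AObj.IsDiv Z.toAObj ∧ WeakEquivalence η := by
  obtain ⟨Z', η', hη', hZ', hw⟩ := hW
  obtain ⟨i, hi⟩ := (hη Z').2 (r.i ≫ η')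
  obtain ⟨p, hp⟩ := (hη' Z).2 (r.r ≫ η)
  have hi : η ≫ (homFunctor B).map i = r.i ≫ η' := hi
  have hp : η' ≫ (homFunctor B).map p = r.r ≫ η := hp
  have hip : i ≫ p = 𝟙 Z := (hη Z).1 (by
    change η ≫ (homFunctor B).map (i ≫ p) = η ≫ (homFunctor B).map (𝟙 Z)
    rw [Functor.map_comp, ← Category.assoc, hi, Category.assoc, hp, ← Category.assoc, r.retract,
      CategoryTheory.Functor.map_id, Category.id_comp, Category.comp_id])
  refine ⟨hZ'.of_surjective (DgA.Hom.pair p).1 fun x => ⟨(DgA.Hom.pair i).1 x, ?_⟩, ⟨?_⟩⟩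
  · exact LinearMap.congr_fun (congrArg (fun f => (DgA.Hom.pair f).1) hip) x
  · refine MorphismProperty.of_retract (P := weakEquivalences (DGMod (endRing B))) (g := η') ?_ hw.mem
    exact
      { i := Arrow.homMk r.i ((homFunctor B).map i) hi.symm
        r := Arrow.homMk r.r ((homFunctor B).map p) hp.symm
        retract := by
          ext
          · exact r.retract
          · change (homFunctor B).map i ≫ (homFunctor B).map p = 𝟙 _
            rw [← Functor.map_comp, hip, CategoryTheory.Functor.map_id] }

lemma bdHom_mono (c : G × ℤ) : Mono (bdHom B c) :=
  ⟨fun u v h => DgA.hom_ext (by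
    have h' : AObj.comp (DgA.Hom.pair (bdHom B c)) (DgA.Hom.pair u) =
      AObj.comp (DgA.Hom.pair (bdHom B c)) (DgA.Hom.pair v) := congrArg DgA.Hom.pair h
    rw [← AObj.one_comp (DgA.Hom.pair u), ← AObj.one_comp (DgA.Hom.pair v), ← bdHom_retraction c,
      AObj.comp_assoc, h', ← AObj.comp_assoc])⟩

lemma good_attachment (hB : ∀ a, AObj.IsDiv (B a).toAObj) (hc : ∀ a, IsCompactUpToQuasiIso (B a)) {ι : Type}
    {c : ι → G × ℤ} {X X' : DGMod (endRing B)} {t : ∀ i, Sp B (c i) ⟶ X} {j : X ⟶ X'}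
    {φ : sum (fun i => Sp B (c i)) ⟶ sum (withDisks c X)} {π : sum (withDisks c X) ⟶ X'}
    (h : IsAttachment c t j φ π) (hX : Good X) : Good X' := by
  obtain ⟨Z, η, hη, hZ, hw⟩ := hX
  obtain ⟨σ, hσ, hσw, hσι⟩ := good_sum_of hc (η := fun i => 𝟙 (Sp B (c i)))
    (fun i => isUniv_id (sphere (B (c i).1) ((c i).2 - 1)).map_bijective)
    (fun i => sphere_isDiv (hB _) _) (fun i => inferInstance)
  let D : ι → DgA := fun i => (disk (B (c i).1) (c i).2).Z
  let η' : ∀ o, withDisks c X o ⟶ (homFunctor B).obj (consFamily Z D o) := fun o => match o with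
    | none => η
    | some i => 𝟙 (Dk B (c i))
  have hD : ∀ o, AObj.IsDiv (consFamily Z D o).toAObj := fun o => match o with
    | none => hZ
    | some i => disk_isDiv (hB _) _
  obtain ⟨θ, hθ, hθw, hθι⟩ := good_sum_of hc (η := η')
    (fun o => match o with
      | none => hη
      | some i => isUniv_id (disk (B (c i).1) (c i).2).map_bijective)
    hD (fun o => match o with
      | none => hw
      | some i => (inferInstance : WeakEquivalence (𝟙 (Dk B (c i)))))
  choose t' ht' using fun i => ((sphere (B (c i).1) ((c i).2 - 1)).map_bijective Z).2 (t i ≫ η)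
  -- The attaching map of the modules, transported to the representing objects; this uses that maps
  -- out of spheres are determined by maps of modules.
  obtain ⟨f, hf⟩ := DgA.exists_sum_desc (fun i => (sphere (B (c i).1) ((c i).2 - 1)).Z) fun i =>
    bdHom B (c i) ≫ DgA.sumι (consFamily Z D) (some i) - t' i ≫ DgA.sumι (consFamily Z D) none
  refine good_coker h.ses hσ hθ hσw hθw (AObj.IsDiv.sum fun i => sphere_isDiv (hB _) _) (AObj.IsDiv.sum hD)
    (f := f) (sum_ext _ fun i => ?_) (attachment_mono (fun i => bdHom_mono (c i)) hf)
  have h₁ : sumι (withDisks c X) (some i) ≫ θ = (homFunctor B).map (DgA.sumι (consFamily Z D) (some i)) :=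
    (hθι (some i)).trans (Category.id_comp _)
  have h₂ : sumι (withDisks c X) none ≫ θ = η ≫ (homFunctor B).map (DgA.sumι (consFamily Z D) none) :=
    hθι none
  rw [← Category.assoc, hσι, Category.assoc, ← Functor.map_comp, hf, ← Category.assoc, h.φ_eq,
    Preadditive.sub_comp, Category.assoc, Category.assoc, h₁, h₂, homFunctor_map_sub, Functor.map_comp,
    Functor.map_comp, map_bdHom, ht', Category.id_comp, Category.assoc]

lemma good_telescope (hc : ∀ a, IsCompactUpToQuasiIso (B a)) {X : ℕ → DGMod (endRing B)}
    {j : ∀ n, X n ⟶ X (n + 1)} {W : DGMod (endRing B)} {i : ∀ n, X n ⟶ W} {φ : sum X ⟶ sum X}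
    {π : sum X ⟶ W} (h : IsTelescope X j i φ π) (hX : ∀ n, Good (X n)) : Good W := by
  choose Z η hη hZ hw using hX
  obtain ⟨θ, hθ, hθw, hθι⟩ := good_sum_of hc hη hZ hw
  choose j' hj' using fun n => (hη n (Z (n + 1))).2 (j n ≫ η (n + 1))
  have hj' (n : ℕ) : η n ≫ (homFunctor B).map (j' n) = j n ≫ η (n + 1) := hj' n
  obtain ⟨f, hf⟩ := DgA.exists_sum_desc Z fun n => DgA.sumι Z n - j' n ≫ DgA.sumι Z (n + 1)
  refine good_coker h.ses hθ hθ hθw hθw (AObj.IsDiv.sum hZ) (AObj.IsDiv.sum hZ) (f := f)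
    (sum_ext _ fun n => ?_) (telescope_mono hf)
  rw [← Category.assoc, hθι, Category.assoc, ← Functor.map_comp, hf, ← Category.assoc, h.φ_eq,
    Preadditive.sub_comp, Category.assoc, hθι, hθι, homFunctor_map_sub, Functor.map_comp,
    Preadditive.comp_sub, ← Category.assoc (η n) _ _, hj', Category.assoc]

lemma isCellular_good (hB : ∀ a, AObj.IsDiv (B a).toAObj) (hc : ∀ a, IsCompactUpToQuasiIso (B a)) :
    IsCellular (Good (B := B)) :=
  ⟨fun h hX => good_attachment hB hc h hX, fun h hX => good_telescope hc h hX⟩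

/-- A universal arrow from a cofibrant module is a weak equivalence to a divisible object. -/
theorem weakEquivalence_of_isCofibrant (hB : ∀ a, AObj.IsDiv (B a).toAObj)
    (hc : ∀ a, IsCompactUpToQuasiIso (B a)) (M : DGMod (endRing B)) [IsCofibrant M] {Z : DgA}
    {η : M ⟶ (homFunctor B).obj Z} (hη : IsUniv η) : AObj.IsDiv Z.toAObj ∧ WeakEquivalence η := by
  -- The initial module is a retract of the empty direct sum, which is good.
  have h0 : Good (⊥_ (DGMod (endRing B))) := by
    obtain ⟨θ, hθ, hθw, -⟩ := good_sum_of (B := B) hc (ι := PEmpty.{1}) (M := fun i => i.elim)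
      (Z := fun i => i.elim) (η := fun i => i.elim) (fun i => i.elim) (fun i => i.elim) (fun i => i.elim)
    have hS : Good (sum (fun i : PEmpty.{1} => (i.elim : DGMod (endRing B)))) :=
      ⟨_, θ, hθ, AObj.IsDiv.sum fun i => i.elim, hθw⟩
    obtain ⟨Z₀, η₀, hη₀⟩ := exists_univ (⊥_ (DGMod (endRing B)))
    obtain ⟨h₁, h₂⟩ := hS.of_retract
      ⟨Limits.initial.to _, (exists_sum_desc _ fun i : PEmpty.{1} => i.elim).choose,
        Limits.initial.hom_ext _ _⟩ hη₀
    exact ⟨Z₀, η₀, hη₀, h₁, h₂⟩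
  obtain ⟨W, i, p, hip, hi, hp, hP⟩ := exists_cell_factorization (Limits.initial.to M)
  have hcof : cofibrations (DGMod (endRing B)) (Limits.initial.to M) :=
    (inferInstance : Cofibration (Limits.initial.to M)).mem
  -- Lifting the identity of M exhibits M as a retract of the cell complex W.
  have : HasLiftingProperty (Limits.initial.to M) p := hcof p hp
  have sq : CommSq i (Limits.initial.to M) p (𝟙 M) := ⟨Limits.initial.hom_ext _ _⟩
  exact (hP Good (isCellular_good hB hc) h0).of_retract ⟨sq.lift, p, sq.fac_right⟩ hη

end DGMod


namespace DgA

open AObj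

/-! #### The functor to modules and the model structures -/

instance : Limits.HasZeroObject DgA := Limits.hasZeroObject_of_hasTerminal_object

lemma isZero_of_isTerminal {Z : DgA} (hZ : Limits.IsTerminal Z) : Limits.IsZero Z :=
  (Limits.isZero_zero DgA).of_iso (hZ.uniqueUpToIso (Limits.isZero_zero DgA).isTerminal)

/-- The map to the terminal object is a retract of a surjection with divisible kernel onto zero. Its
source is then divisible, and divisibility passes to retracts. -/
lemma isDiv_of_isFibrant (Y : DgA) [h : IsFibrant Y] : IsDiv Y.toAObj := by
  have hZ := isZero_of_isTerminal Limits.terminalIsTerminal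
  have hf : Fibration (Limits.terminal.from Y) := inferInstance
  obtain ⟨W, π, hπ, ⟨r⟩⟩ := exists_retract_of_fibration (Limits.terminal.from Y) hf.mem
  have hW : IsDiv W.toAObj := by
    intro s hs x
    have h0 : Hom.pair π = 0 := congrArg Hom.pair (hZ.eq_of_tgt π 0)
    obtain ⟨y, -, e⟩ := hπ.div s hs x (by rw [h0]; rfl)
    exact ⟨y, e⟩
  refine hW.of_surjective (Hom.pair r.r.left).1 fun x => ⟨(Hom.pair r.i.left).1 x, ?_⟩
  exact LinearMap.congr_fun (congrArg (fun f => (Hom.pair f).1) r.left.retract) x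

lemma isFibrantObj_of_isDiv {Y : DgA} (h : IsDiv Y.toAObj) : IsFibrantObj Y := by
  intro Z hZ f
  have h1 : Hom.pair (𝟙 Z) = 0 := congrArg Hom.pair ((isZero_of_isTerminal hZ).eq_of_tgt (𝟙 Z) 0)
  have hx (z : Z.nub) : z = 0 := LinearMap.congr_fun (congrArg Prod.fst h1) z
  have hv (z : Z.vertex) : z = 0 := LinearMap.congr_fun (congrArg Prod.snd h1) z
  refine ⟨IsDivFib.fibration ⟨⟨fun z => ⟨0, ?_⟩, fun z => ⟨0, ?_⟩⟩, fun s hs x _ => ?_⟩⟩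
  · rw [hx z, map_zero]
  · rw [hv z, map_zero]
  · obtain ⟨y, e⟩ := h s hs x
    exact ⟨y, hx _, e⟩

lemma isDiv_fib {X Y : DgA} (f : X ⟶ Y) (hX : IsDiv X.toAObj) (hY : IsDiv Y.toAObj) :
    IsDiv (fib f).toAObj :=
  IsDiv.prod (Y := AObj.susp Y.toAObj (-1)) hX hY

/-- A cycle (x, y) of the homotopy fibre is a cycle x with a primitive y of its image; bounding such
pairs is at once injectivity and surjectivity of f in homology. -/
lemma acyclic_fib_iff {X Y : DgA} (f : X ⟶ Y) : Acyclic (fib f) ↔ weakEquivalences DgA f := by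
  have key {A B : Type} [AddCommGroup A] [AddCommGroup B] (dA : A →+ A) (dB : B →+ B) (g : A →+ B)
      (d : A × B → A × B) (hg : ∀ x, dB (g x) = g (dA x))
      (hd : ∀ x y, d (x, y) = (dA x, g x - dB y)) : IsAcyclic d ↔ IsHomologyIso dA dB g := by
    constructor
    · refine fun h => ⟨fun x hx ⟨y, hy⟩ => ?_, fun y hy => ?_⟩
      · obtain ⟨⟨u, v⟩, e⟩ := h (x, y) (by rw [hd, hx, hy, sub_self]; rfl)
        exact ⟨u, (congrArg Prod.fst ((hd u v).symm.trans e))⟩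
      · obtain ⟨⟨u, v⟩, e⟩ := h (0, y) (by rw [hd, hy, map_zero, map_zero, sub_zero]; rfl)
        have e := (hd u v).symm.trans e
        refine ⟨u, congrArg Prod.fst e, v, ?_⟩
        have e₂ : g u - dB v = y := congrArg Prod.snd e
        rw [← e₂]
        abel
    · rintro ⟨h₁, h₂⟩ ⟨x, y⟩ e
      have e := (hd x y).symm.trans e
      have ex : dA x = 0 := congrArg Prod.fst e
      have ey : g x - dB y = 0 := congrArg Prod.snd e
      obtain ⟨u, rfl⟩ := h₁ x ex ⟨y, (sub_eq_zero.1 ey).symm⟩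
      obtain ⟨w, hw, z, hz⟩ := h₂ (y - g u) (by rw [map_sub, ← sub_eq_zero.1 ey, hg, sub_self])
      refine ⟨(u + w, z), (hd _ _).trans (Prod.ext ?_ ?_)⟩
      · rw [map_add, hw, add_zero]
      · change g (u + w) - dB z = y
        rw [hz, map_add]
        abel
  exact and_congr (key X.d.1.toAddMonoidHom Y.d.1.toAddMonoidHom (Hom.pair f).1.toAddMonoidHom _ (d_apply f)
    (fib_d f)) (key X.d.2.toAddMonoidHom Y.d.2.toAddMonoidHom (Hom.pair f).2.toAddMonoidHom _ (d_apply' f)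
    (fib_d' f))

/-- Every divisible object is acyclic if all maps from the family to it are null-homotopic up to
suspension. -/
def Generates {G : Type} (B : G → DgA) : Prop :=
  ∀ Y : DgA, IsDiv Y.toAObj → (∀ a n, HomAcyclic (B a) Y n) → Acyclic Y

/-! ### Hom complexes into a homotopy fibre -/

section

variable {X Y Z : DgA} (f : Y ⟶ Z)

/-- The map to a homotopy fibre with given components. -/
def toFibPair (u : Pairs X.toAObj Y.toAObj) (v : Pairs X.toAObj Z.toAObj) :
    Pairs X.toAObj (fib f).toAObj :=
  pairing (Y := (Z.susp (-1)).toAObj) u v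

lemma toFibPair_mem {n : ℤ} {u : Pairs X.toAObj Y.toAObj} {v : Pairs X.toAObj Z.toAObj}
    (hu : u ∈ homDeg X.toAObj Y.toAObj n) (hv : v ∈ homDeg X.toAObj Z.toAObj (n + 1)) :
    toFibPair f u v ∈ homDeg X.toAObj (fib f).toAObj n :=
  pairing_mem hu (comp_mem (p := -1) (q := n + 1) (by omega) (toSusp_mem Z.toAObj (-1)) hv)

lemma exists_toFibPair {n : ℤ} {F : Pairs X.toAObj (fib f).toAObj}
    (hF : F ∈ homDeg X.toAObj (fib f).toAObj n) :
    ∃ u ∈ homDeg X.toAObj Y.toAObj n, ∃ v ∈ homDeg X.toAObj Z.toAObj (n + 1), F = toFibPair f u v :=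
  ⟨_, comp_mem (zero_add n) (fst_mem Y.toAObj (Z.susp (-1)).toAObj) hF, _,
    comp_mem (p := 1) (by omega) (ofSusp_mem Z.toAObj (-1))
      (comp_mem (zero_add n) (snd_mem Y.toAObj (Z.susp (-1)).toAObj) hF), rfl⟩

lemma toFibPair_inj {u u' : Pairs X.toAObj Y.toAObj} {v v' : Pairs X.toAObj Z.toAObj}
    (h : toFibPair f u v = toFibPair f u' v') : u = u' ∧ v = v' :=
  ⟨congrArg (AObj.comp (fst Y.toAObj (Z.susp (-1)).toAObj)) h,
    congrArg (AObj.comp (snd Y.toAObj (Z.susp (-1)).toAObj)) h⟩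

lemma toFibPair_zero : toFibPair f (0 : Pairs X.toAObj Y.toAObj) 0 = 0 := rfl

lemma toFibPair_apply (u : Pairs X.toAObj Y.toAObj) (v : Pairs X.toAObj Z.toAObj) (x : X.nub) :
    (toFibPair f u v).1 x = ((u.1 x, v.1 x) : Y.nub × Z.nub) := rfl

lemma toFibPair_apply' (u : Pairs X.toAObj Y.toAObj) (v : Pairs X.toAObj Z.toAObj) (x : X.vertex) :
    (toFibPair f u v).2 x = ((u.2 x, v.2 x) : Y.vertex × Z.vertex) := rfl

lemma diff_toFibPair (k : ℤ) (u : Pairs X.toAObj Y.toAObj) (v : Pairs X.toAObj Z.toAObj) :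
    diff X (fib f) k (toFibPair f u v) =
      toFibPair f (diff X Y k u) (AObj.comp (Hom.pair f) u - diff X Z (k + 1) v) := by
  have hs : sgn (k + 1) = - sgn k := by rw [sgn_add, sgn_one, mul_neg_one]
  refine pairs_ext (fun x => ?_) (fun x => ?_)
  · change (fib f).d.1 ((toFibPair f u v).1 x) - sgn k • (toFibPair f u v).1 (X.d.1 x) = _
    rw [toFibPair_apply, toFibPair_apply, toFibPair_apply]
    refine (congrArg (· - _) (fib_d f (u.1 x) (v.1 x))).trans (Prod.ext rfl ?_)
    change (Hom.pair f).1 (u.1 x) - Z.d.1 (v.1 x) - sgn k • v.1 (X.d.1 x) =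
      (Hom.pair f).1 (u.1 x) - (Z.d.1 (v.1 x) - sgn (k + 1) • v.1 (X.d.1 x))
    rw [hs, neg_smul]
    abel
  · change (fib f).d.2 ((toFibPair f u v).2 x) - sgn k • (toFibPair f u v).2 (X.d.2 x) = _
    rw [toFibPair_apply', toFibPair_apply', toFibPair_apply']
    refine (congrArg (· - _) (fib_d' f (u.2 x) (v.2 x))).trans (Prod.ext rfl ?_)
    change (Hom.pair f).2 (u.2 x) - Z.d.2 (v.2 x) - sgn k • v.2 (X.d.2 x) =
      (Hom.pair f).2 (u.2 x) - (Z.d.2 (v.2 x) - sgn (k + 1) • v.2 (X.d.2 x))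
    rw [hs, neg_smul]
    abel

lemma homAcyclic_fib_iff (n : ℤ) : HomAcyclic X (fib f) n ↔
    ∀ x ∈ homDeg X.toAObj Y.toAObj n, ∀ y ∈ homDeg X.toAObj Z.toAObj (n + 1),
      diff X Y n x = 0 → diff X Z (n + 1) y = AObj.comp (Hom.pair f) x →
      ∃ u ∈ homDeg X.toAObj Y.toAObj (n + 1), ∃ v ∈ homDeg X.toAObj Z.toAObj (n + 1 + 1),
        diff X Y (n + 1) u = x ∧ AObj.comp (Hom.pair f) u - diff X Z (n + 1 + 1) v = y := by
  constructor
  · intro h x hx y hy ex ey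
    obtain ⟨w, hw, e⟩ := h _ (toFibPair_mem f hx hy)
      (by rw [diff_toFibPair, ex, ey, sub_self, toFibPair_zero])
    obtain ⟨u, hu, v, hv, rfl⟩ := exists_toFibPair f hw
    rw [diff_toFibPair] at e
    exact ⟨u, hu, v, hv, toFibPair_inj f e⟩
  · intro h F hF hd
    obtain ⟨x, hx, y, hy, rfl⟩ := exists_toFibPair f hF
    rw [diff_toFibPair, ← toFibPair_zero] at hd
    obtain ⟨e₁, e₂⟩ := toFibPair_inj f hd
    obtain ⟨u, hu, v, hv, e₁, e₂⟩ := h x hx y hy e₁ (sub_eq_zero.1 e₂).symm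
    exact ⟨_, toFibPair_mem f hu hv, by rw [diff_toFibPair, e₁, e₂]⟩

end

end DgA

/-! ### Homotopical properties of the functor of homomorphisms -/

namespace DGMod

open DgA

variable {G : Type} {B : G → DgA}

/-- Hom(B a, -) carries the homotopy fibre of f to that of the induced map, and a chain map is a
quasi-isomorphism exactly when its homotopy fibre is acyclic. -/
lemma homFunctor_weakEquivalence_iff {Y Z : DgA} (f : Y ⟶ Z) :
    WeakEquivalence ((homFunctor B).map f) ↔ ∀ a n, HomAcyclic (B a) (fib f) n := by
  simp only [homAcyclic_fib_iff, weakEquivalence_iff]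
  constructor
  · intro h a n x hx y hy ex ey
    obtain ⟨h₁, -⟩ := h a (n + 1) n (n - 1) rfl (by omega)
    obtain ⟨-, h₂⟩ := h a (n + 1 + 1) (n + 1) n rfl rfl
    obtain ⟨u, hu⟩ := h₁ (elMk x hx) (elVal_injective ((elVal_dl (by omega) _).trans ex))
      ⟨elMk y hy, elVal_injective ((elVal_dl rfl _).trans ey)⟩
    have hu' : diff (B a) Y (n + 1) (elVal u) = x := (elVal_dl rfl u).symm.trans (congrArg elVal hu)
    obtain ⟨w, hw, v, hv⟩ := h₂ (elMk y hy - ap ((homFunctor B).map f) a (n + 1) u) (by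
      rw [map_sub, ← ap_dl, hu, sub_eq_zero]
      exact elVal_injective ((elVal_dl rfl _).trans ey))
    have hw' : diff (B a) Y (n + 1) (elVal w) = 0 := (elVal_dl rfl w).symm.trans ((congrArg elVal hw).trans (map_zero _))
    have hv' : diff (B a) Z (n + 1 + 1) (elVal v) = AObj.comp (DgA.Hom.pair f) (elVal w) -
      (y - AObj.comp (DgA.Hom.pair f) (elVal u)) := (elVal_dl rfl v).symm.trans (congrArg elVal hv)
    refine ⟨_, add_mem (elVal_mem u) (elVal_mem w), _, elVal_mem v, ?_, ?_⟩
    · rw [map_add, hu', hw', add_zero]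
    · rw [hv', map_add]
      abel
  · rintro h a i j k rfl hjk
    refine ⟨fun x hx ⟨y, hy⟩ => ?_, fun y hy => ?_⟩
    · obtain ⟨u, hu, -, -, e, -⟩ := h a j (elVal x) (elVal_mem x) (elVal y) (elVal_mem y)
        ((elVal_dl hjk x).symm.trans ((congrArg elVal hx).trans (map_zero _)))
        ((elVal_dl rfl y).symm.trans (congrArg elVal hy))
      exact ⟨elMk u hu, elVal_injective ((elVal_dl rfl _).trans e)⟩
    · subst hjk
      obtain ⟨u, hu, v, hv, e, e'⟩ := h a k 0 (zero_mem _) (elVal y) (elVal_mem y) (map_zero _)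
        ((elVal_dl rfl y).symm.trans ((congrArg elVal hy).trans ((map_zero _).trans (map_zero _).symm)))
      refine ⟨elMk u hu, elVal_injective ((elVal_dl rfl _).trans (e.trans (map_zero _).symm)), elMk v hv,
        elVal_injective ((elVal_dl rfl _).trans ?_)⟩
      rw [map_sub, elVal_ap, elVal_elMk, elVal_elMk, ← e']
      abel

/-- The functor preserves weak equivalences between divisible objects. -/
lemma homFunctor_weakEquivalence {Y Z : DgA} (f : Y ⟶ Z) (hY : AObj.IsDiv Y.toAObj)
    (hZ : AObj.IsDiv Z.toAObj) (hf : weakEquivalences DgA f) : WeakEquivalence ((homFunctor B).map f) :=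
  (homFunctor_weakEquivalence_iff f).2 fun a n =>
    (((acyclic_fib_iff f).2 hf).contractible (isDiv_fib f hY hZ)).homAcyclic_target n

/-- The functor reflects weak equivalences between divisible objects. -/
lemma weakEquivalence_of_homFunctor (hB : Generates B) {Y Z : DgA} (f : Y ⟶ Z) (hY : AObj.IsDiv Y.toAObj)
    (hZ : AObj.IsDiv Z.toAObj) (hf : WeakEquivalence ((homFunctor B).map f)) : weakEquivalences DgA f :=
  (acyclic_fib_iff f).1 (hB _ (isDiv_fib f hY hZ) ((homFunctor_weakEquivalence_iff f).1 hf))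

lemma homFunctor_trivialFibration {Y Z : DgA} {f : Y ⟶ Z} (hf : trivialFibrations DgA f) :
    trivialFibrations (DGMod (endRing B)) ((homFunctor B).map f) := by
  obtain ⟨W, π, hπ, hπw, ⟨r⟩⟩ := exists_retract_of_trivialFibration f hf.1 hf.2
  have hses := DgA.ker_isSES π hπ.surj
  have hK := (hses.acyclic_left hπw).contractible hπ.isDiv_ker
  have hs := homFunctor_isSES (B := B) hses hπ.isDiv_ker
  have h : trivialFibrations (DGMod (endRing B)) ((homFunctor B).map π) := by
    rw [← isCellInj_iff]
    rintro a i j k rfl hjk z y hz hzy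
    obtain ⟨w, rfl⟩ := hs.surj a (j + 1) y
    -- Lift y to w. The difference between z and the boundary of w is a cycle in the kernel, which
    -- is contractible, so it bounds there and w can be corrected.
    obtain ⟨c, hc⟩ := hs.exact a j (z - dl _ a (j + 1) j w) (by rw [map_sub, hzy, ap_dl, sub_self])
    obtain ⟨h, hh, hd⟩ := hK.homAcyclic_target j (elVal c) (elVal_mem c) (by
      rw [← elVal_dl hjk, ← map_zero elVal]
      congr 1
      refine hs.inj a k ?_
      rw [ap_dl, hc, map_sub, hz, dl_dl, sub_zero, map_zero])
    refine ⟨w + ap ((homFunctor B).map (DgA.kerι π)) a (j + 1) (elMk h hh), ?_, ?_⟩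
    · rw [map_add, ← ap_dl, show dl _ a (j + 1) j (elMk h hh) = c from
        elVal_injective ((elVal_dl rfl _).trans hd), hc, add_sub_cancel]
    · rw [map_add, ← ap_comp, hs.zero, ap_zero, add_zero]
  exact MorphismProperty.of_retract (r.map (homFunctor B)) h

lemma homFunctor_fibration {Y Z : DgA} {f : Y ⟶ Z} (hf : fibrations DgA f) :
    fibrations (DGMod (endRing B)) ((homFunctor B).map f) := by
  obtain ⟨W, π, hπ, ⟨r⟩⟩ := exists_retract_of_fibration f hf
  have hs := homFunctor_isSES (B := B) (DgA.ker_isSES π hπ.surj) hπ.isDiv_ker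
  have h : fibrations (DGMod (endRing B)) ((homFunctor B).map π) := epi_of_surjective hs.surj
  exact MorphismProperty.of_retract (r.map (homFunctor B)) h

end DGMod


section Derived

/-! ### Derived functors and Quillen equivalences -/

/-! ### Left derived functors by passage to opposite categories -/

section Left

variable {C₁ C H D : Type*} [Category* C₁] [Category* C] [Category* H] [Category* D]
  {W₁ : MorphismProperty C₁} {W : MorphismProperty C} {L : C ⥤ D} [L.IsLocalization W]

/-- The universal property of a left derived functor is that of a right derived functor of the
opposite functor, so the criteria for right derived functors apply. -/
lemma isLeftDerivedFunctor_of_op {LF : D ⥤ H} {F : C ⥤ H} (α : L ⋙ LF ⟶ F)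
    (h : LF.op.IsRightDerivedFunctor (F := F.op) (L := L.op) (NatTrans.op α) W.op) :
    LF.IsLeftDerivedFunctor α W := by
  have ext (K : D ⥤ H) (γ₁ γ₂ : K ⟶ LF)
      (hγ : Functor.whiskerLeft L γ₁ ≫ α = Functor.whiskerLeft L γ₂ ≫ α) : γ₁ = γ₂ := by
    have := LF.op.rightDerived_ext (F := F.op) (L := L.op) (NatTrans.op α) W.op K.op (NatTrans.op γ₁)
      (NatTrans.op γ₂) (congrArg (fun k => NatTrans.op k) hγ)
    exact congrArg (fun k => NatTrans.removeOp k) this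
  have fac (K : D ⥤ H) (β : L ⋙ K ⟶ F) : ∃ γ : K ⟶ LF, Functor.whiskerLeft L γ ≫ α = β := by
    refine ⟨NatTrans.removeOp (LF.op.rightDerivedDesc (F := F.op) (L := L.op) (NatTrans.op α) W.op K.op
      (NatTrans.op β)), ?_⟩
    refine NatTrans.ext (funext fun X => ?_)
    exact congrArg Quiver.Hom.unop (LF.op.rightDerived_fac_app (F := F.op) (L := L.op) (NatTrans.op α) W.op K.op
      (NatTrans.op β) (Opposite.op X))
  refine ⟨⟨⟨Limits.IsTerminal.ofUniqueHom
    (fun K => CostructuredArrow.homMk (fac K.left K.hom).choose (fac K.left K.hom).choose_spec) ?_⟩⟩⟩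
  intro K m
  refine CostructuredArrow.hom_ext _ _ (ext _ _ _ ?_)
  exact (CostructuredArrow.w m).trans (fac K.left K.hom).choose_spec.symm

variable {Φ : LocalizerMorphism W₁ W} {F : C ⥤ H}

lemma derives_op (h : Φ.Derives F) : Φ.op.Derives F.op := by
  intro X Y f hf
  have : IsIso ((Φ.functor ⋙ F).map f.unop) := h f.unop hf
  exact (inferInstance : IsIso ((Φ.functor ⋙ F).map f.unop).op)

variable [Φ.IsLeftDerivabilityStructure]

lemma isLeftDerivedFunctor_of_isIso (h : Φ.Derives F) {LF : D ⥤ H} (α : L ⋙ LF ⟶ F)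
    (hα : ∀ X : C₁, IsIso (α.app (Φ.functor.obj X))) : LF.IsLeftDerivedFunctor α W := by
  refine isLeftDerivedFunctor_of_op α ((derives_op h).isRightDerivedFunctor_of_isIso _ fun X => ?_)
  have := hα X.unop
  exact (inferInstance : IsIso (α.app (Φ.functor.obj X.unop)).op)

lemma exists_leftDerivedFunctor (h : Φ.Derives F) (L : C ⥤ D) [L.IsLocalization W] :
    ∃ (LF : D ⥤ H) (α : L ⋙ LF ⟶ F), ∀ X : C₁, IsIso (α.app (Φ.functor.obj X)) := by
  have := (derives_op h).hasPointwiseRightDerivedFunctor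
  let RF := F.op.totalRightDerived L.op W.op
  let u := F.op.totalRightDerivedUnit L.op W.op
  refine ⟨RF.unop, NatTrans.removeOp (F := F) (G := L ⋙ RF.unop) u, fun X => ?_⟩
  have := (derives_op h).isIso_of_isRightDerivedFunctor u (Opposite.op X)
  exact (inferInstance : IsIso (u.app (Φ.op.functor.obj (Opposite.op X))).unop)

end Left

variable {C D : Type*} [Category* C] [Category* D] [ModelCategory C] [ModelCategory D]
  {F : C ⥤ D} {G : D ⥤ C} (adj : F ⊣ G)

/-- A criterion for the total derived functors of a Quillen adjunction to be equivalences. -/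
theorem isQuillenEquivalence_of (hQ : IsQuillenAdjunction adj)
    (hF : ∀ (X Y : C) [IsCofibrant X] [IsCofibrant Y] (f : X ⟶ Y) [WeakEquivalence f], WeakEquivalence (F.map f))
    (hG : ∀ (X Y : D) [IsFibrant X] [IsFibrant Y] (f : X ⟶ Y) [WeakEquivalence f], WeakEquivalence (G.map f))
    (hFX : ∀ (X : C) [IsCofibrant X], IsFibrant (F.obj X))
    (hη : ∀ (X : C) [IsCofibrant X], WeakEquivalence (adj.unit.app X))
    (hε : ∀ (X : C) (Y : D) [IsCofibrant X] [IsFibrant Y] (p : X ⟶ G.obj Y) [WeakEquivalence p],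
      WeakEquivalence (F.map p ≫ adj.counit.app Y)) : IsQuillenEquivalence adj := by
  let L := (weakEquivalences C).Q
  let L' := (weakEquivalences D).Q
  have inv : ∀ {X Y : C} (f : X ⟶ Y) [WeakEquivalence f], IsIso (L.map f) := fun f _ =>
    Localization.inverts L (weakEquivalences C) f (mem_weakEquivalences f)
  have inv' : ∀ {X Y : D} (f : X ⟶ Y) [WeakEquivalence f], IsIso (L'.map f) := fun f _ =>
    Localization.inverts L' (weakEquivalences D) f (mem_weakEquivalences f)
  let Φ := CofibrantObject.localizerMorphism C
  let Ψ := FibrantObject.localizerMorphism D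
  have dF : Φ.Derives (F ⋙ L') := by
    intro X Y f hf
    have : WeakEquivalence (CofibrantObject.ι.map f) := ⟨hf⟩
    have := hF _ _ (CofibrantObject.ι.map f)
    exact inv' (F.map (CofibrantObject.ι.map f))
  have dG : Ψ.Derives (G ⋙ L) := by
    intro X Y f hf
    have : WeakEquivalence (FibrantObject.ι.map f) := ⟨hf⟩
    have := hG _ _ (FibrantObject.ι.map f)
    exact inv (G.map (FibrantObject.ι.map f))
  -- The derived functors are computed by the original ones on cofibrant objects of C and on fibrant
  -- objects of D.
  obtain ⟨F', α, hα⟩ := exists_leftDerivedFunctor dF L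
  have hF' : F'.IsLeftDerivedFunctor α (weakEquivalences C) := isLeftDerivedFunctor_of_isIso dF α hα
  have := dG.hasPointwiseRightDerivedFunctor
  let G' := (G ⋙ L).totalRightDerived L' (weakEquivalences D)
  let β : G ⋙ L ⟶ L' ⋙ G' := (G ⋙ L).totalRightDerivedUnit L' (weakEquivalences D)
  have hβ := dG.isIso_of_isRightDerivedFunctor β
  have hG' : G'.IsRightDerivedFunctor β (weakEquivalences D) := inferInstance
  have hα' : ∀ (X : C) [IsCofibrant X], IsIso (α.app X) := fun X _ => hα (CofibrantObject.mk X)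
  have hβ' : ∀ (Y : D) [IsFibrant Y], IsIso (β.app Y) := fun Y _ => hβ (FibrantObject.mk Y)
  -- The derived adjunction requires the composites to be derived functors too. They are, because
  -- whiskering keeps α and β invertible on cofibrant and fibrant objects respectively.
  have h₁ : (F' ⋙ G').IsLeftDerivedFunctor
      ((Functor.associator _ _ _).inv ≫ Functor.whiskerRight α G') (weakEquivalences C) := by
    refine isLeftDerivedFunctor_of_isIso (Φ := Φ) (fun X Y f hf => ?_) _ fun X => ?_
    · have := dF f hf
      exact (inferInstance : IsIso (G'.map ((Φ.functor ⋙ F ⋙ L').map f)))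
    · have := hα X
      rw [NatTrans.comp_app]
      exact IsIso.comp_isIso' inferInstance (inferInstance : IsIso (G'.map (α.app (Φ.functor.obj X))))
  have h₂ : (G' ⋙ F').IsRightDerivedFunctor
      (Functor.whiskerRight β F' ≫ (Functor.associator _ _ _).hom) (weakEquivalences D) := by
    refine LocalizerMorphism.Derives.isRightDerivedFunctor_of_isIso (Φ := Ψ) (fun X Y f hf => ?_) _ fun X => ?_
    · have := dG f hf
      exact (inferInstance : IsIso (F'.map ((Ψ.functor ⋙ G ⋙ L).map f)))
    · have := hβ X
      rw [NatTrans.comp_app]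
      exact IsIso.comp_isIso' (inferInstance : IsIso (F'.map (β.app (Ψ.functor.obj X)))) inferInstance
  let adj' : F' ⊣ G' := adj.derived (weakEquivalences C) (weakEquivalences D) α β
  have fu (X : C) : adj'.unit.app (L.obj X) ≫ G'.map (α.app X) = L.map (adj.unit.app X) ≫ β.app (F.obj X) :=
    adj.derivedη_fac_app (weakEquivalences C) α β X
  have fc (Y : D) : F'.map (β.app Y) ≫ adj'.counit.app (L'.obj Y) =
      α.app (G.obj Y) ≫ L'.map (adj.counit.app Y) := adj.derivedε_fac_app (weakEquivalences D) α β Y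
  have hu : IsIso adj'.unit := by
    have := Φ.essSurj_of_hasLeftResolutions L
    rw [NatTrans.isIso_iff_isIso_app]
    intro X
    rw [NatTrans.isIso_app_iff_of_iso adj'.unit ((Φ.functor ⋙ L).objObjPreimageIso X).symm]
    -- Every object of the localization comes from a cofibrant M. There the derived unit is the
    -- ordinary unit up to isomorphisms, since F M is fibrant and needs no replacement.
    let M : C := Φ.functor.obj ((Φ.functor ⋙ L).objPreimage X)
    have : IsCofibrant M := inferInstance
    have := hα' M
    have := hη M
    have := hFX M
    have := hβ' (F.obj M)
    have := inv (adj.unit.app M)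
    have h : IsIso (adj'.unit.app (L.obj M) ≫ G'.map (α.app M)) := by
      rw [fu]
      infer_instance
    exact (IsIso.of_isIso_comp_right _ (G'.map (α.app M)) : IsIso (adj'.unit.app (L.obj M)))
  have hc : IsIso adj'.counit := by
    have := Ψ.essSurj_of_hasRightResolutions L'
    rw [NatTrans.isIso_iff_isIso_app]
    intro X
    rw [NatTrans.isIso_app_iff_of_iso adj'.counit ((Ψ.functor ⋙ L').objObjPreimageIso X).symm]
    let Y : D := Ψ.functor.obj ((Ψ.functor ⋙ L').objPreimage X)
    have : IsFibrant Y := inferInstance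
    -- For a fibrant Y, the derived counit is computed on a cofibrant replacement M of G Y, where it
    -- is the map adjoint to p.
    obtain ⟨R⟩ := (inferInstance : Φ.HasLeftResolutions) (G.obj Y)
    let M : C := Φ.functor.obj R.X₁
    let p : M ⟶ G.obj Y := R.w
    have : IsCofibrant M := inferInstance
    have : WeakEquivalence p := ⟨R.hw⟩
    have := hα' M
    have := hβ' Y
    have := hε M Y p
    have := inv' (F.map p ≫ adj.counit.app Y)
    have := inv p
    have h : (F'.map (L.map p) ≫ F'.map (β.app Y)) ≫ adj'.counit.app (L'.obj Y) =
        α.app M ≫ L'.map (F.map p ≫ adj.counit.app Y) := by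
      rw [Category.assoc, fc, Functor.map_comp, ← Category.assoc, ← Category.assoc]
      exact congrArg (· ≫ _) (α.naturality p)
    have h' : IsIso ((F'.map (L.map p) ≫ F'.map (β.app Y)) ≫ adj'.counit.app (L'.obj Y)) := by
      rw [h]
      infer_instance
    exact (IsIso.of_isIso_comp_left (F'.map (L.map p) ≫ F'.map (β.app Y)) _ :
      IsIso (adj'.counit.app (L'.obj Y)))
  exact ⟨hQ, adj'.toEquivalence, α, β, hF', hG', fu⟩

end Derived


/-! ### The Quillen equivalence for compact divisible generators -/

namespace DGMod

open DgA

variable {G : Type} {B : G → DgA}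

/-- A family of compact divisible generators gives rise to a Quillen equivalence. -/
theorem isQuillenEquivalence_homFunctor (hB : ∀ a, AObj.IsDiv (B a).toAObj)
    (hc : ∀ a, IsCompactUpToQuasiIso (B a)) (hgen : Generates B) {F : DGMod (endRing B) ⥤ DgA}
    (adj : F ⊣ homFunctor B) : IsQuillenEquivalence adj := by
  have hη : ∀ (M : DGMod (endRing B)) [IsCofibrant M], AObj.IsDiv (F.obj M).toAObj ∧ WeakEquivalence (adj.unit.app M) :=
    fun M _ => weakEquivalence_of_isCofibrant hB hc M (isUniv_unit adj M)
  refine isQuillenEquivalence_of adj ⟨fun _ _ f hf => homFunctor_fibration hf,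
    fun _ _ f hf => homFunctor_trivialFibration hf⟩ ?_ ?_ ?_ ?_ ?_
  · intro M N _ _ f hf
    obtain ⟨hM, _⟩ := hη M
    obtain ⟨hN, _⟩ := hη N
    -- By generation it suffices to test after Hom(B, -), and there naturality of the unit and two
    -- out of three reduce the claim to f.
    refine ⟨weakEquivalence_of_homFunctor hgen (F.map f) hM hN ?_⟩
    have h : WeakEquivalence (adj.unit.app M ≫ (homFunctor B).map (F.map f)) := by
      have e : adj.unit.app M ≫ (homFunctor B).map (F.map f) = f ≫ adj.unit.app N :=
        (adj.unit.naturality f).symm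
      rw [e]
      infer_instance
    exact weakEquivalence_of_precomp (adj.unit.app M) _
  · intro Y Z _ _ f hf
    exact homFunctor_weakEquivalence f (isDiv_of_isFibrant Y) (isDiv_of_isFibrant Z) hf.mem
  · intro M _
    exact (isFibrant_iff _).2 (isFibrantObj_of_isDiv (hη M).1 _ Limits.terminalIsTerminal _)
  · exact fun M _ => (hη M).2
  · intro M Y _ _ p hp
    obtain ⟨hM, _⟩ := hη M
    refine ⟨weakEquivalence_of_homFunctor hgen _ hM (isDiv_of_isFibrant Y) ?_⟩
    -- The map in question is the adjoint of p, so precomposing its image with the unit gives back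
    -- p.
    have e : adj.unit.app M ≫ (homFunctor B).map (F.map p ≫ adj.counit.app Y) = p := by
      have := adj.homEquiv_unit M Y (F.map p ≫ adj.counit.app Y)
      rw [← this, ← Adjunction.homEquiv_counit, Equiv.apply_symm_apply]
    have h : WeakEquivalence (adj.unit.app M ≫ (homFunctor B).map (F.map p ≫ adj.counit.app Y)) := by
      rw [e]
      infer_instance
    exact weakEquivalence_of_precomp (adj.unit.app M) _

end DGMod


/-! ### The basic cells -/

/-- Finite subgroups are closed and the circle is infinite, so the family of closed subgroups meets
every cell; generation needs all of them. -/
lemma exists_kind_eq (k : Option FinSubgroup) : ∃ H : ClosedSubgroup Circle, kind H = k := by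
  cases k with
  | some H =>
    have hf : Finite H.1 := H.2
    refine ⟨⟨H.1, (Set.toFinite (H.1 : Set Circle)).isClosed⟩, ?_⟩
    exact dif_pos hf
  | none =>
    refine ⟨⟨⊤, isClosed_univ⟩, dif_neg fun h => ?_⟩
    have h : Finite (⊤ : Subgroup Circle) := h
    have : Finite Circle := Finite.of_equiv _ (Subgroup.topEquiv (G := Circle)).toEquiv
    have hinj : Set.InjOn Circle.exp (Set.Ioc (-Real.pi) Real.pi) := by
      intro x hx y hy h
      rw [← Circle.arg_exp hx.1 hx.2, ← Circle.arg_exp hy.1 hy.2, h]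
    exact (Set.Ioc_infinite (by linarith [Real.pi_pos])) (Set.Finite.of_finite_image (Set.toFinite _) hinj)

lemma exists_smul_eq_of_isUnit {S : Type} [CommRing S] [Algebra OF S] {s : OF}
    (hs : IsUnit (algebraMap OF S s)) (x : S) : ∃ y : S, s • y = x := by
  obtain ⟨u, hu⟩ := hs
  refine ⟨((u⁻¹ : Sˣ) : S) * x, ?_⟩
  rw [Algebra.smul_def, ← hu, Units.mul_inv_cancel_left]

lemma exists_smul_eq_quotient {S : Type} [CommRing S] [Algebra OF S] {s : OF}
    (hs : IsUnit (algebraMap OF S s)) (x : S ⧸ imageOF S) : ∃ y : S ⧸ imageOF S, s • y = x := by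
  obtain ⟨x, rfl⟩ := (imageOF S).mkQ_surjective x
  obtain ⟨y, rfl⟩ := exists_smul_eq_of_isUnit hs x
  exact ⟨(imageOF S).mkQ y, (map_smul (imageOF S).mkQ s y).symm⟩

lemma isDiv_injFin (H : FinSubgroup) : AObj.IsDiv (injFin H).toAObj := by
  rintro s hs ⟨x, y⟩
  obtain ⟨x, rfl⟩ := exists_smul_eq_quotient (isUnit_eulerClass H ⟨s, hs⟩) x
  obtain ⟨y, rfl⟩ := exists_smul_eq_quotient (isUnit_eulerClass H ⟨s, hs⟩) y
  exact ⟨(x, y), rfl⟩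

lemma isDiv_injT : AObj.IsDiv injT.toAObj := by
  have hu {s : OF} (hs : s ∈ eulerClasses) : IsUnit (algebraMap OF TF s) :=
    IsLocalization.map_units TF (⟨s, hs⟩ : eulerClasses)
  rintro s hs ⟨x, y⟩
  obtain ⟨x, rfl⟩ := exists_smul_eq_of_isUnit (hu hs) x
  obtain ⟨y, rfl⟩ := exists_smul_eq_quotient (hu hs) y
  exact ⟨(x, y), rfl⟩

lemma isDiv_inj (k : Option FinSubgroup) : AObj.IsDiv (inj k).toAObj := by
  cases k with
  | some H => exact isDiv_injFin H
  | none => exact isDiv_injT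

lemma component_surjective (H : FinSubgroup) : Function.Surjective (component H) := fun p =>
  ⟨p.map (algebraMap ℚ QF), Polynomial.ext fun n => by simp [component]⟩

/-- A multiple q c_H⁻¹ that is a polynomial has q = 0: multiply by c_H and compare constant terms.
-/
lemma residueMap_injective (H : FinSubgroup) : Function.Injective (residueMap H) := by
  rw [injective_iff_map_eq_zero]
  intro q hq
  obtain ⟨f, hf⟩ := (Submodule.Quotient.mk_eq_zero _).1 hq
  have h (r : ℚ) (p : ℚ[X])
      (e : toLaurent p = LaurentPolynomial.C r * LaurentPolynomial.T (-1)) : r = 0 := by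
    have e' : toLaurent (p * X) = toLaurent (C r) := by
      rw [map_mul, e, Polynomial.toLaurent_X, mul_assoc, ← LaurentPolynomial.T_add,
        Polynomial.toLaurent_C]
      simp
    have := congrArg (fun p => p.coeff 0) (Polynomial.toLaurent_injective e')
    simpa using this.symm
  exact h q (component H f) hf

/-- If c_H z is a polynomial p, then z is p(0) c_H⁻¹ plus a polynomial. So the kernel of c_H on 𝕀(H)
is one-dimensional. -/
lemma exists_residueMap_eq (H : FinSubgroup) (x : Laurent H ⧸ imageOF (Laurent H))
    (hx : (X : OF) • x = 0) : ∃ q, residueMap H q = x := by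
  obtain ⟨y, rfl⟩ := (imageOF (Laurent H)).mkQ_surjective x
  rw [← map_smul] at hx
  obtain ⟨f, hf⟩ := (Submodule.Quotient.mk_eq_zero _).1 hx
  have h (z : LaurentPolynomial ℚ) (p : ℚ[X]) (e : toLaurent p = LaurentPolynomial.T 1 * z) :
      toLaurent (-p.divX) = LaurentPolynomial.C (p.coeff 0) * LaurentPolynomial.T (-1) - z := by
    have e' : z = LaurentPolynomial.T (-1) * toLaurent p := by
      rw [e, ← mul_assoc, ← LaurentPolynomial.T_add]
      simp
    rw [e']
    nth_rewrite 3 [← Polynomial.divX_mul_X_add p]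
    rw [map_add, map_mul, Polynomial.toLaurent_X, mul_add, mul_left_comm, ← LaurentPolynomial.T_add,
      Polynomial.toLaurent_C, map_neg]
    simp only [neg_add_cancel, LaurentPolynomial.T_zero, mul_one]
    ring
  obtain ⟨g, hg⟩ := component_surjective H (-(component H f).divX)
  refine ⟨(component H f).coeff 0, ?_⟩
  refine (Submodule.Quotient.eq _).2 ⟨g, ?_⟩
  refine Eq.trans (b := toLaurent (component H g)) rfl ?_
  rw [hg]
  refine h y (component H f) (Eq.trans hf ?_)
  have hX (z : LaurentPolynomial ℚ) : toLaurent (component H X) * z = LaurentPolynomial.T 1 * z := by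
    rw [component_X, Polynomial.toLaurent_X]
  exact hX y

lemma isUnit_algebraMap_X (H : FinSubgroup) : IsUnit (algebraMap OF (Laurent H) X) := by
  have : algebraMap OF (Laurent H) X = (LaurentPolynomial.T 1 : LaurentPolynomial ℚ) := by
    change toLaurent (component H X) = _
    rw [component_X, Polynomial.toLaurent_X]
  rw [this]
  exact LaurentPolynomial.isUnit_T 1

/-! ### The inclusions of the cells and compactness -/

namespace DgA

open AObj

lemma isHomologyIso_id {A : Type} [AddCommGroup A] (d : A → A) : IsHomologyIso d d id :=
  ⟨fun x _ ⟨y, hy⟩ => ⟨y, hy⟩, fun y hy => ⟨y, hy, y, by rw [hy, id, sub_self]⟩⟩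

/-- Multiplication by c_H on 𝕀(H) is onto, because c_H is a unit in the Laurent polynomials, and its
kernel is ℚ(H). -/
lemma inclFin_weakEquivalence (H : FinSubgroup) : weakEquivalences DgA (inclFin H) := by
  refine ⟨⟨fun x _ ⟨y, hy⟩ => ⟨0, ?_⟩, fun y hy => ?_⟩, isHomologyIso_id _⟩
  · have h : residueMap H x = 0 := (congrArg Prod.fst hy).symm
    exact (residueMap_injective H (h.trans (map_zero _).symm)).symm
  · obtain ⟨a, b⟩ := y
    obtain ⟨q, hq⟩ := exists_residueMap_eq H a (congrArg Prod.snd hy)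
    obtain ⟨z, hz⟩ := exists_smul_eq_quotient (isUnit_algebraMap_X H) (-b)
    refine ⟨q, rfl, (z, 0), Prod.ext ?_ ?_⟩
    · exact (sub_eq_zero.2 hq).symm
    · exact hz.trans (zero_sub b).symm

lemma inclT_weakEquivalence : weakEquivalences DgA inclT := by
  refine ⟨⟨fun x _ ⟨y, hy⟩ => ⟨0, ?_⟩, fun y hy => ?_⟩, isHomologyIso_id _⟩
  · have h : algebraMap OF TF x = 0 := (congrArg Prod.fst hy).symm
    exact (algebraMap_OF_TF_injective (h.trans (map_zero _).symm)).symm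
  · obtain ⟨a, b⟩ := y
    obtain ⟨f, hf⟩ := (Submodule.Quotient.mk_eq_zero _).1 (congrArg Prod.snd hy)
    obtain ⟨z, hz⟩ := (imageOF TF).mkQ_surjective (-b)
    refine ⟨f, rfl, (z, 0), Prod.ext ?_ ?_⟩
    · exact (sub_eq_zero.2 hf).symm
    · exact hz.trans (zero_sub b).symm

lemma incl_weakEquivalence (k : Option FinSubgroup) : weakEquivalences DgA (incl k) := by
  cases k with
  | some H => exact inclFin_weakEquivalence H
  | none => exact inclT_weakEquivalence

lemma incl_inj (k : Option FinSubgroup) : Inj (Hom.pair (incl k)) := by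
  cases k with
  | some H => exact ⟨fun x y h => residueMap_injective H (congrArg Prod.fst h), Function.injective_id⟩
  | none => exact ⟨fun x y h => algebraMap_OF_TF_injective (congrArg Prod.fst h), Function.injective_id⟩

lemma isSmall_cell (k : Option FinSubgroup) : IsSmall (cell k).toAObj := by
  cases k with
  | some H =>
    refine isSmall_of_cyclic (L := (cellFin H).toAObj) (show Residue H from (1 : ℚ)) (fun y => ?_)
      PUnit.unit fun w => ⟨0, rfl⟩
    obtain ⟨q, rfl⟩ : ∃ q : ℚ, (q : Residue H) = y := ⟨y, rfl⟩
    refine ⟨algebraMap ℚ OF q, ?_⟩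
    refine (algebraMap_smul OF q (show Residue H from (1 : ℚ))).trans ?_
    exact mul_one q
  | none =>
    exact isSmall_of_cyclic (L := cellT.toAObj) (show OF from 1) (fun y => ⟨y, mul_one (M := OF) y⟩)
      (show ℚ from 1) fun w => ⟨w, mul_one (M := ℚ) w⟩

lemma isCompactUpToQuasiIso_inj (k : Option FinSubgroup) : IsCompactUpToQuasiIso (inj k) :=
  ⟨cell k, incl k, incl_inj k, incl_weakEquivalence k, isSmall_cell k⟩

/-- For divisible Y the quotient of the replacement by the cell contributes no homology, so cycles
on the cell extend to the replacement, bound there, and the primitive restricts. -/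
lemma homAcyclic_cell {Y : DgA} (hY : IsDiv Y.toAObj) (k : Option FinSubgroup)
    (h : ∀ n, HomAcyclic (inj k) Y n) (n : ℤ) : HomAcyclic (cell k) Y n := by
  intro f hf hdf
  have hs := coker_isSES (incl k) (incl_inj k)
  obtain ⟨g, hg, hdg, rfl⟩ := hs.exists_cycle_extension hY (sub_add_cancel n 1)
    ((hs.acyclic_right (incl_weakEquivalence k)).homAcyclic hY (n - 1)) hf hdf
  obtain ⟨h, hh, rfl⟩ := h n g hg hdg
  exact ⟨_, comp_mem (add_zero _) hh (Hom.mem (incl k)), diff_comp_hom _ _ _⟩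

end DgA


namespace DgA

open AObj

/-! #### The basic cells generate -/

lemma X_mem_deg : (X : OF) ∈ OF.deg (-2) := by
  simpa using! OF.monomial_mem_deg 1 1

lemma idem_mem_deg (H : FinSubgroup) : idem H ∈ OF.deg 0 := by
  simpa using! OF.monomial_mem_deg 0 (QF.single H 1)

section Generation

variable {Y : DgA}

lemma β_eq_zero_of_smul {s : OF} (hs : s ∈ eulerClasses) {y : Y.nub} (h : s • y = 0) : Y.β y = 0 :=
  eq_zero_of_smul_tensor hs (by rw [← map_smul, h, map_zero])

lemma β_eq_zero_of_X_pow {H : FinSubgroup} {k : ℕ} {y : Y.nub} (hy : idem H • y = y)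
    (hk : (X ^ k : OF) • y = 0) : Y.β y = 0 := by
  obtain ⟨s, hs, h⟩ := exists_eulerClass H k
  refine β_eq_zero_of_smul hs ?_
  have e : idem H * s = idem H * X ^ k := idem_mul_eq (by rw [h, map_pow, component_X])
  rw [← hy, smul_smul, mul_comm, e, mul_smul, hk, smul_zero]

/-- A homogeneous cycle at H killed by c_H is the same as a cycle in the hom complex from L_H; a
primitive of it, evaluated at the generator, is z. -/
lemma exists_of_cellFin {H : FinSubgroup} (hc : ∀ n, HomAcyclic (cellFin H) Y n) {m : ℤ} {y : Y.nub}
    (hm : y ∈ Y.nub.deg m) (hy : idem H • y = y) (hX : (X : OF) • y = 0) (hd : Y.d.1 y = 0) :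
    ∃ z : Y.nub, idem H • z = z ∧ (X : OF) • z = 0 ∧ Y.d.1 z = y := by
  have hsmul (f : OF) : f • y = Residue.ev H f • y := by
    rw [smul_eq_of_idem_smul hy f, hX, smul_zero, add_zero, Residue.ev_eq]
  let φ : Residue H →ₗ[OF] Y.nub :=
    { toFun := fun q => (show ℚ from q) • y
      map_add' := fun q r => add_smul (show ℚ from q) (show ℚ from r) y
      map_smul' := fun f q => by
        refine (mul_smul (Residue.ev H f) (show ℚ from q) y).trans ?_
        rw [RingHom.id_apply, smul_comm f, hsmul, smul_comm] }
  let f : Pairs (cellFin H).toAObj Y.toAObj := (φ, 0)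
  -- The shift by one appears because the generator of L_H lies in degree 1. Compatibility with β
  -- holds because y is torsion.
  have hf : f ∈ homDeg (cellFin H).toAObj Y.toAObj (m - 1) := by
    refine ⟨fun i q hq => ?_, fun i v hv => zero_mem _, fun q => ?_⟩
    · by_cases h : q = 0
      · rw [h]
        exact (congrArg (· ∈ Y.nub.deg (i + (m - 1))) (map_zero φ)).mpr (zero_mem _)
      · have h₁ : (0 : ℤ) = i - 1 := hq () h
        rw [show i + (m - 1) = m by omega]
        exact Submodule.smul_mem _ (show ℚ from q) hm
    · have h₀ : Y.β y = 0 := β_eq_zero_of_X_pow (k := 1) hy (by rw [pow_one, hX])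
      refine (Y.β.map_smul_of_tower (show ℚ from q) y).trans ?_
      rw [h₀, smul_zero]
      exact (map_zero _).symm
  obtain ⟨h, hh, e⟩ := hc (m - 1) f hf (by
    refine pairs_ext (fun q => ?_) (fun v => ?_)
    · change Y.d.1 ((show ℚ from q) • y) - sgn (m - 1) • f.1 0 = 0
      rw [map_zero, smul_zero, sub_zero, Y.d.1.map_smul_of_tower, hd, smul_zero]
    · change Y.d.2 0 - sgn (m - 1) • (0 : Y.vertex) = 0
      rw [map_zero, smul_zero, sub_zero])
  let one : Residue H := (1 : ℚ)
  have h₁ : idem H • one = one := by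
    refine (Residue.smul_def H (idem H) one).trans ?_
    have : Residue.ev H (idem H) = 1 := by
      rw [Residue.ev_eq, idem, coeff_C_zero, QF.proj_single_self]
    rw [this, one_smul]
  have h₂ : (X : OF) • one = 0 := by
    refine (Residue.smul_def H X one).trans ?_
    rw [Residue.ev_eq, coeff_X_zero, map_zero, zero_smul]
  refine ⟨h.1 one, ?_, ?_, ?_⟩
  · exact (map_smul h.1 (idem H) one).symm.trans (congrArg h.1 h₁)
  · exact (map_smul h.1 (X : OF) one).symm.trans ((congrArg h.1 h₂).trans (map_zero h.1))
  · have := LinearMap.congr_fun (congrArg Prod.fst e) one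
    change Y.d.1 (h.1 one) - sgn (m - 1 + 1) • h.1 0 = (1 : ℚ) • y at this
    rwa [map_zero, smul_zero, sub_zero, one_smul] at this

lemma exists_of_X_smul {H : FinSubgroup} (hc : ∀ n, HomAcyclic (cellFin H) Y n) {y : Y.nub}
    (hy : idem H • y = y) (hX : (X : OF) • y = 0) (hd : Y.d.1 y = 0) :
    ∃ z : Y.nub, idem H • z = z ∧ (X : OF) • z = 0 ∧ Y.d.1 z = y := by
  let K : Submodule OF Y.nub := LinearMap.ker (LinearMap.lsmul OF Y.nub (idem H) - LinearMap.id) ⊓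
    LinearMap.ker (LinearMap.lsmul OF Y.nub X)
  have hK (z : Y.nub) : z ∈ K ↔ idem H • z = z ∧ (X : OF) • z = 0 := and_congr sub_eq_zero Iff.rfl
  suffices y ∈ K.map Y.d.1 by
    obtain ⟨z, hz, e⟩ := this
    obtain ⟨h₁, h₂⟩ := (hK z).1 hz
    exact ⟨z, h₁, h₂, e⟩
  obtain ⟨S, hS⟩ := GrVect.exists_sum_proj y
  rw [← hS S le_rfl]
  refine Submodule.sum_mem _ fun n _ => ?_
  obtain ⟨z, h₁, h₂, e⟩ := exists_of_cellFin hc (GrVect.proj_mem n y)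
    (by rw [← GrMod.proj_smul Y.nub (idem_mem_deg H), hy, zero_add])
    (by rw [← GrMod.proj_smul Y.nub X_mem_deg, hX, map_zero])
    ((GrVect.proj_map (nub_mem Y.d_mem) n y).symm.trans ((congrArg _ hd).trans (map_zero _)))
  exact ⟨z, (hK z).2 ⟨h₁, h₂⟩, e⟩

/-- Induction on the exponent: c_H^k y bounds some z by the case of exponent one. Divide z by c_H^k,
which divisibility allows, and subtract the boundary of the quotient from y; the rest is killed by
c_H^k. -/
lemma exists_of_X_pow_smul (hY : IsDiv Y.toAObj) {H : FinSubgroup} (hc : ∀ n, HomAcyclic (cellFin H) Y n)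
    (k : ℕ) : ∀ y : Y.nub, idem H • y = y → (X ^ k : OF) • y = 0 → Y.d.1 y = 0 →
      ∃ z : Y.nub, Y.β z = 0 ∧ Y.d.1 z = y := by
  induction k with
  | zero =>
    intro y _ hk _
    rw [pow_zero, one_smul] at hk
    exact ⟨0, map_zero _, by rw [map_zero, hk]⟩
  | succ k ih =>
    intro y hy hk hd
    obtain ⟨z, hz, hXz, hdz⟩ := exists_of_X_smul hc (y := (X ^ k : OF) • y)
      (by rw [smul_comm, hy]) (by rw [smul_smul, ← pow_succ', hk]) (by rw [map_smul, hd, smul_zero])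
    obtain ⟨s, hs, h⟩ := exists_eulerClass H k
    obtain ⟨u, rfl⟩ := hY s hs z
    have e : idem H * s = idem H * X ^ k := idem_mul_eq (by rw [h, map_pow, component_X])
    have hii : idem H * idem H = idem H := by
      have := idem_mul_eq (H := H) (f := idem H) (g := 1) (by rw [component_idem_self, map_one])
      rwa [mul_one] at this
    have hw : idem H • idem H • u = idem H • u := by rw [smul_smul, hii]
    have hw' : (X ^ k : OF) • idem H • u = s • u := by
      rw [smul_smul, mul_comm, ← e, mul_smul, hz]
    obtain ⟨z', hz', hdz'⟩ := ih (y - Y.d.1 (idem H • u))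
      (by rw [smul_sub, hy, ← map_smul, hw]) (by rw [smul_sub, ← map_smul, hw', hdz, sub_self])
      (by rw [map_sub, hd, d_d, sub_zero])
    refine ⟨z' + idem H • u, ?_, by rw [map_add, hdz', sub_add_cancel]⟩
    rw [map_add, hz', zero_add]
    exact β_eq_zero_of_X_pow (k := k + 1) hw (by rw [pow_succ', mul_smul, hw', hXz])

/-- The kernel of β is torsion and splits into finitely many parts at single subgroups. Keeping the
primitive in the kernel of β matters later, when it is subtracted without changing vertices. -/
lemma exists_of_β_eq_zero (hY : IsDiv Y.toAObj) (hc : ∀ H n, HomAcyclic (cellFin H) Y n) {y : Y.nub}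
    (hy : Y.β y = 0) (hd : Y.d.1 y = 0) : ∃ z : Y.nub, Y.β z = 0 ∧ Y.d.1 z = y := by
  obtain ⟨s, ⟨v, hv⟩, hs⟩ := Y.exists_smul_eq_zero hy
  -- Outside the support of v the Euler class s is 1, so y has no component there.
  have h₁ : (1 - ∑ H ∈ v.support, idem H) = (1 - ∑ H ∈ v.support, idem H) * s := by
    refine OF.ext_component fun K => ?_
    rw [map_mul, hv]
    by_cases hK : K ∈ v.support
    · rw [map_sub, map_one, component_sum_idem _ hK, sub_self, zero_mul]
    · rw [Finsupp.notMem_support_iff.1 hK, pow_zero, mul_one]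
  have h₂ : y = ∑ H ∈ v.support, idem H • y := by
    rw [← Finset.sum_smul, ← sub_eq_zero]
    nth_rewrite 1 [← one_smul OF y]
    rw [← sub_smul, h₁, mul_smul, hs, smul_zero]
  suffices y ∈ (LinearMap.ker Y.β).map Y.d.1 from this
  rw [h₂]
  refine Submodule.sum_mem _ fun H _ => ?_
  refine exists_of_X_pow_smul hY (hc H) (v H) (idem H • y) ?_ ?_ ?_
  · have := idem_mul_eq (H := H) (f := idem H) (g := 1) (by rw [component_idem_self, map_one])
    rw [smul_smul, this, mul_one]
  · rw [smul_smul, mul_comm, idem_mul_eq (H := H) (f := X ^ v H) (g := s) (by rw [hv, map_pow, component_X]),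
      mul_smul, hs, smul_zero]
  · rw [map_smul, hd, smul_zero]

/-- A compatible pair of cycles x and v with β x = 1 ⊗ v is a cycle in the hom complex from L_𝕋; the
vertex of a primitive bounds v. -/
lemma exists_of_cellT (hc : ∀ n, HomAcyclic cellT Y n) {n : ℤ} {x : Y.nub} (hx : x ∈ Y.nub.deg n)
    {v : Y.vertex} (hv : v ∈ Y.vertex.deg n) (h : Y.β x = 1 ⊗ₜ[ℚ] v) (hdx : Y.d.1 x = 0)
    (hdv : Y.d.2 v = 0) : ∃ w, Y.d.2 w = v := by
  let f : Pairs cellT.toAObj Y.toAObj := (LinearMap.toSpanSingleton OF Y.nub x, LinearMap.toSpanSingleton ℚ Y.vertex v)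
  have hf : f ∈ homDeg cellT.toAObj Y.toAObj n := by
    refine ⟨fun i r hr => Y.nub.smul_mem hr hx, fun i q hq => ?_, fun r => ?_⟩
    · by_cases h : q = 0
      · rw [h, map_zero]
        exact zero_mem _
      · have h₁ : (0 : ℤ) = i := hq () h
        rw [← h₁, zero_add]
        exact Submodule.smul_mem _ (show ℚ from q) hv
    · have h' (r : OF) : Y.β (r • x) = algebraMap OF TF r ⊗ₜ[ℚ] ((1 : ℚ) • v) := by
        rw [map_smul, h, TensorProduct.smul_tmul', one_smul, Algebra.smul_def, mul_one]
      exact h' r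
  obtain ⟨g, hg, e⟩ := hc n f hf (by
    refine pairs_ext (fun r => ?_) (fun q => ?_)
    · change Y.d.1 ((show OF from r) • x) - sgn n • f.1 0 = 0
      rw [map_zero, smul_zero, sub_zero, map_smul, hdx, smul_zero]
    · change Y.d.2 ((show ℚ from q) • v) - sgn n • f.2 0 = 0
      rw [map_zero, smul_zero, sub_zero, map_smul, hdv, smul_zero])
  refine ⟨g.2 (show ℚ from 1), ?_⟩
  have := LinearMap.congr_fun (congrArg Prod.snd e) (show ℚ from 1)
  change Y.d.2 (g.2 (show ℚ from 1)) - sgn (n + 1) • g.2 0 = (1 : ℚ) • v at this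
  rwa [map_zero, smul_zero, sub_zero, one_smul] at this

lemma exists_of_β_eq_tmul (hc : ∀ n, HomAcyclic cellT Y n) {x : Y.nub} {v : Y.vertex}
    (h : Y.β x = 1 ⊗ₜ[ℚ] v) (hdx : Y.d.1 x = 0) (hdv : Y.d.2 v = 0) : ∃ w, Y.d.2 w = v := by
  suffices v ∈ LinearMap.range Y.d.2 from this
  obtain ⟨S, hS⟩ := GrVect.exists_sum_proj v
  rw [← hS S le_rfl]
  refine Submodule.sum_mem _ fun n _ => ?_
  refine exists_of_cellT hc (GrVect.proj_mem n x) (GrVect.proj_mem n v) ?_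
    ((GrVect.proj_map (nub_mem Y.d_mem) n x).symm.trans ((congrArg _ hdx).trans (map_zero _)))
    (by rw [← GrVect.proj_map (vertex_mem Y.d_mem), hdv, map_zero])
  have h₁ := GrVect.proj_map (V := Y.nub.toGrVect) (W := (grTensor Y.vertex).toGrVect)
    (f := Y.β.restrictScalars ℚ) (k := 0) (fun i x hx => by rw [add_zero]; exact Y.β_mem hx) n x
  have h₂ := GrVect.proj_map (V := Y.vertex) (W := (grTensor Y.vertex).toGrVect)
    (f := TensorProduct.mk ℚ TF Y.vertex 1) (k := 0) (fun i x hx => by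
      rw [add_zero]
      refine tmul_mem_tensorDeg (zero_add i) ?_ hx
      rw [← map_one (algebraMap OF TF)]
      exact TF.algebraMap_mem_deg (by simpa using! OF.monomial_mem_deg 0 1)) n v
  exact h₁.symm.trans ((congrArg _ h).trans h₂)

/-- For a cycle v of the vertex, lift 1 ⊗ v to x. The boundary of x is torsion, so a torsion
correction makes x a cycle, and L_𝕋 shows that v bounds. For a cycle x of the nub, β x then bounds
in t ⊗ V, by flatness; lifting a primitive through β leaves a torsion cycle, which bounds by the
cells of finite subgroups. -/
theorem acyclic_of_homAcyclic_cell (hY : IsDiv Y.toAObj) (hc : ∀ k n, HomAcyclic (cell k) Y n) :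
    Acyclic Y := by
  have hF : ∀ H n, HomAcyclic (cellFin H) Y n := fun H => hc (some H)
  have hV : IsAcyclic Y.d.2 := by
    intro v hv
    obtain ⟨x, hx⟩ := hY.β_surjective (1 ⊗ₜ[ℚ] v)
    obtain ⟨z, hz, hdz⟩ := exists_of_β_eq_zero hY hF (y := Y.d.1 x)
      (by rw [β_comm Y.d_mem, hx, tmap_tmul, hv, TensorProduct.tmul_zero]) (d_d x)
    exact exists_of_β_eq_tmul (hc none) (x := x - z) (by rw [map_sub, hz, sub_zero, hx])
      (by rw [map_sub, hdz, sub_self]) hv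
  refine ⟨fun x hx => ?_, hV⟩
  have hex : Function.Exact Y.d.2 Y.d.2 := fun v => ⟨hV v, by rintro ⟨w, rfl⟩; exact d_d' w⟩
  obtain ⟨w, hw⟩ := (tmap_exact hex (Y.β x)).1 (by rw [← β_comm Y.d_mem, hx, map_zero])
  obtain ⟨u, rfl⟩ := hY.β_surjective w
  obtain ⟨z, -, hdz⟩ := exists_of_β_eq_zero hY hF (y := x - Y.d.1 u)
    (by rw [map_sub, β_comm Y.d_mem, hw, sub_self]) (by rw [map_sub, hx, d_d, sub_zero])
  exact ⟨z + u, by rw [map_add, hdz, sub_add_cancel]⟩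

end Generation

theorem generates_basicInj : Generates basicInj := by
  intro Y hY h
  refine acyclic_of_homAcyclic_cell hY fun k => homAcyclic_cell hY k ?_
  obtain ⟨H, rfl⟩ := exists_kind_eq k
  exact h H

end DgA


end CircleModel

end

theorem corollary3p5 :
    CircleModel.IsModelCategory CircleModel.DgA ∧
    CircleModel.IsModelCategory
      (CircleModel.DGMod (CircleModel.DgA.endRing CircleModel.basicInj)) ∧
    (∀ H : ClosedSubgroup Circle,
      HomotopicalAlgebra.WeakEquivalence (CircleModel.basicIncl H) ∧
        CircleModel.IsFibrantObj (CircleModel.basicInj H)) ∧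
    ∃ (F : CategoryTheory.Functor
        (CircleModel.DGMod (CircleModel.DgA.endRing CircleModel.basicInj)) CircleModel.DgA)
      (adj : CategoryTheory.Adjunction F (CircleModel.DgA.homFunctor CircleModel.basicInj)),
      CircleModel.IsQuillenEquivalence adj := by
  refine ⟨⟨CircleModel.DgA.modelCategory, rfl, rfl, rfl⟩, ⟨CircleModel.DGMod.modelCategory, rfl, rfl, rfl⟩,
    fun H => ⟨⟨CircleModel.DgA.incl_weakEquivalence _⟩,
      CircleModel.DgA.isFibrantObj_of_isDiv (CircleModel.isDiv_inj _)⟩, ?_⟩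
  obtain ⟨F, ⟨adj⟩⟩ := CircleModel.DGMod.exists_leftAdjoint CircleModel.basicInj
  exact ⟨F, adj, CircleModel.DGMod.isQuillenEquivalence_homFunctor (fun H => CircleModel.isDiv_inj _)
    (fun H => CircleModel.DgA.isCompactUpToQuasiIso_inj _) CircleModel.DgA.generates_basicInj adj⟩
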